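/- Let $\mathcal F$ be the symmetric Fock space over $L^2(\mathbb R^3)$ with vacuum $\Omega$ and creation/annihilation operators $a^*(f),a(f)$. For $0<\Lambda<\infty$ let $$\varphi_\Lambda(k)=\frac{\chi_\Lambda(k)}{\sqrt{2|k|}}\,\frac{k}{|k|+|k|^2}\in\mathbb R^3,\qquad \chi_\Lambda(k)=(2\pi)^{-3/2}\text{ for }|k|<\Lambda,\quad \chi_\Lambda(k)=0\text{ otherwise},$$ and let $A=a(\varphi_\Lambda)$, $A^*=a^*(\varphi_\Lambda)$ (3-vectors of operators), $\mathcal P=\int k\,a^*(k)a(k)\,dk$, $H_f=\int|k|\,a^*(k)a(k)\,dk$, $D_f=\mathcal P^2+H_f$; $D_f^{-1}$ denotes the inverse of $D_f$ on the orthogonal complement of $\Omega$. In strings of 3-vectors the scalar product is taken in consecutive pairs, e.g. $AA=A\cdot A$, $A^*\mathcal P=A^*\cdot\mathcal P$. For real $e$ put $$T_\Lambda=H_f+\mathcal P^2+2e\,(A^*\mathcal P+\mathcal PA)+e^2\,(A^*A^*+AA+2A^*A).$$ **Theorem 2.1.** There are $e_0>0$ and $C<\infty$ such that for all $0<\Lambda<\infty$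 and all $|e|\le e_0$ the operator $T_\Lambda$ (on the natural domain of the above sum) is self-adjoint with spectrum nonempty and bounded below, $\Omega$ lies in the domains of the four operators below, and the self-energy $E^0_\Lambda(e)=\inf\operatorname{spec}(T_\Lambda)$ satisfies $$\begin{aligned}E^0_\Lambda(e)={}&-e^4(\Omega,AAD_f^{-1}A^*A^*\Omega)-4e^6(\Omega,AAD_f^{-1}\mathcal PA\,D_f^{-1}A^*\mathcal P\,D_f^{-1}A^*A^*\Omega)\\&-4e^6(\Omega,AAD_f^{-1}A^*\mathcal P\,D_f^{-1}\mathcal PA\,D_f^{-1}A^*A^*\Omega)+2e^6(\Omega,AAD_f^{-1}A^*A\,D_f^{-1}A^*A^*\Omega)+r_\Lambda(e)\end{aligned}$$ with $|r_\Lambda(e)|\le C|e|^7$. The constants $e_0$ and $C$ do not depend on $\Lambda$, and $C$ does not depend on $e$. -/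

import Mathlib

open MeasureTheory

noncomputable section

namespace Nelson

/-- Momentum space of one boson. -/
abbrev R3 : Type := EuclideanSpace ℝ (Fin 3)

/-- Momentum configurations of `n` bosons. -/
abbrev Config (n : ℕ) : Type := Fin n → R3

/-! ### The symmetric Fock space over `L²(ℝ³)` -/

theorem measurePreserving_perm {n : ℕ} (σ : Equiv.Perm (Fin n)) :
    MeasurePreserving (fun (k : Config n) (i : Fin n) => k (σ i)) :=
  volume_preserving_arrowCongr' σ.symm (MeasurableEquiv.refl R3) (MeasurePreserving.id _)

/-- The permutation-symmetric elements of `L²((ℝ³)ⁿ; ℂ)`, the `n`-boson sector. -/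
def symL2 (n : ℕ) : Submodule ℂ (Lp ℂ 2 (volume : Measure (Config n))) where
  carrier := {f | ∀ σ : Equiv.Perm (Fin n),
    Lp.compMeasurePreserving _ (measurePreserving_perm σ) f = f}
  add_mem' := by
    intro f g hf hg σ
    rw [map_add, hf σ, hg σ]
  zero_mem' := by
    intro σ
    rw [map_zero]
  smul_mem' := by
    intro c f hf σ
    have h := (Lp.compMeasurePreservingₗ ℂ _ (measurePreserving_perm σ)).map_smul c f
    simp only [Lp.compMeasurePreservingₗ_apply] at h
    exact h.trans (congrArg (c • ·) (hf σ))

instance instCompleteSpaceSymL2 (n : ℕ) : CompleteSpace (symL2 n) := by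
  have h : IsClosed (symL2 n : Set (Lp ℂ 2 (volume : Measure (Config n)))) := by
    have : (symL2 n : Set (Lp ℂ 2 (volume : Measure (Config n)))) =
        ⋂ σ : Equiv.Perm (Fin n),
          {f | Lp.compMeasurePreserving _ (measurePreserving_perm σ) f = f} := by
      ext f
      simp [symL2]
    rw [this]
    exact isClosed_iInter fun σ =>
      isClosed_eq (Lp.isometry_compMeasurePreserving (measurePreserving_perm σ)).continuous
        continuous_id
  exact h.completeSpace_coe

/-- The symmetric Fock space: the Hilbert sum of the `n`-boson sectors. -/
abbrev Fock : Type := lp (fun n : ℕ => symL2 n) 2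

/-- The `n`-boson wave function of a Fock vector. -/
def wave (ψ : Fock) (n : ℕ) : Config n → ℂ := ((ψ n : symL2 n) : Lp ℂ 2 volume)

theorem wave_add (ψ ψ' : Fock) (n : ℕ) :
    ∀ᵐ k, wave (ψ + ψ') n k = wave ψ n k + wave ψ' n k := by
  have h : (((ψ + ψ') n : symL2 n) : Lp ℂ 2 (volume : Measure (Config n))) =
      ((ψ n : symL2 n) : Lp ℂ 2 volume) + ((ψ' n : symL2 n) : Lp ℂ 2 volume) := rfl
  unfold wave
  rw [h]
  exact Lp.coeFn_add _ _

theorem wave_smul (c : ℂ) (ψ : Fock) (n : ℕ) :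
    ∀ᵐ k, wave (c • ψ) n k = c * wave ψ n k := by
  have h : (((c • ψ) n : symL2 n) : Lp ℂ 2 (volume : Measure (Config n))) =
      c • ((ψ n : symL2 n) : Lp ℂ 2 volume) := rfl
  unfold wave
  rw [h]
  exact Lp.coeFn_smul _ _

theorem wave_zero (n : ℕ) : ∀ᵐ k, wave (0 : Fock) n k = 0 := by
  have h : (((0 : Fock) n : symL2 n) : Lp ℂ 2 (volume : Measure (Config n))) = 0 := rfl
  unfold wave
  rw [h]
  exact Lp.coeFn_zero _ _ _

theorem wave_ext {ψ ψ' : Fock} (h : ∀ n, ∀ᵐ k, wave ψ n k = wave ψ' n k) : ψ = ψ' := by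
  apply lp.ext
  funext n
  exact Subtype.ext (Lp.ext (h n))

theorem volume_config_zero_ne_top : (volume : Measure (Config 0)) Set.univ ≠ ⊤ := by
  rw [volume_pi, Measure.pi_of_empty]
  simp

/-- The wave function `1` of the `0`-boson sector. -/
def vacuumWave : symL2 0 :=
  ⟨indicatorConstLp 2 MeasurableSet.univ volume_config_zero_ne_top (1 : ℂ), by
    intro σ
    rw [Subsingleton.elim σ 1]
    exact Lp.compMeasurePreserving_id_apply _⟩

/-- The vacuum vector `Ω = (1, 0, 0, …)`. -/
def vacuum : Fock := lp.single 2 0 vacuumWave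

/-! ### Operators given sector by sector, on their maximal domain -/

/-- Graph of the maximal operator `ψ ↦ op ψ`, where the expression `op ψ n` is the `n`-boson wave
function of the image and makes sense for `ψ ∈ W`:  `(ψ, η)` is in the graph if `ψ ∈ W` and the
wave functions of `η ∈ Fock` are given by `op ψ`. -/
def sectorGraph (op : Fock → (n : ℕ) → Config n → ℂ) (W : Submodule ℂ Fock)
    (hadd : ∀ ψ ∈ W, ∀ ψ' ∈ W, ∀ n, ∀ᵐ k, op (ψ + ψ') n k = op ψ n k + op ψ' n k)
    (hsmul : ∀ c : ℂ, ∀ ψ ∈ W, ∀ n, ∀ᵐ k, op (c • ψ) n k = c * op ψ n k) :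
    Submodule ℂ (Fock × Fock) where
  carrier := {p | p.1 ∈ W ∧ ∀ n, ∀ᵐ k, wave p.2 n k = op p.1 n k}
  add_mem' := by
    rintro ⟨ψ, η⟩ ⟨ψ', η'⟩ ⟨hW, h⟩ ⟨hW', h'⟩
    refine ⟨W.add_mem hW hW', fun n => ?_⟩
    filter_upwards [h n, h' n, hadd ψ hW ψ' hW' n, wave_add η η' n] with k h1 h2 h3 h4
    simp only [Prod.mk_add_mk] at *
    rw [h3, h4, h1, h2]
  zero_mem' := by
    refine ⟨W.zero_mem, fun n => ?_⟩
    filter_upwards [hsmul 0 0 W.zero_mem n, wave_zero n] with k h1 h2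
    rw [zero_smul, zero_mul] at h1
    exact h2.trans h1.symm
  smul_mem' := by
    rintro c ⟨ψ, η⟩ ⟨hW, h⟩
    refine ⟨W.smul_mem c hW, fun n => ?_⟩
    filter_upwards [h n, hsmul c ψ hW n, wave_smul c η n] with k h1 h2 h3
    simp only [Prod.smul_mk] at *
    rw [h2, h3, h1]

/-- A sector graph is the graph of a single-valued operator. -/
theorem sectorGraph_single_valued {op : Fock → (n : ℕ) → Config n → ℂ} {W : Submodule ℂ Fock}
    {hadd : ∀ ψ ∈ W, ∀ ψ' ∈ W, ∀ n, ∀ᵐ k, op (ψ + ψ') n k = op ψ n k + op ψ' n k}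
    {hsmul : ∀ c : ℂ, ∀ ψ ∈ W, ∀ n, ∀ᵐ k, op (c • ψ) n k = c * op ψ n k}
    (p : Fock × Fock) (hp : p ∈ sectorGraph op W hadd hsmul) (h0 : p.1 = 0) : p.2 = 0 := by
  obtain ⟨ψ, η⟩ := p
  obtain ⟨hW, h⟩ := hp
  simp only at hW h h0
  subst h0
  refine wave_ext fun n => ?_
  filter_upwards [h n, hsmul 0 0 hW n, wave_zero n] with k h1 h2 h3
  rw [zero_smul, zero_mul] at h2
  rw [h1, h2, h3]

/-- The maximal operator `ψ ↦ op ψ`: its domain consists of all `ψ ∈ W` such that `op ψ` is (the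
sequence of wave functions of) a Fock vector. -/
def sectorOp (op : Fock → (n : ℕ) → Config n → ℂ) (W : Submodule ℂ Fock)
    (hadd : ∀ ψ ∈ W, ∀ ψ' ∈ W, ∀ n, ∀ᵐ k, op (ψ + ψ') n k = op ψ n k + op ψ' n k)
    (hsmul : ∀ c : ℂ, ∀ ψ ∈ W, ∀ n, ∀ᵐ k, op (c • ψ) n k = c * op ψ n k) : Fock →ₗ.[ℂ] Fock :=
  (sectorGraph op W hadd hsmul).toLinearPMap

theorem mem_graph_sectorOp {op : Fock → (n : ℕ) → Config n → ℂ} {W : Submodule ℂ Fock}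
    {hadd : ∀ ψ ∈ W, ∀ ψ' ∈ W, ∀ n, ∀ᵐ k, op (ψ + ψ') n k = op ψ n k + op ψ' n k}
    {hsmul : ∀ c : ℂ, ∀ ψ ∈ W, ∀ n, ∀ᵐ k, op (c • ψ) n k = c * op ψ n k} {ψ η : Fock} :
    (ψ, η) ∈ (sectorOp op W hadd hsmul).graph ↔ ψ ∈ W ∧ ∀ n, ∀ᵐ k, wave η n k = op ψ n k := by
  unfold sectorOp
  rw [Submodule.toLinearPMap_graph_eq _ sectorGraph_single_valued]
  rfl

/-- `(mψ)ₙ(k) = m n k ψₙ(k)`. -/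
def mulWave (m : (n : ℕ) → Config n → ℝ) (ψ : Fock) (n : ℕ) (k : Config n) : ℂ :=
  (m n k : ℂ) * wave ψ n k

theorem mulWave_add (m : (n : ℕ) → Config n → ℝ) (ψ ψ' : Fock) (n : ℕ) :
    ∀ᵐ k, mulWave m (ψ + ψ') n k = mulWave m ψ n k + mulWave m ψ' n k := by
  filter_upwards [wave_add ψ ψ' n] with k hk
  simp only [mulWave, hk, mul_add]

theorem mulWave_smul (m : (n : ℕ) → Config n → ℝ) (c : ℂ) (ψ : Fock) (n : ℕ) :
    ∀ᵐ k, mulWave m (c • ψ) n k = c * mulWave m ψ n k := by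
  filter_upwards [wave_smul c ψ n] with k hk
  simp only [mulWave, hk]
  ring

/-- Multiplication by the function `m n` in the `n`-boson sector, on its maximal domain. -/
def mulOp (m : (n : ℕ) → Config n → ℝ) : Fock →ₗ.[ℂ] Fock :=
  sectorOp (mulWave m) ⊤ (fun ψ _ ψ' _ n => mulWave_add m ψ ψ' n)
    (fun c ψ _ n => mulWave_smul m c ψ n)

theorem quasiMeasurePreserving_removeNth {n : ℕ} (j : Fin (n + 1)) :
    Measure.QuasiMeasurePreserving (fun k : Config (n + 1) => (j.removeNth k : Config n)) :=
  Measure.quasiMeasurePreserving_snd.comp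
    (volume_preserving_piFinSuccAbove (fun _ : Fin (n + 1) => R3) j).quasiMeasurePreserving

/-- `(a*(f)ψ)₀ = 0` and
`(a*(f)ψ)ₙ₊₁(k₀,…,kₙ) = (n+1)^{-1/2} ∑ⱼ f(kⱼ) ψₙ(k₀,…,k̸ⱼ,…,kₙ)`. -/
def creationWave (f : R3 → ℂ) (ψ : Fock) : (n : ℕ) → Config n → ℂ
  | 0, _ => 0
  | n + 1, k => ((Real.sqrt (n + 1) : ℝ) : ℂ)⁻¹ *
      ∑ j : Fin (n + 1), f (k j) * wave ψ n (j.removeNth k)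

theorem creationWave_add (f : R3 → ℂ) (ψ ψ' : Fock) (n : ℕ) :
    ∀ᵐ k, creationWave f (ψ + ψ') n k = creationWave f ψ n k + creationWave f ψ' n k := by
  cases n with
  | zero => simp [creationWave]
  | succ n =>
    have h : ∀ j : Fin (n + 1), ∀ᵐ k : Config (n + 1),
        wave (ψ + ψ') n (j.removeNth k) =
          wave ψ n (j.removeNth k) + wave ψ' n (j.removeNth k) :=
      fun j => (quasiMeasurePreserving_removeNth j).ae (wave_add ψ ψ' n)
    filter_upwards [ae_all_iff.2 h] with k hk
    simp only [creationWave, hk, mul_add, Finset.sum_add_distrib]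

theorem creationWave_smul (f : R3 → ℂ) (c : ℂ) (ψ : Fock) (n : ℕ) :
    ∀ᵐ k, creationWave f (c • ψ) n k = c * creationWave f ψ n k := by
  cases n with
  | zero => simp [creationWave]
  | succ n =>
    have h : ∀ j : Fin (n + 1), ∀ᵐ k : Config (n + 1),
        wave (c • ψ) n (j.removeNth k) = c * wave ψ n (j.removeNth k) :=
      fun j => (quasiMeasurePreserving_removeNth j).ae (wave_smul c ψ n)
    filter_upwards [ae_all_iff.2 h] with k hk
    simp only [creationWave, hk, Finset.mul_sum]
    refine Finset.sum_congr rfl fun j _ => ?_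
    ring

/-- The creation operator `a*(f)` on its maximal domain. -/
def creation (f : R3 → ℂ) : Fock →ₗ.[ℂ] Fock :=
  sectorOp (creationWave f) ⊤ (fun ψ _ ψ' _ n => creationWave_add f ψ ψ' n)
    (fun c ψ _ n => creationWave_smul f c ψ n)

/-- `(a(f)ψ)ₙ(k₁,…,kₙ) = (n+1)^{1/2} ∫ conj (f(q)) ψₙ₊₁(q,k₁,…,kₙ) dq`. -/
def annihilationWave (f : R3 → ℂ) (ψ : Fock) (n : ℕ) (k : Config n) : ℂ :=
  ((Real.sqrt (n + 1) : ℝ) : ℂ) *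
    ∫ q : R3, (starRingEnd ℂ) (f q) * wave ψ (n + 1) (Fin.cons q k : Config (n + 1))

/-- A property that holds almost everywhere on `(ℝ³)ⁿ⁺¹` holds for almost every `(k₁,…,kₙ)` at
`(q,k₁,…,kₙ)` for almost every `q`. -/
theorem ae_ae_cons {n : ℕ} {p : Config (n + 1) → Prop} (h : ∀ᵐ k, p k) :
    ∀ᵐ k : Config n, ∀ᵐ q : R3, p (Fin.cons q k : Config (n + 1)) := by
  have h1 := (volume_preserving_piFinSuccAbove
    (fun _ : Fin (n + 1) => R3) 0).symm.quasiMeasurePreserving.ae h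
  have h2 : ∀ᵐ z : Config n × R3, p (Fin.cons z.2 z.1 : Config (n + 1)) := by
    have h3 := (Measure.measurePreserving_swap (μ := (volume : Measure (Config n)))
      (ν := (volume : Measure R3))).quasiMeasurePreserving.ae h1
    filter_upwards [h3] with z hz
    simpa [MeasurableEquiv.piFinSuccAbove_symm_apply, Fin.insertNthEquiv] using hz
  exact Measure.ae_ae_of_ae_prod h2

/-- The Fock vectors for which the integrals defining `a(f)ψ` converge absolutely almost
everywhere (all Fock vectors if `f ∈ L²`). -/
def annihilationIntegrable (f : R3 → ℂ) : Submodule ℂ Fock where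
  carrier := {ψ | ∀ n, ∀ᵐ k : Config n, Integrable fun q : R3 =>
    (starRingEnd ℂ) (f q) * wave ψ (n + 1) (Fin.cons q k : Config (n + 1))}
  add_mem' := by
    intro ψ ψ' h h' n
    filter_upwards [h n, h' n, ae_ae_cons (wave_add ψ ψ' (n + 1))] with k h1 h2 h3
    refine (h1.add h2).congr ?_
    filter_upwards [h3] with q hq
    simp only [Pi.add_apply, hq, mul_add]
  zero_mem' := by
    intro n
    filter_upwards [ae_ae_cons (wave_zero (n + 1))] with k h3
    refine (integrable_zero R3 ℂ (volume : Measure R3)).congr ?_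
    filter_upwards [h3] with q hq
    simp [hq]
  smul_mem' := by
    intro c ψ h n
    filter_upwards [h n, ae_ae_cons (wave_smul c ψ (n + 1))] with k h1 h3
    refine (h1.const_mul c).congr ?_
    filter_upwards [h3] with q hq
    rw [hq]
    ring

theorem annihilationWave_add (f : R3 → ℂ) (ψ : Fock) (hψ : ψ ∈ annihilationIntegrable f)
    (ψ' : Fock) (hψ' : ψ' ∈ annihilationIntegrable f) (n : ℕ) :
    ∀ᵐ k, annihilationWave f (ψ + ψ') n k =
      annihilationWave f ψ n k + annihilationWave f ψ' n k := by
  filter_upwards [hψ n, hψ' n, ae_ae_cons (wave_add ψ ψ' (n + 1))] with k h1 h2 h3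
  unfold annihilationWave
  rw [← mul_add, ← integral_add h1 h2]
  congr 1
  refine integral_congr_ae ?_
  filter_upwards [h3] with q hq
  rw [hq, mul_add]

theorem annihilationWave_smul (f : R3 → ℂ) (c : ℂ) (ψ : Fock) (n : ℕ) :
    ∀ᵐ k, annihilationWave f (c • ψ) n k = c * annihilationWave f ψ n k := by
  filter_upwards [ae_ae_cons (wave_smul c ψ (n + 1))] with k h3
  unfold annihilationWave
  rw [mul_left_comm, ← integral_const_mul (μ := (volume : Measure R3)) c]
  congr 1
  refine integral_congr_ae ?_
  filter_upwards [h3] with q hq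
  rw [hq]
  ring

/-- The annihilation operator `a(f)` on its maximal domain. -/
def annihilation (f : R3 → ℂ) : Fock →ₗ.[ℂ] Fock :=
  sectorOp (annihilationWave f) (annihilationIntegrable f) (annihilationWave_add f)
    (fun c ψ _ n => annihilationWave_smul f c ψ n)

/-! ### Products of unbounded operators -/

/-- The product `S T` of unbounded operators, with domain `{ψ ∈ D(T) | T ψ ∈ D(S)}`. -/
def opMul {E : Type*} [AddCommGroup E] [Module ℂ E] (S T : E →ₗ.[ℂ] E) : E →ₗ.[ℂ] E where
  domain :=
    { carrier := {ψ | ∃ h : ψ ∈ T.domain, T ⟨ψ, h⟩ ∈ S.domain}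
      add_mem' := by
        rintro ψ ψ' ⟨h, hS⟩ ⟨h', hS'⟩
        refine ⟨T.domain.add_mem h h', ?_⟩
        have := T.map_add ⟨ψ, h⟩ ⟨ψ', h'⟩
        exact this ▸ S.domain.add_mem hS hS'
      zero_mem' := by
        refine ⟨T.domain.zero_mem, ?_⟩
        have h0 : T ⟨0, T.domain.zero_mem⟩ = 0 := T.map_zero
        rw [h0]
        exact S.domain.zero_mem
      smul_mem' := by
        rintro c ψ ⟨h, hS⟩
        refine ⟨T.domain.smul_mem c h, ?_⟩
        have := T.map_smul c ⟨ψ, h⟩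
        exact this ▸ S.domain.smul_mem c hS }
  toFun :=
    { toFun := fun ψ => S ⟨T ⟨ψ.1, ψ.2.1⟩, ψ.2.2⟩
      map_add' := by
        rintro ⟨ψ, h, hS⟩ ⟨ψ', h', hS'⟩
        refine Eq.trans ?_ (S.map_add ⟨T ⟨ψ, h⟩, hS⟩ ⟨T ⟨ψ', h'⟩, hS'⟩)
        exact congrArg S (Subtype.ext (T.map_add ⟨ψ, h⟩ ⟨ψ', h'⟩))
      map_smul' := by
        rintro c ⟨ψ, h, hS⟩
        refine Eq.trans ?_ (S.map_smul c ⟨T ⟨ψ, h⟩, hS⟩)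
        exact congrArg S (Subtype.ext (T.map_smul c ⟨ψ, h⟩)) }

/-- The scalar product `∑ⱼ Vⱼ Wⱼ` of two 3-vectors of unbounded operators. -/
def dot (V W : Fin 3 → (Fock →ₗ.[ℂ] Fock)) : Fock →ₗ.[ℂ] Fock :=
  opMul (V 0) (W 0) + opMul (V 1) (W 1) + opMul (V 2) (W 2)

infixr:70 " ⊙ " => Nelson.opMul

/-! ### The Nelson operator at total momentum zero -/

/-- The components of the field momentum `𝒫 = ∫ k a*(k) a(k) dk`. -/
def fieldMomentum (j : Fin 3) : Fock →ₗ.[ℂ] Fock := mulOp fun _ k => ∑ i, k i j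

/-- The symbol `|k₁ + ⋯ + kₙ|² + |k₁| + ⋯ + |kₙ|` of `D_f = 𝒫² + H_f`. -/
def freeSymbol (n : ℕ) (k : Config n) : ℝ := ‖∑ i, k i‖ ^ 2 + ∑ i, ‖k i‖

/-- `D_f = 𝒫² + H_f`. -/
def freeOp : Fock →ₗ.[ℂ] Fock := mulOp freeSymbol

/-- `D_f⁻¹`, the inverse of `D_f` on the orthogonal complement of the vacuum (the symbol of `D_f`
vanishes on the vacuum sector and is positive almost everywhere on the other ones); on the vacuum
this operator is `0`, because `0⁻¹ = 0`. -/
def freeInv : Fock →ₗ.[ℂ] Fock := mulOp fun n k => (freeSymbol n k)⁻¹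

/-- The components of `φ(k) = χ(k) (2ω)^{-1/2} k / (ω + k²)`, with `ω = |k|` and
`χ = (2π)^{-3/2} 1_{|k| < Λ}`. -/
def formFactor (Λ : ℝ) (j : Fin 3) (k : R3) : ℂ :=
  (((if ‖k‖ < Λ then (2 * Real.pi) ^ (-(3 / 2) : ℝ) else 0) *
    (1 / Real.sqrt (2 * ‖k‖)) * (k j / (‖k‖ + ‖k‖ ^ 2)) : ℝ) : ℂ)

/-- The 3-vector `A = a(φ)`. -/
def fieldA (Λ : ℝ) (j : Fin 3) : Fock →ₗ.[ℂ] Fock := annihilation (formFactor Λ j)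

/-- The 3-vector `A* = a*(φ)`. -/
def fieldAstar (Λ : ℝ) (j : Fin 3) : Fock →ₗ.[ℂ] Fock := creation (formFactor Λ j)

/-- `A · A`. -/
def opAA (Λ : ℝ) : Fock →ₗ.[ℂ] Fock := dot (fieldA Λ) (fieldA Λ)

/-- `A* · A*`. -/
def opAsAs (Λ : ℝ) : Fock →ₗ.[ℂ] Fock := dot (fieldAstar Λ) (fieldAstar Λ)

/-- `A* · A`. -/
def opAsA (Λ : ℝ) : Fock →ₗ.[ℂ] Fock := dot (fieldAstar Λ) (fieldA Λ)

/-- `A* · 𝒫`. -/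
def opAsP (Λ : ℝ) : Fock →ₗ.[ℂ] Fock := dot (fieldAstar Λ) fieldMomentum

/-- `𝒫 · A`. -/
def opPA (Λ : ℝ) : Fock →ₗ.[ℂ] Fock := dot fieldMomentum (fieldA Λ)

/-- `T_Λ = 𝒫² + H_f + 2e (A*·𝒫 + 𝒫·A) + e² (A*·A* + A·A + 2 A*·A)`, with the natural domain of a
sum of products of unbounded operators. -/
def nelsonT (Λ e : ℝ) : Fock →ₗ.[ℂ] Fock :=
  freeOp + ((2 * e : ℝ) : ℂ) • (opAsP Λ + opPA Λ) +
    ((e ^ 2 : ℝ) : ℂ) • (opAsAs Λ + opAA Λ + (2 : ℂ) • opAsA Λ)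

/-- The spectrum of an unbounded operator `T`: the set of `z` such that `T - z` has no bounded
everywhere defined two-sided inverse. -/
def spec (T : Fock →ₗ.[ℂ] Fock) : Set ℂ :=
  {z | ¬ ∃ R : Fock →L[ℂ] Fock,
    (∀ η : Fock, ∃ h : R η ∈ T.domain, T ⟨R η, h⟩ - z • R η = η) ∧
    ∀ ψ : T.domain, R (T ψ - z • (ψ : Fock)) = ψ}

/-- The self-energy `E⁰_Λ(e) = inf spec(T_Λ)`. -/
def selfEnergy (Λ e : ℝ) : ℝ := sInf {x : ℝ | (x : ℂ) ∈ spec (nelsonT Λ e)}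

/-- The operator `AA D_f⁻¹ A*A*`. -/
def term4 (Λ : ℝ) : Fock →ₗ.[ℂ] Fock := opAA Λ ⊙ freeInv ⊙ opAsAs Λ

/-- The operator `AA D_f⁻¹ 𝒫A D_f⁻¹ A*𝒫 D_f⁻¹ A*A*`. -/
def term6a (Λ : ℝ) : Fock →ₗ.[ℂ] Fock :=
  opAA Λ ⊙ freeInv ⊙ opPA Λ ⊙ freeInv ⊙ opAsP Λ ⊙ freeInv ⊙ opAsAs Λ

/-- The operator `AA D_f⁻¹ A*𝒫 D_f⁻¹ 𝒫A D_f⁻¹ A*A*`. -/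
def term6b (Λ : ℝ) : Fock →ₗ.[ℂ] Fock :=
  opAA Λ ⊙ freeInv ⊙ opAsP Λ ⊙ freeInv ⊙ opPA Λ ⊙ freeInv ⊙ opAsAs Λ

/-- The operator `AA D_f⁻¹ A*A D_f⁻¹ A*A*`. -/
def term6c (Λ : ℝ) : Fock →ₗ.[ℂ] Fock :=
  opAA Λ ⊙ freeInv ⊙ opAsA Λ ⊙ freeInv ⊙ opAsAs Λ

end Nelson

end

/-!
# Expansion of the self-energy of the Nelson-type operator `T_Λ` to order `e⁷`

Self-adjointness is Kato–Rellich: the interaction is bounded relative to `D_f` with relative bound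
`O(|e|)`, uniformly in `Λ`, because `‖a(f)ψ‖` and `‖a(f)a(f)ψ‖` are controlled by `∫ |f|² / |k|` and
`∫ |f|² / |k|^{1/2}`, both bounded uniformly in the cutoff (`exists_isFormFactor`). So the energy is
the infimum of the quadratic form of `T_Λ`, and it remains to bound this form from both sides.

The form has the abstract shape `QForm`. Its only structure used is that `A` is dominated by
`H_f^{1/2}` and that `(ψ, A·A ψ)` is dominated by `‖H_f^{1/2}ψ‖ (‖ψ‖ + ‖H_f^{1/2}ψ‖)`. This gives
the a priori bound `T_Λ ≥ ½ D_f - O(e⁴)` (`QForm.IsBounded.apriori`).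

Upper bound: put `w = D_f⁻¹ A*A* Ω`, `v = D_f⁻¹ (A*𝒫 + 𝒫A) w` and `u = -e² w + 2 e³ v`. The form at
`Ω + u` is the series of the theorem up to `O(e⁷)`, and `‖Ω + u‖² = 1 + O(e⁴)`
(`QForm.IsBounded.upper`). The four expectation values appear as `(w, D_f w)`, the two parts of `(v,
D_f v)`, which belong to one and to three bosons, and `‖A w‖²`.

Lower bound: write `ψ = α (Ω + u) + r` with `r ⊥ Ω`. The cross term is at most `O(e⁴) |α|` times the
form norm of `r`, since `Ω + u` solves the eigenvalue equation up to `O(e⁴)`. It costs only `O(e⁸)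
|α|²` if half of `(r, D_f r)` is available, that is, if the `O(e⁴) ‖r‖²` of the a priori bound is
absorbed by a gap `σ ~ e⁴` above the vacuum (`QForm.IsBounded.lower_of_gap`). There is a gap for
states without soft bosons, of energy below `σ`. The general case is reduced to it as follows.
* The interaction with soft bosons is removed. The soft part of the form factor satisfies `∫_{|k|<σ}
  |f|² / |k| ≤ C σ`, hence has size `O(e²)`, and vectors of negative energy satisfy `‖H_f^{1/2}ψ‖ =
  O(e²) ‖ψ‖`; the change is `O(e⁷)` (`QForm.IsBounded.lower_replace`).
* Soft bosons that do not interact only contribute their energy and momentum. Conditioning on the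
  momentum `q` of one of them leaves a state with one soft boson less and total momentum shifted by
  `q`, plus the energy `|q|` (`negForm_le_posForm`). By induction it is enough to treat states
  without soft bosons and a shift `ξ`, with a loss of at most `|ξ|` in the energy.
* That loss is enough: where the energy is negative, `𝒫 + ξ` and `A` are `O(e²)`, so that a change
  of `ξ` changes the form by less than `|ξ| ‖ψ‖²` (`QForm.IsBounded.lower_shift`).

The form inequality in the second item is an inequality between numbers in `[0, ∞]`, obtained by
completing squares, so that it can be integrated over `q` without any question of domains.
-/

noncomputable section

namespace Nelson

open scoped ENNReal NNReal

/-! ### Semibounded self-adjoint operators -/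

section Abstract

variable {E : Type*} [NormedAddCommGroup E] [InnerProductSpace ℂ E] [CompleteSpace E]

/-- A symmetric operator `T` such that `T + l` is onto for some real `l` is self-adjoint. -/
theorem isSelfAdjoint_of_symmetric_of_surjective {T : E →ₗ.[ℂ] E}
    (hd : Dense (T.domain : Set E))
    (hsymm : ∀ x y : T.domain, inner ℂ (T x) (y : E) = inner ℂ (x : E) (T y)) (l : ℝ)
    (hsurj : ∀ η : E, ∃ x : T.domain, T x + (l : ℂ) • (x : E) = η) : IsSelfAdjoint T := by
  rw [LinearPMap.isSelfAdjoint_def]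
  have hle : T ≤ T.adjoint := LinearPMap.IsFormalAdjoint.le_adjoint hd fun x y => hsymm x y
  refine le_antisymm ?_ hle
  refine ⟨?_, ?_⟩
  · intro y hy
    obtain ⟨ψ, hψ⟩ := hsurj (T.adjoint ⟨y, hy⟩ + (l : ℂ) • y)
    have key : ∀ χ : T.domain, inner ℂ (y - (ψ : E)) (T χ + (l : ℂ) • (χ : E)) = 0 := by
      intro χ
      have h1 : inner ℂ (T.adjoint ⟨y, hy⟩) (χ : E) = inner ℂ y (T χ) :=
        LinearPMap.adjoint_isFormalAdjoint hd ⟨y, hy⟩ χ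
      have h2 := hsymm ψ χ
      have h3 := congrArg (fun z => inner ℂ z (χ : E)) hψ
      simp only [inner_add_left, inner_smul_left, Complex.conj_ofReal] at h3
      simp only [inner_sub_left, inner_add_right, inner_smul_right]
      rw [← h1, ← h2]
      linear_combination -h3
    obtain ⟨χ, hχ⟩ := hsurj (y - ψ)
    have h0 := key χ
    rw [hχ, inner_self_eq_zero, sub_eq_zero] at h0
    rw [h0]
    exact ψ.2
  · rintro x y hxy
    exact (hle.2 (x := y) (y := x) hxy.symm).symm

/-- `T - c` has a bounded everywhere defined two-sided inverse. -/
def HasResolvent (T : E →ₗ.[ℂ] E) (z : ℂ) : Prop :=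
  ∃ R : E →L[ℂ] E, (∀ η : E, ∃ h : R η ∈ T.domain, T ⟨R η, h⟩ - z • R η = η) ∧
    ∀ ψ : T.domain, R (T ψ - z • (ψ : E)) = ψ

theorem IsSelfAdjoint.inner_symm {T : E →ₗ.[ℂ] E} (hT : IsSelfAdjoint T) (x y : T.domain) :
    inner ℂ (T x) (y : E) = inner ℂ (x : E) (T y) := by
  have h := LinearPMap.adjoint_isFormalAdjoint hT.dense_domain
  rw [LinearPMap.isSelfAdjoint_def.1 hT] at h
  exact h x y

theorem hasResolvent_of_lt {T : E →ₗ.[ℂ] E} (hT : IsSelfAdjoint T) {c δ : ℝ} (hδ : 0 < δ)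
    (hb : ∀ x : T.domain, (c + δ) * ‖(x : E)‖ ^ 2 ≤ (inner ℂ (x : E) (T x)).re) :
    HasResolvent T c := by
  set S : T.domain →ₗ[ℂ] E := T.toFun - (c : ℂ) • T.domain.subtype with hS
  have hSx : ∀ x : T.domain, S x = T x - (c : ℂ) • (x : E) := fun x => rfl
  have hlow : ∀ x : T.domain, δ * ‖(x : E)‖ ≤ ‖S x‖ := by
    intro x
    have h1 : (inner ℂ (x : E) (S x)).re = (inner ℂ (x : E) (T x)).re - c * ‖(x : E)‖ ^ 2 := by
      rw [hSx, inner_sub_right, inner_smul_right, inner_self_eq_norm_sq_to_K]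
      simp [← Complex.ofReal_pow]
    have h2 : (inner ℂ (x : E) (S x)).re ≤ ‖(x : E)‖ * ‖S x‖ :=
      (Complex.re_le_norm _).trans (norm_inner_le_norm _ _)
    have h3 := hb x
    by_cases h0 : ‖(x : E)‖ = 0
    · rw [h0]; simp
    · have hp : 0 < ‖(x : E)‖ := lt_of_le_of_ne (norm_nonneg _) (Ne.symm h0)
      have : ‖(x : E)‖ * (δ * ‖(x : E)‖) ≤ ‖(x : E)‖ * ‖S x‖ := by nlinarith
      exact le_of_mul_le_mul_left this hp
  have hinj : Function.Injective S := by
    rw [← LinearMap.ker_eq_bot, LinearMap.ker_eq_bot']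
    intro x hx
    have := hlow x
    rw [hx, norm_zero] at this
    have h0 : ‖(x : E)‖ = 0 := by nlinarith [norm_nonneg (x : E)]
    exact Subtype.ext (norm_eq_zero.1 h0)
  have hclosed : IsClosed (LinearMap.range S : Set E) := by
    rw [← isSeqClosed_iff_isClosed]
    intro u η hu hη
    choose x hx using hu
    have hc : CauchySeq fun n => (x n : E) := by
      have hcu := hη.cauchySeq
      rw [Metric.cauchySeq_iff] at hcu ⊢
      intro ε hε
      obtain ⟨N, hN⟩ := hcu (δ * ε) (mul_pos hδ hε)
      refine ⟨N, fun m hm n hn => ?_⟩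
      have h1 := hlow (x m - x n)
      rw [map_sub, hx, hx] at h1
      have h2 := hN m hm n hn
      rw [dist_eq_norm] at h2 ⊢
      push_cast at h1
      exact lt_of_mul_lt_mul_left (h1.trans_lt h2) hδ.le
    obtain ⟨y, hy⟩ := cauchySeq_tendsto_of_complete hc
    have hTx : Filter.Tendsto (fun n => T (x n)) Filter.atTop (nhds (η + (c : ℂ) • y)) := by
      have : (fun n => T (x n)) = fun n => u n + (c : ℂ) • (x n : E) := by
        funext n
        rw [← hx n, hSx]
        simp
      rw [this]
      exact hη.add (hy.const_smul _)
    have hg : (y, η + (c : ℂ) • y) ∈ T.graph := by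
      have hcl : IsClosed (T.graph : Set (E × E)) := hT.isClosed
      refine hcl.mem_of_tendsto (hy.prodMk_nhds hTx) (Filter.Eventually.of_forall fun n => ?_)
      exact T.mem_graph (x n)
    rw [LinearPMap.mem_graph_iff] at hg
    obtain ⟨z, hz1, hz2⟩ := hg
    simp only at hz1 hz2
    refine ⟨z, ?_⟩
    rw [hSx, hz2, hz1]
    simp
  have hrange : LinearMap.range S = ⊤ := by
    have : CompleteSpace (LinearMap.range S) := hclosed.completeSpace_coe
    rw [← Submodule.orthogonal_eq_bot_iff, Submodule.eq_bot_iff]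
    intro η hη
    rw [Submodule.mem_orthogonal] at hη
    have horth : ∀ x : T.domain, inner ℂ ((c : ℂ) • η) (x : E) = inner ℂ η (T x) := by
      intro x
      have h1 := hη (S x) ⟨x, rfl⟩
      have h2 : inner ℂ η (S x) = 0 := by rw [← inner_conj_symm, h1, map_zero]
      rw [hSx, inner_sub_right, inner_smul_right, sub_eq_zero] at h2
      rw [h2, inner_smul_left, Complex.conj_ofReal]
    have hmem : η ∈ T.adjoint.domain :=
      LinearPMap.mem_adjoint_domain_of_exists η ⟨_, horth⟩
    have hval := LinearPMap.adjoint_apply_eq hT.dense_domain ⟨η, hmem⟩ horth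
    have hTT := LinearPMap.isSelfAdjoint_def.1 hT
    have hmem' : η ∈ T.domain := by rw [hTT] at hmem; exact hmem
    have hval' : T ⟨η, hmem'⟩ = (c : ℂ) • η := by
      have : T.adjoint ⟨η, hmem⟩ = T ⟨η, hmem'⟩ := (le_of_eq hTT).2 rfl
      rw [← this, hval]
    have := hlow ⟨η, hmem'⟩
    rw [hSx, hval'] at this
    simp only [sub_self, norm_zero] at this
    have h0 : ‖η‖ = 0 := by nlinarith [norm_nonneg η]
    exact norm_eq_zero.1 h0
  let e := LinearEquiv.ofBijective S ⟨hinj, LinearMap.range_eq_top.1 hrange⟩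
  have hbd : ∀ η : E, ‖(T.domain.subtype ∘ₗ (e.symm : E →ₗ[ℂ] T.domain)) η‖ ≤ δ⁻¹ * ‖η‖ := by
    intro η
    have h1 := hlow (e.symm η)
    have h2 : S (e.symm η) = η := e.apply_symm_apply η
    rw [h2] at h1
    rw [inv_mul_eq_div, le_div_iff₀ hδ, mul_comm]
    exact h1
  refine ⟨(T.domain.subtype ∘ₗ (e.symm : E →ₗ[ℂ] T.domain)).mkContinuous _ hbd, ?_, ?_⟩
  · intro η
    exact ⟨(e.symm η).2, e.apply_symm_apply η⟩
  · intro ψ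
    exact congrArg (Subtype.val) (e.symm_apply_apply ψ)

theorem not_hasResolvent_of_isGLB {T : E →ₗ.[ℂ] E} (hT : IsSelfAdjoint T) {c : ℝ}
    (hb : ∀ x : T.domain, c * ‖(x : E)‖ ^ 2 ≤ (inner ℂ (x : E) (T x)).re)
    (hR : HasResolvent T c) :
    ∃ δ > 0, ∀ x : T.domain, (c + δ) * ‖(x : E)‖ ^ 2 ≤ (inner ℂ (x : E) (T x)).re := by
  obtain ⟨R, hR1, -⟩ := hR
  set K : ℝ := ‖R‖ + 1 with hK
  have hKpos : 0 < K := by positivity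
  refine ⟨K⁻¹, inv_pos.2 hKpos, fun x => ?_⟩
  obtain ⟨hy, hyx⟩ := hR1 x
  set y : T.domain := ⟨R x, hy⟩ with hydef
  have hTy : T y = (x : E) + (c : ℂ) • (y : E) := by
    rw [← sub_eq_iff_eq_add]; exact hyx
  have hyn : ‖(y : E)‖ ≤ ‖R‖ * ‖(x : E)‖ := R.le_opNorm _
  -- the form of `T - c` at `x - K⁻¹ R x` is nonnegative
  have h := hb (x - ((K⁻¹ : ℝ) : ℂ) • y)
  have hsym := IsSelfAdjoint.inner_symm hT y x
  have hxx : (inner ℂ (x : E) (x : E)) = ((‖(x : E)‖ ^ 2 : ℝ) : ℂ) := by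
    rw [inner_self_eq_norm_sq_to_K]; simp
  have hyy : (inner ℂ (y : E) (y : E)) = ((‖(y : E)‖ ^ 2 : ℝ) : ℂ) := by
    rw [inner_self_eq_norm_sq_to_K]; simp
  have hconj : (inner ℂ (x : E) (y : E)).re = (inner ℂ (y : E) (x : E)).re := by
    rw [← inner_conj_symm, Complex.conj_re]
  have hyxb : (inner ℂ (y : E) (x : E)).re ≤ ‖R‖ * ‖(x : E)‖ ^ 2 := by
    refine ((Complex.re_le_norm _).trans (norm_inner_le_norm _ _)).trans ?_
    nlinarith [norm_nonneg (x : E)]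
  rw [hTy, inner_add_left, hxx, inner_smul_left, Complex.conj_ofReal] at hsym
  have hnorm : ‖((x - ((K⁻¹ : ℝ) : ℂ) • y : T.domain) : E)‖ ^ 2 =
      ‖(x : E)‖ ^ 2 - 2 * K⁻¹ * (inner ℂ (y : E) (x : E)).re + K⁻¹ ^ 2 * ‖(y : E)‖ ^ 2 := by
    have : ((x - ((K⁻¹ : ℝ) : ℂ) • y : T.domain) : E) = (x : E) - ((K⁻¹ : ℝ) : ℂ) • (y : E) := rfl
    rw [this, @norm_sub_sq ℂ, inner_smul_right, norm_smul]
    have : RCLike.re (((K⁻¹ : ℝ) : ℂ) * inner ℂ (x : E) (y : E)) =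
        K⁻¹ * (inner ℂ (y : E) (x : E)).re := by
      rw [← hconj]; simp
    rw [this, Complex.norm_real, mul_pow, Real.norm_eq_abs, sq_abs]
    ring
  have hform : (inner ℂ ((x - ((K⁻¹ : ℝ) : ℂ) • y : T.domain) : E)
      (T (x - ((K⁻¹ : ℝ) : ℂ) • y))).re = (inner ℂ (x : E) (T x)).re
        - K⁻¹ * ((‖(x : E)‖ ^ 2 + c * (inner ℂ (y : E) (x : E)).re) * 2)
        + K⁻¹ ^ 2 * ((inner ℂ (y : E) (x : E)).re + c * ‖(y : E)‖ ^ 2) := by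
    have h1 : ((x - ((K⁻¹ : ℝ) : ℂ) • y : T.domain) : E) = (x : E) - ((K⁻¹ : ℝ) : ℂ) • (y : E) := rfl
    rw [h1, T.map_sub, T.map_smul, hTy]
    simp only [inner_sub_left, inner_sub_right, inner_smul_left, inner_smul_right, inner_add_right,
      ← hsym, hxx, hyy, Complex.conj_ofReal, Complex.add_re, Complex.sub_re, Complex.re_ofReal_mul,
      Complex.ofReal_re, hconj]
    ring
  rw [hnorm, hform] at h
  have hKK : K⁻¹ * K = 1 := inv_mul_cancel₀ hKpos.ne'
  have hRK : K⁻¹ * ‖R‖ ≤ 1 := by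
    rw [← hKK]; exact mul_le_mul_of_nonneg_left (by linarith) (inv_pos.2 hKpos).le
  have h5 : K⁻¹ ^ 2 * (inner ℂ (y : E) (x : E)).re ≤ K⁻¹ * ‖(x : E)‖ ^ 2 := by
    have hx2 : 0 ≤ K⁻¹ * ‖(x : E)‖ ^ 2 := by positivity
    calc K⁻¹ ^ 2 * (inner ℂ (y : E) (x : E)).re ≤ K⁻¹ ^ 2 * (‖R‖ * ‖(x : E)‖ ^ 2) := by gcongr
      _ = (K⁻¹ * ‖R‖) * (K⁻¹ * ‖(x : E)‖ ^ 2) := by ring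
      _ ≤ 1 * (K⁻¹ * ‖(x : E)‖ ^ 2) := by gcongr
      _ = _ := one_mul _
  nlinarith

/-- The infimum of the spectrum of a semibounded self-adjoint operator is the infimum of its
quadratic form on unit vectors. -/
theorem isGLB_spectrum_of_isGLB_form {T : E →ₗ.[ℂ] E} (hT : IsSelfAdjoint T) {c : ℝ}
    (hb : ∀ x : T.domain, c * ‖(x : E)‖ ^ 2 ≤ (inner ℂ (x : E) (T x)).re)
    (hopt : ∀ δ > 0, ∃ x : T.domain, (inner ℂ (x : E) (T x)).re < (c + δ) * ‖(x : E)‖ ^ 2) :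
    IsGLB {x : ℝ | ¬ HasResolvent T (x : ℂ)} c := by
  constructor
  · intro x hx
    by_contra hlt
    push Not at hlt
    refine hx (hasResolvent_of_lt hT (δ := c - x) (by linarith) fun y => ?_)
    have := hb y
    simpa using this
  · intro b hbl
    refine hbl fun hR => ?_
    obtain ⟨δ, hδ, h⟩ := not_hasResolvent_of_isGLB hT hb hR
    obtain ⟨x, hx⟩ := hopt δ hδ
    exact absurd (h x) (not_le.2 hx)

/-- Kato–Rellich: a perturbation with relative bound less than `1` keeps `D + V + l` onto for
large `l`. -/
theorem exists_surjective_add_of_relatively_bounded {S : Submodule ℂ E} (D V : S →ₗ[ℂ] E)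
    (hsurj : ∀ l : ℝ, 0 < l → ∀ η : E, ∃ x : S, D x + (l : ℂ) • (x : E) = η)
    (hlow : ∀ l : ℝ, 0 < l → ∀ x : S, l * ‖(x : E)‖ ≤ ‖D x + (l : ℂ) • (x : E)‖)
    (hD : ∀ l : ℝ, 0 < l → ∀ x : S, ‖D x‖ ≤ ‖D x + (l : ℂ) • (x : E)‖)
    {a b : ℝ} (ha0 : 0 ≤ a) (ha : a < 1) (hb : 0 ≤ b)
    (hV : ∀ x : S, ‖V x‖ ≤ a * ‖D x‖ + b * ‖(x : E)‖) :
    ∃ l : ℝ, ∀ η : E, ∃ x : S, D x + V x + (l : ℂ) • (x : E) = η := by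
  set l : ℝ := 2 * (b + 1) / (1 - a) with hl
  have h1a : 0 < 1 - a := by linarith
  have hlpos : 0 < l := by positivity
  refine ⟨l, ?_⟩
  set G : S →ₗ[ℂ] E := D + (l : ℂ) • S.subtype with hG
  have hGx : ∀ x : S, G x = D x + (l : ℂ) • (x : E) := fun x => rfl
  have hinj : Function.Injective G := by
    rw [← LinearMap.ker_eq_bot, LinearMap.ker_eq_bot']
    intro x hx
    have := hlow l hlpos x
    rw [← hGx, hx, norm_zero] at this
    have h0 : ‖(x : E)‖ = 0 := by nlinarith [norm_nonneg (x : E)]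
    exact Subtype.ext (norm_eq_zero.1 h0)
  let e := LinearEquiv.ofBijective G ⟨hinj, fun η => hsurj l hlpos η⟩
  set q : ℝ := a + b / l with hq
  have hq1 : q < 1 := by
    have : b / l < 1 - a := by
      rw [div_lt_iff₀ hlpos, hl]
      field_simp
      linarith
    linarith
  have hK : ∀ η : E, ‖(V ∘ₗ (e.symm : E →ₗ[ℂ] S)) η‖ ≤ q * ‖η‖ := by
    intro η
    have h2 : D (e.symm η) + (l : ℂ) • ((e.symm η : S) : E) = η := e.apply_symm_apply η
    have h3 := hlow l hlpos (e.symm η)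
    have h4 := hD l hlpos (e.symm η)
    rw [h2] at h3 h4
    refine (hV (e.symm η)).trans ?_
    have h5 : ‖((e.symm η : S) : E)‖ ≤ ‖η‖ / l := by rw [le_div_iff₀ hlpos]; linarith
    calc a * ‖D (e.symm η)‖ + b * ‖((e.symm η : S) : E)‖ ≤ a * ‖η‖ + b * (‖η‖ / l) := by gcongr
      _ = q * ‖η‖ := by rw [hq]; ring
  set K : E →L[ℂ] E := (V ∘ₗ (e.symm : E →ₗ[ℂ] S)).mkContinuous q hK with hKdef
  have hKn : ‖-K‖ < 1 := by
    rw [norm_neg]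
    refine lt_of_le_of_lt (LinearMap.mkContinuous_norm_le _ ?_ _) hq1
    have := div_nonneg hb hlpos.le
    linarith
  obtain ⟨u, hu⟩ := isUnit_one_sub_of_norm_lt_one hKn
  intro η
  refine ⟨e.symm ((↑u⁻¹ : E →L[ℂ] E) η), ?_⟩
  set ζ := (↑u⁻¹ : E →L[ℂ] E) η with hζ
  have h2 : D (e.symm ζ) + (l : ℂ) • ((e.symm ζ : S) : E) = ζ := e.apply_symm_apply ζ
  have h3 : ζ + K ζ = η := by
    have : (u : E →L[ℂ] E) ζ = η := by
      rw [hζ, ← mul_apply_eq_comp, Units.mul_inv, one_apply_eq_self]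
    rw [hu] at this
    simpa using this
  have h4 : K ζ = V (e.symm ζ) := rfl
  rw [← h3, h4, add_right_comm, h2]

end Abstract

/-! ### Wave functions and weighted energies -/

/-- A sequence of wave functions, one for each boson number. -/
abbrev Wave : Type := (n : ℕ) → Config n → ℂ

/-- A weight on each sector. -/
abbrev Weight : Type := (n : ℕ) → Config n → ℝ≥0∞

/-- Measurable wave functions that are symmetric everywhere (not only almost everywhere). -/
structure IsBose (g : Wave) : Prop where
  meas : ∀ n, Measurable (g n)
  symm : ∀ n (σ : Equiv.Perm (Fin n)) k, g n (fun i => k (σ i)) = g n k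

/-- Measurable symmetric weights. -/
structure IsBoseWeight (m : Weight) : Prop where
  meas : ∀ n, Measurable (m n)
  symm : ∀ n (σ : Equiv.Perm (Fin n)) k, m n (fun i => k (σ i)) = m n k

/-- The weighted energy `∑ₙ ∫ m |gₙ|²`. -/
def en (m : Weight) (g : Wave) : ℝ≥0∞ := ∑' n, ∫⁻ k, m n k * ‖g n k‖ₑ ^ 2

/-- The weight `1`. -/
def one' : Weight := fun _ _ => 1

/-- The weight `|k₁| + ⋯ + |kₙ|`, the symbol of `H_f`. -/
def absSum : Weight := fun _ k => ∑ i, ‖k i‖ₑ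

theorem en_congr {m : Weight} {g g' : Wave} (h : ∀ n, ∀ᵐ k, g n k = g' n k) :
    en m g = en m g' := by
  unfold en
  refine tsum_congr fun n => lintegral_congr_ae ?_
  filter_upwards [h n] with k hk
  rw [hk]

theorem en_mono {m m' : Weight} {g g' : Wave}
    (h : ∀ n, ∀ᵐ k, m n k * ‖g n k‖ₑ ^ 2 ≤ m' n k * ‖g' n k‖ₑ ^ 2) : en m g ≤ en m' g' :=
  ENNReal.tsum_le_tsum fun n => lintegral_mono_ae (h n)

theorem measurePreserving_cons (n : ℕ) :
    MeasurePreserving (fun p : R3 × Config n => (Fin.cons p.1 p.2 : Config (n + 1))) := by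
  have h := (volume_preserving_piFinSuccAbove (fun _ : Fin (n + 1) => R3) 0).symm
  convert h using 1
  ext p i
  refine Fin.cases ?_ (fun j => ?_) i <;>
    simp [MeasurableEquiv.piFinSuccAbove_symm_apply, Fin.insertNthEquiv]

theorem measurable_cons (n : ℕ) :
    Measurable (fun p : R3 × Config n => (Fin.cons p.1 p.2 : Config (n + 1))) :=
  (measurePreserving_cons n).measurable

theorem measurable_cons_left {n : ℕ} (k : Config n) :
    Measurable (fun q : R3 => (Fin.cons q k : Config (n + 1))) :=
  (measurable_cons n).comp (measurable_id.prodMk measurable_const)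

theorem measurable_cons_right {n : ℕ} (q : R3) :
    Measurable (fun k : Config n => (Fin.cons q k : Config (n + 1))) :=
  (measurable_cons n).comp (measurable_const.prodMk measurable_id)

theorem measurableEmbedding_cons (n : ℕ) :
    MeasurableEmbedding (fun p : R3 × Config n => (Fin.cons p.1 p.2 : Config (n + 1))) := by
  have h := (MeasurableEquiv.piFinSuccAbove (fun _ : Fin (n + 1) => R3) 0).symm.measurableEmbedding
  convert h using 1
  ext p i
  refine Fin.cases ?_ (fun j => ?_) i <;>
    simp [MeasurableEquiv.piFinSuccAbove_symm_apply, Fin.insertNthEquiv]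

theorem lintegral_cons {n : ℕ} {F : Config (n + 1) → ℝ≥0∞} (hF : Measurable F) :
    ∫⁻ k, F k = ∫⁻ q : R3, ∫⁻ k : Config n, F (Fin.cons q k) := by
  rw [← (measurePreserving_cons n).lintegral_comp hF]
  exact lintegral_prod _ (hF.comp (measurable_cons n)).aemeasurable

theorem lintegral_cons' {n : ℕ} {F : Config (n + 1) → ℝ≥0∞} (hF : Measurable F) :
    ∫⁻ k, F k = ∫⁻ k : Config n, ∫⁻ q : R3, F (Fin.cons q k) := by
  rw [← (measurePreserving_cons n).lintegral_comp hF]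
  exact lintegral_prod_symm' _ (hF.comp (measurable_cons n))

theorem integrable_cons {n : ℕ} {F : Config (n + 1) → ℂ} (hF : Integrable F) :
    Integrable (fun p : R3 × Config n => F (Fin.cons p.1 p.2)) :=
  (measurePreserving_cons n).integrable_comp_of_integrable hF

theorem integral_cons {n : ℕ} {F : Config (n + 1) → ℂ} (hF : Integrable F) :
    ∫ k, F k = ∫ q : R3, ∫ k : Config n, F (Fin.cons q k) := by
  rw [← (measurePreserving_cons n).integral_comp (measurableEmbedding_cons n)]
  exact integral_prod _ (integrable_cons hF)

theorem lintegral_perm {n : ℕ} (σ : Equiv.Perm (Fin n)) {F : Config n → ℝ≥0∞}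
    (hF : Measurable F) : ∫⁻ k : Config n, F (fun i => k (σ i)) = ∫⁻ k, F k :=
  (measurePreserving_perm σ).lintegral_comp hF

theorem integral_perm {n : ℕ} (σ : Equiv.Perm (Fin n)) (F : Config n → ℂ) :
    ∫ k : Config n, F (fun i => k (σ i)) = ∫ k, F k := by
  have h : MeasurableEmbedding (fun (k : Config n) (i : Fin n) => k (σ i)) :=
    (MeasurableEquiv.arrowCongr' σ.symm (MeasurableEquiv.refl R3)).measurableEmbedding
  exact (measurePreserving_perm σ).integral_comp h F

theorem lintegral_sum_symm {n : ℕ} {h : R3 → ℝ≥0∞} (hh : Measurable h)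
    {g : Config (n + 1) → ℝ≥0∞} (hg : Measurable g)
    (hs : ∀ (σ : Equiv.Perm (Fin (n + 1))) k, g (fun i => k (σ i)) = g k) :
    ∫⁻ k, (∑ i, h (k i)) * g k = ((n : ℝ≥0∞) + 1) * ∫⁻ q : R3, ∫⁻ k : Config n,
      h q * g (Fin.cons q k) := by
  have hm : ∀ i : Fin (n + 1), Measurable fun k : Config (n + 1) => h (k i) * g k := fun i =>
    (hh.comp (measurable_pi_apply i)).mul hg
  have h1 : ∀ i : Fin (n + 1), ∫⁻ k : Config (n + 1), h (k i) * g k =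
      ∫⁻ k : Config (n + 1), h (k 0) * g k := by
    intro i
    rw [← lintegral_perm (Equiv.swap 0 i) (hm 0)]
    simp only [Equiv.swap_apply_left, hs]
  simp_rw [Finset.sum_mul]
  rw [lintegral_finsetSum _ fun i _ => hm i]
  simp_rw [h1]
  rw [Finset.sum_const, Finset.card_univ, Fintype.card_fin, nsmul_eq_mul, lintegral_cons (hm 0)]
  simp

theorem absSum_cons {n : ℕ} (q : R3) (k : Config n) :
    absSum (n + 1) (Fin.cons q k) = ‖q‖ₑ + absSum n k := by
  simp [absSum, Fin.sum_univ_succ]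

theorem isBoseWeight_absSum : IsBoseWeight absSum where
  meas n := by unfold absSum; fun_prop
  symm n σ k := by
    unfold absSum
    exact Equiv.sum_comp σ (fun i => ‖k i‖ₑ)

theorem isBoseWeight_one : IsBoseWeight one' where
  meas _ := measurable_const
  symm _ _ _ := rfl

theorem absSum_lt_top {n : ℕ} (k : Config n) : absSum n k < ⊤ := by
  unfold absSum
  exact ENNReal.sum_lt_top.2 fun i _ => enorm_lt_top

theorem exists_perm_cons {n : ℕ} (σ : Equiv.Perm (Fin n)) :
    ∃ τ : Equiv.Perm (Fin (n + 1)), ∀ (q : R3) (k : Config n),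
      (Fin.cons q (fun i => k (σ i)) : Config (n + 1)) =
        fun i => (Fin.cons q k : Config (n + 1)) (τ i) := by
  refine ⟨Equiv.Perm.decomposeFin.symm (0, σ), fun q k => ?_⟩
  funext i
  refine Fin.cases ?_ (fun j => ?_) i <;> simp

theorem exists_perm_removeNth {n : ℕ} (σ : Equiv.Perm (Fin (n + 1))) (j : Fin (n + 1)) :
    ∃ τ : Equiv.Perm (Fin n), ∀ k : Config (n + 1),
      (j.removeNth (fun i => k (σ i)) : Config n) = fun i => (σ j).removeNth k (τ i) := by
  let e1 : Fin n ≃ {x // x ≠ j} := finSuccAboveEquiv j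
  let e2 : Fin n ≃ {x // x ≠ σ j} := finSuccAboveEquiv (σ j)
  let s : {x // x ≠ j} ≃ {x // x ≠ σ j} := σ.subtypeEquiv fun x => by simp
  refine ⟨(e1.trans s).trans e2.symm, fun k => ?_⟩
  funext i
  have h : (σ j).succAbove (e2.symm (s (e1 i))) = σ (j.succAbove i) := by
    have := e2.apply_symm_apply (s (e1 i))
    have h2 := congrArg Subtype.val this
    exact h2
  change k (σ (j.succAbove i)) = k ((σ j).succAbove (e2.symm (s (e1 i))))
  rw [h]

theorem IsBose.measurable_sq {g : Wave} (hg : IsBose g) (n : ℕ) :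
    Measurable fun k => ‖g n k‖ₑ ^ 2 := (hg.meas n).enorm.pow_const 2

theorem IsBose.symm_sq {g : Wave} (hg : IsBose g) (n : ℕ) (σ : Equiv.Perm (Fin n)) (k : Config n) :
    ‖g n (fun i => k (σ i))‖ₑ ^ 2 = ‖g n k‖ₑ ^ 2 := by rw [hg.symm]

theorem ae_ne_zero_R3 : ∀ᵐ q : R3, q ≠ 0 := by
  exact compl_mem_ae_iff.2 (measure_singleton 0)

theorem ae_forall_ne_zero (n : ℕ) : ∀ᵐ k : Config n, ∀ i, k i ≠ 0 := by
  rw [ae_all_iff]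
  intro i
  exact (Measure.quasiMeasurePreserving_eval (μ := fun _ : Fin n => (volume : Measure R3)) i).ae
    ae_ne_zero_R3

/-! ### Fock vectors and their wave functions -/

theorem measurable_wave (ψ : Fock) (n : ℕ) : Measurable (wave ψ n) :=
  (Lp.stronglyMeasurable _).measurable

theorem wave_perm (ψ : Fock) (n : ℕ) (σ : Equiv.Perm (Fin n)) :
    ∀ᵐ k, wave ψ n (fun i => k (σ i)) = wave ψ n k := by
  have h1 := Lp.coeFn_compMeasurePreserving ((ψ n : symL2 n) : Lp ℂ 2 volume)
    (measurePreserving_perm σ)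
  rw [(ψ n).2 σ] at h1
  filter_upwards [h1] with k hk
  exact hk.symm

/-- A representative of the wave functions of `ψ` that is measurable and symmetric everywhere. -/
def rep (ψ : Fock) : Wave := fun n k =>
  ((n.factorial : ℂ))⁻¹ * ∑ σ : Equiv.Perm (Fin n), wave ψ n (fun i => k (σ i))

theorem rep_ae (ψ : Fock) (n : ℕ) : ∀ᵐ k, rep ψ n k = wave ψ n k := by
  filter_upwards [ae_all_iff.2 (wave_perm ψ n)] with k hk
  unfold rep
  simp only [hk, Finset.sum_const, Finset.card_univ, Fintype.card_perm, Fintype.card_fin,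
    nsmul_eq_mul]
  rw [← mul_assoc, inv_mul_cancel₀ (by exact_mod_cast n.factorial_ne_zero), one_mul]

theorem isBose_rep (ψ : Fock) : IsBose (rep ψ) where
  meas n := by
    refine Measurable.const_mul (Finset.measurable_sum _ fun σ _ => ?_) _
    exact (measurable_wave ψ n).comp (measurePreserving_perm σ).measurable
  symm n τ k := by
    unfold rep
    congr 1
    exact Fintype.sum_equiv (Equiv.mulLeft τ) _ _ fun σ => rfl

theorem enorm_sq_sector {n : ℕ} (f : Lp ℂ 2 (volume : Measure (Config n))) :
    ‖f‖ₑ ^ 2 = ∫⁻ k, ‖f k‖ₑ ^ 2 := by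
  rw [Lp.enorm_def, eLpNorm_eq_lintegral_rpow_enorm_toReal (by norm_num) (by norm_num)]
  simp only [ENNReal.toReal_ofNat, ENNReal.rpow_ofNat, one_div]
  rw [← ENNReal.rpow_natCast, ← ENNReal.rpow_mul]
  norm_num

theorem enorm_sq_eq_en (ψ : Fock) : ‖ψ‖ₑ ^ 2 = en one' (wave ψ) := by
  have h2 : (0 : ℝ) < (2 : ℝ≥0∞).toReal := by norm_num
  have h := lp.hasSum_norm h2 ψ
  simp only [ENNReal.toReal_ofNat, Real.rpow_ofNat] at h
  have h3 := ENNReal.ofReal_tsum_of_nonneg (fun n => sq_nonneg ‖ψ n‖) h.summable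
  rw [h.tsum_eq] at h3
  rw [← ofReal_norm, ← ENNReal.ofReal_pow (norm_nonneg _), h3]
  unfold en one'
  refine tsum_congr fun n => ?_
  rw [ENNReal.ofReal_pow (norm_nonneg _), ofReal_norm]
  simp only [one_mul]
  exact enorm_sq_sector _

theorem en_wave_lt_top (ψ : Fock) : en one' (wave ψ) < ⊤ := by
  rw [← enorm_sq_eq_en]
  exact ENNReal.pow_lt_top enorm_lt_top

theorem en_rep (m : Weight) (ψ : Fock) : en m (rep ψ) = en m (wave ψ) := en_congr (rep_ae ψ)

theorem memLp_of_en {g : Wave} (hg : IsBose g) (h : en one' g < ⊤) (n : ℕ) : MemLp (g n) 2 := by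
  refine ⟨(hg.meas n).aestronglyMeasurable, ?_⟩
  rw [eLpNorm_lt_top_iff_lintegral_rpow_enorm_lt_top (by norm_num) (by norm_num)]
  simp only [ENNReal.toReal_ofNat, ENNReal.rpow_ofNat]
  refine lt_of_le_of_lt ?_ h
  unfold en one'
  simp only [one_mul]
  exact ENNReal.le_tsum (f := fun n => ∫⁻ k, ‖g n k‖ₑ ^ 2) n

theorem symm_toLp {g : Wave} (hg : IsBose g) (h : en one' g < ⊤) (n : ℕ) :
    (memLp_of_en hg h n).toLp (g n) ∈ symL2 n := by
  intro σ
  rw [Lp.toLp_compMeasurePreserving]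
  congr 1
  funext k
  exact hg.symm n σ k

/-- The Fock vector with given wave functions of finite norm. -/
def ofWave (g : Wave) (hg : IsBose g) (h : en one' g < ⊤) : Fock :=
  ⟨fun n => ⟨(memLp_of_en hg h n).toLp (g n), symm_toLp hg h n⟩, by
    refine memℓp_gen ?_
    simp only [ENNReal.toReal_ofNat, Real.rpow_ofNat]
    have h1 : ∀ n, ENNReal.ofReal (‖(⟨(memLp_of_en hg h n).toLp (g n), symm_toLp hg h n⟩ :
        symL2 n)‖ ^ 2) = ∫⁻ k, ‖g n k‖ₑ ^ 2 := by
      intro n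
      rw [ENNReal.ofReal_pow (norm_nonneg _), ofReal_norm]
      refine (enorm_sq_sector _).trans (lintegral_congr_ae ?_)
      filter_upwards [(memLp_of_en hg h n).coeFn_toLp] with k hk
      exact congrArg (fun z : ℂ => ‖z‖ₑ ^ 2) hk
    refine summable_of_sum_le (c := (en one' g).toReal) (fun n => sq_nonneg _) fun s => ?_
    rw [← ENNReal.ofReal_le_iff_le_toReal h.ne,
      ENNReal.ofReal_sum_of_nonneg fun n _ => sq_nonneg _]
    simp_rw [h1]
    unfold en one'
    simp only [one_mul]
    exact ENNReal.sum_le_tsum s⟩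

theorem wave_ofWave {g : Wave} (hg : IsBose g) (h : en one' g < ⊤) (n : ℕ) :
    ∀ᵐ k, wave (ofWave g hg h) n k = g n k :=
  (memLp_of_en hg h n).coeFn_toLp

theorem hasSum_inner_wave (ψ χ : Fock) :
    HasSum (fun n => ∫ k, (starRingEnd ℂ) (wave ψ n k) * wave χ n k) (inner ℂ ψ χ) := by
  have h := lp.hasSum_inner (𝕜 := ℂ) ψ χ
  refine (congrArg (fun F => HasSum F (inner ℂ ψ χ)) (funext fun n => ?_)).mp h
  have : inner ℂ (ψ n) (χ n) = inner ℂ ((ψ n : symL2 n) : Lp ℂ 2 (volume : Measure (Config n)))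
    ((χ n : symL2 n) : Lp ℂ 2 (volume : Measure (Config n))) := rfl
  rw [this, L2.inner_def]
  refine integral_congr_ae (Filter.Eventually.of_forall fun k => ?_)
  simp only [RCLike.inner_apply]
  exact mul_comm _ _

theorem inner_eq_of_ae {ψ χ ψ' χ' : Fock} (h : ∀ n, ∀ᵐ k,
    (starRingEnd ℂ) (wave ψ n k) * wave χ n k = (starRingEnd ℂ) (wave ψ' n k) * wave χ' n k) :
    inner ℂ ψ χ = inner ℂ ψ' χ' := by
  refine (hasSum_inner_wave ψ χ).unique ?_
  refine (congrArg (fun F => HasSum F (inner ℂ ψ' χ')) (funext fun n => ?_)).mp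
    (hasSum_inner_wave ψ' χ')
  symm
  exact integral_congr_ae (h n)

/-! ### Creation and annihilation of wave functions -/

/-- The creation operator on sequences of wave functions. -/
def crW (f : R3 → ℂ) (g : Wave) : Wave
  | 0, _ => 0
  | n + 1, k => ((Real.sqrt (n + 1) : ℝ) : ℂ)⁻¹ *
      ∑ j : Fin (n + 1), f (k j) * g n (j.removeNth k)

/-- The annihilation operator on sequences of wave functions. -/
def anW (f : R3 → ℂ) (g : Wave) : Wave := fun n k =>
  ((Real.sqrt (n + 1) : ℝ) : ℂ) *
    ∫ q : R3, (starRingEnd ℂ) (f q) * g (n + 1) (Fin.cons q k : Config (n + 1))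

theorem creationWave_eq (f : R3 → ℂ) (ψ : Fock) : creationWave f ψ = crW f (wave ψ) := by
  funext n k
  cases n <;> rfl

theorem annihilationWave_eq (f : R3 → ℂ) (ψ : Fock) : annihilationWave f ψ = anW f (wave ψ) := rfl

theorem crW_congr (f : R3 → ℂ) {g g' : Wave} (h : ∀ n, ∀ᵐ k, g n k = g' n k) (n : ℕ) :
    ∀ᵐ k, crW f g n k = crW f g' n k := by
  cases n with
  | zero => simp [crW]
  | succ n =>
    have h1 : ∀ j : Fin (n + 1), ∀ᵐ k : Config (n + 1),
        g n (j.removeNth k) = g' n (j.removeNth k) :=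
      fun j => (quasiMeasurePreserving_removeNth j).ae (h n)
    filter_upwards [ae_all_iff.2 h1] with k hk
    simp only [crW, hk]

theorem anW_congr (f : R3 → ℂ) {g g' : Wave} (h : ∀ n, ∀ᵐ k, g n k = g' n k) (n : ℕ) :
    ∀ᵐ k, anW f g n k = anW f g' n k := by
  filter_upwards [ae_ae_cons (h (n + 1))] with k hk
  unfold anW
  congr 1
  refine integral_congr_ae ?_
  filter_upwards [hk] with q hq
  rw [hq]

theorem measurable_removeNth {n : ℕ} (j : Fin (n + 1)) :
    Measurable (fun k : Config (n + 1) => (j.removeNth k : Config n)) :=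
  (quasiMeasurePreserving_removeNth j).measurable

theorem isBose_crW {f : R3 → ℂ} (hf : Measurable f) {g : Wave} (hg : IsBose g) :
    IsBose (crW f g) where
  meas n := by
    cases n with
    | zero => exact measurable_const
    | succ n =>
      refine Measurable.const_mul (Finset.measurable_sum _ fun j _ => ?_) _
      exact (hf.comp (measurable_pi_apply j)).mul ((hg.meas n).comp (measurable_removeNth j))
  symm n σ k := by
    cases n with
    | zero => rfl
    | succ n =>
      simp only [crW]
      congr 1
      refine Fintype.sum_equiv σ _ _ fun j => ?_
      obtain ⟨τ, hτ⟩ := exists_perm_removeNth σ j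
      rw [hτ, hg.symm]

theorem isBose_anW {f : R3 → ℂ} (hf : Measurable f) {g : Wave} (hg : IsBose g) :
    IsBose (anW f g) where
  meas n := by
    refine Measurable.const_mul ?_ _
    have h : StronglyMeasurable (fun p : Config n × R3 => (starRingEnd ℂ) (f p.2) *
        g (n + 1) (Fin.cons p.2 p.1 : Config (n + 1))) := by
      refine Measurable.stronglyMeasurable ?_
      refine (Complex.continuous_conj.measurable.comp (hf.comp measurable_snd)).mul ?_
      exact (hg.meas (n + 1)).comp ((measurable_cons n).comp measurable_swap)
    exact (StronglyMeasurable.integral_prod_right (ν := (volume : Measure R3)) h).measurable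
  symm n σ k := by
    obtain ⟨τ, hτ⟩ := exists_perm_cons σ
    unfold anW
    simp only [hτ, hg.symm]

/-! ### Cauchy–Schwarz in weighted form -/

theorem lintegral_mul_sq_le {α : Type*} [MeasurableSpace α] (μ : Measure α) {f g : α → ℝ≥0∞}
    (hf : AEMeasurable f μ) (hg : AEMeasurable g μ) :
    (∫⁻ a, f a * g a ∂μ) ^ 2 ≤ (∫⁻ a, f a ^ 2 ∂μ) * ∫⁻ a, g a ^ 2 ∂μ := by
  have h := ENNReal.lintegral_mul_le_Lp_mul_Lq μ Real.HolderConjugate.two_two hf hg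
  simp only [Pi.mul_apply, ENNReal.rpow_ofNat] at h
  calc (∫⁻ a, f a * g a ∂μ) ^ 2
      ≤ ((∫⁻ a, f a ^ 2 ∂μ) ^ (1 / 2 : ℝ) * (∫⁻ a, g a ^ 2 ∂μ) ^ (1 / 2 : ℝ)) ^ 2 := by gcongr
    _ = _ := by
      rw [mul_pow, ← ENNReal.rpow_natCast, ← ENNReal.rpow_natCast, ← ENNReal.rpow_mul,
        ← ENNReal.rpow_mul]
      norm_num

theorem lintegral_mul_sq_le_weight {α : Type*} [MeasurableSpace α] (μ : Measure α)
    {f g w : α → ℝ≥0∞} (hf : Measurable f) (hg : Measurable g) (hw : Measurable w)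
    (h0 : ∀ᵐ a ∂μ, w a ≠ 0) (ht : ∀ᵐ a ∂μ, w a ≠ ⊤) :
    (∫⁻ a, f a * g a ∂μ) ^ 2 ≤ (∫⁻ a, f a ^ 2 * (w a)⁻¹ ∂μ) * ∫⁻ a, w a * g a ^ 2 ∂μ := by
  have hsq : ∀ x : ℝ≥0∞, (x ^ (1 / 2 : ℝ)) ^ 2 = x := by
    intro x
    rw [← ENNReal.rpow_natCast, ← ENNReal.rpow_mul]
    norm_num
  have h := lintegral_mul_sq_le μ (f := fun a => f a * ((w a) ^ (1 / 2 : ℝ))⁻¹)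
    (g := fun a => (w a) ^ (1 / 2 : ℝ) * g a)
    (hf.mul (hw.pow_const _).inv).aemeasurable ((hw.pow_const _).mul hg).aemeasurable
  have e1 : ∫⁻ a, f a * g a ∂μ =
      ∫⁻ a, (f a * ((w a) ^ (1 / 2 : ℝ))⁻¹) * ((w a) ^ (1 / 2 : ℝ) * g a) ∂μ := by
    refine lintegral_congr_ae ?_
    filter_upwards [h0, ht] with a h1 h2
    have h3 : (w a) ^ (1 / 2 : ℝ) ≠ 0 := by
      simp [h1, h2]
    have h4 : (w a) ^ (1 / 2 : ℝ) ≠ ⊤ := by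
      simp [h1, h2]
    rw [mul_assoc, ← mul_assoc _ _ (g a), ENNReal.inv_mul_cancel h3 h4, one_mul]
  rw [e1]
  refine h.trans (le_of_eq ?_)
  simp only [mul_pow, hsq]
  congr 1
  refine lintegral_congr fun a => ?_
  rw [← ENNReal.inv_pow, hsq]

theorem enorm_integral_sq_le {a b : R3 → ℂ} {w : R3 → ℝ≥0∞} (ha : Measurable a)
    (hb : Measurable b) (hw : Measurable w) (h0 : ∀ᵐ q, w q ≠ 0) (ht : ∀ᵐ q, w q ≠ ⊤) :
    ‖∫ q, (starRingEnd ℂ) (a q) * b q‖ₑ ^ 2 ≤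
      (∫⁻ q, ‖a q‖ₑ ^ 2 * (w q)⁻¹) * ∫⁻ q, w q * ‖b q‖ₑ ^ 2 := by
  have h1 : ‖∫ q, (starRingEnd ℂ) (a q) * b q‖ₑ ≤ ∫⁻ q, ‖a q‖ₑ * ‖b q‖ₑ := by
    refine (enorm_integral_le_lintegral_enorm _).trans (le_of_eq ?_)
    refine lintegral_congr fun q => ?_
    rw [enorm_mul, RCLike.enorm_conj]
  refine le_trans (by gcongr) (lintegral_mul_sq_le_weight volume ha.enorm hb.enorm hw h0 ht)

theorem enorm_sqrt_sq (n : ℕ) : ‖((Real.sqrt (n + 1) : ℝ) : ℂ)‖ₑ ^ 2 = (n : ℝ≥0∞) + 1 := by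
  have h0 : (0 : ℝ) ≤ (n : ℝ) + 1 := by positivity
  rw [← ofReal_norm, Complex.norm_real, ← ENNReal.ofReal_pow (norm_nonneg _), Real.norm_eq_abs,
    sq_abs, Real.sq_sqrt h0, ENNReal.ofReal_add (by positivity) zero_le_one]
  simp

theorem ae_enorm_ne_zero : ∀ᵐ q : R3, ‖q‖ₑ ≠ 0 := by
  filter_upwards [ae_ne_zero_R3] with q hq
  simpa using hq

/-- The basic bound `‖m^{1/2} a(f) g‖² ≤ ‖f / |k|^{1/2}‖² ‖m^{1/2} H_f^{1/2} g‖²`, for weights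
that do not decrease when a boson is added. -/
theorem en_anW_le {f : R3 → ℂ} (hf : Measurable f) {g : Wave} (hg : IsBose g) {m m' : Weight}
    (hm' : IsBoseWeight m') (hm : ∀ n q k, m n k ≤ m' (n + 1) (Fin.cons q k)) :
    en m (anW f g) ≤ (∫⁻ q, ‖f q‖ₑ ^ 2 * ‖q‖ₑ⁻¹) * en (fun n k => m' n k * absSum n k) g := by
  set c := ∫⁻ q, ‖f q‖ₑ ^ 2 * ‖q‖ₑ⁻¹
  have key : ∀ n, ∫⁻ k, m n k * ‖anW f g n k‖ₑ ^ 2 ≤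
      c * ∫⁻ k, (m' (n + 1) k * absSum (n + 1) k) * ‖g (n + 1) k‖ₑ ^ 2 := by
    intro n
    have hmeas : Measurable fun k : Config (n + 1) => m' (n + 1) k * ‖g (n + 1) k‖ₑ ^ 2 :=
      (hm'.meas _).mul (hg.measurable_sq _)
    have h1 : ∀ k : Config n, m n k * ‖anW f g n k‖ₑ ^ 2 ≤ c * (((n : ℝ≥0∞) + 1) *
        ∫⁻ q : R3, ‖q‖ₑ * (m' (n + 1) (Fin.cons q k) * ‖g (n + 1) (Fin.cons q k)‖ₑ ^ 2)) := by
      intro k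
      have h2 := enorm_integral_sq_le (w := fun q => ‖q‖ₑ) hf
        ((hg.meas (n + 1)).comp (measurable_cons_left k)) measurable_enorm
        ae_enorm_ne_zero (Filter.Eventually.of_forall fun q => enorm_ne_top)
      simp only [Function.comp_apply] at h2
      unfold anW
      rw [enorm_mul, mul_pow, enorm_sqrt_sq]
      calc m n k * (((n : ℝ≥0∞) + 1) *
            ‖∫ q : R3, (starRingEnd ℂ) (f q) * g (n + 1) (Fin.cons q k)‖ₑ ^ 2)
          ≤ m n k * (((n : ℝ≥0∞) + 1) * (c *
            ∫⁻ q : R3, ‖q‖ₑ * ‖g (n + 1) (Fin.cons q k)‖ₑ ^ 2)) := by gcongr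
        _ = c * (((n : ℝ≥0∞) + 1) * (m n k * ∫⁻ q : R3, ‖q‖ₑ *
            ‖g (n + 1) (Fin.cons q k)‖ₑ ^ 2)) := by ring
        _ = c * (((n : ℝ≥0∞) + 1) * ∫⁻ q : R3, m n k * (‖q‖ₑ *
            ‖g (n + 1) (Fin.cons q k)‖ₑ ^ 2)) := by
          rw [lintegral_const_mul]
          exact measurable_enorm.mul ((hg.measurable_sq _).comp (measurable_cons_left k))
        _ ≤ _ := by
          refine mul_le_mul_right (mul_le_mul_right (lintegral_mono fun q => ?_) _) _
          rw [mul_left_comm]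
          gcongr
          exact hm n q k
    refine (lintegral_mono h1).trans (le_of_eq ?_)
    have hm2 : Measurable fun k : Config (n + 1) => ‖k 0‖ₑ * (m' (n + 1) k * ‖g (n + 1) k‖ₑ ^ 2) :=
      (measurable_pi_apply 0).enorm.mul hmeas
    have hm3 : Measurable fun k : Config n => ∫⁻ q : R3, ‖q‖ₑ * (m' (n + 1) (Fin.cons q k) *
        ‖g (n + 1) (Fin.cons q k)‖ₑ ^ 2) :=
      ((hm2.comp (measurable_cons n)).comp measurable_swap).lintegral_prod_right'
    rw [lintegral_const_mul _ (hm3.const_mul _), lintegral_const_mul _ hm3]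
    congr 1
    have h4 := lintegral_sum_symm (h := fun q => ‖q‖ₑ) measurable_enorm hmeas
      (fun σ k => by rw [hm'.symm, hg.symm])
    have h5 : ∫⁻ k, m' (n + 1) k * absSum (n + 1) k * ‖g (n + 1) k‖ₑ ^ 2 =
        ∫⁻ k : Config (n + 1), (∑ i, ‖k i‖ₑ) * (m' (n + 1) k * ‖g (n + 1) k‖ₑ ^ 2) := by
      refine lintegral_congr fun k => ?_
      unfold absSum
      ring
    rw [h5, h4]
    congr 1
    exact lintegral_lintegral_swap
      ((hm2.comp (measurable_cons n)).comp measurable_swap).aemeasurable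
  unfold en
  calc ∑' n, ∫⁻ k, m n k * ‖anW f g n k‖ₑ ^ 2
      ≤ ∑' n, c * ∫⁻ k, (m' (n + 1) k * absSum (n + 1) k) * ‖g (n + 1) k‖ₑ ^ 2 :=
        ENNReal.tsum_le_tsum key
    _ = c * ∑' n, ∫⁻ k, (m' (n + 1) k * absSum (n + 1) k) * ‖g (n + 1) k‖ₑ ^ 2 :=
        ENNReal.tsum_mul_left
    _ ≤ _ := mul_le_mul_right (ENNReal.tsum_comp_le_tsum_of_injective (add_left_injective 1)
        (fun n => ∫⁻ k, (m' n k * absSum n k) * ‖g n k‖ₑ ^ 2)) _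

/-- Cauchy–Schwarz with weights `‖k i‖` (Sedrakyan's inequality). -/
theorem enorm_sum_sq_le {n : ℕ} (z : Fin n → ℂ) (k : Config n) (hk : ∀ i, k i ≠ 0) :
    ‖∑ j, z j‖ₑ ^ 2 ≤ ∑ j, absSum n k * (‖k j‖ₑ⁻¹ * ‖z j‖ₑ ^ 2) := by
  have hpos : ∀ i, 0 < ‖k i‖ := fun i => norm_pos_iff.2 (hk i)
  have h : ‖∑ j, z j‖ ^ 2 ≤ ∑ j, (∑ i, ‖k i‖) * (‖k j‖⁻¹ * ‖z j‖ ^ 2) := by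
    rcases isEmpty_or_nonempty (Fin n) with hn | hn
    · simp
    have hS : 0 < ∑ i, ‖k i‖ := Finset.sum_pos (fun i _ => hpos i) Finset.univ_nonempty
    have h1 := Finset.sq_sum_div_le_sum_sq_div Finset.univ (fun j => ‖z j‖) (g := fun j => ‖k j‖)
      fun i _ => hpos i
    rw [div_le_iff₀ hS] at h1
    calc ‖∑ j, z j‖ ^ 2 ≤ (∑ j, ‖z j‖) ^ 2 := by
          gcongr; exact norm_sum_le _ _
      _ ≤ (∑ j, ‖z j‖ ^ 2 / ‖k j‖) * ∑ i, ‖k i‖ := h1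
      _ = _ := by
        rw [← Finset.mul_sum, mul_comm]
        congr 1
        exact Finset.sum_congr rfl fun j _ => by rw [div_eq_inv_mul]
  have h2 := ENNReal.ofReal_le_ofReal h
  rw [ENNReal.ofReal_pow (norm_nonneg _), ofReal_norm,
    ENNReal.ofReal_sum_of_nonneg fun i _ => by positivity] at h2
  refine h2.trans (le_of_eq (Finset.sum_congr rfl fun j _ => ?_))
  rw [ENNReal.ofReal_mul (by positivity), ENNReal.ofReal_mul (by positivity),
    ENNReal.ofReal_sum_of_nonneg fun i _ => by positivity, ENNReal.ofReal_inv_of_pos (hpos j),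
    ENNReal.ofReal_pow (norm_nonneg _)]
  simp only [ofReal_norm, absSum]

theorem en_crW_le {f : R3 → ℂ} (hf : Measurable f) {g : Wave} (hg : IsBose g) {m : Weight}
    (hm : IsBoseWeight m) :
    en m (crW f g) ≤ ∑' n, ∫⁻ q : R3, ∫⁻ k : Config n, (m (n + 1) (Fin.cons q k) *
      (1 + absSum n k * ‖q‖ₑ⁻¹)) * (‖f q‖ₑ ^ 2 * ‖g n k‖ₑ ^ 2) := by
  have h0 : ∫⁻ k, m 0 k * ‖crW f g 0 k‖ₑ ^ 2 = 0 := by simp [crW]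
  unfold en
  rw [tsum_eq_zero_add' ENNReal.summable, h0, zero_add]
  refine ENNReal.tsum_le_tsum fun n => ?_
  set G : Fin (n + 1) → Config (n + 1) → ℝ≥0∞ := fun j k =>
    m (n + 1) k * (absSum (n + 1) k * (‖k j‖ₑ⁻¹ * (‖f (k j)‖ₑ ^ 2 * ‖g n (j.removeNth k)‖ₑ ^ 2)))
    with hG
  have hGm : ∀ j, Measurable (G j) := fun j =>
    (hm.meas _).mul ((isBoseWeight_absSum.meas _).mul ((measurable_pi_apply j).enorm.inv.mul
      (((hf.comp (measurable_pi_apply j)).enorm.pow_const 2).mul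
        ((hg.measurable_sq n).comp (measurable_removeNth j)))))
  have hGj : ∀ j, ∫⁻ k, G j k = ∫⁻ k, G 0 k := by
    intro j
    rw [← lintegral_perm (Equiv.swap 0 j) (hGm 0)]
    refine lintegral_congr fun k => ?_
    obtain ⟨τ, hτ⟩ := exists_perm_removeNth (Equiv.swap 0 j) 0
    simp only [hG, hτ, hm.symm, isBoseWeight_absSum.symm, hg.symm, Equiv.swap_apply_left]
  have hpt : ∀ᵐ k, m (n + 1) k * ‖crW f g (n + 1) k‖ₑ ^ 2 ≤ ((n : ℝ≥0∞) + 1)⁻¹ * ∑ j, G j k := by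
    filter_upwards [ae_forall_ne_zero (n + 1)] with k hk
    have h1 := enorm_sum_sq_le (fun j => f (k j) * g n (j.removeNth k)) k hk
    simp only [crW]
    rw [enorm_mul, mul_pow, enorm_inv (by
      rw [Complex.ofReal_ne_zero]; positivity), ← ENNReal.inv_pow, enorm_sqrt_sq]
    calc m (n + 1) k * (((n : ℝ≥0∞) + 1)⁻¹ * ‖∑ j, f (k j) * g n (j.removeNth k)‖ₑ ^ 2)
        ≤ m (n + 1) k * (((n : ℝ≥0∞) + 1)⁻¹ * ∑ j, absSum (n + 1) k *
          (‖k j‖ₑ⁻¹ * ‖f (k j) * g n (j.removeNth k)‖ₑ ^ 2)) := by gcongr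
      _ = _ := by
        rw [mul_left_comm, Finset.mul_sum]
        simp only [hG, enorm_mul, mul_pow]
  refine (lintegral_mono_ae hpt).trans ?_
  rw [lintegral_const_mul _ (Finset.measurable_sum _ fun j _ => hGm j),
    lintegral_finsetSum _ fun j _ => hGm j]
  simp_rw [hGj]
  rw [Finset.sum_const, Finset.card_univ, Fintype.card_fin, nsmul_eq_mul, ← mul_assoc]
  have hn : ((n : ℝ≥0∞) + 1)⁻¹ * ((n + 1 : ℕ) : ℝ≥0∞) = 1 := by
    rw [Nat.cast_add, Nat.cast_one]
    exact ENNReal.inv_mul_cancel (by simp) (by simp)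
  rw [hn, one_mul, lintegral_cons (hGm 0)]
  refine lintegral_mono_ae ?_
  filter_upwards [ae_enorm_ne_zero] with q hq
  refine lintegral_mono fun k => ?_
  simp only [hG, Fin.cons_zero, Fin.removeNth_zero, Fin.tail_cons, absSum_cons]
  refine le_of_eq ?_
  have : (‖q‖ₑ + absSum n k) * ‖q‖ₑ⁻¹ = 1 + absSum n k * ‖q‖ₑ⁻¹ := by
    rw [add_mul, ENNReal.mul_inv_cancel hq enorm_ne_top]
  rw [← this]
  ring

/-- The bound on creation operators with a weight that is dominated by a sum of products. -/
theorem en_crW_le_of_weight {f : R3 → ℂ} (hf : Measurable f) {g : Wave} (hg : IsBose g)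
    {m : Weight} (hm : IsBoseWeight m) {N : ℕ} {a : Fin N → R3 → ℝ≥0∞} {b : Fin N → Weight}
    (ha : ∀ i, Measurable (a i)) (hb : ∀ i, IsBoseWeight (b i))
    (h : ∀ n q (k : Config n), q ≠ 0 → m (n + 1) (Fin.cons q k) * (1 + absSum n k * ‖q‖ₑ⁻¹) ≤
      ∑ i, a i q * b i n k) :
    en m (crW f g) ≤ ∑ i, (∫⁻ q, ‖f q‖ₑ ^ 2 * a i q) * en (b i) g := by
  refine (en_crW_le hf hg hm).trans ?_
  have hsum : ∑ i, (∫⁻ q, ‖f q‖ₑ ^ 2 * a i q) * en (b i) g =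
      ∑' n, ∑ i, (∫⁻ q, ‖f q‖ₑ ^ 2 * a i q) * ∫⁻ k, b i n k * ‖g n k‖ₑ ^ 2 := by
    rw [Summable.tsum_finsetSum fun i _ => ENNReal.summable]
    simp only [en, ENNReal.tsum_mul_left]
  rw [hsum]
  refine ENNReal.tsum_le_tsum fun n => ?_
  have hfa : ∀ i, Measurable fun q => ‖f q‖ₑ ^ 2 * a i q := fun i =>
    (hf.enorm.pow_const 2).mul (ha i)
  have hbg : ∀ i, Measurable fun k : Config n => b i n k * ‖g n k‖ₑ ^ 2 := fun i =>
    ((hb i).meas n).mul (hg.measurable_sq n)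
  calc ∫⁻ q : R3, ∫⁻ k : Config n, (m (n + 1) (Fin.cons q k) *
      (1 + absSum n k * ‖q‖ₑ⁻¹)) * (‖f q‖ₑ ^ 2 * ‖g n k‖ₑ ^ 2)
      ≤ ∫⁻ q : R3, ∫⁻ k : Config n, ∑ i, (‖f q‖ₑ ^ 2 * a i q) * (b i n k * ‖g n k‖ₑ ^ 2) := by
        refine lintegral_mono_ae ?_
        filter_upwards [ae_ne_zero_R3] with q hq
        refine lintegral_mono fun k => ?_
        refine (mul_le_mul_left (h n q k hq) _).trans (le_of_eq ?_)
        rw [Finset.sum_mul]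
        exact Finset.sum_congr rfl fun i _ => by ring
    _ = ∑ i, (∫⁻ q, ‖f q‖ₑ ^ 2 * a i q) * ∫⁻ k, b i n k * ‖g n k‖ₑ ^ 2 := by
        have h1 : ∀ q : R3, ∫⁻ k : Config n, ∑ i, (‖f q‖ₑ ^ 2 * a i q) *
            (b i n k * ‖g n k‖ₑ ^ 2) = ∑ i, (‖f q‖ₑ ^ 2 * a i q) *
              ∫⁻ k : Config n, b i n k * ‖g n k‖ₑ ^ 2 := by
          intro q
          rw [lintegral_finsetSum _ fun i _ => (hbg i).const_mul _]
          exact Finset.sum_congr rfl fun i _ => lintegral_const_mul _ (hbg i)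
        simp_rw [h1]
        rw [lintegral_finsetSum _ fun i _ => (hfa i).mul_const _]
        exact Finset.sum_congr rfl fun i _ => lintegral_mul_const _ (hfa i)

theorem rpow_half_mul_self (x : ℝ≥0∞) : x ^ (1 / 2 : ℝ) * x ^ (1 / 2 : ℝ) = x := by
  rw [← ENNReal.rpow_add_of_nonneg _ _ (by norm_num) (by norm_num)]
  norm_num

/-- The weight `p q / (s + (p q)^{1/2})` of a pair of bosons with energies `p`, `q` in the
presence of bosons with total energy `s`. -/
def pairWeight (s : ℝ≥0∞) (z : R3 × R3) : ℝ≥0∞ :=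
  ‖z.1‖ₑ * ‖z.2‖ₑ * (s + ‖z.1‖ₑ ^ (1 / 2 : ℝ) * ‖z.2‖ₑ ^ (1 / 2 : ℝ))⁻¹

theorem measurable_pairWeight (s : ℝ≥0∞) : Measurable (pairWeight s) := by
  have : Measurable fun z : R3 × R3 => ‖z.1‖ₑ := measurable_fst.enorm
  have : Measurable fun z : R3 × R3 => ‖z.2‖ₑ := measurable_snd.enorm
  unfold pairWeight
  fun_prop

theorem enorm_anW_anW_sq_le {f₁ f₂ : R3 → ℂ} (hf₁ : Measurable f₁) (hf₂ : Measurable f₂)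
    {g : Wave} (hg : IsBose g) {c δ : ℝ≥0∞}
    (h1 : (∫⁻ q, ‖f₁ q‖ₑ ^ 2 * ‖q‖ₑ⁻¹) * (∫⁻ q, ‖f₂ q‖ₑ ^ 2 * ‖q‖ₑ⁻¹) ≤ c)
    (h2 : (∫⁻ q, ‖f₁ q‖ₑ ^ 2 * (‖q‖ₑ ^ (1 / 2 : ℝ))⁻¹) *
      (∫⁻ q, ‖f₂ q‖ₑ ^ 2 * (‖q‖ₑ ^ (1 / 2 : ℝ))⁻¹) ≤ c * δ) (n : ℕ) (k : Config n) :
    ‖anW f₁ (anW f₂ g) n k‖ₑ ^ 2 ≤ (c * (δ + absSum n k)) *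
    (((n : ℝ≥0∞) + 1) * ((n : ℝ≥0∞) + 2) * ∫⁻ z : R3 × R3, pairWeight (absSum n k) z *
      ‖g (n + 2) (Fin.cons z.2 (Fin.cons z.1 k))‖ₑ ^ 2) := by
  have hae : ∀ᵐ z : R3 × R3, z.1 ≠ 0 ∧ z.2 ≠ 0 :=
    (Measure.quasiMeasurePreserving_fst.ae ae_ne_zero_R3).and
      (Measure.quasiMeasurePreserving_snd.ae ae_ne_zero_R3)
  have hr0 : ∀ q : R3, q ≠ 0 → ‖q‖ₑ ^ (1 / 2 : ℝ) ≠ 0 ∧ ‖q‖ₑ ^ (1 / 2 : ℝ) ≠ ⊤ := by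
    intro q hq
    have : ‖q‖ₑ ≠ 0 := by simpa using hq
    constructor <;> simp [this]
  set s := absSum n k
  have hs : s ≠ ⊤ := (absSum_lt_top k).ne
  have hgm : Measurable fun z : R3 × R3 =>
      ‖g (n + 2) (Fin.cons z.2 (Fin.cons z.1 k))‖ₑ := by
    refine ((hg.meas (n + 2)).comp ?_).enorm
    exact (measurable_cons (n + 1)).comp
      (measurable_snd.prodMk ((measurable_cons_left k).comp measurable_fst))
  have e1 : ‖anW f₁ (anW f₂ g) n k‖ₑ ≤ ‖((Real.sqrt (n + 1) : ℝ) : ℂ)‖ₑ *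
      (‖((Real.sqrt ((n + 1 : ℕ) + 1) : ℝ) : ℂ)‖ₑ * ∫⁻ z : R3 × R3, (‖f₁ z.1‖ₑ * ‖f₂ z.2‖ₑ) *
        ‖g (n + 2) (Fin.cons z.2 (Fin.cons z.1 k))‖ₑ) := by
    rw [anW, enorm_mul]
    gcongr
    have hm1 : Measurable fun z : R3 × R3 => (‖f₁ z.1‖ₑ * ‖f₂ z.2‖ₑ) *
        ‖g (n + 2) (Fin.cons z.2 (Fin.cons z.1 k))‖ₑ :=
      ((hf₁.comp measurable_fst).enorm.mul (hf₂.comp measurable_snd).enorm).mul hgm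
    rw [Measure.volume_eq_prod, lintegral_prod _ hm1.aemeasurable,
      ← lintegral_const_mul' _ _ enorm_ne_top]
    refine (enorm_integral_le_lintegral_enorm _).trans (lintegral_mono fun p => ?_)
    rw [enorm_mul, RCLike.enorm_conj, anW, enorm_mul, mul_left_comm]
    gcongr
    refine (mul_le_mul_right (enorm_integral_le_lintegral_enorm _) _).trans ?_
    rw [← lintegral_const_mul' _ _ enorm_ne_top]
    refine lintegral_mono fun q => ?_
    rw [enorm_mul, RCLike.enorm_conj, mul_assoc]
  have e2 := lintegral_mul_sq_le_weight (volume : Measure (R3 × R3))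
    (f := fun z => ‖f₁ z.1‖ₑ * ‖f₂ z.2‖ₑ)
    (g := fun z => ‖g (n + 2) (Fin.cons z.2 (Fin.cons z.1 k))‖ₑ) (w := pairWeight s)
    ((hf₁.comp measurable_fst).enorm.mul (hf₂.comp measurable_snd).enorm) hgm (measurable_pairWeight s)
    (by
      filter_upwards [hae] with z hz
      have h3 := hr0 z.1 hz.1
      have h4 := hr0 z.2 hz.2
      have h5 : ‖z.1‖ₑ ≠ 0 := by simpa using hz.1
      have h6 : ‖z.2‖ₑ ≠ 0 := by simpa using hz.2
      refine mul_ne_zero (mul_ne_zero h5 h6) (ENNReal.inv_ne_zero.2 ?_)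
      exact ENNReal.add_ne_top.2 ⟨hs, ENNReal.mul_ne_top h3.2 h4.2⟩)
    (by
      filter_upwards [hae] with z hz
      have h3 := hr0 z.1 hz.1
      have h4 := hr0 z.2 hz.2
      refine ENNReal.mul_ne_top (ENNReal.mul_ne_top enorm_ne_top enorm_ne_top)
        (ENNReal.inv_ne_top.2 ?_)
      exact fun h => mul_ne_zero h3.1 h4.1 (add_eq_zero.1 h).2)
  have e3 : ∫⁻ z : R3 × R3, (‖f₁ z.1‖ₑ * ‖f₂ z.2‖ₑ) ^ 2 * (pairWeight s z)⁻¹ ≤ c * (δ + s) := by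
    have hf1 : ∀ {f : R3 → ℂ}, Measurable f → Measurable fun q : R3 => ‖f q‖ₑ ^ 2 * ‖q‖ₑ⁻¹ :=
      fun hf => (hf.enorm.pow_const 2).mul measurable_enorm.inv
    have hf2 : ∀ {f : R3 → ℂ}, Measurable f →
        Measurable fun q : R3 => ‖f q‖ₑ ^ 2 * (‖q‖ₑ ^ (1 / 2 : ℝ))⁻¹ :=
      fun hf => (hf.enorm.pow_const 2).mul (measurable_enorm.pow_const _).inv
    have e4 : ∫⁻ z : R3 × R3, (‖f₁ z.1‖ₑ * ‖f₂ z.2‖ₑ) ^ 2 * (pairWeight s z)⁻¹ =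
        ∫⁻ z : R3 × R3, (s * ((‖f₁ z.1‖ₑ ^ 2 * ‖z.1‖ₑ⁻¹) * (‖f₂ z.2‖ₑ ^ 2 * ‖z.2‖ₑ⁻¹)) +
          (‖f₁ z.1‖ₑ ^ 2 * (‖z.1‖ₑ ^ (1 / 2 : ℝ))⁻¹) *
          (‖f₂ z.2‖ₑ ^ 2 * (‖z.2‖ₑ ^ (1 / 2 : ℝ))⁻¹)) := by
      refine lintegral_congr_ae ?_
      filter_upwards [hae] with z hz
      have h3 := hr0 z.1 hz.1
      have h4 := hr0 z.2 hz.2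
      have h5 : ‖z.1‖ₑ ≠ 0 := by simpa using hz.1
      have h6 : ‖z.2‖ₑ ≠ 0 := by simpa using hz.2
      have e5 : (pairWeight s z)⁻¹ = ‖z.1‖ₑ⁻¹ * ‖z.2‖ₑ⁻¹ *
          (s + ‖z.1‖ₑ ^ (1 / 2 : ℝ) * ‖z.2‖ₑ ^ (1 / 2 : ℝ)) := by
        simp only [pairWeight]
        rw [ENNReal.mul_inv (Or.inl (mul_ne_zero h5 h6))
          (Or.inl (ENNReal.mul_ne_top enorm_ne_top enorm_ne_top)), inv_inv,
          ENNReal.mul_inv (Or.inl h5) (Or.inl enorm_ne_top)]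
      have e6 : ∀ x : ℝ≥0∞, x ≠ 0 → x ≠ ⊤ → x⁻¹ * x ^ (1 / 2 : ℝ) = (x ^ (1 / 2 : ℝ))⁻¹ := by
        intro x hx hx'
        rw [← ENNReal.rpow_neg_one, ← ENNReal.rpow_add _ _ hx hx', ← ENNReal.rpow_neg]
        norm_num
      rw [e5, ← e6 _ h5 enorm_ne_top, ← e6 _ h6 enorm_ne_top]
      ring
    rw [e4, lintegral_add_left, lintegral_const_mul, Measure.volume_eq_prod,
      lintegral_prod_mul (hf1 hf₁).aemeasurable (hf1 hf₂).aemeasurable,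
      lintegral_prod_mul (hf2 hf₁).aemeasurable (hf2 hf₂).aemeasurable]
    · calc _ ≤ s * c + c * δ := add_le_add (mul_le_mul_right h1 _) h2
        _ = _ := by ring
    · exact ((hf1 hf₁).comp measurable_fst).mul ((hf1 hf₂).comp measurable_snd)
    · exact (((hf1 hf₁).comp measurable_fst).mul ((hf1 hf₂).comp measurable_snd)).const_mul _
  calc ‖anW f₁ (anW f₂ g) n k‖ₑ ^ 2 ≤ _ := pow_le_pow_left' e1 2
    _ = ((n : ℝ≥0∞) + 1) * (((n + 1 : ℕ) : ℝ≥0∞) + 1) * (∫⁻ z : R3 × R3,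
        (‖f₁ z.1‖ₑ * ‖f₂ z.2‖ₑ) * ‖g (n + 2) (Fin.cons z.2 (Fin.cons z.1 k))‖ₑ) ^ 2 := by
      rw [mul_pow, mul_pow, enorm_sqrt_sq, enorm_sqrt_sq]
      ring
    _ ≤ ((n : ℝ≥0∞) + 1) * (((n + 1 : ℕ) : ℝ≥0∞) + 1) * ((c * (δ + s)) *
        ∫⁻ z : R3 × R3, pairWeight s z * ‖g (n + 2) (Fin.cons z.2 (Fin.cons z.1 k))‖ₑ ^ 2) := by
      gcongr
      exact e2.trans (by gcongr)
    _ = _ := by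
      push_cast
      ring
theorem IsBose.measurable_sq_pair {g : Wave} (hg : IsBose g) (n : ℕ) :
    Measurable fun y : Config n × R3 × R3 =>
    ‖g (n + 2) (Fin.cons y.2.2 (Fin.cons y.2.1 y.1))‖ₑ ^ 2 := by
  refine (((hg.meas (n + 2)).comp ?_).enorm).pow_const 2
  refine (measurable_cons (n + 1)).comp (measurable_snd.snd.prodMk ?_)
  exact (measurable_cons n).comp (measurable_snd.fst.prodMk measurable_fst)

theorem lintegral_pair_le {g : Wave} (hg : IsBose g) (n : ℕ) :
    ((n : ℝ≥0∞) + 1) * ((n : ℝ≥0∞) + 2) * ∫⁻ k : Config n, ∫⁻ q : R3, ∫⁻ p : R3,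
    (‖p‖ₑ * ‖q‖ₑ * (absSum n k + ‖p‖ₑ)⁻¹) * ‖g (n + 2) (Fin.cons q (Fin.cons p k))‖ₑ ^ 2 ≤
    ∫⁻ k, absSum (n + 2) k * ‖g (n + 2) k‖ₑ ^ 2 := by
  have ha : Measurable fun y : Config n × R3 × R3 =>
      (‖y.2.1‖ₑ * ‖y.2.2‖ₑ * (absSum n y.1 + ‖y.2.1‖ₑ)⁻¹) *
        ‖g (n + 2) (Fin.cons y.2.2 (Fin.cons y.2.1 y.1))‖ₑ ^ 2 :=
    ((measurable_snd.fst.enorm.mul measurable_snd.snd.enorm).mul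
      (((isBoseWeight_absSum.meas n).comp measurable_fst).add
        measurable_snd.fst.enorm).inv).mul (hg.measurable_sq_pair n)
  -- move the integration over `q` outside
  have e1 : ∫⁻ k : Config n, ∫⁻ q : R3, ∫⁻ p : R3,
      (‖p‖ₑ * ‖q‖ₑ * (absSum n k + ‖p‖ₑ)⁻¹) * ‖g (n + 2) (Fin.cons q (Fin.cons p k))‖ₑ ^ 2 =
      ∫⁻ q : R3, ∫⁻ p : R3, ∫⁻ k : Config n,
      (‖p‖ₑ * ‖q‖ₑ * (absSum n k + ‖p‖ₑ)⁻¹) * ‖g (n + 2) (Fin.cons q (Fin.cons p k))‖ₑ ^ 2 := by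
    rw [lintegral_lintegral_swap]
    · refine lintegral_congr fun q => ?_
      rw [lintegral_lintegral_swap]
      exact (ha.comp (measurable_fst.prodMk (measurable_snd.prodMk
        measurable_const))).aemeasurable
    · have hφ : Measurable fun y : (Config n × R3) × R3 => (y.1.1, y.2, y.1.2) :=
        measurable_fst.fst.prodMk (measurable_snd.prodMk measurable_fst.snd)
      exact (ha.comp hφ).lintegral_prod_right'.aemeasurable
  have e2 : ∀ q : R3, ((n : ℝ≥0∞) + 1) * ∫⁻ p : R3, ∫⁻ k : Config n,
      (‖p‖ₑ * ‖q‖ₑ * (absSum n k + ‖p‖ₑ)⁻¹) * ‖g (n + 2) (Fin.cons q (Fin.cons p k))‖ₑ ^ 2 ≤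
      ‖q‖ₑ * ∫⁻ k : Config (n + 1), ‖g (n + 2) (Fin.cons q k)‖ₑ ^ 2 := by
    intro q
    have hgq : Measurable fun k : Config (n + 1) => ‖g (n + 2) (Fin.cons q k)‖ₑ ^ 2 :=
      (hg.measurable_sq (n + 2)).comp (measurable_cons_right q)
    have h3 := lintegral_sum_symm (h := fun q => ‖q‖ₑ) measurable_enorm
      (g := fun k : Config (n + 1) => ‖q‖ₑ * ((absSum (n + 1) k)⁻¹ *
        ‖g (n + 2) (Fin.cons q k)‖ₑ ^ 2))
      (((isBoseWeight_absSum.meas (n + 1)).inv.mul hgq).const_mul _)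
      (fun σ k => by
        obtain ⟨τ, hτ⟩ := exists_perm_cons σ
        rw [isBoseWeight_absSum.symm, hτ, hg.symm])
    calc _ = ((n : ℝ≥0∞) + 1) * ∫⁻ p : R3, ∫⁻ k : Config n, ‖p‖ₑ * (‖q‖ₑ *
          ((absSum (n + 1) (Fin.cons p k))⁻¹ *
            ‖g (n + 2) (Fin.cons q (Fin.cons p k))‖ₑ ^ 2)) := by
          congr 1
          refine lintegral_congr fun p => lintegral_congr fun k => ?_
          rw [absSum_cons, add_comm (absSum n k)]
          ring
      _ = _ := h3.symm
      _ ≤ ∫⁻ k : Config (n + 1), ‖q‖ₑ * ‖g (n + 2) (Fin.cons q k)‖ₑ ^ 2 := by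
          refine lintegral_mono fun k => ?_
          calc (∑ i, ‖k i‖ₑ) * (‖q‖ₑ * ((absSum (n + 1) k)⁻¹ *
                ‖g (n + 2) (Fin.cons q k)‖ₑ ^ 2))
              = (absSum (n + 1) k * (absSum (n + 1) k)⁻¹) *
                (‖q‖ₑ * ‖g (n + 2) (Fin.cons q k)‖ₑ ^ 2) := by
                unfold absSum; ring
            _ ≤ 1 * (‖q‖ₑ * ‖g (n + 2) (Fin.cons q k)‖ₑ ^ 2) := by
                gcongr
                exact ENNReal.mul_inv_le_one _
            _ = _ := one_mul _
      _ = _ := lintegral_const_mul _ hgq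
  have e4 := lintegral_sum_symm (n := n + 1) (h := fun q => ‖q‖ₑ) measurable_enorm
    (hg.measurable_sq (n + 2)) (hg.symm_sq (n + 2))
  calc _ = ((n : ℝ≥0∞) + 2) * ∫⁻ q : R3, ((n : ℝ≥0∞) + 1) * ∫⁻ p : R3, ∫⁻ k : Config n,
        (‖p‖ₑ * ‖q‖ₑ * (absSum n k + ‖p‖ₑ)⁻¹) *
          ‖g (n + 2) (Fin.cons q (Fin.cons p k))‖ₑ ^ 2 := by
        rw [e1, lintegral_const_mul' _ _ (by simp)]
        ring
    _ ≤ ((n : ℝ≥0∞) + 2) * ∫⁻ q : R3, ‖q‖ₑ *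
        ∫⁻ k : Config (n + 1), ‖g (n + 2) (Fin.cons q k)‖ₑ ^ 2 := by
        exact mul_le_mul_right (lintegral_mono fun q => e2 q) _
    _ = ∫⁻ k, absSum (n + 2) k * ‖g (n + 2) k‖ₑ ^ 2 := by
        unfold absSum
        rw [e4]
        have h2 : (((n + 1 : ℕ) : ℝ≥0∞) + 1) = (n : ℝ≥0∞) + 2 := by
          push_cast
          rw [add_assoc]
          norm_num
        rw [h2]
        congr 1
        refine lintegral_congr fun q => ?_
        rw [lintegral_const_mul]
        exact (hg.measurable_sq (n + 2)).comp (measurable_cons_right q)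

theorem IsBose.cons_swap {g : Wave} (hg : IsBose g) {n : ℕ} (q p : R3) (k : Config n) :
    g (n + 2) (Fin.cons q (Fin.cons p k)) =
    g (n + 2) (Fin.cons p (Fin.cons q k)) := by
  rw [← hg.symm (n + 2) (Equiv.swap 0 1) (Fin.cons q (Fin.cons p k))]
  congr 1
  funext i
  refine Fin.cases ?_ (fun j => Fin.cases ?_ (fun l => ?_) j) i
  · rw [Equiv.swap_apply_left]; rfl
  · have : (Fin.succ 0 : Fin (n + 2)) = 1 := rfl
    rw [this, Equiv.swap_apply_right]; rfl
  · rw [Equiv.swap_apply_of_ne_of_ne]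
    · rfl
    · exact Fin.succ_ne_zero _
    · intro h
      have h3 : (Fin.succ (Fin.succ l) : Fin (n + 2)) = Fin.succ 0 := h
      exact Fin.succ_ne_zero _ (Fin.succ_injective _ h3)

theorem lintegral_prod_add_swap {F : R3 → R3 → ℝ≥0∞}
    (hF : Measurable fun z : R3 × R3 => F z.1 z.2) :
    ∫⁻ z : R3 × R3, (F z.1 z.2 + F z.2 z.1) = 2 * ∫⁻ q, ∫⁻ p, F q p := by
  have e1 : ∫⁻ z : R3 × R3, F z.1 z.2 = ∫⁻ q, ∫⁻ p, F q p :=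
    lintegral_prod _ hF.aemeasurable
  have e2 : ∫⁻ z : R3 × R3, F z.2 z.1 = ∫⁻ q, ∫⁻ p, F q p :=
    lintegral_prod_symm' (fun z : R3 × R3 => F z.2 z.1) (hF.comp measurable_swap)
  rw [lintegral_add_left hF, e1, e2, two_mul]

theorem lintegral_pairWeight_le {g : Wave} (hg : IsBose g) (n : ℕ) :
    ((n : ℝ≥0∞) + 1) * ((n : ℝ≥0∞) + 2) * ∫⁻ k : Config n, ∫⁻ z : R3 × R3,
    pairWeight (absSum n k) z * ‖g (n + 2) (Fin.cons z.2 (Fin.cons z.1 k))‖ₑ ^ 2 ≤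
    2 * ∫⁻ k, absSum (n + 2) k * ‖g (n + 2) k‖ₑ ^ 2 := by
  set F : Config n → R3 → R3 → ℝ≥0∞ := fun k q p =>
    (‖p‖ₑ * ‖q‖ₑ * (absSum n k + ‖p‖ₑ)⁻¹) * ‖g (n + 2) (Fin.cons q (Fin.cons p k))‖ₑ ^ 2 with hF
  have hFm : ∀ k, Measurable fun z : R3 × R3 => F k z.1 z.2 := by
    intro k
    have hφ : Measurable fun z : R3 × R3 => (k, z.2, z.1) :=
      measurable_const.prodMk (measurable_snd.prodMk measurable_fst)
    have h1 : Measurable fun z : R3 × R3 => ‖z.2‖ₑ * ‖z.1‖ₑ * (absSum n k + ‖z.2‖ₑ)⁻¹ :=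
      (measurable_snd.enorm.mul measurable_fst.enorm).mul
        (measurable_const.add measurable_snd.enorm).inv
    have h2 := (hg.measurable_sq_pair n).comp hφ
    exact h1.mul h2
  have hle : ∀ k, ∫⁻ z : R3 × R3, pairWeight (absSum n k) z *
      ‖g (n + 2) (Fin.cons z.2 (Fin.cons z.1 k))‖ₑ ^ 2 ≤ 2 * ∫⁻ q, ∫⁻ p, F k q p := by
    intro k
    have hle1 : ∀ z : R3 × R3, pairWeight (absSum n k) z *
        ‖g (n + 2) (Fin.cons z.2 (Fin.cons z.1 k))‖ₑ ^ 2 ≤ F k z.1 z.2 + F k z.2 z.1 := by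
      rintro ⟨p, q⟩
      simp only [pairWeight, hF]
      rw [hg.cons_swap p q k, ← add_mul, mul_comm ‖q‖ₑ ‖p‖ₑ, ← mul_add]
      gcongr
      rcases le_total ‖p‖ₑ ‖q‖ₑ with hpq | hpq
      · refine le_add_left (ENNReal.inv_le_inv.2 ?_)
        gcongr
        calc ‖p‖ₑ = ‖p‖ₑ ^ (1 / 2 : ℝ) * ‖p‖ₑ ^ (1 / 2 : ℝ) := (rpow_half_mul_self _).symm
          _ ≤ _ := by gcongr
      · refine le_add_right (ENNReal.inv_le_inv.2 ?_)
        gcongr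
        calc ‖q‖ₑ = ‖q‖ₑ ^ (1 / 2 : ℝ) * ‖q‖ₑ ^ (1 / 2 : ℝ) := (rpow_half_mul_self _).symm
          _ ≤ _ := by gcongr
    refine (lintegral_mono hle1).trans (le_of_eq ?_)
    exact lintegral_prod_add_swap (hFm k)
  calc _ ≤ ((n : ℝ≥0∞) + 1) * ((n : ℝ≥0∞) + 2) * ∫⁻ k : Config n, 2 * ∫⁻ q, ∫⁻ p, F k q p := by
        gcongr with k
        exact hle k
    _ = 2 * (((n : ℝ≥0∞) + 1) * ((n : ℝ≥0∞) + 2) * ∫⁻ k : Config n, ∫⁻ q, ∫⁻ p, F k q p) := by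
        rw [lintegral_const_mul' _ _ (by simp)]
        ring
    _ ≤ _ := by
        gcongr
        exact lintegral_pair_le hg n

/-- The form bound on two annihilation operators:
`‖(δ + H_f)^{-1/2} a(f₁) a(f₂) g‖² ≤ 2 c ‖H_f^{1/2} g‖²`. It involves `‖fᵢ / |k|^{1/2}‖` and
`‖fᵢ / |k|^{1/4}‖` but not `‖fᵢ‖`. -/
theorem en_anW_anW_le {f₁ f₂ : R3 → ℂ} (hf₁ : Measurable f₁) (hf₂ : Measurable f₂)
    {g : Wave} (hg : IsBose g) {c δ : ℝ≥0∞} (hδ : δ ≠ 0) (hδ' : δ ≠ ⊤)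
    (h1 : (∫⁻ q, ‖f₁ q‖ₑ ^ 2 * ‖q‖ₑ⁻¹) * (∫⁻ q, ‖f₂ q‖ₑ ^ 2 * ‖q‖ₑ⁻¹) ≤ c)
    (h2 : (∫⁻ q, ‖f₁ q‖ₑ ^ 2 * (‖q‖ₑ ^ (1 / 2 : ℝ))⁻¹) *
      (∫⁻ q, ‖f₂ q‖ₑ ^ 2 * (‖q‖ₑ ^ (1 / 2 : ℝ))⁻¹) ≤ c * δ) :
    en (fun n k => (δ + absSum n k)⁻¹) (anW f₁ (anW f₂ g)) ≤ 2 * c * en absSum g := by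
  unfold en
  calc ∑' n, ∫⁻ k, (δ + absSum n k)⁻¹ * ‖anW f₁ (anW f₂ g) n k‖ₑ ^ 2
      ≤ ∑' n, (2 * c) * ∫⁻ k, absSum (n + 2) k * ‖g (n + 2) k‖ₑ ^ 2 := by
        refine ENNReal.tsum_le_tsum fun n => ?_
        calc ∫⁻ k, (δ + absSum n k)⁻¹ * ‖anW f₁ (anW f₂ g) n k‖ₑ ^ 2
            ≤ ∫⁻ k, (c * (((n : ℝ≥0∞) + 1) * ((n : ℝ≥0∞) + 2))) * ∫⁻ z : R3 × R3,
              pairWeight (absSum n k) z * ‖g (n + 2) (Fin.cons z.2 (Fin.cons z.1 k))‖ₑ ^ 2 := by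
              refine lintegral_mono fun k => ?_
              refine (mul_le_mul_right (enorm_anW_anW_sq_le hf₁ hf₂ hg h1 h2 n k) _).trans ?_
              have h1s : (δ + absSum n k)⁻¹ * (δ + absSum n k) = 1 :=
                ENNReal.inv_mul_cancel (by simp [hδ]) (by simp [(absSum_lt_top k).ne, hδ'])
              refine le_of_eq ?_
              rw [show ∀ a b c d e : ℝ≥0∞, a * (b * c * (d * e)) = (a * c) * (b * d * e) by
                intros; ring, h1s, one_mul]
          _ = c * (((n : ℝ≥0∞) + 1) * ((n : ℝ≥0∞) + 2) * ∫⁻ k : Config n, ∫⁻ z : R3 × R3,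
              pairWeight (absSum n k) z * ‖g (n + 2) (Fin.cons z.2 (Fin.cons z.1 k))‖ₑ ^ 2) := by
              rw [lintegral_const_mul]
              · ring
              · have : Measurable fun y : Config n × R3 × R3 => pairWeight (absSum n y.1) y.2 *
                    ‖g (n + 2) (Fin.cons y.2.2 (Fin.cons y.2.1 y.1))‖ₑ ^ 2 := by
                  refine Measurable.mul ?_ (hg.measurable_sq_pair n)
                  exact (measurable_snd.fst.enorm.mul measurable_snd.snd.enorm).mul
                    (((isBoseWeight_absSum.meas n).comp measurable_fst).add
                      ((measurable_snd.fst.enorm.pow_const _).mul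
                        (measurable_snd.snd.enorm.pow_const _))).inv
                exact this.lintegral_prod_right'
          _ ≤ c * (2 * ∫⁻ k, absSum (n + 2) k * ‖g (n + 2) k‖ₑ ^ 2) := by
              exact mul_le_mul_right (lintegral_pairWeight_le hg n) _
          _ = _ := by ring
    _ = (2 * c) * ∑' n, ∫⁻ k, absSum (n + 2) k * ‖g (n + 2) k‖ₑ ^ 2 := ENNReal.tsum_mul_left
    _ ≤ _ := mul_le_mul_right (ENNReal.tsum_comp_le_tsum_of_injective (add_left_injective 2)
          (fun n => ∫⁻ k, absSum n k * ‖g n k‖ₑ ^ 2)) _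

/-! ### The operators on Fock space -/

section SectorOp

variable {op : Fock → (n : ℕ) → Config n → ℂ} {W : Submodule ℂ Fock}
  {hadd : ∀ ψ ∈ W, ∀ ψ' ∈ W, ∀ n, ∀ᵐ k, op (ψ + ψ') n k = op ψ n k + op ψ' n k}
  {hsmul : ∀ c : ℂ, ∀ ψ ∈ W, ∀ n, ∀ᵐ k, op (c • ψ) n k = c * op ψ n k}

theorem wave_sectorOp (x : (sectorOp op W hadd hsmul).domain) (n : ℕ) :
    ∀ᵐ k, wave (sectorOp op W hadd hsmul x) n k = op x n k :=
  (mem_graph_sectorOp.1 ((sectorOp op W hadd hsmul).mem_graph x)).2 n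

theorem mem_domain_sectorOp {ψ : Fock} {g : Wave} (hW : ψ ∈ W) (hg : IsBose g)
    (h : en one' g < ⊤) (hop : ∀ n, ∀ᵐ k, op ψ n k = g n k) :
    ψ ∈ (sectorOp op W hadd hsmul).domain := by
  have h1 : (ψ, ofWave g hg h) ∈ (sectorOp op W hadd hsmul).graph := by
    rw [mem_graph_sectorOp]
    refine ⟨hW, fun n => ?_⟩
    filter_upwards [wave_ofWave hg h n, hop n] with k h1 h2
    rw [h1, h2]
  exact LinearPMap.mem_domain_of_mem_graph h1

end SectorOp

theorem enorm_ofReal_mul_sq (r : ℝ) (z : ℂ) : ‖(r : ℂ) * z‖ₑ ^ 2 = ‖r‖ₑ ^ 2 * ‖z‖ₑ ^ 2 := by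
  have : ‖(r : ℂ)‖ₑ = ‖r‖ₑ := by rw [← ofReal_norm, Complex.norm_real, ofReal_norm]
  rw [enorm_mul, mul_pow, this]

theorem mem_domain_mulOp {m : (n : ℕ) → Config n → ℝ} (hm : ∀ n, Measurable (m n))
    (hs : ∀ n (σ : Equiv.Perm (Fin n)) k, m n (fun i => k (σ i)) = m n k) {ψ : Fock}
    (h : en (fun n k => ‖m n k‖ₑ ^ 2) (wave ψ) < ⊤) : ψ ∈ (mulOp m).domain := by
  have hb : IsBose (fun n k => (m n k : ℂ) * rep ψ n k) :=
    { meas := fun n => (Complex.measurable_ofReal.comp (hm n)).mul ((isBose_rep ψ).meas n)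
      symm := fun n σ k => by rw [hs, (isBose_rep ψ).symm] }
  refine mem_domain_sectorOp (g := fun n k => (m n k : ℂ) * rep ψ n k) trivial hb ?_ ?_
  · rw [← en_rep] at h
    refine lt_of_le_of_lt (le_of_eq ?_) h
    unfold en one'
    simp only [one_mul, enorm_ofReal_mul_sq]
  · intro n
    filter_upwards [rep_ae ψ n] with k hk
    rw [mulWave, hk]

theorem wave_mulOp {m : (n : ℕ) → Config n → ℝ} (x : (mulOp m).domain) (n : ℕ) :
    ∀ᵐ k, wave (mulOp m x) n k = (m n k : ℂ) * wave x n k := wave_sectorOp x n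

theorem en_mulOp (w : Weight) {m : (n : ℕ) → Config n → ℝ} (x : (mulOp m).domain) :
    en w (wave (mulOp m x)) = en (fun n k => w n k * ‖m n k‖ₑ ^ 2) (wave x) := by
  rw [en_congr (wave_mulOp x)]
  unfold en
  simp only [enorm_ofReal_mul_sq, mul_assoc]

theorem mem_domain_creation {f : R3 → ℂ} (hf : Measurable f) {ψ : Fock}
    (h : en one' (crW f (wave ψ)) < ⊤) : ψ ∈ (creation f).domain := by
  refine mem_domain_sectorOp (g := crW f (rep ψ)) trivial (isBose_crW hf (isBose_rep ψ)) ?_ ?_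
  · rwa [en_congr (crW_congr f (rep_ae ψ))]
  · intro n
    rw [creationWave_eq]
    filter_upwards [crW_congr f (rep_ae ψ) n] with k hk
    rw [hk]

theorem wave_creation {f : R3 → ℂ} (x : (creation f).domain) (n : ℕ) :
    ∀ᵐ k, wave (creation f x) n k = crW f (wave x) n k := by
  rw [← creationWave_eq]
  exact wave_sectorOp x n

theorem integrable_conj_mul_cons {f : R3 → ℂ} (hf : Measurable f) (h2 : ∫⁻ q, ‖f q‖ₑ ^ 2 < ⊤)
    (ψ : Fock) (n : ℕ) : ∀ᵐ k : Config n, Integrable fun q : R3 =>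
      (starRingEnd ℂ) (f q) * wave ψ (n + 1) (Fin.cons q k : Config (n + 1)) := by
  have hw := measurable_wave ψ (n + 1)
  have h1 : ∫⁻ k : Config n, ∫⁻ q : R3, ‖wave ψ (n + 1) (Fin.cons q k)‖ₑ ^ 2 ≠ ⊤ := by
    rw [← lintegral_cons' (hw.enorm.pow_const 2)]
    refine ne_of_lt (lt_of_le_of_lt ?_ (en_wave_lt_top ψ))
    unfold en one'
    simp only [one_mul]
    exact ENNReal.le_tsum (f := fun n => ∫⁻ k, ‖wave ψ n k‖ₑ ^ 2) (n + 1)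
  have hm : Measurable fun k : Config n => ∫⁻ q : R3, ‖wave ψ (n + 1) (Fin.cons q k)‖ₑ ^ 2 := by
    have hφ : Measurable fun y : Config n × R3 => ‖wave ψ (n + 1) (Fin.cons y.2 y.1)‖ₑ ^ 2 :=
      (hw.enorm.pow_const 2).comp ((measurable_cons n).comp measurable_swap)
    exact hφ.lintegral_prod_right'
  filter_upwards [ae_lt_top hm h1] with k hk
  refine ⟨?_, ?_⟩
  · exact ((Complex.continuous_conj.measurable.comp hf).mul
      (hw.comp (measurable_cons_left k))).aestronglyMeasurable
  · rw [HasFiniteIntegral]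
    have h3 := lintegral_mul_sq_le volume hf.enorm.aemeasurable
      (hw.comp (measurable_cons_left k)).enorm.aemeasurable
    have h4 : (∫⁻ q, ‖f q‖ₑ * ‖(wave ψ (n + 1) ∘ fun q => Fin.cons q k) q‖ₑ) ^ 2 < ⊤ :=
      lt_of_le_of_lt h3 (ENNReal.mul_lt_top h2 hk)
    have h5 : ∫⁻ q, ‖f q‖ₑ * ‖(wave ψ (n + 1) ∘ fun q => Fin.cons q k) q‖ₑ < ⊤ := by
      by_contra hcon
      rw [not_lt, top_le_iff] at hcon
      rw [hcon] at h4
      simp at h4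
    refine lt_of_le_of_lt (le_of_eq (lintegral_congr fun q => ?_)) h5
    rw [enorm_mul, RCLike.enorm_conj]
    rfl

theorem mem_domain_annihilation {f : R3 → ℂ} (hf : Measurable f) (h2 : ∫⁻ q, ‖f q‖ₑ ^ 2 < ⊤)
    {ψ : Fock} (h : en one' (anW f (wave ψ)) < ⊤) : ψ ∈ (annihilation f).domain := by
  refine mem_domain_sectorOp (g := anW f (rep ψ)) (integrable_conj_mul_cons hf h2 ψ)
    (isBose_anW hf (isBose_rep ψ)) ?_ ?_
  · rwa [en_congr (anW_congr f (rep_ae ψ))]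
  · intro n
    rw [annihilationWave_eq]
    filter_upwards [anW_congr f (rep_ae ψ) n] with k hk
    rw [hk]

theorem wave_annihilation {f : R3 → ℂ} (x : (annihilation f).domain) (n : ℕ) :
    ∀ᵐ k, wave (annihilation f x) n k = anW f (wave x) n k := wave_sectorOp x n

/-! ### Adjointness -/

theorem inner_mulOp_left {m : (n : ℕ) → Config n → ℝ} (x y : (mulOp m).domain) :
    inner ℂ (mulOp m x) (y : Fock) = inner ℂ (x : Fock) (mulOp m y) := by
  refine inner_eq_of_ae fun n => ?_
  filter_upwards [wave_mulOp x n, wave_mulOp y n] with k h1 h2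
  rw [h1, h2, map_mul, Complex.conj_ofReal]
  ring

theorem integrable_conj_mul_of_sq {α : Type*} [MeasurableSpace α] {μ : Measure α} {a b : α → ℂ}
    (ha : Measurable a) (hb : Measurable b) (ha2 : ∫⁻ x, ‖a x‖ₑ ^ 2 ∂μ < ⊤)
    (hb2 : ∫⁻ x, ‖b x‖ₑ ^ 2 ∂μ < ⊤) : Integrable (fun x => (starRingEnd ℂ) (a x) * b x) μ := by
  refine ⟨((Complex.continuous_conj.measurable.comp ha).mul hb).aestronglyMeasurable, ?_⟩
  rw [HasFiniteIntegral]
  have h3 := lintegral_mul_sq_le μ ha.enorm.aemeasurable hb.enorm.aemeasurable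
  have h4 : (∫⁻ q, ‖a q‖ₑ * ‖b q‖ₑ ∂μ) ^ 2 < ⊤ := lt_of_le_of_lt h3 (ENNReal.mul_lt_top ha2 hb2)
  have h5 : ∫⁻ q, ‖a q‖ₑ * ‖b q‖ₑ ∂μ < ⊤ := by
    by_contra hcon
    rw [not_lt, top_le_iff] at hcon
    rw [hcon] at h4
    simp at h4
  refine lt_of_le_of_lt (le_of_eq (lintegral_congr fun q => ?_)) h5
  rw [enorm_mul, RCLike.enorm_conj]

theorem lintegral_wave_sq_lt_top (ψ : Fock) (n : ℕ) : ∫⁻ k, ‖rep ψ n k‖ₑ ^ 2 < ⊤ := by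
  refine lt_of_le_of_lt ?_ (en_wave_lt_top ψ)
  rw [← en_rep]
  unfold en one'
  simp only [one_mul]
  exact ENNReal.le_tsum (f := fun n => ∫⁻ k, ‖rep ψ n k‖ₑ ^ 2) n

theorem integral_conj_crW_mul {f : R3 → ℂ} (hf : Measurable f) (h2 : ∫⁻ q, ‖f q‖ₑ ^ 2 < ⊤)
    {g h : Wave} (hg : IsBose g) (hh : IsBose h) (n : ℕ) (hg2 : ∫⁻ k, ‖g n k‖ₑ ^ 2 < ⊤)
    (hh2 : ∫⁻ k, ‖h (n + 1) k‖ₑ ^ 2 < ⊤) :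
    ∫ k, (starRingEnd ℂ) (crW f g (n + 1) k) * h (n + 1) k =
      ∫ k, (starRingEnd ℂ) (g n k) * anW f h n k := by
  set F : Fin (n + 1) → Config (n + 1) → ℂ := fun j k =>
    (starRingEnd ℂ) (f (k j) * g n (j.removeNth k)) * h (n + 1) k with hF
  have hperm : ∀ j, F j = fun k => F 0 (fun i => k (Equiv.swap 0 j i)) := by
    intro j
    funext k
    obtain ⟨τ, hτ⟩ := exists_perm_removeNth (Equiv.swap 0 j) 0
    simp only [hF, hτ, hg.symm, hh.symm, Equiv.swap_apply_left]
  have hm0 : Measurable fun k : Config (n + 1) => f (k 0) * g n (Fin.removeNth 0 k) :=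
    (hf.comp (measurable_pi_apply 0)).mul ((hg.meas n).comp (measurable_removeNth 0))
  have hF0 : Integrable (F 0) := by
    refine integrable_conj_mul_of_sq hm0 (hh.meas (n + 1)) ?_ hh2
    rw [lintegral_cons (hm0.enorm.pow_const 2)]
    simp only [Fin.cons_zero, Fin.removeNth_zero, Fin.tail_cons, enorm_mul, mul_pow]
    have h1 : ∀ q : R3, ∫⁻ k, ‖f q‖ₑ ^ 2 * ‖g n k‖ₑ ^ 2 = ‖f q‖ₑ ^ 2 * ∫⁻ k, ‖g n k‖ₑ ^ 2 :=
      fun q => lintegral_const_mul _ (hg.measurable_sq n)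
    simp_rw [h1]
    rw [lintegral_mul_const _ (hf.enorm.pow_const 2)]
    exact ENNReal.mul_lt_top h2 hg2
  have hFj : ∀ j, Integrable (F j) := by
    intro j
    rw [hperm j]
    exact (measurePreserving_perm (Equiv.swap 0 j)).integrable_comp_of_integrable hF0
  have hIj : ∀ j, ∫ k, F j k = ∫ k, F 0 k := by
    intro j
    rw [hperm j]
    exact integral_perm (Equiv.swap 0 j) (F 0)
  have hs : ((Real.sqrt (n + 1) : ℝ) : ℂ) * ((Real.sqrt (n + 1) : ℝ) : ℂ) = (n : ℂ) + 1 := by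
    rw [← Complex.ofReal_mul, Real.mul_self_sqrt (by positivity)]
    simp
  have hs0 : ((Real.sqrt (n + 1) : ℝ) : ℂ) ≠ 0 := by
    rw [Complex.ofReal_ne_zero]; positivity
  have hL : ∫ k, (starRingEnd ℂ) (crW f g (n + 1) k) * h (n + 1) k =
      ((Real.sqrt (n + 1) : ℝ) : ℂ) * ∫ k, F 0 k := by
    have e1 : ∀ k, (starRingEnd ℂ) (crW f g (n + 1) k) * h (n + 1) k =
        ((Real.sqrt (n + 1) : ℝ) : ℂ)⁻¹ * ∑ j, F j k := by
      intro k
      simp only [crW, hF, map_mul, map_inv₀, Complex.conj_ofReal, map_sum]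
      rw [mul_assoc, Finset.sum_mul]
    simp_rw [e1]
    rw [integral_const_mul, integral_finsetSum _ fun j _ => hFj j]
    simp_rw [hIj]
    rw [Finset.sum_const, Finset.card_univ, Fintype.card_fin, nsmul_eq_mul, ← mul_assoc]
    congr 1
    push_cast
    rw [← hs, ← mul_assoc, inv_mul_cancel₀ hs0, one_mul]
  rw [hL, integral_cons hF0]
  have hsw : ∫ q : R3, ∫ k : Config n, F 0 (Fin.cons q k) =
      ∫ k : Config n, ∫ q : R3, F 0 (Fin.cons q k) :=
    integral_integral_swap (f := fun (q : R3) (k : Config n) => F 0 (Fin.cons q k))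
      (integrable_cons hF0)
  have e2 : ∀ k : Config n, ((Real.sqrt (n + 1) : ℝ) : ℂ) * ∫ q : R3, F 0 (Fin.cons q k) =
      (starRingEnd ℂ) (g n k) * anW f h n k := by
    intro k
    have e3 : ∫ q : R3, F 0 (Fin.cons q k) = (starRingEnd ℂ) (g n k) *
        ∫ q : R3, (starRingEnd ℂ) (f q) * h (n + 1) (Fin.cons q k : Config (n + 1)) := by
      rw [← integral_const_mul (μ := (volume : Measure R3))]
      refine congrArg (fun F : R3 → ℂ => ∫ q, F q) (funext fun q => ?_)
      simp only [hF, Fin.cons_zero, Fin.removeNth_zero, Fin.tail_cons, map_mul]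
      ring
    rw [e3, anW]
    ring
  rw [hsw, ← integral_const_mul (μ := (volume : Measure (Config n)))]
  exact congrArg (fun F : Config n → ℂ => ∫ k, F k) (funext e2)

/-- `a*(f)` and `a(f)` are formal adjoints of each other on their maximal domains. -/
theorem inner_creation_left {f : R3 → ℂ} (hf : Measurable f) (h2 : ∫⁻ q, ‖f q‖ₑ ^ 2 < ⊤)
    (x : (creation f).domain) (y : (annihilation f).domain) :
    inner ℂ (creation f x) (y : Fock) = inner ℂ (x : Fock) (annihilation f y) := by
  have h1 := hasSum_inner_wave (creation f x) y
  have h3 := hasSum_inner_wave (x : Fock) (annihilation f y)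
  have hx := isBose_rep (x : Fock)
  have hy := isBose_rep (y : Fock)
  have e0 : ∫ k, (starRingEnd ℂ) (wave (creation f x) 0 k) * wave y 0 k = 0 := by
    rw [← integral_zero (Config 0) ℂ]
    refine integral_congr_ae ?_
    filter_upwards [wave_creation x 0] with k hk
    rw [hk]
    simp [crW]
  have e1 : ∀ n, ∫ k, (starRingEnd ℂ) (wave (creation f x) (n + 1) k) * wave y (n + 1) k =
      ∫ k, (starRingEnd ℂ) (wave x n k) * wave (annihilation f y) n k := by
    intro n
    have := integral_conj_crW_mul hf h2 hx hy n (lintegral_wave_sq_lt_top x n)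
      (lintegral_wave_sq_lt_top y (n + 1))
    calc _ = ∫ k, (starRingEnd ℂ) (crW f (rep x) (n + 1) k) * rep y (n + 1) k := by
          refine integral_congr_ae ?_
          filter_upwards [wave_creation x (n + 1), rep_ae (y : Fock) (n + 1),
            crW_congr f (rep_ae (x : Fock)) (n + 1)] with k h1 h2 h3
          rw [h1, h2, h3]
      _ = ∫ k, (starRingEnd ℂ) (rep x n k) * anW f (rep y) n k := this
      _ = _ := by
          refine integral_congr_ae ?_
          filter_upwards [wave_annihilation y n, rep_ae (x : Fock) n,
            anW_congr f (rep_ae (y : Fock)) n] with k h1 h2 h3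
          rw [h1, h2, h3]
  rw [← hasSum_nat_add_iff' 1] at h1
  simp only [Finset.sum_range_one, e0, sub_zero, e1] at h1
  exact h1.unique h3

/-! ### Form factors and the domain of `D_f` -/

/-- The integrability properties of a form factor: the integrals with negative powers
of `|k|` are bounded in terms of `C`, the others, which need not be uniform in the cutoff, are only
finite. -/
structure IsFormFactor (C : ℝ≥0) (f : R3 → ℂ) : Prop where
  meas : Measurable f
  real : ∀ q, (starRingEnd ℂ) (f q) = f q
  int_inv : ∫⁻ q, ‖f q‖ₑ ^ 2 * ‖q‖ₑ⁻¹ ≤ C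
  int_inv_half : ∫⁻ q, ‖f q‖ₑ ^ 2 * (‖q‖ₑ ^ (1 / 2 : ℝ))⁻¹ ≤ C
  int_soft : ∀ σ : ℝ≥0, ∫⁻ q in {q : R3 | ‖q‖ < σ}, ‖f q‖ₑ ^ 2 * ‖q‖ₑ⁻¹ ≤ C * σ
  sq_lt_top : ∫⁻ q, ‖f q‖ₑ ^ 2 < ⊤
  sq_mul_lt_top : ∫⁻ q, ‖f q‖ₑ ^ 2 * ‖q‖ₑ < ⊤
  sq_mul_sq_lt_top : ∫⁻ q, ‖f q‖ₑ ^ 2 * ‖q‖ₑ ^ 2 < ⊤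
  integrable : Integrable f

/-- The symbol of `D_f` as a weight. -/
def freeW : Weight := fun n k => ENNReal.ofReal (freeSymbol n k)

theorem freeSymbol_nonneg (n : ℕ) (k : Config n) : 0 ≤ freeSymbol n k := by
  unfold freeSymbol
  positivity

theorem measurable_freeSymbol (n : ℕ) : Measurable (freeSymbol n) := by
  unfold freeSymbol
  fun_prop

theorem freeSymbol_perm (n : ℕ) (σ : Equiv.Perm (Fin n)) (k : Config n) :
    freeSymbol n (fun i => k (σ i)) = freeSymbol n k := by
  unfold freeSymbol
  rw [Equiv.sum_comp σ (fun i => k i), Equiv.sum_comp σ (fun i => ‖k i‖)]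

theorem isBoseWeight_freeW : IsBoseWeight freeW where
  meas n := ENNReal.measurable_ofReal.comp (measurable_freeSymbol n)
  symm n σ k := by unfold freeW; rw [freeSymbol_perm]

theorem enorm_freeSymbol (n : ℕ) (k : Config n) : ‖freeSymbol n k‖ₑ = freeW n k := by
  rw [← ofReal_norm, Real.norm_eq_abs, abs_of_nonneg (freeSymbol_nonneg n k)]
  rfl

theorem absSum_eq_ofReal (n : ℕ) (k : Config n) : absSum n k = ENNReal.ofReal (∑ i, ‖k i‖) := by
  rw [ENNReal.ofReal_sum_of_nonneg fun i _ => norm_nonneg _]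
  simp only [ofReal_norm, absSum]

theorem absSum_le_freeW (n : ℕ) (k : Config n) : absSum n k ≤ freeW n k := by
  rw [absSum_eq_ofReal]
  refine ENNReal.ofReal_le_ofReal ?_
  unfold freeSymbol
  nlinarith [sq_nonneg ‖∑ i, k i‖]

theorem abs_coord_le (v : R3) (j : Fin 3) : |v j| ≤ ‖v‖ := by
  rw [← Real.norm_eq_abs]
  exact PiLp.norm_apply_le v j

theorem momentum_apply {n : ℕ} (k : Config n) (j : Fin 3) : ∑ i, k i j = (∑ i, k i) j := by
  rw [WithLp.ofLp_sum, Finset.sum_apply]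

theorem momentum_sq_le_freeW (n : ℕ) (k : Config n) (j : Fin 3) :
    ‖∑ i, k i j‖ₑ ^ 2 ≤ freeW n k := by
  have h1 : ‖∑ i, k i j‖ ≤ ‖∑ i, k i‖ := by
    rw [momentum_apply, Real.norm_eq_abs]
    exact abs_coord_le (∑ i, k i) j
  have h2 : 0 ≤ ∑ i, ‖k i‖ := Finset.sum_nonneg fun i _ => norm_nonneg _
  have h3 : ‖∑ i, k i j‖ ^ 2 ≤ freeSymbol n k :=
    (pow_le_pow_left₀ (norm_nonneg _) h1 2).trans (le_add_of_nonneg_right h2)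
  have h4 := ENNReal.ofReal_le_ofReal h3
  rwa [ENNReal.ofReal_pow (norm_nonneg _), ofReal_norm] at h4

theorem momentum_le_absSum (n : ℕ) (k : Config n) (j : Fin 3) :
    ‖∑ i, k i j‖ₑ ≤ absSum n k := by
  rw [absSum_eq_ofReal, ← ofReal_norm]
  refine ENNReal.ofReal_le_ofReal ?_
  rw [momentum_apply, Real.norm_eq_abs]
  exact (abs_coord_le _ j).trans (norm_sum_le _ _)

theorem absSum_mul_momentum_sq_le (n : ℕ) (k : Config n) (j : Fin 3) :
    absSum n k * ‖∑ i, k i j‖ₑ ^ 2 ≤ freeW n k ^ 2 := by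
  rw [pow_two (freeW n k)]
  exact mul_le_mul' (absSum_le_freeW n k) (momentum_sq_le_freeW n k j)

theorem measurable_momentum (n : ℕ) (j : Fin 3) : Measurable fun k : Config n => ∑ i, k i j := by
  refine Finset.measurable_sum _ fun i _ => ?_
  fun_prop

theorem momentum_perm (n : ℕ) (j : Fin 3) (σ : Equiv.Perm (Fin n)) (k : Config n) :
    ∑ i, (fun i => k (σ i)) i j = ∑ i, k i j := Equiv.sum_comp σ (fun i => k i j)

theorem en_freeOp (w : Weight) (x : freeOp.domain) :
    en w (wave (freeOp x)) = en (fun n k => w n k * ‖freeSymbol n k‖ₑ ^ 2) (wave x) := en_mulOp w x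

theorem en_fieldMomentum (w : Weight) (j : Fin 3) (x : (fieldMomentum j).domain) :
    en w (wave (fieldMomentum j x)) =
      en (fun n k => w n k * ‖∑ i, k i j‖ₑ ^ 2) (wave x) := en_mulOp w x

/-- The common domain of all operators: the domain of `D_f`. -/
abbrev fdom : Submodule ℂ Fock := freeOp.domain

theorem mem_fdom {ψ : Fock} : ψ ∈ fdom ↔ en (fun n k => freeW n k ^ 2) (wave ψ) < ⊤ := by
  constructor
  · intro h
    have h1 := en_wave_lt_top (freeOp ⟨ψ, h⟩)
    rw [en_freeOp] at h1
    simpa only [one', one_mul, enorm_freeSymbol] using h1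
  · intro h
    refine mem_domain_mulOp measurable_freeSymbol freeSymbol_perm ?_
    simpa only [enorm_freeSymbol] using h

theorem enorm_freeOp_sq (x : fdom) :
    ‖freeOp x‖ₑ ^ 2 = en (fun n k => freeW n k ^ 2) (wave x) := by
  rw [enorm_sq_eq_en, en_freeOp]
  simp only [one', one_mul, enorm_freeSymbol]

theorem en_const_mul (B : ℝ≥0∞) (hB : B ≠ ⊤) (m : Weight) (g : Wave) :
    en (fun n k => B * m n k) g = B * en m g := by
  unfold en
  rw [← ENNReal.tsum_mul_left]
  refine tsum_congr fun n => ?_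
  rw [← lintegral_const_mul' _ _ hB]
  simp only [mul_assoc]

theorem en_add (m m' : Weight) (hm : ∀ n, Measurable (m n)) (g : Wave) (hg : IsBose g) :
    en (fun n k => m n k + m' n k) g = en m g + en m' g := by
  unfold en
  rw [← ENNReal.tsum_add]
  refine tsum_congr fun n => ?_
  simp only [add_mul]
  exact lintegral_add_left ((hm n).mul (hg.measurable_sq n)) _

theorem en_mono_weight {m m' : Weight} (g : Wave) (h : ∀ n k, m n k ≤ m' n k) :
    en m g ≤ en m' g :=
  en_mono fun n => Filter.Eventually.of_forall fun k => mul_le_mul_left (h n k) _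

/-- Lower order energies are infinitesimally small with respect to `‖D_f ψ‖²`. -/
theorem const_mul_en_freeW_le (B : ℝ≥0∞) (hB : B ≠ ⊤) (ψ : Fock) :
    B * en freeW (wave ψ) ≤
      en (fun n k => freeW n k ^ 2) (wave ψ) + B ^ 2 * en one' (wave ψ) := by
  simp only [← en_rep]
  rw [← en_const_mul B hB, ← en_const_mul (B ^ 2) (ENNReal.pow_ne_top hB),
    ← en_add _ _ (fun n => (isBoseWeight_freeW.meas n).pow_const 2) _ (isBose_rep ψ)]
  refine en_mono_weight _ fun n k => ?_
  simp only [one', mul_one]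
  rcases le_total B (freeW n k) with h | h
  · exact le_add_right (by rw [pow_two]; gcongr)
  · exact le_add_left (by rw [pow_two]; gcongr)

theorem en_absSum_le_freeW (ψ : Fock) : en absSum (wave ψ) ≤ en freeW (wave ψ) :=
  en_mono_weight _ absSum_le_freeW

theorem en_absSum_sq_le (ψ : Fock) : en (fun n k => absSum n k * absSum n k) (wave ψ) ≤
    en (fun n k => freeW n k ^ 2) (wave ψ) := by
  refine en_mono_weight _ fun n k => ?_
  rw [pow_two]
  exact mul_le_mul' (absSum_le_freeW n k) (absSum_le_freeW n k)

theorem en_freeW_lt_top (x : fdom) : en freeW (wave x) < ⊤ := by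
  have h := const_mul_en_freeW_le 1 ENNReal.one_ne_top x
  rw [one_mul] at h
  refine lt_of_le_of_lt h (ENNReal.add_lt_top.2 ⟨mem_fdom.1 x.2, ?_⟩)
  simpa using en_wave_lt_top (x : Fock)

theorem en_absSum_lt_top (x : fdom) : en absSum (wave x) < ⊤ :=
  lt_of_le_of_lt (en_absSum_le_freeW x) (en_freeW_lt_top x)

/-! ### Bounds on the elementary operators -/

section Bounds

variable {C : ℝ≥0} {f : R3 → ℂ}

theorem en_anW_wave_le (hf : Measurable f) (ψ : Fock) {m m' : Weight}
    (hm' : IsBoseWeight m') (hm : ∀ n q k, m n k ≤ m' (n + 1) (Fin.cons q k)) :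
    en m (anW f (wave ψ)) ≤
      (∫⁻ q, ‖f q‖ₑ ^ 2 * ‖q‖ₑ⁻¹) * en (fun n k => m' n k * absSum n k) (wave ψ) := by
  rw [← en_rep, ← en_congr (anW_congr f (rep_ae ψ))]
  exact en_anW_le hf (isBose_rep ψ) hm' hm

theorem mem_annihilation (hf : Measurable f) (h2 : ∫⁻ q, ‖f q‖ₑ ^ 2 < ⊤)
    (hc : ∫⁻ q, ‖f q‖ₑ ^ 2 * ‖q‖ₑ⁻¹ < ⊤) {ψ : Fock} (h : en absSum (wave ψ) < ⊤) :
    ψ ∈ (annihilation f).domain := by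
  refine mem_domain_annihilation hf h2 ?_
  have h1 := en_anW_wave_le hf ψ (m := one') (m' := one') isBoseWeight_one fun n q k => le_rfl
  simp only [one', one_mul] at h1
  exact lt_of_le_of_lt h1 (ENNReal.mul_lt_top hc h)

theorem enorm_annihilation_sq_le (hf : Measurable f) (x : (annihilation f).domain) :
    ‖annihilation f x‖ₑ ^ 2 ≤ (∫⁻ q, ‖f q‖ₑ ^ 2 * ‖q‖ₑ⁻¹) * en absSum (wave x) := by
  rw [enorm_sq_eq_en, en_congr (wave_annihilation x)]
  have h1 := en_anW_wave_le hf (x : Fock) (m := one') (m' := one') isBoseWeight_one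
    fun n q k => le_rfl
  simpa only [one', one_mul] using h1

theorem en_absSum_annihilation_le (hf : Measurable f) (x : (annihilation f).domain) :
    en absSum (wave (annihilation f x)) ≤
      (∫⁻ q, ‖f q‖ₑ ^ 2 * ‖q‖ₑ⁻¹) * en (fun n k => absSum n k * absSum n k) (wave x) := by
  rw [en_congr (wave_annihilation x)]
  refine en_anW_wave_le hf (x : Fock) isBoseWeight_absSum fun n q k => ?_
  rw [absSum_cons]
  exact le_add_left le_rfl

theorem en_crW_wave_le (hf : Measurable f) (ψ : Fock) :
    en one' (crW f (wave ψ)) ≤ (∫⁻ q, ‖f q‖ₑ ^ 2) * en one' (wave ψ) +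
      (∫⁻ q, ‖f q‖ₑ ^ 2 * ‖q‖ₑ⁻¹) * en absSum (wave ψ) := by
  rw [← en_rep, ← en_rep, ← en_congr (crW_congr f (rep_ae ψ))]
  have h := en_crW_le_of_weight (N := 2) hf (isBose_rep ψ) isBoseWeight_one
    (a := ![fun _ => 1, fun q => ‖q‖ₑ⁻¹]) (b := ![one', absSum])
    (by
      intro i
      fin_cases i
      · exact measurable_const
      · exact measurable_enorm.inv)
    (by
      intro i
      fin_cases i
      · exact isBoseWeight_one
      · exact isBoseWeight_absSum)
    (fun n q k _ => by
      simp only [one', one_mul, Fin.sum_univ_two, Matrix.cons_val_zero, Matrix.cons_val_one]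
      rw [mul_comm])
  simpa only [Fin.sum_univ_two, Matrix.cons_val_zero, Matrix.cons_val_one, mul_one] using h

theorem en_absSum_crW_wave_le (hf : Measurable f) (ψ : Fock) :
    en absSum (crW f (wave ψ)) ≤ (∫⁻ q, ‖f q‖ₑ ^ 2 * ‖q‖ₑ) * en one' (wave ψ) +
      (∫⁻ q, ‖f q‖ₑ ^ 2 * 2) * en absSum (wave ψ) +
      (∫⁻ q, ‖f q‖ₑ ^ 2 * ‖q‖ₑ⁻¹) * en (fun n k => absSum n k * absSum n k) (wave ψ) := by
  simp only [← en_rep]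
  rw [← en_congr (crW_congr f (rep_ae ψ))]
  have h := en_crW_le_of_weight (N := 3) hf (isBose_rep ψ) isBoseWeight_absSum
    (a := ![fun q => ‖q‖ₑ, fun _ => 2, fun q => ‖q‖ₑ⁻¹])
    (b := ![one', absSum, fun n k => absSum n k * absSum n k])
    (by
      intro i
      fin_cases i
      · exact measurable_enorm
      · exact measurable_const
      · exact measurable_enorm.inv)
    (by
      intro i
      fin_cases i
      · exact isBoseWeight_one
      · exact isBoseWeight_absSum
      · exact ⟨fun n => (isBoseWeight_absSum.meas n).mul (isBoseWeight_absSum.meas n),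
          fun n σ k => congrArg (fun z => z * z) (isBoseWeight_absSum.symm n σ k)⟩)
    (fun n q k hq => by
      have hq1 : ‖q‖ₑ ≠ 0 := by simpa using hq
      simp only [Fin.sum_univ_three, Matrix.cons_val_zero, Matrix.cons_val_one, Matrix.cons_val,
        absSum_cons, one', mul_one]
      have h1 : ‖q‖ₑ * (absSum n k * ‖q‖ₑ⁻¹) = absSum n k := by
        rw [mul_left_comm, ENNReal.mul_inv_cancel hq1 enorm_ne_top, mul_one]
      refine le_of_eq ?_
      calc (‖q‖ₑ + absSum n k) * (1 + absSum n k * ‖q‖ₑ⁻¹)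
          = ‖q‖ₑ + ‖q‖ₑ * (absSum n k * ‖q‖ₑ⁻¹) + absSum n k +
            ‖q‖ₑ⁻¹ * (absSum n k * absSum n k) := by ring
        _ = _ := by rw [h1]; ring)
  simpa only [Fin.sum_univ_three, Matrix.cons_val_zero, Matrix.cons_val_one, Matrix.cons_val,
    mul_one] using h

theorem mem_creation (hf : IsFormFactor C f) {ψ : Fock} (h : en absSum (wave ψ) < ⊤) :
    ψ ∈ (creation f).domain := by
  refine mem_domain_creation hf.meas (lt_of_le_of_lt (en_crW_wave_le hf.meas ψ) ?_)
  exact ENNReal.add_lt_top.2 ⟨ENNReal.mul_lt_top hf.sq_lt_top (en_wave_lt_top ψ),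
    ENNReal.mul_lt_top (lt_of_le_of_lt hf.int_inv ENNReal.coe_lt_top) h⟩

theorem enorm_creation_sq_le (hf : IsFormFactor C f) (x : (creation f).domain) :
    ‖creation f x‖ₑ ^ 2 ≤ (∫⁻ q, ‖f q‖ₑ ^ 2) * ‖(x : Fock)‖ₑ ^ 2 + C * en absSum (wave x) := by
  rw [enorm_sq_eq_en, enorm_sq_eq_en, en_congr (wave_creation x)]
  refine (en_crW_wave_le hf.meas x).trans ?_
  gcongr
  exact hf.int_inv

theorem en_absSum_creation_le (hf : IsFormFactor C f) (x : (creation f).domain) :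
    en absSum (wave (creation f x)) ≤ (∫⁻ q, ‖f q‖ₑ ^ 2 * ‖q‖ₑ) * ‖(x : Fock)‖ₑ ^ 2 +
      (2 * ∫⁻ q, ‖f q‖ₑ ^ 2) * en absSum (wave x) +
      C * en (fun n k => absSum n k * absSum n k) (wave x) := by
  rw [enorm_sq_eq_en, en_congr (wave_creation x)]
  refine (en_absSum_crW_wave_le hf.meas x).trans ?_
  rw [lintegral_mul_const _ (hf.meas.enorm.pow_const 2), mul_comm _ (2 : ℝ≥0∞)]
  gcongr
  exact hf.int_inv

theorem mem_annihilation_of_formFactor (hf : IsFormFactor C f) {ψ : Fock}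
    (h : en absSum (wave ψ) < ⊤) : ψ ∈ (annihilation f).domain :=
  mem_annihilation hf.meas hf.sq_lt_top (lt_of_le_of_lt hf.int_inv ENNReal.coe_lt_top) h

theorem mem_fieldMomentum {ψ : Fock} (j : Fin 3) (h : en freeW (wave ψ) < ⊤) :
    ψ ∈ (fieldMomentum j).domain := by
  refine mem_domain_mulOp (fun n => measurable_momentum n j) (fun n => momentum_perm n j) ?_
  exact lt_of_le_of_lt (en_mono_weight _ fun n k => momentum_sq_le_freeW n k j) h

theorem enorm_fieldMomentum_sq_le (j : Fin 3) (x : (fieldMomentum j).domain) :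
    ‖fieldMomentum j x‖ₑ ^ 2 ≤ en freeW (wave x) := by
  rw [enorm_sq_eq_en, en_fieldMomentum]
  refine en_mono_weight _ fun n k => ?_
  rw [one', one_mul]
  exact momentum_sq_le_freeW n k j

theorem en_absSum_fieldMomentum_le (j : Fin 3) (x : (fieldMomentum j).domain) :
    en absSum (wave (fieldMomentum j x)) ≤ en (fun n k => freeW n k ^ 2) (wave x) := by
  rw [en_fieldMomentum]
  exact en_mono_weight _ fun n k => absSum_mul_momentum_sq_le n k j

theorem measurable_coord_mul (hf : Measurable f) (j : Fin 3) :
    Measurable fun q : R3 => ((q j : ℝ) : ℂ) * f q := by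
  refine Measurable.mul (Complex.measurable_ofReal.comp ?_) hf
  fun_prop

theorem enorm_coord_mul_sq_le (j : Fin 3) (q : R3) :
    ‖((q j : ℝ) : ℂ) * f q‖ₑ ^ 2 ≤ ‖f q‖ₑ ^ 2 * ‖q‖ₑ ^ 2 := by
  rw [enorm_ofReal_mul_sq, mul_comm]
  gcongr
  rw [← ofReal_norm, ← ofReal_norm, Real.norm_eq_abs]
  exact ENNReal.ofReal_le_ofReal (abs_coord_le q j)

theorem lintegral_coord_mul_lt_top (hf : IsFormFactor C f) (j : Fin 3) :
    ∫⁻ q : R3, ‖((q j : ℝ) : ℂ) * f q‖ₑ ^ 2 < ⊤ :=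
  lt_of_le_of_lt (lintegral_mono fun q => enorm_coord_mul_sq_le j q) hf.sq_mul_sq_lt_top

theorem lintegral_coord_mul_inv_le (f : R3 → ℂ) (j : Fin 3) :
    ∫⁻ q : R3, ‖((q j : ℝ) : ℂ) * f q‖ₑ ^ 2 * ‖q‖ₑ⁻¹ ≤ ∫⁻ q : R3, ‖f q‖ₑ ^ 2 * ‖q‖ₑ := by
  refine lintegral_mono fun q => ?_
  calc ‖((q j : ℝ) : ℂ) * f q‖ₑ ^ 2 * ‖q‖ₑ⁻¹ ≤ (‖f q‖ₑ ^ 2 * ‖q‖ₑ ^ 2) * ‖q‖ₑ⁻¹ := by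
        gcongr
        exact enorm_coord_mul_sq_le j q
    _ = ‖f q‖ₑ ^ 2 * ‖q‖ₑ * (‖q‖ₑ * ‖q‖ₑ⁻¹) := by ring
    _ ≤ ‖f q‖ₑ ^ 2 * ‖q‖ₑ * 1 := by
        gcongr
        exact ENNReal.mul_inv_le_one _
    _ = _ := mul_one _

/-- `𝒫 a(f) = a(f) 𝒫 - a(k f)`, on wave functions. -/
theorem momentum_mul_anW (hf : IsFormFactor C f) (j : Fin 3) (x : (fieldMomentum j).domain)
    (n : ℕ) : ∀ᵐ k : Config n, ((∑ i, k i j : ℝ) : ℂ) * anW f (wave x) n k =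
      anW f (wave (fieldMomentum j x)) n k -
        anW (fun q => ((q j : ℝ) : ℂ) * f q) (wave x) n k := by
  have h1 : ∀ᵐ k : Config (n + 1), wave (fieldMomentum j x) (n + 1) k =
      ((∑ i, k i j : ℝ) : ℂ) * wave x (n + 1) k := wave_mulOp x (n + 1)
  filter_upwards [ae_ae_cons h1,
    integrable_conj_mul_cons hf.meas hf.sq_lt_top (fieldMomentum j x) n,
    integrable_conj_mul_cons (measurable_coord_mul hf.meas j) (lintegral_coord_mul_lt_top hf j)
      (x : Fock) n] with k h2 h3 h4
  unfold anW
  rw [← mul_sub, ← integral_sub h3 h4, mul_left_comm,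
    ← integral_const_mul (μ := (volume : Measure R3))]
  congr 1
  refine integral_congr_ae ?_
  filter_upwards [h2] with q hq
  rw [hq]
  simp only [map_mul, Complex.conj_ofReal, Fin.sum_univ_succ, Fin.cons_zero, Fin.cons_succ]
  push_cast
  ring

end Bounds

/-! ### The terms of the Nelson operator on the domain of `D_f` -/

theorem mem_opMul {S T : Fock →ₗ.[ℂ] Fock} {ψ : Fock} (h : ψ ∈ T.domain)
    (h' : T ⟨ψ, h⟩ ∈ S.domain) : ψ ∈ (opMul S T).domain := ⟨h, h'⟩

/-- The restriction of an operator to the domain of `D_f`. -/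
def resMap (S : Fock →ₗ.[ℂ] Fock) (h : fdom ≤ S.domain) : fdom →ₗ[ℂ] Fock :=
  S.toFun ∘ₗ Submodule.inclusion h

theorem le_dot_domain {V W : Fin 3 → (Fock →ₗ.[ℂ] Fock)}
    (h : ∀ j, fdom ≤ (opMul (V j) (W j)).domain) : fdom ≤ (dot V W).domain :=
  le_inf (le_inf (h 0) (h 1)) (h 2)

theorem resMap_dot {V W : Fin 3 → (Fock →ₗ.[ℂ] Fock)}
    (h : ∀ j, fdom ≤ (opMul (V j) (W j)).domain) (x : fdom) :
    resMap (dot V W) (le_dot_domain h) x = ∑ j, resMap (opMul (V j) (W j)) (h j) x := by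
  rw [Fin.sum_univ_three]
  rfl

theorem le_of_sq_le_add_sq {a p d b n : ℝ} (hp : 0 ≤ p * d) (hb : 0 ≤ b * n)
    (h : a ^ 2 ≤ (p * d) ^ 2 + (b * n) ^ 2) : a ≤ p * d + b * n := by
  by_contra hcon
  push Not at hcon
  nlinarith

/-- `S` is bounded relative to `D_f` with relative bound `C + 1`. -/
def RelBdd (C : ℝ≥0) (S : fdom →ₗ[ℂ] Fock) : Prop :=
  ∃ B : ℝ, 0 ≤ B ∧ ∀ x : fdom, ‖S x‖ ≤ (C + 1) * ‖freeOp x‖ + B * ‖(x : Fock)‖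

theorem real_le_of_enorm_sq_le {C B : ℝ≥0} {s d n : ℝ} (hd : 0 ≤ d) (hn : 0 ≤ n)
    (h : ENNReal.ofReal s ^ 2 ≤ ((C : ℝ≥0∞) + 1) ^ 2 * ENNReal.ofReal d ^ 2 +
      ((B : ℝ≥0∞) ^ 2 + B) * ENNReal.ofReal n ^ 2) :
    s ≤ (C + 1) * d + Real.sqrt ((B : ℝ) ^ 2 + B) * n := by
  rcases le_total s 0 with hs | hs
  · exact hs.trans (by positivity)
  lift s to ℝ≥0 using hs
  lift d to ℝ≥0 using hd
  lift n to ℝ≥0 using hn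
  simp only [ENNReal.ofReal_coe_nnreal] at h
  have h3 : s ^ 2 ≤ (C + 1) ^ 2 * d ^ 2 + (B ^ 2 + B) * n ^ 2 := by exact_mod_cast h
  refine le_of_sq_le_add_sq (by positivity) (by positivity) ?_
  rw [mul_pow, mul_pow, Real.sq_sqrt (by positivity)]
  exact_mod_cast h3

theorem relBdd_of_sq {C : ℝ≥0} {S : fdom →ₗ[ℂ] Fock} {B : ℝ≥0∞} (hB : B ≠ ⊤)
    (h : ∀ x : fdom, ‖S x‖ₑ ^ 2 ≤ (C ^ 2 + 2 * C) * en (fun n k => freeW n k ^ 2) (wave x) +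
      B * en freeW (wave x) + B * ‖(x : Fock)‖ₑ ^ 2) : RelBdd C S := by
  lift B to ℝ≥0 using hB
  refine ⟨Real.sqrt ((B : ℝ) ^ 2 + B), Real.sqrt_nonneg _, fun x => ?_⟩
  refine real_le_of_enorm_sq_le (norm_nonneg _) (norm_nonneg _) ?_
  rw [ofReal_norm, ofReal_norm, ofReal_norm]
  have h2 := const_mul_en_freeW_le B ENNReal.coe_ne_top x
  rw [← enorm_sq_eq_en] at h2
  calc _ ≤ _ := h x
    _ ≤ (C ^ 2 + 2 * C) * en (fun n k => freeW n k ^ 2) (wave x) +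
        (en (fun n k => freeW n k ^ 2) (wave x) + B ^ 2 * ‖(x : Fock)‖ₑ ^ 2) +
        B * ‖(x : Fock)‖ₑ ^ 2 := add_le_add (add_le_add le_rfl h2) le_rfl
    _ = _ := by rw [enorm_freeOp_sq]; ring

/-! ### Differences of Fock vectors -/

theorem wave_sub (ψ φ : Fock) (n : ℕ) : ∀ᵐ k, wave (ψ - φ) n k = wave ψ n k - wave φ n k := by
  rw [sub_eq_add_neg, ← neg_one_smul ℂ φ]
  filter_upwards [wave_add ψ ((-1 : ℂ) • φ) n, wave_smul (-1) φ n] with k h1 h2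
  rw [h1, h2]
  ring

theorem enorm_sub_sq_le (ψ φ : Fock) : ‖ψ - φ‖ₑ ^ 2 ≤ 2 * ‖ψ‖ₑ ^ 2 + 2 * ‖φ‖ₑ ^ 2 := by
  have h : ‖ψ - φ‖₊ ≤ ‖ψ‖₊ + ‖φ‖₊ := nnnorm_sub_le ψ φ
  simp only [enorm_eq_nnnorm]
  norm_cast
  refine (pow_le_pow_left' h 2).trans ?_
  rw [← mul_add]
  exact add_sq_le.trans le_rfl

section Terms

variable {C : ℝ≥0} {f : R3 → ℂ}

theorem fdom_le_annihilation (hf : IsFormFactor C f) : fdom ≤ (annihilation f).domain :=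
  fun ψ h => mem_annihilation_of_formFactor hf (en_absSum_lt_top ⟨ψ, h⟩)

theorem fdom_le_creation (hf : IsFormFactor C f) : fdom ≤ (creation f).domain :=
  fun ψ h => mem_creation hf (en_absSum_lt_top ⟨ψ, h⟩)

theorem fdom_le_fieldMomentum (j : Fin 3) : fdom ≤ (fieldMomentum j).domain :=
  fun ψ h => mem_fieldMomentum j (en_freeW_lt_top ⟨ψ, h⟩)

theorem en_absSum_annihilation_lt_top (hf : IsFormFactor C f) (x : fdom)
    (hx : (x : Fock) ∈ (annihilation f).domain) :
    en absSum (wave (annihilation f ⟨x, hx⟩)) ≤ C * en (fun n k => freeW n k ^ 2) (wave x) := by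
  refine (en_absSum_annihilation_le hf.meas _).trans ?_
  gcongr
  · exact hf.int_inv
  · exact en_absSum_sq_le (x : Fock)

theorem coe_mul_en_lt_top (x : fdom) :
    (C : ℝ≥0∞) * en (fun n k => freeW n k ^ 2) (wave x) < ⊤ :=
  ENNReal.mul_lt_top ENNReal.coe_lt_top (mem_fdom.1 x.2)

theorem fdom_le_annihilation_annihilation (hf : IsFormFactor C f) :
    fdom ≤ (opMul (annihilation f) (annihilation f)).domain := fun ψ h =>
  mem_opMul (fdom_le_annihilation hf h) (mem_annihilation_of_formFactor hf
    (lt_of_le_of_lt (en_absSum_annihilation_lt_top hf ⟨ψ, h⟩ _) (coe_mul_en_lt_top ⟨ψ, h⟩)))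

theorem fdom_le_creation_annihilation (hf : IsFormFactor C f) :
    fdom ≤ (opMul (creation f) (annihilation f)).domain := fun ψ h =>
  mem_opMul (fdom_le_annihilation hf h) (mem_creation hf
    (lt_of_le_of_lt (en_absSum_annihilation_lt_top hf ⟨ψ, h⟩ _) (coe_mul_en_lt_top ⟨ψ, h⟩)))

theorem en_absSum_creation_le_freeW (hf : IsFormFactor C f) (x : fdom)
    (hx : (x : Fock) ∈ (creation f).domain) :
    en absSum (wave (creation f ⟨x, hx⟩)) ≤ (∫⁻ q, ‖f q‖ₑ ^ 2 * ‖q‖ₑ) * ‖(x : Fock)‖ₑ ^ 2 +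
      (2 * ∫⁻ q, ‖f q‖ₑ ^ 2) * en freeW (wave x) +
      C * en (fun n k => freeW n k ^ 2) (wave x) := by
  refine (en_absSum_creation_le hf _).trans ?_
  gcongr
  · exact en_absSum_le_freeW (x : Fock)
  · exact en_absSum_sq_le (x : Fock)

theorem fdom_le_creation_creation (hf : IsFormFactor C f) :
    fdom ≤ (opMul (creation f) (creation f)).domain := fun ψ h => by
  refine mem_opMul (fdom_le_creation hf h) (mem_creation hf
    (lt_of_le_of_lt (en_absSum_creation_le_freeW hf ⟨ψ, h⟩ _) ?_))
  refine ENNReal.add_lt_top.2 ⟨ENNReal.add_lt_top.2 ⟨?_, ?_⟩, coe_mul_en_lt_top ⟨ψ, h⟩⟩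
  · exact ENNReal.mul_lt_top hf.sq_mul_lt_top (ENNReal.pow_lt_top enorm_lt_top)
  · exact ENNReal.mul_lt_top (ENNReal.mul_lt_top (by norm_num) hf.sq_lt_top)
      (en_freeW_lt_top ⟨ψ, h⟩)

theorem en_absSum_fieldMomentum_lt_top (j : Fin 3) (x : fdom)
    (hx : (x : Fock) ∈ (fieldMomentum j).domain) :
    en absSum (wave (fieldMomentum j ⟨x, hx⟩)) < ⊤ :=
  lt_of_le_of_lt (en_absSum_fieldMomentum_le j _) (mem_fdom.1 x.2)

theorem fdom_le_creation_fieldMomentum (hf : IsFormFactor C f) (j : Fin 3) :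
    fdom ≤ (opMul (creation f) (fieldMomentum j)).domain := fun ψ h =>
  mem_opMul (fdom_le_fieldMomentum j h)
    (mem_creation hf (en_absSum_fieldMomentum_lt_top j ⟨ψ, h⟩ _))

/-- The bound on `𝒫 a(f)`. -/
theorem en_fieldMomentum_annihilation_le (hf : IsFormFactor C f) (j : Fin 3) (x : fdom)
    (hx : (x : Fock) ∈ (annihilation f).domain) :
    en (fun _ k => ‖∑ i, k i j‖ₑ ^ 2) (wave (annihilation f ⟨x, hx⟩)) ≤
      2 * (C * en (fun n k => freeW n k ^ 2) (wave x)) +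
      2 * ((∫⁻ q, ‖f q‖ₑ ^ 2 * ‖q‖ₑ) * en freeW (wave x)) := by
  have hP := fdom_le_fieldMomentum j x.2
  set y : (fieldMomentum j).domain := ⟨x, hP⟩ with hy
  have hyA : fieldMomentum j y ∈ (annihilation f).domain :=
    mem_annihilation_of_formFactor hf (en_absSum_fieldMomentum_lt_top j x hP)
  have hfin : ∫⁻ q : R3, ‖((q j : ℝ) : ℂ) * f q‖ₑ ^ 2 * ‖q‖ₑ⁻¹ < ⊤ :=
    lt_of_le_of_lt (lintegral_coord_mul_inv_le f j) hf.sq_mul_lt_top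
  have hxk : (x : Fock) ∈ (annihilation (fun q => ((q j : ℝ) : ℂ) * f q)).domain :=
    mem_annihilation (measurable_coord_mul hf.meas j) (lintegral_coord_mul_lt_top hf j) hfin
      (en_absSum_lt_top x)
  have h1 : en (fun n k => ‖∑ i, k i j‖ₑ ^ 2) (wave (annihilation f ⟨x, hx⟩)) =
      en one' (wave (annihilation f ⟨_, hyA⟩ - annihilation _ ⟨x, hxk⟩)) := by
    unfold en
    refine tsum_congr fun n => lintegral_congr_ae ?_
    filter_upwards [wave_sub (annihilation f ⟨_, hyA⟩) (annihilation _ ⟨x, hxk⟩) n,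
      wave_annihilation ⟨x, hx⟩ n, wave_annihilation ⟨_, hyA⟩ n,
      wave_annihilation ⟨x, hxk⟩ n, momentum_mul_anW hf j y n] with k h1 h2 h3 h4 h5
    rw [one', one_mul, h1, h2, h3, h4, ← enorm_ofReal_mul_sq]
    exact congrArg (fun z : ℂ => ‖z‖ₑ ^ 2) h5
  rw [h1, ← enorm_sq_eq_en]
  refine (enorm_sub_sq_le _ _).trans ?_
  gcongr
  · refine (enorm_annihilation_sq_le hf.meas _).trans ?_
    gcongr
    · exact hf.int_inv
    · exact en_absSum_fieldMomentum_le j _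
  · refine (enorm_annihilation_sq_le (measurable_coord_mul hf.meas j) _).trans ?_
    exact mul_le_mul' (lintegral_coord_mul_inv_le f j) (en_absSum_le_freeW (x : Fock))

theorem fdom_le_fieldMomentum_annihilation (hf : IsFormFactor C f) (j : Fin 3) :
    fdom ≤ (opMul (fieldMomentum j) (annihilation f)).domain := fun ψ h => by
  refine mem_opMul (fdom_le_annihilation hf h) ?_
  refine mem_domain_mulOp (fun n => measurable_momentum n j) (fun n => momentum_perm n j) ?_
  refine lt_of_le_of_lt (en_fieldMomentum_annihilation_le hf j ⟨ψ, h⟩ _) ?_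
  refine ENNReal.add_lt_top.2 ⟨ENNReal.mul_lt_top (by norm_num) (coe_mul_en_lt_top ⟨ψ, h⟩),
    ENNReal.mul_lt_top (by norm_num) (ENNReal.mul_lt_top hf.sq_mul_lt_top
      (en_freeW_lt_top ⟨ψ, h⟩))⟩

theorem relBdd_annihilation_annihilation (hf : IsFormFactor C f) :
    RelBdd C (resMap _ (fdom_le_annihilation_annihilation hf)) := by
  refine relBdd_of_sq ENNReal.zero_ne_top fun x => ?_
  have h1 := enorm_annihilation_sq_le hf.meas
    ⟨annihilation f ⟨x, _⟩, (fdom_le_annihilation_annihilation hf x.2).2⟩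
  have h2 := en_absSum_annihilation_lt_top hf x (fdom_le_annihilation hf x.2)
  simp only [zero_mul, add_zero]
  calc _ ≤ _ := h1
    _ ≤ C * (C * en (fun n k => freeW n k ^ 2) (wave x)) := by
        gcongr
        exact hf.int_inv
    _ = C ^ 2 * en (fun n k => freeW n k ^ 2) (wave x) := by ring
    _ ≤ _ := mul_le_mul_left (le_add_right le_rfl) _

theorem relBdd_creation_annihilation (hf : IsFormFactor C f) :
    RelBdd C (resMap _ (fdom_le_creation_annihilation hf)) := by
  have hB : (∫⁻ q, ‖f q‖ₑ ^ 2) * C ≠ ⊤ := (ENNReal.mul_lt_top hf.sq_lt_top ENNReal.coe_lt_top).ne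
  refine relBdd_of_sq hB fun x => ?_
  have h1 := enorm_creation_sq_le hf
    ⟨annihilation f ⟨x, _⟩, (fdom_le_creation_annihilation hf x.2).2⟩
  have h2 := en_absSum_annihilation_lt_top hf x (fdom_le_annihilation hf x.2)
  have h3 := enorm_annihilation_sq_le hf.meas ⟨x, fdom_le_annihilation hf x.2⟩
  calc _ ≤ _ := h1
    _ ≤ (∫⁻ q, ‖f q‖ₑ ^ 2) * (C * en freeW (wave x)) +
        C * (C * en (fun n k => freeW n k ^ 2) (wave x)) := by
        gcongr
        refine h3.trans ?_
        gcongr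
        · exact hf.int_inv
        · exact en_absSum_le_freeW (x : Fock)
    _ = C ^ 2 * en (fun n k => freeW n k ^ 2) (wave x) +
        ((∫⁻ q, ‖f q‖ₑ ^ 2) * C) * en freeW (wave x) := by ring
    _ ≤ _ := by
        refine le_add_right ?_
        gcongr
        exact le_add_right le_rfl

theorem relBdd_creation_creation (hf : IsFormFactor C f) :
    RelBdd C (resMap _ (fdom_le_creation_creation hf)) := by
  set a0 := ∫⁻ q, ‖f q‖ₑ ^ 2
  set a1 := ∫⁻ q, ‖f q‖ₑ ^ 2 * ‖q‖ₑ
  have h0 : a0 ≠ ⊤ := hf.sq_lt_top.ne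
  have h1' : a1 ≠ ⊤ := hf.sq_mul_lt_top.ne
  have hC : (C : ℝ≥0∞) ≠ ⊤ := ENNReal.coe_ne_top
  have hB : 3 * a0 * C + (a0 * a0 + C * a1) ≠ ⊤ := by finiteness
  refine relBdd_of_sq hB fun x => ?_
  have h1 := enorm_creation_sq_le hf
    ⟨creation f ⟨x, _⟩, (fdom_le_creation_creation hf x.2).2⟩
  have h2 := en_absSum_creation_le_freeW hf x (fdom_le_creation hf x.2)
  have h3 := enorm_creation_sq_le hf ⟨x, fdom_le_creation hf x.2⟩
  calc _ ≤ _ := h1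
    _ ≤ a0 * (a0 * ‖(x : Fock)‖ₑ ^ 2 + C * en freeW (wave x)) +
        C * (a1 * ‖(x : Fock)‖ₑ ^ 2 + (2 * a0) * en freeW (wave x) +
          C * en (fun n k => freeW n k ^ 2) (wave x)) := by
        gcongr
        refine h3.trans ?_
        gcongr
        exact en_absSum_le_freeW (x : Fock)
    _ = C ^ 2 * en (fun n k => freeW n k ^ 2) (wave x) +
        (3 * a0 * C) * en freeW (wave x) + (a0 * a0 + C * a1) * ‖(x : Fock)‖ₑ ^ 2 := by ring
    _ ≤ _ := add_le_add (add_le_add (mul_le_mul_left (le_add_right le_rfl) _)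
        (mul_le_mul_left (le_add_right le_rfl) _)) (mul_le_mul_left (le_add_left le_rfl) _)

theorem relBdd_creation_fieldMomentum (hf : IsFormFactor C f) (j : Fin 3) :
    RelBdd C (resMap _ (fdom_le_creation_fieldMomentum hf j)) := by
  refine relBdd_of_sq hf.sq_lt_top.ne fun x => ?_
  have h1 := enorm_creation_sq_le hf
    ⟨fieldMomentum j ⟨x, _⟩, (fdom_le_creation_fieldMomentum hf j x.2).2⟩
  calc _ ≤ _ := h1
    _ ≤ (∫⁻ q, ‖f q‖ₑ ^ 2) * en freeW (wave x) +
        C * en (fun n k => freeW n k ^ 2) (wave x) := by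
        gcongr
        · exact enorm_fieldMomentum_sq_le j ⟨x, fdom_le_fieldMomentum j x.2⟩
        · exact en_absSum_fieldMomentum_le j ⟨x, fdom_le_fieldMomentum j x.2⟩
    _ = C * en (fun n k => freeW n k ^ 2) (wave x) +
        (∫⁻ q, ‖f q‖ₑ ^ 2) * en freeW (wave x) := add_comm _ _
    _ ≤ _ := by
        refine le_add_right ?_
        gcongr
        refine le_add_left ?_
        rw [two_mul]
        exact le_add_right le_rfl

theorem relBdd_fieldMomentum_annihilation (hf : IsFormFactor C f) (j : Fin 3) :
    RelBdd C (resMap _ (fdom_le_fieldMomentum_annihilation hf j)) := by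
  have hB : 2 * ∫⁻ q, ‖f q‖ₑ ^ 2 * ‖q‖ₑ ≠ ⊤ :=
    (ENNReal.mul_lt_top (by norm_num) hf.sq_mul_lt_top).ne
  refine relBdd_of_sq hB fun x => ?_
  have h2 := en_fieldMomentum_annihilation_le hf j x (fdom_le_annihilation hf x.2)
  have h1 : ‖resMap _ (fdom_le_fieldMomentum_annihilation hf j) x‖ₑ ^ 2 =
      en (fun n k => ‖∑ i, k i j‖ₑ ^ 2)
        (wave (annihilation f ⟨x, fdom_le_annihilation hf x.2⟩)) := by
    rw [enorm_sq_eq_en]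
    refine (en_fieldMomentum one' j ⟨annihilation f ⟨x, _⟩,
      (fdom_le_fieldMomentum_annihilation hf j x.2).2⟩).trans ?_
    simp only [one', one_mul]
  rw [h1]
  calc _ ≤ _ := h2
    _ = (2 * C) * en (fun n k => freeW n k ^ 2) (wave x) +
        (2 * ∫⁻ q, ‖f q‖ₑ ^ 2 * ‖q‖ₑ) * en freeW (wave x) := by ring
    _ ≤ _ := by
        refine le_add_right ?_
        gcongr
        exact le_add_left le_rfl

end Terms

/-! ### Relative boundedness of the interaction -/

/-- `‖S x‖ ≤ a ‖D_f x‖ + B ‖x‖` for some constant `B`. -/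
def RelBddBy (a : ℝ) (S : fdom →ₗ[ℂ] Fock) : Prop :=
  ∃ B : ℝ, 0 ≤ B ∧ ∀ x : fdom, ‖S x‖ ≤ a * ‖freeOp x‖ + B * ‖(x : Fock)‖

theorem RelBddBy.add {a b : ℝ} {S T : fdom →ₗ[ℂ] Fock} (hS : RelBddBy a S) (hT : RelBddBy b T) :
    RelBddBy (a + b) (S + T) := by
  obtain ⟨B, hB, h⟩ := hS
  obtain ⟨B', hB', h'⟩ := hT
  refine ⟨B + B', add_nonneg hB hB', fun x => ?_⟩
  refine (norm_add_le (S x) (T x)).trans ((add_le_add (h x) (h' x)).trans (le_of_eq ?_))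
  ring

theorem RelBddBy.smul {a : ℝ} {S : fdom →ₗ[ℂ] Fock} (hS : RelBddBy a S) (c : ℂ) :
    RelBddBy (‖c‖ * a) (c • S) := by
  obtain ⟨B, hB, h⟩ := hS
  refine ⟨‖c‖ * B, by positivity, fun x => ?_⟩
  rw [LinearMap.smul_apply, norm_smul]
  refine (mul_le_mul_of_nonneg_left (h x) (norm_nonneg c)).trans (le_of_eq ?_)
  ring

theorem RelBddBy.sum_three {a : ℝ} {S : Fin 3 → fdom →ₗ[ℂ] Fock} (hS : ∀ j, RelBddBy a (S j)) :
    RelBddBy (3 * a) (∑ j, S j) := by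
  rw [Fin.sum_univ_three, show 3 * a = a + a + a by ring]
  exact ((hS 0).add (hS 1)).add (hS 2)

theorem RelBddBy.of_eq {a b : ℝ} {S : fdom →ₗ[ℂ] Fock} (h : RelBddBy a S) (hab : a = b) :
    RelBddBy b S := hab ▸ h

theorem relative_bound_eq (e c : ℝ) :
    ‖((2 * e : ℝ) : ℂ)‖ * (3 * c + 3 * c) +
      ‖((e ^ 2 : ℝ) : ℂ)‖ * (3 * c + 3 * c + ‖(2 : ℂ)‖ * (3 * c)) =
      12 * (|e| + e ^ 2) * c := by
  have e1 : ‖((2 * e : ℝ) : ℂ)‖ = 2 * |e| := by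
    rw [Complex.norm_real, Real.norm_eq_abs, abs_mul, abs_two]
  have e2 : ‖((e ^ 2 : ℝ) : ℂ)‖ = e ^ 2 := by
    rw [Complex.norm_real, Real.norm_eq_abs, abs_pow, sq_abs]
  have e3 : ‖(2 : ℂ)‖ = 2 := Complex.norm_ofNat 2
  rw [e1, e2, e3]
  ring

theorem RelBddBy.combine {c : ℝ} {S₁ S₂ S₃ S₄ S₅ : fdom →ₗ[ℂ] Fock} (h₁ : RelBddBy (3 * c) S₁)
    (h₂ : RelBddBy (3 * c) S₂) (h₃ : RelBddBy (3 * c) S₃) (h₄ : RelBddBy (3 * c) S₄)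
    (h₅ : RelBddBy (3 * c) S₅) (a b : ℂ) :
    RelBddBy (‖a‖ * (3 * c + 3 * c) + ‖b‖ * (3 * c + 3 * c + ‖(2 : ℂ)‖ * (3 * c)))
      (a • (S₁ + S₂) + b • (S₃ + S₄ + (2 : ℂ) • S₅)) :=
  ((h₁.add h₂).smul a).add (((h₃.add h₄).add (h₅.smul (2 : ℂ))).smul b)

theorem domain_of_sum {E : Type*} [AddCommGroup E] [Module ℂ E] (D S₁ S₂ S₃ S₄ S₅ : E →ₗ.[ℂ] E)
    (a b : ℂ) (h₁ : D.domain ≤ S₁.domain) (h₂ : D.domain ≤ S₂.domain)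
    (h₃ : D.domain ≤ S₃.domain) (h₄ : D.domain ≤ S₄.domain) (h₅ : D.domain ≤ S₅.domain) :
    (D + a • (S₁ + S₂) + b • (S₃ + S₄ + (2 : ℂ) • S₅)).domain = D.domain :=
  le_antisymm (fun _ h => h.1.1) fun _ h => ⟨⟨h, h₁ h, h₂ h⟩, ⟨h₃ h, h₄ h⟩, h₅ h⟩

theorem apply_of_sum {E : Type*} [AddCommGroup E] [Module ℂ E] (D S₁ S₂ S₃ S₄ S₅ : E →ₗ.[ℂ] E)
    (a b : ℂ) (x : (D + a • (S₁ + S₂) + b • (S₃ + S₄ + (2 : ℂ) • S₅)).domain)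
    (h : (x : E) ∈ D.domain) (h₁ : (x : E) ∈ S₁.domain) (h₂ : (x : E) ∈ S₂.domain)
    (h₃ : (x : E) ∈ S₃.domain) (h₄ : (x : E) ∈ S₄.domain) (h₅ : (x : E) ∈ S₅.domain) :
    (D + a • (S₁ + S₂) + b • (S₃ + S₄ + (2 : ℂ) • S₅)) x = D ⟨x, h⟩ +
      (a • (S₁ ⟨x, h₁⟩ + S₂ ⟨x, h₂⟩) + b • (S₃ ⟨x, h₃⟩ + S₄ ⟨x, h₄⟩ + (2 : ℂ) • S₅ ⟨x, h₅⟩)) :=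
  add_assoc (D ⟨x, h⟩) _ _

section

variable {C : ℝ≥0} {Λ : ℝ} (hf : ∀ j, IsFormFactor C (formFactor Λ j))
include hf

theorem fdom_le_opAsP : fdom ≤ (opAsP Λ).domain :=
  le_dot_domain fun j => fdom_le_creation_fieldMomentum (hf j) j

theorem fdom_le_opPA : fdom ≤ (opPA Λ).domain :=
  le_dot_domain fun j => fdom_le_fieldMomentum_annihilation (hf j) j

theorem fdom_le_opAsAs : fdom ≤ (opAsAs Λ).domain :=
  le_dot_domain fun j => fdom_le_creation_creation (hf j)

theorem fdom_le_opAA : fdom ≤ (opAA Λ).domain :=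
  le_dot_domain fun j => fdom_le_annihilation_annihilation (hf j)

theorem fdom_le_opAsA : fdom ≤ (opAsA Λ).domain :=
  le_dot_domain fun j => fdom_le_creation_annihilation (hf j)

theorem relBddBy_opAsP : RelBddBy (3 * (C + 1)) (resMap _ (fdom_le_opAsP hf)) := by
  have h := RelBddBy.sum_three fun j => relBdd_creation_fieldMomentum (hf j) j
  convert h using 1
  ext1 x
  rw [LinearMap.sum_apply]
  exact resMap_dot (fun j => fdom_le_creation_fieldMomentum (hf j) j) x

theorem relBddBy_opPA : RelBddBy (3 * (C + 1)) (resMap _ (fdom_le_opPA hf)) := by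
  have h := RelBddBy.sum_three fun j => relBdd_fieldMomentum_annihilation (hf j) j
  convert h using 1
  ext1 x
  rw [LinearMap.sum_apply]
  exact resMap_dot (fun j => fdom_le_fieldMomentum_annihilation (hf j) j) x

theorem relBddBy_opAsAs : RelBddBy (3 * (C + 1)) (resMap _ (fdom_le_opAsAs hf)) := by
  have h := RelBddBy.sum_three fun j => relBdd_creation_creation (hf j)
  convert h using 1
  ext1 x
  rw [LinearMap.sum_apply]
  exact resMap_dot (fun j => fdom_le_creation_creation (hf j)) x

theorem relBddBy_opAA : RelBddBy (3 * (C + 1)) (resMap _ (fdom_le_opAA hf)) := by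
  have h := RelBddBy.sum_three fun j => relBdd_annihilation_annihilation (hf j)
  convert h using 1
  ext1 x
  rw [LinearMap.sum_apply]
  exact resMap_dot (fun j => fdom_le_annihilation_annihilation (hf j)) x

theorem relBddBy_opAsA : RelBddBy (3 * (C + 1)) (resMap _ (fdom_le_opAsA hf)) := by
  have h := RelBddBy.sum_three fun j => relBdd_creation_annihilation (hf j)
  convert h using 1
  ext1 x
  rw [LinearMap.sum_apply]
  exact resMap_dot (fun j => fdom_le_creation_annihilation (hf j)) x

/-- The interaction `T_Λ - D_f` on the domain of `D_f`. -/
def interaction (e : ℝ) : fdom →ₗ[ℂ] Fock :=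
  ((2 * e : ℝ) : ℂ) • (resMap _ (fdom_le_opAsP hf) + resMap _ (fdom_le_opPA hf)) +
    ((e ^ 2 : ℝ) : ℂ) • (resMap _ (fdom_le_opAsAs hf) + resMap _ (fdom_le_opAA hf) +
      (2 : ℂ) • resMap _ (fdom_le_opAsA hf))

theorem relBddBy_interaction (e : ℝ) :
    RelBddBy (12 * (|e| + e ^ 2) * (C + 1)) (interaction hf e) :=
  (RelBddBy.combine (relBddBy_opAsP hf) (relBddBy_opPA hf) (relBddBy_opAsAs hf)
    (relBddBy_opAA hf) (relBddBy_opAsA hf) _ _).of_eq (relative_bound_eq e _)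

theorem domain_nelsonT (e : ℝ) : (nelsonT Λ e).domain = fdom :=
  domain_of_sum _ _ _ _ _ _ _ _ (fdom_le_opAsP hf) (fdom_le_opPA hf) (fdom_le_opAsAs hf)
    (fdom_le_opAA hf) (fdom_le_opAsA hf)

theorem nelsonT_apply {e : ℝ} (x : (nelsonT Λ e).domain) (h : (x : Fock) ∈ fdom) :
    nelsonT Λ e x = freeOp ⟨x, h⟩ + interaction hf e ⟨x, h⟩ := by
  exact apply_of_sum _ _ _ _ _ _ _ _ x h (fdom_le_opAsP hf h) (fdom_le_opPA hf h)
    (fdom_le_opAsAs hf h) (fdom_le_opAA hf h) (fdom_le_opAsA hf h)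

end

/-! ### Resolvent of `D_f` -/

theorem exists_freeOp_add_smul {l : ℝ} (hl : 0 < l) (η : Fock) :
    ∃ x : fdom, freeOp x + (l : ℂ) • (x : Fock) = η := by
  have hpos : ∀ n k, 0 < freeSymbol n k + l := fun n k =>
    add_pos_of_nonneg_of_pos (freeSymbol_nonneg n k) hl
  set g : Wave := fun n k => (((freeSymbol n k + l)⁻¹ : ℝ) : ℂ) * rep η n k with hg
  have hgB : IsBose g :=
    { meas := fun n => (Complex.measurable_ofReal.comp
        ((measurable_freeSymbol n).add_const l).inv).mul ((isBose_rep η).meas n)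
      symm := fun n σ k => by
        simp only [hg]
        rw [freeSymbol_perm, (isBose_rep η).symm] }
  have hle : ∀ n k, ‖g n k‖ₑ ^ 2 ≤ ENNReal.ofReal (l⁻¹ ^ 2) * ‖rep η n k‖ₑ ^ 2 := fun n k => by
    simp only [hg]
    rw [enorm_ofReal_mul_sq, ← ofReal_norm, ← ENNReal.ofReal_pow (norm_nonneg _),
      Real.norm_eq_abs, abs_of_pos (inv_pos.2 (hpos n k))]
    gcongr
    · exact (inv_pos.2 (hpos n k)).le
    · exact le_add_of_nonneg_left (freeSymbol_nonneg n k)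
  have hle2 : ∀ n k, freeW n k ^ 2 * ‖g n k‖ₑ ^ 2 ≤ 1 * ‖rep η n k‖ₑ ^ 2 := fun n k => by
    simp only [hg]
    rw [enorm_ofReal_mul_sq, ← ofReal_norm (freeSymbol n k + l)⁻¹,
      ← ENNReal.ofReal_pow (norm_nonneg _), ← mul_assoc]
    gcongr
    unfold freeW
    rw [← ENNReal.ofReal_pow (freeSymbol_nonneg n k),
      ← ENNReal.ofReal_mul (by positivity), ENNReal.ofReal_le_one, Real.norm_eq_abs,
      abs_of_pos (inv_pos.2 (hpos n k)), ← mul_pow]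
    refine pow_le_one₀ (mul_nonneg (freeSymbol_nonneg n k) (inv_pos.2 (hpos n k)).le) ?_
    rw [← div_eq_mul_inv, div_le_one (hpos n k)]
    linarith
  have h1 : en one' g < ⊤ := by
    refine lt_of_le_of_lt (en_mono (m' := fun _ _ => ENNReal.ofReal (l⁻¹ ^ 2)) (g' := rep η)
      fun n => Filter.Eventually.of_forall fun k => ?_) ?_
    · rw [one', one_mul]
      exact hle n k
    · have := en_const_mul (ENNReal.ofReal (l⁻¹ ^ 2)) ENNReal.ofReal_ne_top one' (rep η)
      simp only [one', mul_one] at this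
      rw [this, en_rep]
      exact ENNReal.mul_lt_top ENNReal.ofReal_lt_top (en_wave_lt_top η)
  have hx : ofWave g hgB h1 ∈ fdom := by
    rw [mem_fdom, en_congr (wave_ofWave hgB h1)]
    refine lt_of_le_of_lt (en_mono (m' := one') (g' := rep η)
      fun n => Filter.Eventually.of_forall fun k => hle2 n k) ?_
    rw [en_rep]
    exact en_wave_lt_top η
  refine ⟨⟨_, hx⟩, wave_ext fun n => ?_⟩
  filter_upwards [wave_add (freeOp ⟨_, hx⟩) ((l : ℂ) • ofWave g hgB h1) n,
    wave_smul (l : ℂ) (ofWave g hgB h1) n, wave_mulOp (m := freeSymbol) ⟨_, hx⟩ n,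
    wave_ofWave hgB h1 n, rep_ae η n] with k e1 e2 e3 e4 e5
  rw [e1, e2]
  refine (congrArg (· + _) e3).trans ?_
  rw [e4, ← e5, ← add_mul]
  simp only [hg]
  rw [← mul_assoc, ← Complex.ofReal_add, ← Complex.ofReal_mul, mul_inv_cancel₀ (hpos n k).ne',
    Complex.ofReal_one, one_mul]

/-- The quadratic form of `D_f` is nonnegative. -/
theorem re_inner_freeOp_nonneg (x : fdom) : 0 ≤ (inner ℂ (x : Fock) (freeOp x)).re := by
  have h := hasSum_inner_wave (x : Fock) (freeOp x)
  have h' := Complex.hasSum_re h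
  refine h'.nonneg fun n => ?_
  have e : ∀ᵐ k, (starRingEnd ℂ) (wave x n k) * wave (freeOp x) n k =
      ((freeSymbol n k * ‖wave x n k‖ ^ 2 : ℝ) : ℂ) := by
    have e3 : ∀ᵐ k, wave (freeOp x) n k = (freeSymbol n k : ℂ) * wave x n k := wave_mulOp x n
    filter_upwards [e3] with k e3
    rw [e3, mul_left_comm, Complex.conj_mul']
    push_cast
    rfl
  rw [integral_congr_ae e, integral_complex_ofReal, Complex.ofReal_re]
  exact integral_nonneg fun k => mul_nonneg (freeSymbol_nonneg n k) (by positivity)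

theorem norm_freeOp_add_smul_sq {l : ℝ} (hl : 0 < l) (x : fdom) :
    ‖freeOp x‖ ^ 2 + l ^ 2 * ‖(x : Fock)‖ ^ 2 ≤ ‖freeOp x + (l : ℂ) • (x : Fock)‖ ^ 2 := by
  rw [norm_add_sq (𝕜 := ℂ), inner_smul_right, norm_smul, Complex.norm_real, Real.norm_eq_abs,
    abs_of_pos hl, mul_pow]
  have h : 0 ≤ (inner ℂ (freeOp x) (x : Fock)).re := by
    rw [← inner_conj_symm, Complex.conj_re]
    exact re_inner_freeOp_nonneg x
  have : RCLike.re ((l : ℂ) * inner ℂ (freeOp x) (x : Fock)) =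
      l * (inner ℂ (freeOp x) (x : Fock)).re := Complex.re_ofReal_mul _ _
  rw [this]
  nlinarith [mul_nonneg hl.le h]

theorem dense_fdom : Dense (fdom : Set Fock) := by
  rw [Submodule.dense_iff_topologicalClosure_eq_top, Submodule.topologicalClosure_eq_top_iff,
    Submodule.eq_bot_iff]
  intro η hη
  obtain ⟨x, hx⟩ := exists_freeOp_add_smul one_pos η
  have h := Submodule.inner_right_of_mem_orthogonal x.2 hη
  rw [← hx, inner_add_right, inner_smul_right] at h
  have h2 := congrArg Complex.re h
  have h3 := re_inner_freeOp_nonneg x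
  rw [Complex.add_re, inner_self_eq_norm_sq_to_K] at h2
  norm_cast at h2
  simp only [one_mul, Complex.coe_algebraMap, Complex.ofReal_re] at h2
  have h4 : ‖(x : Fock)‖ = 0 := by
    have h7 : (inner ℂ (x : Fock) (freeOp x)).re + ‖(x : Fock)‖ ^ 2 = 0 := h2
    have h6 : ‖(x : Fock)‖ ^ 2 = 0 := le_antisymm (by linarith) (sq_nonneg _)
    exact pow_eq_zero_iff two_ne_zero |>.1 h6
  have h5 : x = 0 := Subtype.ext (norm_eq_zero.1 h4)
  rw [← hx, h5]
  have : freeOp (0 : fdom) = 0 := freeOp.map_zero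
  rw [this]
  simp

/-! ### Perturbation theory for quadratic forms -/

section Abstract

variable {E : Type*} [NormedAddCommGroup E] [InnerProductSpace ℂ E]

/-- The sesquilinear form `(x, y) ↦ (S x, T y)`. -/
def sesq {V : Submodule ℂ E} (S T : V →ₗ[ℂ] E) : V →ₗ⋆[ℂ] V →ₗ[ℂ] ℂ :=
  LinearMap.mk₂'ₛₗ (starRingEnd ℂ) (RingHom.id ℂ) (fun x y => inner ℂ (S x) (T y))
    (fun x x' y => by rw [map_add, inner_add_left])
    (fun c x y => by rw [map_smul, inner_smul_left]; rfl)
    (fun x y y' => by rw [map_add, inner_add_right])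
    (fun c x y => by rw [map_smul, inner_smul_right]; rfl)

theorem sesq_apply {V : Submodule ℂ E} (S T : V →ₗ[ℂ] E) (x y : V) :
    sesq S T x y = inner ℂ (S x) (T y) := rfl

theorem conj_sesq {V : Submodule ℂ E} (S T : V →ₗ[ℂ] E) (x y : V) :
    (starRingEnd ℂ) (sesq S T x y) = sesq T S y x := inner_conj_symm _ _

/-- The data of a form `∑ ‖𝒫ψ‖² + ‖Hψ‖² + 2e·2 Re (Aψ, 𝒫ψ) + e² (2 Re (ψ, Bψ) + 2 ‖Aψ‖²)` on the
form domain `V`; here `H` stands for `H_f^{1/2}` and `B j` for `A j A j`. -/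
structure QForm (E : Type*) [NormedAddCommGroup E] [InnerProductSpace ℂ E] where
  V : Submodule ℂ E
  P : Fin 3 → V →ₗ[ℂ] E
  A : Fin 3 → V →ₗ[ℂ] E
  B : Fin 3 → V →ₗ[ℂ] E
  H : V →ₗ[ℂ] E

namespace QForm

variable (q : QForm E)

/-- The form of `D_f = 𝒫² + H_f`. -/
def free : q.V →ₗ⋆[ℂ] q.V →ₗ[ℂ] ℂ := (∑ j, sesq (q.P j) (q.P j)) + sesq q.H q.H

/-- The form of `A*·𝒫 + 𝒫·A`. -/
def mixed : q.V →ₗ⋆[ℂ] q.V →ₗ[ℂ] ℂ := ∑ j, (sesq (q.A j) (q.P j) + sesq (q.P j) (q.A j))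

/-- The form of `A*·A* + A·A`. -/
def pair : q.V →ₗ⋆[ℂ] q.V →ₗ[ℂ] ℂ :=
  ∑ j, (sesq (q.B j) q.V.subtype + sesq q.V.subtype (q.B j))

/-- The form of `A*·A`. -/
def number : q.V →ₗ⋆[ℂ] q.V →ₗ[ℂ] ℂ := ∑ j, sesq (q.A j) (q.A j)

/-- The form of the Nelson operator. -/
def form (e : ℝ) : q.V →ₗ⋆[ℂ] q.V →ₗ[ℂ] ℂ :=
  q.free + ((2 * e : ℝ) : ℂ) • q.mixed + ((e ^ 2 : ℝ) : ℂ) • (q.pair + (2 : ℂ) • q.number)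

/-- The quadratic form of `D_f`. -/
def kin (x : q.V) : ℝ := (∑ j, ‖q.P j x‖ ^ 2) + ‖q.H x‖ ^ 2

theorem kin_nonneg (x : q.V) : 0 ≤ q.kin x := by unfold kin; positivity

theorem free_self (x : q.V) : q.free x x = (q.kin x : ℂ) := by
  simp only [free, kin, LinearMap.add_apply, LinearMap.sum_apply, sesq_apply,
    inner_self_eq_norm_sq_to_K]
  push_cast
  rfl

theorem sq_P_le (j : Fin 3) (x : q.V) : ‖q.P j x‖ ^ 2 ≤ q.kin x := by
  unfold kin
  have := Finset.single_le_sum (f := fun j => ‖q.P j x‖ ^ 2) (fun i _ => sq_nonneg _)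
    (Finset.mem_univ j)
  nlinarith [sq_nonneg ‖q.H x‖]

theorem sq_H_le (x : q.V) : ‖q.H x‖ ^ 2 ≤ q.kin x := by
  unfold kin
  exact le_add_of_nonneg_left (Finset.sum_nonneg fun i _ => sq_nonneg _)

theorem P_le (j : Fin 3) (x : q.V) : ‖q.P j x‖ ≤ Real.sqrt (q.kin x) :=
  Real.le_sqrt_of_sq_le (q.sq_P_le j x)

theorem H_le (x : q.V) : ‖q.H x‖ ≤ Real.sqrt (q.kin x) := Real.le_sqrt_of_sq_le (q.sq_H_le x)

theorem conj_free (x y : q.V) : (starRingEnd ℂ) (q.free x y) = q.free y x := by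
  simp only [free, LinearMap.add_apply, LinearMap.sum_apply, map_add, map_sum, conj_sesq]

theorem conj_mixed (x y : q.V) : (starRingEnd ℂ) (q.mixed x y) = q.mixed y x := by
  simp only [mixed, LinearMap.add_apply, LinearMap.sum_apply, map_add, map_sum, conj_sesq]
  exact Finset.sum_congr rfl fun j _ => add_comm _ _

theorem conj_pair (x y : q.V) : (starRingEnd ℂ) (q.pair x y) = q.pair y x := by
  simp only [pair, LinearMap.add_apply, LinearMap.sum_apply, map_add, map_sum, conj_sesq]
  exact Finset.sum_congr rfl fun j _ => add_comm _ _

theorem conj_number (x y : q.V) : (starRingEnd ℂ) (q.number x y) = q.number y x := by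
  simp only [number, LinearMap.sum_apply, map_sum, conj_sesq]

theorem form_apply (e : ℝ) (x y : q.V) : q.form e x y = q.free x y +
    ((2 * e : ℝ) : ℂ) * q.mixed x y + ((e ^ 2 : ℝ) : ℂ) * (q.pair x y + 2 * q.number x y) := rfl

theorem conj_form (e : ℝ) (x y : q.V) : (starRingEnd ℂ) (q.form e x y) = q.form e y x := by
  simp only [form_apply, map_add, map_mul, Complex.conj_ofReal, conj_free, conj_mixed, conj_pair,
    conj_number, Complex.conj_ofNat]

/-- The bounds on the annihilation operators in terms of `H`, with constant `C`. -/
structure IsBounded (C : ℝ) : Prop where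
  nonneg : 0 ≤ C
  A_le : ∀ j x, ‖q.A j x‖ ^ 2 ≤ C * ‖q.H x‖ ^ 2
  B_le : ∀ j (x y : q.V), ‖inner ℂ (y : E) (q.B j x)‖ ≤ C * ‖q.H x‖ * (‖(y : E)‖ + ‖q.H y‖)

variable {q} {C : ℝ}

theorem IsBounded.A_le_sqrt (hq : q.IsBounded C) (j : Fin 3) (x : q.V) :
    ‖q.A j x‖ ≤ Real.sqrt C * Real.sqrt (q.kin x) := by
  rw [← Real.sqrt_mul hq.nonneg]
  refine Real.le_sqrt_of_sq_le ((hq.A_le j x).trans ?_)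
  exact mul_le_mul_of_nonneg_left (q.sq_H_le x) hq.nonneg

theorem re_form_self (e : ℝ) (x : q.V) : (q.form e x x).re = q.kin x +
    4 * e * ∑ j, (inner ℂ (q.A j x) (q.P j x)).re +
    e ^ 2 * (2 * (∑ j, (inner ℂ (x : E) (q.B j x)).re) + 2 * ∑ j, ‖q.A j x‖ ^ 2) := by
  have h1 : (q.mixed x x).re = 2 * ∑ j, (inner ℂ (q.A j x) (q.P j x)).re := by
    simp only [mixed, LinearMap.add_apply, LinearMap.sum_apply, sesq_apply, Complex.re_sum,
      Complex.add_re, Finset.mul_sum]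
    refine Finset.sum_congr rfl fun j _ => ?_
    rw [← inner_conj_symm (q.P j x), Complex.conj_re]
    ring
  have h2 : (q.pair x x).re = 2 * ∑ j, (inner ℂ (x : E) (q.B j x)).re := by
    simp only [pair, LinearMap.add_apply, LinearMap.sum_apply, sesq_apply, Complex.re_sum,
      Complex.add_re, Finset.mul_sum, Submodule.subtype_apply]
    refine Finset.sum_congr rfl fun j _ => ?_
    rw [← inner_conj_symm (q.B j x), Complex.conj_re]
    ring
  have h3 : (q.number x x).re = ∑ j, ‖q.A j x‖ ^ 2 := by
    simp only [number, LinearMap.sum_apply, sesq_apply, Complex.re_sum]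
    refine Finset.sum_congr rfl fun j _ => ?_
    exact inner_self_eq_norm_sq (𝕜 := ℂ) _
  rw [form_apply, Complex.add_re, Complex.add_re, Complex.re_ofReal_mul, Complex.re_ofReal_mul,
    Complex.add_re, h1, h2, free_self, Complex.ofReal_re]
  have h4 : (2 * q.number x x).re = 2 * (q.number x x).re := by
    simp [Complex.mul_re]
  rw [h4, h3]
  ring

/-- The a priori bound. Half of `D_f` absorbs the interaction after completing squares. The
operators `P j` are arbitrary, so that it applies to all total momenta. -/
theorem IsBounded.apriori (hq : q.IsBounded C) {e : ℝ} (he : 120 * C * e ^ 2 ≤ 1) (x : q.V) :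
    1 / 2 * q.kin x - 36 * C ^ 2 * e ^ 4 * ‖(x : E)‖ ^ 2 ≤ (q.form e x x).re := by
  have hC := hq.nonneg
  have h1 : ∀ j, -(1 / 2 * ‖q.P j x‖ ^ 2 + 8 * e ^ 2 * (C * ‖q.H x‖ ^ 2)) ≤
      4 * e * (inner ℂ (q.A j x) (q.P j x)).re := fun j => by
    have h2 := hq.A_le j x
    have h3 : |(inner ℂ (q.A j x) (q.P j x)).re| ≤ ‖q.A j x‖ * ‖q.P j x‖ :=
      (Complex.abs_re_le_norm _).trans (norm_inner_le_norm _ _)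
    have h4 : |4 * e * (inner ℂ (q.A j x) (q.P j x)).re| ≤
        4 * |e| * (‖q.A j x‖ * ‖q.P j x‖) := by
      rw [abs_mul, abs_mul, abs_of_pos (by norm_num : (0 : ℝ) < 4)]
      gcongr
    have h5 : 4 * |e| * (‖q.A j x‖ * ‖q.P j x‖) ≤
        1 / 2 * ‖q.P j x‖ ^ 2 + 8 * e ^ 2 * ‖q.A j x‖ ^ 2 := by
      nlinarith [sq_nonneg (‖q.P j x‖ - 4 * (|e| * ‖q.A j x‖)), sq_abs e]
    have h6 : 8 * e ^ 2 * ‖q.A j x‖ ^ 2 ≤ 8 * e ^ 2 * (C * ‖q.H x‖ ^ 2) :=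
      mul_le_mul_of_nonneg_left h2 (by positivity)
    linarith [neg_le_of_abs_le h4]
  have h2 : ∀ j, -(2 * e ^ 2 * C * ‖q.H x‖ ^ 2 + 1 / 12 * ‖q.H x‖ ^ 2 +
      12 * C ^ 2 * e ^ 4 * ‖(x : E)‖ ^ 2) ≤ 2 * e ^ 2 * (inner ℂ (x : E) (q.B j x)).re := fun j => by
    have h3 := (Complex.abs_re_le_norm _).trans (hq.B_le j x x)
    have h4 := neg_le_of_abs_le h3
    have h5 : 2 * e ^ 2 * C * (‖q.H x‖ * ‖(x : E)‖) ≤ 1 / 12 * ‖q.H x‖ ^ 2 +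
        12 * C ^ 2 * e ^ 4 * ‖(x : E)‖ ^ 2 := by
      nlinarith [sq_nonneg (‖q.H x‖ - 12 * (C * e ^ 2 * ‖(x : E)‖))]
    nlinarith [mul_le_mul_of_nonneg_left h4 (by positivity : 0 ≤ 2 * e ^ 2)]
  rw [re_form_self]
  have h3 : 0 ≤ e ^ 2 * (2 * ∑ j, ‖q.A j x‖ ^ 2) := by positivity
  have h4 : 30 * e ^ 2 * C * ‖q.H x‖ ^ 2 ≤ 1 / 4 * ‖q.H x‖ ^ 2 :=
    mul_le_mul_of_nonneg_right (by linarith) (sq_nonneg _)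
  simp only [Fin.sum_univ_three, kin] at *
  have a0 := h1 0
  have a1 := h1 1
  have a2 := h1 2
  have b0 := h2 0
  have b1 := h2 1
  have b2 := h2 2
  linarith

/-- The data of second order perturbation theory: `w` and `v` stand for `D_f⁻¹ A*A* Ω` and `D_f⁻¹
(𝒫A + A*𝒫) w`, with the equations `free_w` and `free_v` in the sense of forms. The fields `B_w` and
`B_v` hold because `A·A w` is a multiple of `Ω` and `A·A v` is a one boson function. -/
structure Trial (q : QForm E) (K : ℝ) where
  Ω : q.V
  w : q.V
  v : q.V
  norm_Ω : ‖(Ω : E)‖ = 1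
  P_Ω : ∀ j, q.P j Ω = 0
  A_Ω : ∀ j, q.A j Ω = 0
  B_Ω : ∀ j, q.B j Ω = 0
  H_Ω : q.H Ω = 0
  free_w : ∀ x, q.free w x = ∑ j, inner ℂ (Ω : E) (q.B j x)
  free_v : ∀ x, q.free v x = q.mixed w x
  free_v_w : q.free v w = 0
  norm_w : ‖(w : E)‖ ≤ K
  norm_v : ‖(v : E)‖ ≤ K
  inner_Ω_w : inner ℂ (Ω : E) (w : E) = 0
  inner_Ω_v : inner ℂ (Ω : E) (v : E) = 0
  B_w : ∀ j (r : q.V), inner ℂ (Ω : E) (r : E) = 0 → inner ℂ (q.B j w) (r : E) = 0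
  B_v : ∀ j (r : q.V), ‖inner ℂ (q.B j v) (r : E)‖ ≤ K * ‖q.H r‖

variable {K : ℝ} (T : Trial q K)

/-- The correction to the vacuum in the trial vector. -/
def Trial.u (e : ℝ) : q.V := ((-e ^ 2 : ℝ) : ℂ) • T.w + ((2 * e ^ 3 : ℝ) : ℂ) • T.v

/-- The first terms of the perturbation series of the energy. -/
def Trial.series (e : ℝ) : ℝ :=
  -e ^ 4 * q.kin T.w - 4 * e ^ 6 * q.kin T.v + 2 * e ^ 6 * ∑ j, ‖q.A j T.w‖ ^ 2

theorem Trial.form_Ω (e : ℝ) (x : q.V) :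
    q.form e T.Ω x = ((e ^ 2 : ℝ) : ℂ) * q.free T.w x := by
  have h1 : q.free T.Ω x = 0 := by
    simp [free, LinearMap.sum_apply, sesq_apply, T.P_Ω, T.H_Ω]
  have h2 : q.mixed T.Ω x = 0 := by
    simp [mixed, LinearMap.sum_apply, sesq_apply, T.P_Ω, T.A_Ω]
  have h3 : q.number T.Ω x = 0 := by
    simp [number, LinearMap.sum_apply, sesq_apply, T.A_Ω]
  have h4 : q.pair T.Ω x = q.free T.w x := by
    simp [pair, LinearMap.sum_apply, sesq_apply, T.B_Ω, T.free_w]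
  rw [form_apply, h1, h2, h3, h4]
  ring

/-- The residual of the trial vector is of order `e⁴`. -/
theorem Trial.form_trial (e : ℝ) (x : q.V) : q.form e (T.Ω + T.u e) x =
    ((4 * e ^ 4 : ℝ) : ℂ) * q.mixed T.v x +
      ((e ^ 2 : ℝ) : ℂ) * (q.pair (T.u e) x + 2 * q.number (T.u e) x) := by
  rw [map_add, LinearMap.add_apply, T.form_Ω, form_apply]
  have h1 : q.free (T.u e) x =
      ((-e ^ 2 : ℝ) : ℂ) * q.free T.w x + ((2 * e ^ 3 : ℝ) : ℂ) * q.free T.v x := by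
    simp only [u, map_add, LinearMap.map_smulₛₗ, LinearMap.add_apply, LinearMap.smul_apply,
      smul_eq_mul, Complex.conj_ofReal]
  have h2 : q.mixed (T.u e) x =
      ((-e ^ 2 : ℝ) : ℂ) * q.mixed T.w x + ((2 * e ^ 3 : ℝ) : ℂ) * q.mixed T.v x := by
    simp only [u, map_add, LinearMap.map_smulₛₗ, LinearMap.add_apply, LinearMap.smul_apply,
      smul_eq_mul, Complex.conj_ofReal]
  rw [h1, h2, T.free_v]
  push_cast
  ring

end QForm

end Abstract

/-! ### The trial vector of perturbation theory -/

section Abstract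

variable {E : Type*} [NormedAddCommGroup E] [InnerProductSpace ℂ E]

namespace QForm

variable {q : QForm E} {C K : ℝ}

/-- `M` bounds all the constants of a trial vector. -/
structure Trial.IsBdd (T : Trial q K) (C M : ℝ) : Prop where
  one_le : 1 ≤ M
  sqrt_C : Real.sqrt C ≤ M
  C_le : C ≤ M
  K_le : K ≤ M
  kin_w : Real.sqrt (q.kin T.w) ≤ M
  kin_v : Real.sqrt (q.kin T.v) ≤ M

theorem IsBounded.norm_mixed_le (hq : q.IsBounded C) (x y : q.V) :
    ‖q.mixed x y‖ ≤ 6 * (Real.sqrt C * Real.sqrt (q.kin x) * Real.sqrt (q.kin y)) := by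
  have h : ∀ j, ‖inner ℂ (q.A j x) (q.P j y) + inner ℂ (q.P j x) (q.A j y)‖ ≤
      2 * (Real.sqrt C * Real.sqrt (q.kin x) * Real.sqrt (q.kin y)) := fun j => by
    refine (norm_add_le _ _).trans ?_
    have h1 : ‖inner ℂ (q.A j x) (q.P j y)‖ ≤
        (Real.sqrt C * Real.sqrt (q.kin x)) * Real.sqrt (q.kin y) :=
      (norm_inner_le_norm _ _).trans (mul_le_mul (hq.A_le_sqrt j x) (q.P_le j y) (norm_nonneg _)
        (by positivity))
    have h2 : ‖inner ℂ (q.P j x) (q.A j y)‖ ≤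
        Real.sqrt (q.kin x) * (Real.sqrt C * Real.sqrt (q.kin y)) :=
      (norm_inner_le_norm _ _).trans (mul_le_mul (q.P_le j x) (hq.A_le_sqrt j y) (norm_nonneg _)
        (by positivity))
    linarith
  have h2 : q.mixed x y =
      ∑ j, (inner ℂ (q.A j x) (q.P j y) + inner ℂ (q.P j x) (q.A j y)) := by
    simp only [mixed, LinearMap.sum_apply, LinearMap.add_apply, sesq_apply]
  rw [h2]
  refine (norm_sum_le _ _).trans ((Finset.sum_le_sum fun j _ => h j).trans (le_of_eq ?_))
  simp only [Fin.sum_univ_three]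
  ring

theorem IsBounded.norm_number_le (hq : q.IsBounded C) (x y : q.V) :
    ‖q.number x y‖ ≤ 3 * (Real.sqrt C * Real.sqrt (q.kin x) *
      (Real.sqrt C * Real.sqrt (q.kin y))) := by
  have h : ∀ j, ‖inner ℂ (q.A j x) (q.A j y)‖ ≤
      Real.sqrt C * Real.sqrt (q.kin x) * (Real.sqrt C * Real.sqrt (q.kin y)) := fun j =>
    (norm_inner_le_norm _ _).trans (mul_le_mul (hq.A_le_sqrt j x) (hq.A_le_sqrt j y)
      (norm_nonneg _) (by positivity))
  have h2 : q.number x y = ∑ j, inner ℂ (q.A j x) (q.A j y) := by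
    simp only [number, LinearMap.sum_apply, sesq_apply]
  rw [h2]
  refine (norm_sum_le _ _).trans ((Finset.sum_le_sum fun j _ => h j).trans (le_of_eq ?_))
  simp only [Fin.sum_univ_three]
  ring

theorem IsBounded.trial_isBdd (hq : q.IsBounded C) (T : Trial q K) :
    T.IsBdd C (18 * (1 + C) ^ 2 + |K|) := by
  have hC := hq.nonneg
  have hK := abs_nonneg K
  have hsq : Real.sqrt C ≤ 1 + C := by
    rw [Real.sqrt_le_left (by positivity)]
    nlinarith
  have hw : Real.sqrt (q.kin T.w) ≤ 3 * C := by
    have h1 : q.kin T.w ≤ 3 * C * Real.sqrt (q.kin T.w) := by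
      have h2 : ‖q.free T.w T.w‖ ≤ 3 * C * Real.sqrt (q.kin T.w) := by
        rw [T.free_w]
        refine (norm_sum_le _ _).trans ?_
        have h3 : ∀ j, ‖inner ℂ (T.Ω : E) (q.B j T.w)‖ ≤ C * Real.sqrt (q.kin T.w) := fun j => by
          refine (hq.B_le j T.w T.Ω).trans ?_
          rw [T.norm_Ω, T.H_Ω, norm_zero, add_zero, mul_one]
          exact mul_le_mul_of_nonneg_left (q.H_le _) hC
        refine (Finset.sum_le_sum fun j _ => h3 j).trans (le_of_eq ?_)
        simp only [Fin.sum_univ_three]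
        ring
      rwa [free_self, Complex.norm_real, Real.norm_eq_abs, abs_of_nonneg (q.kin_nonneg _)] at h2
    by_contra hcon
    push Not at hcon
    nlinarith [Real.sq_sqrt (q.kin_nonneg T.w)]
  have hv : Real.sqrt (q.kin T.v) ≤ 6 * (Real.sqrt C * Real.sqrt (q.kin T.w)) := by
    have h1 : q.kin T.v ≤ 6 * (Real.sqrt C * Real.sqrt (q.kin T.w)) * Real.sqrt (q.kin T.v) := by
      have h2 := hq.norm_mixed_le T.w T.v
      rw [← T.free_v, free_self, Complex.norm_real, Real.norm_eq_abs,
        abs_of_nonneg (q.kin_nonneg _)] at h2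
      linarith
    by_contra hcon
    push Not at hcon
    have h0 : 0 ≤ 6 * (Real.sqrt C * Real.sqrt (q.kin T.w)) := by positivity
    nlinarith [Real.sq_sqrt (q.kin_nonneg T.v)]
  have hv2 : Real.sqrt C * Real.sqrt (q.kin T.w) ≤ (1 + C) * (3 * C) :=
    mul_le_mul hsq hw (Real.sqrt_nonneg _) (by positivity)
  refine ⟨?_, ?_, ?_, ?_, ?_, ?_⟩ <;> nlinarith [le_abs_self K]

section Estimates

variable {T : Trial q K} {M : ℝ} {e : ℝ}

theorem Trial.inner_Ω_u (T : Trial q K) (e : ℝ) : inner ℂ (T.Ω : E) (T.u e : E) = 0 := by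
  simp only [u, Submodule.coe_add, Submodule.coe_smul, inner_add_right, inner_smul_right,
    T.inner_Ω_w, T.inner_Ω_v, mul_zero, add_zero]

theorem norm_comb_le {F : Type*} [NormedAddCommGroup F] [NormedSpace ℂ F] {a b : F} {e M : ℝ}
    (he : |e| ≤ 1) (ha : ‖a‖ ≤ M) (hb : ‖b‖ ≤ M) :
    ‖((-e ^ 2 : ℝ) : ℂ) • a + ((2 * e ^ 3 : ℝ) : ℂ) • b‖ ≤ 3 * M * e ^ 2 := by
  refine (norm_add_le _ _).trans ?_
  have hM : 0 ≤ M := (norm_nonneg _).trans ha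
  have h1 : ‖((-e ^ 2 : ℝ) : ℂ)‖ = e ^ 2 := by
    rw [Complex.norm_real, Real.norm_eq_abs, abs_neg, abs_of_nonneg (sq_nonneg e)]
  have h2 : ‖((2 * e ^ 3 : ℝ) : ℂ)‖ ≤ 2 * e ^ 2 := by
    rw [Complex.norm_real, Real.norm_eq_abs, abs_mul, abs_two, abs_pow, ← sq_abs e]
    nlinarith [abs_nonneg e, sq_nonneg |e|]
  rw [norm_smul, norm_smul, h1]
  have h3 : e ^ 2 * ‖a‖ ≤ e ^ 2 * M := mul_le_mul_of_nonneg_left ha (sq_nonneg _)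
  have h4 : ‖((2 * e ^ 3 : ℝ) : ℂ)‖ * ‖b‖ ≤ 2 * e ^ 2 * M :=
    mul_le_mul h2 hb (norm_nonneg _) (by positivity)
  linarith

theorem Trial.IsBdd.norm_u (hT : T.IsBdd C M) (he : |e| ≤ 1) :
    ‖(T.u e : E)‖ ≤ 3 * M * e ^ 2 := by
  simp only [u, Submodule.coe_add, Submodule.coe_smul]
  exact norm_comb_le he (T.norm_w.trans hT.K_le) (T.norm_v.trans hT.K_le)

theorem Trial.IsBdd.H_u (hT : T.IsBdd C M) (he : |e| ≤ 1) :
    ‖q.H (T.u e)‖ ≤ 3 * M * e ^ 2 := by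
  simp only [u, map_add, map_smul]
  exact norm_comb_le he ((q.H_le _).trans hT.kin_w) ((q.H_le _).trans hT.kin_v)

theorem Trial.norm_inner_B_u (T : Trial q K) (hK : K ≤ M) (j : Fin 3) (r : q.V)
    (hr : inner ℂ (T.Ω : E) (r : E) = 0) :
    ‖inner ℂ (q.B j (T.u e)) (r : E)‖ ≤ 2 * |e| ^ 3 * (M * ‖q.H r‖) := by
  simp only [u, map_add, map_smul, inner_add_left, inner_smul_left, T.B_w j r hr, mul_zero,
    zero_add, Complex.conj_ofReal, norm_mul, Complex.norm_real, Real.norm_eq_abs,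
    abs_two, abs_pow]
  refine mul_le_mul_of_nonneg_left ((T.B_v j r).trans ?_) (by positivity)
  exact mul_le_mul_of_nonneg_right hK (norm_nonneg _)

theorem abs_cube_le (he : |e| ≤ 1) : |e| ^ 3 ≤ e ^ 2 := by
  rw [← sq_abs e]
  exact pow_le_pow_of_le_one (abs_nonneg e) he (by norm_num)

/-- The residual of the trial vector, as a functional on the complement of the vacuum, is of
order `e⁴` in the norm dual to that of the form domain. -/
theorem IsBounded.norm_form_trial_le (hq : q.IsBounded C) (hT : T.IsBdd C M) (he : |e| ≤ 1)
    (r : q.V) (hr : inner ℂ (T.Ω : E) (r : E) = 0) :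
    ‖q.form e (T.Ω + T.u e) r‖ ≤ 66 * M ^ 3 * e ^ 4 * Real.sqrt (q.kin r) := by
  have hM := hT.one_le
  set s := Real.sqrt (q.kin r) with hs
  have hs0 : 0 ≤ s := Real.sqrt_nonneg _
  have hCM := hT.sqrt_C
  have hM2 : 1 ≤ M ^ 2 := one_le_pow₀ hM
  have hM3 : M ^ 2 ≤ M ^ 3 := pow_le_pow_right₀ hM (by norm_num)
  have hM1 : M ≤ M ^ 2 := by nlinarith
  have h1 : ‖q.mixed T.v r‖ ≤ 6 * (M * M * s) :=
    (hq.norm_mixed_le _ _).trans (by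
      gcongr
      exact hT.kin_v)
  have h2 : ‖q.number (T.u e) r‖ ≤ 9 * M ^ 3 * e ^ 2 * s := by
    have h3 : q.number (T.u e) r = ∑ j, inner ℂ (q.A j (T.u e)) (q.A j r) := by
      simp only [number, LinearMap.sum_apply, sesq_apply]
    rw [h3]
    have h4 : ∀ j, ‖inner ℂ (q.A j (T.u e)) (q.A j r)‖ ≤ M * (3 * M * e ^ 2) * (M * s) := fun j => by
      refine (norm_inner_le_norm _ _).trans ?_
      refine mul_le_mul ?_ ((hq.A_le_sqrt j r).trans (by gcongr)) (norm_nonneg _) (by positivity)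
      have h5 : ‖q.A j (T.u e)‖ ≤ Real.sqrt C * ‖q.H (T.u e)‖ := by
        refine Real.le_sqrt_of_sq_le (hq.A_le j _) |>.trans (le_of_eq ?_)
        rw [Real.sqrt_mul hq.nonneg, Real.sqrt_sq (norm_nonneg _)]
      exact h5.trans (mul_le_mul hCM (hT.H_u he) (norm_nonneg _) (by positivity))
    refine (norm_sum_le _ _).trans ((Finset.sum_le_sum fun j _ => h4 j).trans (le_of_eq ?_))
    simp only [Fin.sum_univ_three]
    ring
  have h3 : ‖q.pair (T.u e) r‖ ≤ 24 * M ^ 2 * e ^ 2 * s := by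
    have h4 : q.pair (T.u e) r =
        ∑ j, (inner ℂ (q.B j (T.u e)) (r : E) + inner ℂ (T.u e : E) (q.B j r)) := by
      simp only [pair, LinearMap.sum_apply, LinearMap.add_apply, sesq_apply,
        Submodule.subtype_apply]
    rw [h4]
    have h5 : ∀ j, ‖inner ℂ (q.B j (T.u e)) (r : E) + inner ℂ (T.u e : E) (q.B j r)‖ ≤
        2 * e ^ 2 * (M * s) + M * s * (3 * M * e ^ 2 + 3 * M * e ^ 2) := fun j => by
      refine (norm_add_le _ _).trans (add_le_add ?_ ?_)
      · refine (T.norm_inner_B_u hT.K_le j r hr).trans ?_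
        have h6 := abs_cube_le he
        have h7 : ‖q.H r‖ ≤ s := q.H_le r
        gcongr
      · refine (hq.B_le j r (T.u e)).trans ?_
        have h7 : ‖q.H r‖ ≤ s := q.H_le r
        have h8 := hT.norm_u (e := e) he
        have h9 := hT.H_u (e := e) he
        have h10 := hT.C_le
        gcongr
    refine (norm_sum_le _ _).trans ((Finset.sum_le_sum fun j _ => h5 j).trans ?_)
    simp only [Fin.sum_univ_three]
    have : 0 ≤ e ^ 2 * s := by positivity
    nlinarith [mul_le_mul_of_nonneg_right hM1 this]
  rw [T.form_trial]
  have h4 : ‖((4 * e ^ 4 : ℝ) : ℂ) * q.mixed T.v r‖ ≤ 4 * e ^ 4 * (6 * (M * M * s)) := by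
    rw [norm_mul, Complex.norm_real, Real.norm_eq_abs, abs_of_nonneg (by positivity)]
    gcongr
  have h5 : ‖((e ^ 2 : ℝ) : ℂ) * (q.pair (T.u e) r + 2 * q.number (T.u e) r)‖ ≤
      e ^ 2 * (24 * M ^ 2 * e ^ 2 * s + 2 * (9 * M ^ 3 * e ^ 2 * s)) := by
    rw [norm_mul, Complex.norm_real, Real.norm_eq_abs, abs_of_nonneg (by positivity)]
    gcongr
    refine (norm_add_le _ _).trans (add_le_add h3 ?_)
    rw [norm_mul, Complex.norm_ofNat]
    gcongr
  refine (norm_add_le _ _).trans ((add_le_add h4 h5).trans ?_)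
  have : 0 ≤ e ^ 4 * s := by positivity
  nlinarith [mul_le_mul_of_nonneg_right hM3 this]

/-- The energy of the trial vector. -/
theorem IsBounded.abs_form_trial_sub_le (hq : q.IsBounded C) (hT : T.IsBdd C M) (he : |e| ≤ 1) :
    |(q.form e (T.Ω + T.u e) (T.Ω + T.u e)).re - T.series e| ≤ 132 * M ^ 4 * |e| ^ 7 := by
  have hM := hT.one_le
  have hM4 : M ^ 2 ≤ M ^ 4 := pow_le_pow_right₀ hM (by norm_num)
  have hM34 : M ^ 3 ≤ M ^ 4 := pow_le_pow_right₀ hM (by norm_num)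
  have hwv : q.free T.w T.v = 0 := by rw [← conj_free, T.free_v_w, map_zero]
  have hwΩ : q.free T.w T.Ω = 0 := by
    rw [T.free_w]
    simp [T.B_Ω]
  have hA : q.form e (T.Ω + T.u e) T.Ω = ((-e ^ 4 * q.kin T.w : ℝ) : ℂ) := by
    rw [← conj_form, T.form_Ω, map_mul, Complex.conj_ofReal, map_add, hwΩ, zero_add]
    have : q.free T.w (T.u e) = ((-e ^ 2 * q.kin T.w : ℝ) : ℂ) := by
      simp only [Trial.u, map_add, map_smul, smul_eq_mul, hwv, mul_zero, add_zero, free_self]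
      push_cast
      ring
    rw [this, Complex.conj_ofReal]
    push_cast
    ring
  have hB : q.mixed T.v (T.u e) =
      ((-e ^ 2 * q.kin T.v : ℝ) : ℂ) + ((2 * e ^ 3 : ℝ) : ℂ) * q.mixed T.v T.v := by
    have : q.mixed T.v T.w = (q.kin T.v : ℂ) := by
      rw [← conj_mixed, ← T.free_v, free_self, Complex.conj_ofReal]
    simp only [Trial.u, map_add, map_smul, smul_eq_mul, this]
    push_cast
    ring
  have hN : q.number (T.u e) (T.u e) = ((e ^ 4 * ∑ j, ‖q.A j T.w‖ ^ 2 : ℝ) : ℂ) +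
      (((-2 * e ^ 5 : ℝ) : ℂ) * (q.number T.w T.v + q.number T.v T.w) +
        ((4 * e ^ 6 : ℝ) : ℂ) * q.number T.v T.v) := by
    have : q.number T.w T.w = ((∑ j, ‖q.A j T.w‖ ^ 2 : ℝ) : ℂ) := by
      simp only [number, LinearMap.sum_apply, sesq_apply, inner_self_eq_norm_sq_to_K]
      push_cast
      rfl
    simp only [Trial.u, map_add, map_smul, LinearMap.map_smulₛₗ, LinearMap.add_apply,
      LinearMap.smul_apply, smul_eq_mul, Complex.conj_ofReal, this]
    push_cast
    ring
  have b1 : ‖q.mixed T.v T.v‖ ≤ 6 * M ^ 3 := by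
    refine (hq.norm_mixed_le _ _).trans ?_
    have := hT.kin_v
    have := hT.sqrt_C
    rw [show M ^ 3 = M * M * M by ring]
    gcongr
  have bN : ∀ x y : q.V, Real.sqrt (q.kin x) ≤ M → Real.sqrt (q.kin y) ≤ M →
      ‖q.number x y‖ ≤ 3 * M ^ 4 := fun x y hx hy => by
    refine (hq.norm_number_le _ _).trans ?_
    have := hT.sqrt_C
    rw [show M ^ 4 = M * M * (M * M) by ring]
    gcongr
  have b2 : ‖((-2 * e ^ 5 : ℝ) : ℂ) * (q.number T.w T.v + q.number T.v T.w) +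
        ((4 * e ^ 6 : ℝ) : ℂ) * q.number T.v T.v‖ ≤ 24 * M ^ 4 * |e| ^ 5 := by
    have h6 : |e| ^ 6 ≤ |e| ^ 5 := pow_le_pow_of_le_one (abs_nonneg e) he (by norm_num)
    refine (norm_add_le _ _).trans ?_
    rw [norm_mul, norm_mul, Complex.norm_real, Complex.norm_real, Real.norm_eq_abs,
      Real.norm_eq_abs, abs_mul, abs_mul, abs_pow, abs_pow, abs_neg, abs_two,
      abs_of_pos (by norm_num : (0 : ℝ) < 4)]
    have h7 : ‖q.number T.w T.v + q.number T.v T.w‖ ≤ 3 * M ^ 4 + 3 * M ^ 4 :=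
      (norm_add_le _ _).trans (add_le_add (bN _ _ hT.kin_w hT.kin_v) (bN _ _ hT.kin_v hT.kin_w))
    have h8 := bN _ _ hT.kin_v hT.kin_v
    calc _ ≤ 2 * |e| ^ 5 * (3 * M ^ 4 + 3 * M ^ 4) + 4 * |e| ^ 5 * (3 * M ^ 4) := by gcongr
      _ = _ := by ring
  have b3 : ‖q.pair (T.u e) (T.u e)‖ ≤ 36 * M ^ 2 * |e| ^ 5 := by
    have h4 : q.pair (T.u e) (T.u e) =
        ∑ j, (inner ℂ (q.B j (T.u e)) (T.u e : E) + inner ℂ (T.u e : E) (q.B j (T.u e))) := by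
      simp only [pair, LinearMap.sum_apply, LinearMap.add_apply, sesq_apply,
        Submodule.subtype_apply]
    have h5 : ∀ j, ‖inner ℂ (q.B j (T.u e)) (T.u e : E)‖ ≤ 6 * M ^ 2 * |e| ^ 5 := fun j => by
      refine (T.norm_inner_B_u hT.K_le j _ (T.inner_Ω_u e)).trans ?_
      have h6 := hT.H_u (e := e) he
      calc _ ≤ 2 * |e| ^ 3 * (M * (3 * M * e ^ 2)) := by gcongr
        _ = _ := by rw [← sq_abs e]; ring
    have h6 : ∀ j, ‖inner ℂ (q.B j (T.u e)) (T.u e : E) + inner ℂ (T.u e : E) (q.B j (T.u e))‖ ≤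
        12 * M ^ 2 * |e| ^ 5 := fun j => by
      refine (norm_add_le _ _).trans ?_
      rw [norm_inner_symm (T.u e : E)]
      linarith [h5 j]
    rw [h4]
    refine (norm_sum_le _ _).trans ((Finset.sum_le_sum fun j _ => h6 j).trans (le_of_eq ?_))
    simp only [Fin.sum_univ_three]
    ring
  have key : q.form e (T.Ω + T.u e) (T.Ω + T.u e) - ((T.series e : ℝ) : ℂ) =
      ((8 * e ^ 7 : ℝ) : ℂ) * q.mixed T.v T.v + (((e ^ 2 : ℝ) : ℂ) * q.pair (T.u e) (T.u e) +
        ((2 * e ^ 2 : ℝ) : ℂ) * (((-2 * e ^ 5 : ℝ) : ℂ) *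
          (q.number T.w T.v + q.number T.v T.w) + ((4 * e ^ 6 : ℝ) : ℂ) * q.number T.v T.v)) := by
    rw [map_add, hA, T.form_trial, hB, hN, Trial.series]
    push_cast
    ring
  have h := (Complex.abs_re_le_norm _).trans_eq (congrArg norm key)
  rw [Complex.sub_re, Complex.ofReal_re] at h
  refine h.trans ((norm_add_le _ _).trans ((add_le_add le_rfl (norm_add_le _ _)).trans ?_))
  rw [norm_mul, norm_mul, norm_mul, Complex.norm_real, Complex.norm_real, Complex.norm_real,
    Real.norm_eq_abs, Real.norm_eq_abs, Real.norm_eq_abs, abs_mul, abs_mul, abs_pow, abs_pow,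
    abs_two, abs_of_pos (by norm_num : (0 : ℝ) < 8)]
  calc _ ≤ 8 * |e| ^ 7 * (6 * M ^ 3) + (|e| ^ 2 * (36 * M ^ 2 * |e| ^ 5) +
        2 * |e| ^ 2 * (24 * M ^ 4 * |e| ^ 5)) := by gcongr
    _ = |e| ^ 7 * (48 * M ^ 3 + 36 * M ^ 2 + 48 * M ^ 4) := by ring
    _ ≤ |e| ^ 7 * (132 * M ^ 4) := by
        refine mul_le_mul_of_nonneg_left ?_ (by positivity)
        linarith
    _ = _ := by ring

theorem form_smul_add_self (e : ℝ) (α : ℂ) (y r : q.V) :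
    (q.form e (α • y + r) (α • y + r)).re = ‖α‖ ^ 2 * (q.form e y y).re +
      2 * ((starRingEnd ℂ) α * q.form e y r).re + (q.form e r r).re := by
  have h1 : q.form e (α • y + r) (α • y + r) = ((‖α‖ ^ 2 : ℝ) : ℂ) * q.form e y y +
      ((starRingEnd ℂ) α * q.form e y r + α * q.form e r y) + q.form e r r := by
    have : ((‖α‖ ^ 2 : ℝ) : ℂ) = (starRingEnd ℂ) α * α := by
      rw [Complex.conj_mul']
      push_cast
      rfl
    simp only [map_add, map_smul, LinearMap.map_smulₛₗ, LinearMap.add_apply,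
      LinearMap.smul_apply, smul_eq_mul, this]
    ring
  have h2 : α * q.form e r y = (starRingEnd ℂ) ((starRingEnd ℂ) α * q.form e y r) := by
    rw [map_mul, conj_form, Complex.conj_conj]
  rw [h1, h2, Complex.add_re, Complex.add_re, Complex.add_re, Complex.conj_re,
    Complex.re_ofReal_mul]
  ring

/-- The lower bound for vectors whose component `r` outside the trial vector is controlled by its
energy. The number `288 = 8 · 36` makes the negative term of the a priori bound for `r` at most an
eighth of the kinetic energy; a quarter is left to absorb the cross term. -/
theorem IsBounded.form_lower (hq : q.IsBounded C) (hT : T.IsBdd C M) (he : |e| ≤ 1)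
    (he' : 120 * C * e ^ 2 ≤ 1) (α : ℂ) (r : q.V) (hr : inner ℂ (T.Ω : E) (r : E) = 0)
    (hgap : 288 * C ^ 2 * e ^ 4 * ‖(r : E)‖ ^ 2 ≤
      q.kin r + 288 * C ^ 2 * e ^ 4 * (‖α‖ ^ 2 * ‖(T.u e : E)‖ ^ 2)) :
    ‖α‖ ^ 2 * ((q.form e (T.Ω + T.u e) (T.Ω + T.u e)).re - 20000 * M ^ 6 * e ^ 8) ≤
      (q.form e (α • (T.Ω + T.u e) + r) (α • (T.Ω + T.u e) + r)).re := by
  have hM := hT.one_le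
  have h1 := hq.apriori he' r
  have h2 := hq.norm_form_trial_le hT he r hr
  have h3 := hT.norm_u (e := e) he
  have hs := Real.sq_sqrt (q.kin_nonneg r)
  set s := Real.sqrt (q.kin r)
  rw [form_smul_add_self]
  have h4 : |((starRingEnd ℂ) α * q.form e (T.Ω + T.u e) r).re| ≤
      ‖α‖ * (66 * M ^ 3 * e ^ 4 * s) := by
    refine (Complex.abs_re_le_norm _).trans ?_
    rw [norm_mul, RCLike.norm_conj]
    gcongr
  have h5 := neg_le_of_abs_le h4
  have h6 : 2 * (‖α‖ * (66 * M ^ 3 * e ^ 4 * s)) ≤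
      1 / 4 * s ^ 2 + ‖α‖ ^ 2 * (17424 * M ^ 6 * e ^ 8) := by
    nlinarith [sq_nonneg (s - 4 * (‖α‖ * (66 * M ^ 3 * e ^ 4)))]
  have h7 : ‖(T.u e : E)‖ ^ 2 ≤ 9 * M ^ 2 * e ^ 4 := by
    calc ‖(T.u e : E)‖ ^ 2 ≤ (3 * M * e ^ 2) ^ 2 := by gcongr
      _ = _ := by ring
  have h8 : 288 * C ^ 2 * e ^ 4 * (‖α‖ ^ 2 * ‖(T.u e : E)‖ ^ 2) ≤
      ‖α‖ ^ 2 * (2592 * M ^ 6 * e ^ 8) := by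
    have hCM : C ^ 2 ≤ M ^ 2 := pow_le_pow_left₀ hq.nonneg hT.C_le 2
    have hM6 : M ^ 2 * M ^ 2 ≤ M ^ 6 := by
      rw [← pow_add]
      exact pow_le_pow_right₀ hM (by norm_num)
    calc _ ≤ 288 * M ^ 2 * e ^ 4 * (‖α‖ ^ 2 * (9 * M ^ 2 * e ^ 4)) := by gcongr
      _ = ‖α‖ ^ 2 * (2592 * e ^ 8) * (M ^ 2 * M ^ 2) := by ring
      _ ≤ ‖α‖ ^ 2 * (2592 * e ^ 8) * M ^ 6 := by gcongr
      _ = _ := by ring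
  have h9 : 0 ≤ ‖α‖ ^ 2 * (M ^ 6 * e ^ 8) := by positivity
  have h10 := q.kin_nonneg r
  nlinarith

theorem IsBounded.series_nonpos (hq : q.IsBounded C) (he' : 120 * C * e ^ 2 ≤ 1) :
    T.series e ≤ 0 := by
  have h1 : ∀ j, ‖q.A j T.w‖ ^ 2 ≤ C * q.kin T.w := fun j =>
    (hq.A_le j _).trans (mul_le_mul_of_nonneg_left (q.sq_H_le _) hq.nonneg)
  have h2 : ∑ j, ‖q.A j T.w‖ ^ 2 ≤ 3 * (C * q.kin T.w) := by
    simp only [Fin.sum_univ_three]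
    linarith [h1 0, h1 1, h1 2]
  have h3 := q.kin_nonneg T.w
  have h4 := q.kin_nonneg T.v
  have h5 : 0 ≤ e ^ 4 := by positivity
  have h6 : 0 ≤ e ^ 6 := by positivity
  unfold Trial.series
  have h7 : 2 * e ^ 6 * ∑ j, ‖q.A j T.w‖ ^ 2 ≤ 2 * e ^ 6 * (3 * (C * q.kin T.w)) := by gcongr
  have h8 : 2 * e ^ 6 * (3 * (C * q.kin T.w)) ≤ e ^ 4 * q.kin T.w := by
    have : 6 * C * e ^ 2 ≤ 1 := by nlinarith [mul_nonneg hq.nonneg (sq_nonneg e)]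
    nlinarith [mul_le_mul_of_nonneg_right this (mul_nonneg h5 h3)]
  have h9 := mul_nonneg h6 h4
  linarith

theorem IsBounded.neg_series_le (_hq : q.IsBounded C) (hT : T.IsBdd C M) (he : |e| ≤ 1) :
    -T.series e ≤ 5 * M ^ 2 * e ^ 4 := by
  have h1 : q.kin T.w ≤ M ^ 2 := (Real.sqrt_le_left (by linarith [hT.one_le])).1 hT.kin_w
  have h2 : q.kin T.v ≤ M ^ 2 := (Real.sqrt_le_left (by linarith [hT.one_le])).1 hT.kin_v
  have h3 : 0 ≤ 2 * e ^ 6 * ∑ j, ‖q.A j T.w‖ ^ 2 := by positivity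
  have h4 : e ^ 6 ≤ e ^ 4 := by
    have : e ^ 2 ≤ 1 := by rw [← sq_abs]; exact pow_le_one₀ (abs_nonneg e) he
    nlinarith [show (0 : ℝ) ≤ e ^ 4 by positivity]
  have h5 := q.kin_nonneg T.v
  have h6 : e ^ 4 * q.kin T.w ≤ e ^ 4 * M ^ 2 := by gcongr
  have h7 : e ^ 6 * q.kin T.v ≤ e ^ 4 * M ^ 2 := by gcongr
  unfold Trial.series
  linarith

end Estimates

end QForm

end Abstract

/-! ### Bounds on the energy -/

section Abstract

variable {E : Type*} [NormedAddCommGroup E] [InnerProductSpace ℂ E]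

namespace QForm

variable {q : QForm E} {C K : ℝ}

theorem abs_pow_eight_le {e : ℝ} (he : |e| ≤ 1) : e ^ 8 ≤ |e| ^ 7 := by
  have : e ^ 8 = |e| ^ 8 := by rw [← abs_pow, abs_of_nonneg (by positivity)]
  rw [this]
  exact pow_le_pow_of_le_one (abs_nonneg e) he (by norm_num)

/-- The lower bound for vectors that have a gap of order `e⁴` above the vacuum. -/
theorem IsBounded.lower_of_gap (hq : q.IsBounded C) {T : Trial q K} {M e : ℝ}
    (hT : T.IsBdd C M) (he : |e| ≤ 1) (he' : 120 * C * e ^ 2 ≤ 1) (x : q.V) (α : ℂ)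
    (hα : inner ℂ (T.Ω : E) (x : E) = α)
    (hgap : 288 * C ^ 2 * e ^ 4 * ‖(x - α • (T.Ω + T.u e) : E)‖ ^ 2 ≤
      ‖q.H (x - α • (T.Ω + T.u e))‖ ^ 2 +
        288 * C ^ 2 * e ^ 4 * (‖α‖ ^ 2 * ‖(T.u e : E)‖ ^ 2)) :
    -(-T.series e + 20132 * M ^ 6 * |e| ^ 7) * ‖(x : E)‖ ^ 2 ≤ (q.form e x x).re := by
  have hM := hT.one_le
  set r : q.V := x - α • (T.Ω + T.u e) with hr
  have hx : x = α • (T.Ω + T.u e) + r := by rw [hr]; abel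
  have hr0 : inner ℂ (T.Ω : E) (r : E) = 0 := by
    rw [hr, Submodule.coe_sub, Submodule.coe_smul, Submodule.coe_add, inner_sub_right,
      inner_smul_right, inner_add_right, T.inner_Ω_u, hα, inner_self_eq_norm_sq_to_K, T.norm_Ω]
    simp
  have h1 := hq.form_lower hT he he' α r hr0 (hgap.trans (add_le_add (q.sq_H_le r) le_rfl))
  rw [← hx] at h1
  have h2 := hq.abs_form_trial_sub_le hT he
  have h3 := neg_le_of_abs_le h2
  have hα' : ‖α‖ ≤ ‖(x : E)‖ := by
    rw [← hα]
    refine (norm_inner_le_norm _ _).trans ?_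
    rw [T.norm_Ω, one_mul]
  have h4 : 0 ≤ -T.series e + 20132 * M ^ 6 * |e| ^ 7 := by
    have := hq.series_nonpos (T := T) he'
    have : 0 ≤ 20132 * M ^ 6 * |e| ^ 7 := by positivity
    linarith
  have h5 : (-T.series e + 20132 * M ^ 6 * |e| ^ 7) * ‖α‖ ^ 2 ≤
      (-T.series e + 20132 * M ^ 6 * |e| ^ 7) * ‖(x : E)‖ ^ 2 := by gcongr
  have h6 : -(-T.series e + 20132 * M ^ 6 * |e| ^ 7) ≤
      (q.form e (T.Ω + T.u e) (T.Ω + T.u e)).re - 20000 * M ^ 6 * e ^ 8 := by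
    have h7 : 132 * M ^ 4 * |e| ^ 7 ≤ 132 * M ^ 6 * |e| ^ 7 := by
      have : M ^ 4 ≤ M ^ 6 := pow_le_pow_right₀ hM (by norm_num)
      gcongr
    have h8 : 20000 * M ^ 6 * e ^ 8 ≤ 20000 * M ^ 6 * |e| ^ 7 := by
      have := abs_pow_eight_le he
      gcongr
    linarith
  have h9 := mul_le_mul_of_nonneg_left h6 (sq_nonneg ‖α‖)
  linarith

/-- The upper bound obtained from the trial vector. -/
theorem IsBounded.upper (hq : q.IsBounded C) {T : Trial q K} {M e c N : ℝ}
    (hT : T.IsBdd C M) (he : |e| ≤ 1) (hN : 0 ≤ N) (hc' : -c ≤ N * e ^ 4)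
    (hc : c * ‖(T.Ω + T.u e : E)‖ ^ 2 ≤ (q.form e (T.Ω + T.u e) (T.Ω + T.u e)).re) :
    c ≤ T.series e + (132 * M ^ 4 + 9 * M ^ 2 * N) * |e| ^ 7 := by
  have hM := hT.one_le
  have h1 : ‖(T.Ω + T.u e : E)‖ ^ 2 = 1 + ‖(T.u e : E)‖ ^ 2 := by
    have h := norm_add_sq (𝕜 := ℂ) (T.Ω : E) (T.u e : E)
    rw [T.inner_Ω_u, T.norm_Ω] at h
    simpa using h
  rw [h1] at hc
  have h2 := (abs_le.1 (hq.abs_form_trial_sub_le hT he)).2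
  have h3 : ‖(T.u e : E)‖ ^ 2 ≤ 9 * M ^ 2 * e ^ 4 := by
    have := hT.norm_u (e := e) he
    calc ‖(T.u e : E)‖ ^ 2 ≤ (3 * M * e ^ 2) ^ 2 := by gcongr
      _ = _ := by ring
  have h4 : -c * ‖(T.u e : E)‖ ^ 2 ≤ 9 * M ^ 2 * N * |e| ^ 7 := by
    calc -c * ‖(T.u e : E)‖ ^ 2 ≤ N * e ^ 4 * ‖(T.u e : E)‖ ^ 2 := by gcongr
      _ ≤ N * e ^ 4 * (9 * M ^ 2 * e ^ 4) := by gcongr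
      _ = 9 * M ^ 2 * N * e ^ 8 := by ring
      _ ≤ _ := by
        have := abs_pow_eight_le he
        gcongr
  nlinarith

/-- The form with `𝒫` replaced by `𝒫 + ξ`. -/
def shift (q : QForm E) (ξ : Fin 3 → ℝ) : QForm E :=
  { q with P := fun j => q.P j + ((ξ j : ℝ) : ℂ) • q.V.subtype }

theorem IsBounded.shift (hq : q.IsBounded C) (ξ : Fin 3 → ℝ) : (q.shift ξ).IsBounded C :=
  ⟨hq.nonneg, hq.A_le, hq.B_le⟩

/-- If the form at total momentum `ξ` is negative, then all its terms are of order `e⁴`. -/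
theorem IsBounded.sqrt_kin_le (hq : q.IsBounded C) {e a : ℝ} (he' : 120 * C * e ^ 2 ≤ 1) (x : q.V)
    (ha : 0 ≤ a) (hx : (q.form e x x).re ≤ -a * ‖(x : E)‖ ^ 2) :
    Real.sqrt (q.kin x) ≤ 9 * C * e ^ 2 * ‖(x : E)‖ ∧
      a * ‖(x : E)‖ ^ 2 ≤ 36 * C ^ 2 * e ^ 4 * ‖(x : E)‖ ^ 2 := by
  have h1 := hq.apriori he' x
  have hk := q.kin_nonneg x
  have hC := hq.nonneg
  have h2 : 0 ≤ a * ‖(x : E)‖ ^ 2 := by positivity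
  refine ⟨Real.sqrt_le_iff.2 ⟨by positivity, ?_⟩, by linarith⟩
  have h3 : 0 ≤ C ^ 2 * e ^ 4 * ‖(x : E)‖ ^ 2 := by positivity
  nlinarith

/-- At small coupling the energy at total momentum `ξ` lies at most `|ξ|` below the energy at total
momentum zero. A vector below this bound has negative energy at total momentum `ξ`, so that its
momentum is of order `e²`, and undoing the shift then changes the form by less than `|ξ| ‖x‖²`. -/
theorem IsBounded.lower_shift (hq : q.IsBounded C) {M e ε l : ℝ} (hM : 1 ≤ M) (hCM : C ≤ M)
    (hsM : Real.sqrt C ≤ M) (he : |e| ≤ 1) (he' : 300 * M ^ 2 * e ^ 2 ≤ 1) (hε : 0 ≤ ε)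
    {ξ : Fin 3 → ℝ} (hl : ∀ j, |ξ j| ≤ l) (x : q.V)
    (hx : -ε * ‖(x : E)‖ ^ 2 ≤ (q.form e x x).re) :
    -(ε + l) * ‖(x : E)‖ ^ 2 ≤ ((q.shift ξ).form e x x).re := by
  by_contra hcon
  push Not at hcon
  have hl0 : 0 ≤ l := (abs_nonneg _).trans (hl 0)
  have hC := hq.nonneg
  have he2 : 120 * C * e ^ 2 ≤ 1 := by
    have : C ≤ M ^ 2 := by nlinarith
    nlinarith [mul_le_mul_of_nonneg_right this (sq_nonneg e), sq_nonneg (M * e)]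
  obtain ⟨h1, h2⟩ := (hq.shift ξ).sqrt_kin_le he2 x (add_nonneg hε hl0) hcon.le
  set s := Real.sqrt ((q.shift ξ).kin x) with hs
  have hP : ∀ j, ‖q.P j x + ((ξ j : ℝ) : ℂ) • (x : E)‖ ≤ s := fun j => (q.shift ξ).P_le j x
  have hA : ∀ j, ‖q.A j x‖ ≤ Real.sqrt C * s := fun j => (hq.shift ξ).A_le_sqrt j x
  set n := ‖(x : E)‖ with hn
  have hn0 : 0 ≤ n := norm_nonneg _
  have hs0 : 0 ≤ s := Real.sqrt_nonneg _
  have hx1 : l * n ^ 2 ≤ 36 * C ^ 2 * e ^ 4 * n ^ 2 := by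
    have : 0 ≤ ε * n ^ 2 := by positivity
    linarith
  have hdiff : ∀ j, ‖q.P j x‖ ^ 2 + 4 * e * (inner ℂ (q.A j x) (q.P j x)).re -
      ‖q.P j x + ((ξ j : ℝ) : ℂ) • (x : E)‖ ^ 2 -
      4 * e * (inner ℂ (q.A j x) (q.P j x + ((ξ j : ℝ) : ℂ) • (x : E))).re ≤
      l * (2 * s * n) + l * (l * n ^ 2) + 4 * |e| * (l * (M * s * n)) := fun j => by
    set p := q.P j x + ((ξ j : ℝ) : ℂ) • (x : E) with hp
    have e1 : q.P j x = p - ((ξ j : ℝ) : ℂ) • (x : E) := by rw [hp]; abel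
    have e2 : ‖q.P j x‖ ^ 2 = ‖p‖ ^ 2 - 2 * (ξ j * (inner ℂ p (x : E)).re) + (ξ j) ^ 2 * n ^ 2 := by
      rw [e1, norm_sub_sq (𝕜 := ℂ), inner_smul_right, norm_smul, Complex.norm_real, mul_pow,
        Real.norm_eq_abs, sq_abs]
      have : RCLike.re (((ξ j : ℝ) : ℂ) * inner ℂ p (x : E)) = ξ j * (inner ℂ p (x : E)).re :=
        Complex.re_ofReal_mul _ _
      rw [this]
    have e3 : (inner ℂ (q.A j x) (q.P j x)).re =
        (inner ℂ (q.A j x) p).re - ξ j * (inner ℂ (q.A j x) (x : E)).re := by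
      rw [e1, inner_sub_right, inner_smul_right, Complex.sub_re, Complex.re_ofReal_mul]
    have i1 : |ξ j * (inner ℂ p (x : E)).re| ≤ l * (s * n) := by
      rw [abs_mul]
      refine mul_le_mul (hl j) ((Complex.abs_re_le_norm _).trans ((norm_inner_le_norm _ _).trans ?_))
        (abs_nonneg _) hl0
      gcongr
      exact hP j
    have i2 : |ξ j * (inner ℂ (q.A j x) (x : E)).re| ≤ l * (M * s * n) := by
      rw [abs_mul]
      refine mul_le_mul (hl j) ((Complex.abs_re_le_norm _).trans ((norm_inner_le_norm _ _).trans ?_))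
        (abs_nonneg _) hl0
      gcongr
      exact (hA j).trans (by gcongr)
    have i3 : |4 * e * (ξ j * (inner ℂ (q.A j x) (x : E)).re)| ≤ 4 * |e| * (l * (M * s * n)) := by
      rw [abs_mul, abs_mul, abs_of_pos (by norm_num : (0 : ℝ) < 4)]
      gcongr
    have i4 : (ξ j) ^ 2 ≤ l * l := by
      rw [← sq_abs, ← sq]
      exact pow_le_pow_left₀ (abs_nonneg _) (hl j) 2
    have i5 : (ξ j) ^ 2 * n ^ 2 ≤ l * l * n ^ 2 := by gcongr
    rw [e2, e3]
    have := neg_le_of_abs_le i1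
    have := neg_le_of_abs_le i3
    linarith
  have hform : (q.form e x x).re - ((q.shift ξ).form e x x).re ≤
      3 * (l * (2 * s * n) + l * (l * n ^ 2) + 4 * |e| * (l * (M * s * n))) := by
    have k : ((q.shift ξ).form e x x).re =
        ((∑ j, ‖q.P j x + ((ξ j : ℝ) : ℂ) • (x : E)‖ ^ 2) + ‖q.H x‖ ^ 2) +
        4 * e * ∑ j, (inner ℂ (q.A j x) (q.P j x + ((ξ j : ℝ) : ℂ) • (x : E))).re +
        e ^ 2 * (2 * (∑ j, (inner ℂ (x : E) (q.B j x)).re) + 2 * ∑ j, ‖q.A j x‖ ^ 2) :=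
      re_form_self (q := q.shift ξ) e x
    have k5 : q.kin x = (∑ j, ‖q.P j x‖ ^ 2) + ‖q.H x‖ ^ 2 := rfl
    have d0 := hdiff 0
    have d1 := hdiff 1
    have d2 := hdiff 2
    rw [re_form_self, k, k5]
    clear k k5 hdiff hcon h2
    simp only [Fin.sum_univ_three] at *
    linarith
  have hsn : s * n ≤ 9 * C * e ^ 2 * n ^ 2 := by
    calc s * n ≤ 9 * C * e ^ 2 * n * n := by gcongr
      _ = _ := by ring
  have hlx : 3 * (l * (2 * s * n) + l * (l * n ^ 2) + 4 * |e| * (l * (M * s * n))) ≤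
      l * n ^ 2 := by
    have hMe : M ^ 2 * e ^ 2 * e ^ 2 ≤ M ^ 2 * e ^ 2 := by
      have : e ^ 2 ≤ 1 := by rw [← sq_abs]; exact pow_le_one₀ (abs_nonneg e) he
      exact mul_le_of_le_one_right (by positivity) this
    have hCM2 : C ^ 2 ≤ M ^ 2 := pow_le_pow_left₀ hC hCM 2
    have g1 : 2 * (s * n) ≤ 18 * (M ^ 2 * e ^ 2) * n ^ 2 := by
      have : C ≤ M ^ 2 := by nlinarith
      calc 2 * (s * n) ≤ 2 * (9 * C * e ^ 2 * n ^ 2) := by gcongr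
        _ ≤ 2 * (9 * M ^ 2 * e ^ 2 * n ^ 2) := by gcongr
        _ = _ := by ring
    have g2 : l * n ^ 2 ≤ 36 * (M ^ 2 * e ^ 2) * n ^ 2 := by
      calc l * n ^ 2 ≤ 36 * C ^ 2 * e ^ 4 * n ^ 2 := hx1
        _ ≤ 36 * M ^ 2 * e ^ 4 * n ^ 2 := by gcongr
        _ = 36 * (M ^ 2 * e ^ 2 * e ^ 2) * n ^ 2 := by ring
        _ ≤ _ := by gcongr
    have g3 : 4 * |e| * (M * (s * n)) ≤ 36 * (M ^ 2 * e ^ 2) * n ^ 2 := by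
      calc 4 * |e| * (M * (s * n)) ≤ 4 * 1 * (M * (9 * C * e ^ 2 * n ^ 2)) := by gcongr
        _ ≤ 4 * 1 * (M * (9 * M * e ^ 2 * n ^ 2)) := by gcongr
        _ = _ := by ring
    have g4 : 3 * (2 * (s * n) + l * n ^ 2 + 4 * |e| * (M * (s * n))) ≤ n ^ 2 := by
      have := mul_le_mul_of_nonneg_right he' (sq_nonneg n)
      have h0 : 0 ≤ M ^ 2 * e ^ 2 * n ^ 2 := by positivity
      linarith
    have := mul_le_mul_of_nonneg_left g4 hl0
    linarith
  linarith

/-- The form with other annihilation operators. -/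
def replaceA (q : QForm E) (A B : Fin 3 → q.V →ₗ[ℂ] E) : QForm E := { q with A := A, B := B }

/-- A lower bound is stable under a change of order `e²` of the annihilation operators: where the
form is negative, `P`, `H` and `A` are themselves of order `e²`. -/
theorem IsBounded.lower_replace (hq : q.IsBounded C) {M e ε : ℝ} (hM : 1 ≤ M) (hCM : C ≤ M)
    (hsM : Real.sqrt C ≤ M) (he : |e| ≤ 1) (he' : 120 * C * e ^ 2 ≤ 1) (hε : 0 ≤ ε)
    {A B : Fin 3 → q.V →ₗ[ℂ] E} (x : q.V)
    (hA : ∀ j, ‖q.A j x - A j x‖ ≤ M * e ^ 2 * ‖q.H x‖)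
    (hB : ∀ j, ‖inner ℂ (x : E) (q.B j x - B j x)‖ ≤
      M * e ^ 2 * ‖q.H x‖ * (M * |e| * ‖(x : E)‖ + ‖q.H x‖))
    (hx : -ε * ‖(x : E)‖ ^ 2 ≤ ((q.replaceA A B).form e x x).re) :
    -(ε + 3000 * M ^ 4 * |e| ^ 7) * ‖(x : E)‖ ^ 2 ≤ (q.form e x x).re := by
  have hpos : 0 ≤ ε + 3000 * M ^ 4 * |e| ^ 7 := by positivity
  rcases le_or_gt 0 (q.form e x x).re with h0 | h0
  · refine le_trans ?_ h0
    nlinarith [mul_nonneg hpos (sq_nonneg ‖(x : E)‖)]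
  have hC := hq.nonneg
  obtain ⟨h1, -⟩ := hq.sqrt_kin_le he' x le_rfl (by simpa using h0.le)
  have hP : ∀ j, ‖q.P j x‖ ≤ 9 * M * e ^ 2 * ‖(x : E)‖ := fun j =>
    (q.P_le j x).trans (h1.trans (by gcongr))
  have hH : ‖q.H x‖ ≤ 9 * M * e ^ 2 * ‖(x : E)‖ := (q.H_le x).trans (h1.trans (by gcongr))
  have hAx : ∀ j, ‖q.A j x‖ ≤ M * ‖q.H x‖ := fun j => by
    have := Real.le_sqrt_of_sq_le (hq.A_le j x)
    rw [Real.sqrt_mul hC, Real.sqrt_sq (norm_nonneg _)] at this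
    exact this.trans (by gcongr)
  set n := ‖(x : E)‖ with hn
  have hn0 : 0 ≤ n := norm_nonneg _
  have he2 : e ^ 2 ≤ 1 := by rw [← sq_abs]; exact pow_le_one₀ (abs_nonneg e) he
  have hea : e ^ 2 ≤ |e| := by
    rw [← sq_abs]; nlinarith [abs_nonneg e]
  have d1 : ∀ j, 4 * e * (inner ℂ (A j x) (q.P j x)).re - 324 * M ^ 4 * |e| ^ 7 * n ^ 2 ≤
      4 * e * (inner ℂ (q.A j x) (q.P j x)).re := fun j => by
    have e1 : (inner ℂ (A j x) (q.P j x)).re = (inner ℂ (q.A j x) (q.P j x)).re -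
        (inner ℂ (q.A j x - A j x) (q.P j x)).re := by
      rw [inner_sub_left, Complex.sub_re]; ring
    have e2 : |4 * e * (inner ℂ (q.A j x - A j x) (q.P j x)).re| ≤
        4 * |e| * ((M * e ^ 2 * (9 * M * e ^ 2 * n)) * (9 * M * e ^ 2 * n)) := by
      rw [abs_mul, abs_mul, abs_of_pos (by norm_num : (0 : ℝ) < 4)]
      refine mul_le_mul_of_nonneg_left ((Complex.abs_re_le_norm _).trans
        ((norm_inner_le_norm _ _).trans ?_)) (by positivity)
      refine mul_le_mul ((hA j).trans (by gcongr)) (hP j) (norm_nonneg _) (by positivity)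
    have e3 : 4 * |e| * ((M * e ^ 2 * (9 * M * e ^ 2 * n)) * (9 * M * e ^ 2 * n)) ≤
        324 * M ^ 4 * |e| ^ 7 * n ^ 2 := by
      have : M ^ 3 ≤ M ^ 4 := pow_le_pow_right₀ hM (by norm_num)
      calc _ = 324 * M ^ 3 * |e| ^ 7 * n ^ 2 := by rw [← sq_abs e]; ring
        _ ≤ _ := by gcongr
    rw [e1]
    have := (neg_le_of_abs_le e2)
    nlinarith
  have d2 : ∀ j, e ^ 2 * (2 * (inner ℂ (x : E) (B j x)).re) - 180 * M ^ 4 * |e| ^ 7 * n ^ 2 ≤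
      e ^ 2 * (2 * (inner ℂ (x : E) (q.B j x)).re) := fun j => by
    have e1 : (inner ℂ (x : E) (B j x)).re = (inner ℂ (x : E) (q.B j x)).re -
        (inner ℂ (x : E) (q.B j x - B j x)).re := by
      rw [inner_sub_right, Complex.sub_re]; ring
    have e2 : |(inner ℂ (x : E) (q.B j x - B j x)).re| ≤
        M * e ^ 2 * (9 * M * e ^ 2 * n) * (M * |e| * n + 9 * M * |e| * n) := by
      refine (Complex.abs_re_le_norm _).trans ((hB j).trans ?_)
      have : ‖q.H x‖ ≤ 9 * M * |e| * n := hH.trans (by gcongr)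
      gcongr
    have e3 : 2 * (M * e ^ 2 * (9 * M * e ^ 2 * n) * (M * |e| * n + 9 * M * |e| * n)) * e ^ 2 ≤
        180 * M ^ 4 * |e| ^ 7 * n ^ 2 := by
      have : M ^ 3 ≤ M ^ 4 := pow_le_pow_right₀ hM (by norm_num)
      calc _ = 180 * M ^ 3 * |e| ^ 7 * n ^ 2 := by rw [← sq_abs e]; ring
        _ ≤ _ := by gcongr
    rw [e1]
    have := mul_le_mul_of_nonneg_right (neg_le_of_abs_le e2) (sq_nonneg e)
    linarith
  have d3 : ∀ j, e ^ 2 * (2 * ‖A j x‖ ^ 2) - 486 * M ^ 4 * |e| ^ 7 * n ^ 2 ≤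
      e ^ 2 * (2 * ‖q.A j x‖ ^ 2) := fun j => by
    have hH0 := norm_nonneg (q.H x)
    have e0 : ‖A j x‖ ≤ ‖q.A j x‖ + M * e ^ 2 * ‖q.H x‖ := by
      have : A j x = q.A j x - (q.A j x - A j x) := by abel
      calc ‖A j x‖ = ‖q.A j x - (q.A j x - A j x)‖ := congrArg norm this
        _ ≤ ‖q.A j x‖ + ‖q.A j x - A j x‖ := norm_sub_le _ _
        _ ≤ _ := by gcongr; exact hA j
    have e1 : ‖A j x‖ ^ 2 ≤ ‖q.A j x‖ ^ 2 + 3 * M ^ 2 * e ^ 2 * ‖q.H x‖ ^ 2 := by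
      have h2 : ‖A j x‖ ^ 2 ≤ (‖q.A j x‖ + M * e ^ 2 * ‖q.H x‖) ^ 2 := by gcongr
      have h3 : ‖q.A j x‖ * (M * e ^ 2 * ‖q.H x‖) ≤ (M * ‖q.H x‖) * (M * e ^ 2 * ‖q.H x‖) := by
        gcongr
        exact hAx j
      have h4 : M ^ 2 * e ^ 2 * ‖q.H x‖ ^ 2 * e ^ 2 ≤ M ^ 2 * e ^ 2 * ‖q.H x‖ ^ 2 :=
        mul_le_of_le_one_right (by positivity) he2
      nlinarith
    have e2 : e ^ 2 * (2 * (3 * M ^ 2 * e ^ 2 * ‖q.H x‖ ^ 2)) ≤ 486 * M ^ 4 * |e| ^ 7 * n ^ 2 := by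
      have := abs_pow_eight_le he
      calc _ ≤ e ^ 2 * (2 * (3 * M ^ 2 * e ^ 2 * (9 * M * e ^ 2 * n) ^ 2)) := by gcongr
        _ = 486 * M ^ 4 * e ^ 8 * n ^ 2 := by ring
        _ ≤ _ := by gcongr
    have := mul_le_mul_of_nonneg_left e1 (by positivity : 0 ≤ e ^ 2 * 2)
    linarith
  have k : ((q.replaceA A B).form e x x).re = q.kin x +
      4 * e * ∑ j, (inner ℂ (A j x) (q.P j x)).re +
      e ^ 2 * (2 * (∑ j, (inner ℂ (x : E) (B j x)).re) + 2 * ∑ j, ‖A j x‖ ^ 2) :=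
    re_form_self (q := q.replaceA A B) e x
  rw [k] at hx
  rw [re_form_self]
  have a0 := d1 0
  have a1 := d1 1
  have a2 := d1 2
  have b0 := d2 0
  have b1 := d2 1
  have b2 := d2 2
  have c0 := d3 0
  have c1 := d3 1
  have c2 := d3 2
  have hz : 0 ≤ M ^ 4 * |e| ^ 7 * n ^ 2 := by positivity
  simp only [Fin.sum_univ_three] at *
  linarith

end QForm

end Abstract

/-! ### Weighted Cauchy–Schwarz inequality on Fock space -/

theorem tsum_mul_sq_le (a b : ℕ → ℝ≥0∞) :
    (∑' n, a n * b n) ^ 2 ≤ (∑' n, a n ^ 2) * ∑' n, b n ^ 2 := by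
  have h := lintegral_mul_sq_le (Measure.count : Measure ℕ) (f := a) (g := b)
    (measurable_from_nat).aemeasurable (measurable_from_nat).aemeasurable
  simpa only [lintegral_count] using h

theorem rpow_half_sq (x : ℝ≥0∞) : (x ^ (1 / 2 : ℝ)) ^ 2 = x := by
  rw [pow_two]
  exact rpow_half_mul_self x

theorem le_rpow_half_mul {x y z : ℝ≥0∞} (h : x ^ 2 ≤ y * z) :
    x ≤ y ^ (1 / 2 : ℝ) * z ^ (1 / 2 : ℝ) := by
  rw [← ENNReal.mul_rpow_of_nonneg _ _ (by norm_num)]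
  calc x = (x ^ 2) ^ (1 / 2 : ℝ) := by
        rw [← ENNReal.rpow_natCast, ← ENNReal.rpow_mul]; norm_num
    _ ≤ _ := by gcongr

theorem enorm_inner_le_tsum (χ φ : Fock) :
    ‖inner ℂ χ φ‖ₑ ≤ ∑' n, ∫⁻ k, ‖wave χ n k‖ₑ * ‖wave φ n k‖ₑ := by
  have h := hasSum_inner_wave χ φ
  have h1 : ∀ n, ‖∫ k, (starRingEnd ℂ) (wave χ n k) * wave φ n k‖ₑ ≤
      ∫⁻ k, ‖wave χ n k‖ₑ * ‖wave φ n k‖ₑ := fun n => by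
    refine (enorm_integral_le_lintegral_enorm _).trans (lintegral_mono fun k => ?_)
    rw [enorm_mul, RCLike.enorm_conj]
  rw [← h.tsum_eq]
  have h2 : Filter.Tendsto (fun s : Finset ℕ => ‖∑ n ∈ s,
      ∫ k, (starRingEnd ℂ) (wave χ n k) * wave φ n k‖ₑ) Filter.atTop
      (nhds ‖∑' n, ∫ k, (starRingEnd ℂ) (wave χ n k) * wave φ n k‖ₑ) :=
    (continuous_enorm.tendsto _).comp h.summable.hasSum
  refine le_of_tendsto h2 (Filter.Eventually.of_forall fun s => ?_)
  calc _ ≤ ∑ n ∈ s, ‖∫ k, (starRingEnd ℂ) (wave χ n k) * wave φ n k‖ₑ := enorm_sum_le _ _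
    _ ≤ ∑ n ∈ s, ∫⁻ k, ‖wave χ n k‖ₑ * ‖wave φ n k‖ₑ := Finset.sum_le_sum fun n _ => h1 n
    _ ≤ _ := ENNReal.sum_le_tsum s

/-- `|(χ, φ)|² ≤ ‖m^{1/2} χ‖² ‖m'^{1/2} φ‖²` if `m m' ≥ 1` on the support of `φ`. -/
theorem enorm_inner_sq_le (χ φ : Fock) {m m' : Weight} (hm : ∀ n, Measurable (m n))
    (hm' : ∀ n, Measurable (m' n))
    (h : ∀ n, ∀ᵐ k, wave φ n k = 0 ∨ 1 ≤ m n k * m' n k) :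
    ‖inner ℂ χ φ‖ₑ ^ 2 ≤ en m (wave χ) * en m' (wave φ) := by
  have h1 : ∀ n, ∫⁻ k, ‖wave χ n k‖ₑ * ‖wave φ n k‖ₑ ≤
      (∫⁻ k, m n k * ‖wave χ n k‖ₑ ^ 2) ^ (1 / 2 : ℝ) *
        (∫⁻ k, m' n k * ‖wave φ n k‖ₑ ^ 2) ^ (1 / 2 : ℝ) := fun n => by
    refine le_rpow_half_mul ?_
    have h2 := lintegral_mul_sq_le (volume : Measure (Config n))
      (f := fun k => m n k ^ (1 / 2 : ℝ) * ‖wave χ n k‖ₑ)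
      (g := fun k => m' n k ^ (1 / 2 : ℝ) * ‖wave φ n k‖ₑ)
      (((hm n).pow_const _).mul (measurable_wave χ n).enorm).aemeasurable
      (((hm' n).pow_const _).mul (measurable_wave φ n).enorm).aemeasurable
    simp only [mul_pow, rpow_half_sq] at h2
    refine (pow_le_pow_left' (lintegral_mono_ae ?_) 2).trans h2
    filter_upwards [h n] with k hk
    rcases hk with hk | hk
    · simp [hk]
    · calc ‖wave χ n k‖ₑ * ‖wave φ n k‖ₑ
          ≤ (m n k * m' n k) ^ (1 / 2 : ℝ) * (‖wave χ n k‖ₑ * ‖wave φ n k‖ₑ) := by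
            refine le_mul_of_one_le_left' ?_
            exact ENNReal.one_le_rpow hk (by norm_num)
        _ = _ := by
            rw [ENNReal.mul_rpow_of_nonneg _ _ (by norm_num)]
            ring
  refine (pow_le_pow_left' ((enorm_inner_le_tsum χ φ).trans (ENNReal.tsum_le_tsum h1)) 2).trans
    ((tsum_mul_sq_le _ _).trans (le_of_eq ?_))
  simp only [rpow_half_sq]
  rfl

/-! ### The form domain -/

/-- The operator `H_f^{1/2}`. -/
def sqrtField : Fock →ₗ.[ℂ] Fock := mulOp fun _ k => Real.sqrt (∑ i, ‖k i‖)

theorem measurable_sqrtField (n : ℕ) : Measurable fun k : Config n => Real.sqrt (∑ i, ‖k i‖) := by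
  fun_prop

theorem enorm_sqrtField (n : ℕ) (k : Config n) :
    ‖Real.sqrt (∑ i, ‖k i‖)‖ₑ ^ 2 = absSum n k := by
  rw [← ofReal_norm, ← ENNReal.ofReal_pow (norm_nonneg _), Real.norm_eq_abs, sq_abs,
    Real.sq_sqrt (Finset.sum_nonneg fun i _ => norm_nonneg _), absSum_eq_ofReal]

theorem mem_sqrtField {ψ : Fock} (h : en absSum (wave ψ) < ⊤) : ψ ∈ sqrtField.domain := by
  refine mem_domain_mulOp measurable_sqrtField (fun n σ k => ?_) ?_
  · simp only
    rw [Equiv.sum_comp σ (fun i => ‖k i‖)]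
  · simpa only [enorm_sqrtField] using h

theorem enorm_sqrtField_sq (x : sqrtField.domain) : ‖sqrtField x‖ₑ ^ 2 = en absSum (wave x) := by
  rw [enorm_sq_eq_en]
  refine (en_mulOp one' x).trans ?_
  simp only [one', one_mul, enorm_sqrtField]

/-- The restriction of an operator to a subspace of its domain. -/
def restrictTo (S : Fock →ₗ.[ℂ] Fock) {W : Submodule ℂ Fock} (h : W ≤ S.domain) :
    W →ₗ[ℂ] Fock := S.toFun ∘ₗ Submodule.inclusion h

theorem restrictTo_apply (S : Fock →ₗ.[ℂ] Fock) {W : Submodule ℂ Fock} (h : W ≤ S.domain)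
    (x : W) : restrictTo S h x = S ⟨x, h x.2⟩ := rfl

/-- The common domain of the operators in the form of `T_Λ`. -/
def formDom (f : Fin 3 → R3 → ℂ) : Submodule ℂ Fock :=
  ((⨅ j, (fieldMomentum j).domain) ⊓
    (⨅ j, (opMul (annihilation (f j)) (annihilation (f j))).domain)) ⊓ sqrtField.domain

theorem mem_formDom {f : Fin 3 → R3 → ℂ} {ψ : Fock} : ψ ∈ formDom f ↔
    ((∀ j, ψ ∈ (fieldMomentum j).domain) ∧
      ∀ j, ψ ∈ (opMul (annihilation (f j)) (annihilation (f j))).domain) ∧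
    ψ ∈ sqrtField.domain := by
  simp only [formDom, Submodule.mem_inf, Submodule.mem_iInf]

theorem formDom_le_fieldMomentum (f : Fin 3 → R3 → ℂ) (j : Fin 3) :
    formDom f ≤ (fieldMomentum j).domain := fun _ h => (mem_formDom.1 h).1.1 j

theorem formDom_le_pair (f : Fin 3 → R3 → ℂ) (j : Fin 3) :
    formDom f ≤ (opMul (annihilation (f j)) (annihilation (f j))).domain :=
  fun _ h => (mem_formDom.1 h).1.2 j

theorem formDom_le_annihilation (f : Fin 3 → R3 → ℂ) (j : Fin 3) :
    formDom f ≤ (annihilation (f j)).domain := fun _ h => (formDom_le_pair f j h).1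

theorem formDom_le_sqrtField (f : Fin 3 → R3 → ℂ) : formDom f ≤ sqrtField.domain :=
  fun _ h => (mem_formDom.1 h).2

/-- The form of the Nelson operator with form factors `f`. -/
def nelsonForm (f : Fin 3 → R3 → ℂ) : QForm Fock where
  V := formDom f
  P j := restrictTo _ (formDom_le_fieldMomentum f j)
  A j := restrictTo _ (formDom_le_annihilation f j)
  B j := restrictTo _ (formDom_le_pair f j)
  H := restrictTo _ (formDom_le_sqrtField f)

section

variable {C : ℝ≥0} {f : Fin 3 → R3 → ℂ}

theorem enorm_H_sq (x : (nelsonForm f).V) : ‖(nelsonForm f).H x‖ₑ ^ 2 = en absSum (wave x) :=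
  enorm_sqrtField_sq ⟨x, formDom_le_sqrtField f x.2⟩

theorem fdom_le_formDom (hf : ∀ j, IsFormFactor C (f j)) : fdom ≤ formDom f := fun ψ h =>
  mem_formDom.2 ⟨⟨fun j => fdom_le_fieldMomentum j h,
    fun j => fdom_le_annihilation_annihilation (hf j) h⟩, mem_sqrtField (en_absSum_lt_top ⟨ψ, h⟩)⟩

theorem measurable_one_add_absSum (n : ℕ) : Measurable fun k : Config n => 1 + absSum n k :=
  (isBoseWeight_absSum.meas n).const_add 1

theorem wave_annihilation_annihilation {f : R3 → ℂ} {ψ : Fock}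
    (h : ψ ∈ (opMul (annihilation f) (annihilation f)).domain) (n : ℕ) :
    ∀ᵐ k, wave (opMul (annihilation f) (annihilation f) ⟨ψ, h⟩) n k =
      anW f (anW f (wave ψ)) n k := by
  have h1 : ∀ᵐ k, wave (opMul (annihilation f) (annihilation f) ⟨ψ, h⟩) n k =
    anW f (wave (annihilation f ⟨ψ, h.1⟩)) n k := wave_annihilation ⟨annihilation f ⟨ψ, h.1⟩, h.2⟩ n
  filter_upwards [h1, anW_congr f (wave_annihilation ⟨ψ, h.1⟩) n] with k e1 e2
  exact e1.trans e2

theorem en_one_add_absSum (ψ : Fock) :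
    en (fun n k => 1 + absSum n k) (wave ψ) = ‖ψ‖ₑ ^ 2 + en absSum (wave ψ) := by
  rw [enorm_sq_eq_en, ← en_rep, ← en_rep, ← en_rep]
  exact en_add one' absSum (fun n => measurable_const) _ (isBose_rep ψ)

theorem real_of_enorm_sq_le {C : ℝ≥0} {a h n k : ℝ} (hh : 0 ≤ h) (hn : 0 ≤ n) (hk : 0 ≤ k)
    (H : ENNReal.ofReal a ^ 2 ≤ (ENNReal.ofReal n ^ 2 + ENNReal.ofReal k ^ 2) *
      (2 * (C : ℝ≥0∞) ^ 2 * ENNReal.ofReal h ^ 2)) : a ≤ 2 * C * h * (n + k) := by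
  rcases le_total a 0 with ha | ha
  · exact ha.trans (by positivity)
  lift a to ℝ≥0 using ha
  lift h to ℝ≥0 using hh
  lift n to ℝ≥0 using hn
  lift k to ℝ≥0 using hk
  simp only [ENNReal.ofReal_coe_nnreal] at H
  have h3 : a ^ 2 ≤ (n ^ 2 + k ^ 2) * (2 * C ^ 2 * h ^ 2) := by exact_mod_cast H
  have h4 : (a : ℝ) ^ 2 ≤ (n ^ 2 + k ^ 2) * (2 * C ^ 2 * h ^ 2) := by exact_mod_cast h3
  refine le_of_sq_le_sq ?_ (by positivity)
  have : 0 ≤ (C : ℝ) ^ 2 * h ^ 2 * (n * k) := by positivity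
  nlinarith [mul_nonneg (sq_nonneg (C : ℝ)) (mul_nonneg (sq_nonneg (h : ℝ))
    (add_nonneg (sq_nonneg (n : ℝ)) (sq_nonneg (k : ℝ))))]

theorem enorm_inner_pair_sq_le {f : R3 → ℂ} (hf : IsFormFactor C f) (y : Fock) {ψ : Fock}
    (h : ψ ∈ (opMul (annihilation f) (annihilation f)).domain) :
    ‖inner ℂ y (opMul (annihilation f) (annihilation f) ⟨ψ, h⟩)‖ₑ ^ 2 ≤
      (‖y‖ₑ ^ 2 + en absSum (wave y)) * (2 * (C : ℝ≥0∞) ^ 2 * en absSum (wave ψ)) := by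
  rw [← en_one_add_absSum]
  refine (enorm_inner_sq_le _ _ (m' := fun n k => (1 + absSum n k)⁻¹)
    measurable_one_add_absSum (fun n => (measurable_one_add_absSum n).inv)
    (fun n => Filter.Eventually.of_forall fun k => Or.inr (le_of_eq ?_))).trans
    (mul_le_mul_right ?_ _)
  · exact (ENNReal.mul_inv_cancel (by simp) (by simp [(absSum_lt_top k).ne])).symm
  · have h1 : en (fun n k => (1 + absSum n k)⁻¹)
          (wave (opMul (annihilation f) (annihilation f) ⟨ψ, h⟩)) =
        en (fun n k => (1 + absSum n k)⁻¹) (anW f (anW f (rep ψ))) := by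
      refine en_congr fun n => ?_
      filter_upwards [wave_annihilation_annihilation h n,
        anW_congr f (fun n => anW_congr f (rep_ae ψ) n) n] with k e1 e2
      rw [e1, e2]
    rw [h1, ← en_rep absSum ψ]
    refine en_anW_anW_le hf.meas hf.meas (isBose_rep _) one_ne_zero ENNReal.one_ne_top ?_ ?_
    · rw [pow_two]
      exact mul_le_mul' hf.int_inv hf.int_inv
    · rw [pow_two, mul_one]
      exact mul_le_mul' hf.int_inv_half hf.int_inv_half

theorem real_sq_le_of_enorm {C : ℝ≥0} {a h : ℝ} (ha : 0 ≤ a) (hh : 0 ≤ h)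
    (H : ENNReal.ofReal a ^ 2 ≤ C * ENNReal.ofReal h ^ 2) : a ^ 2 ≤ C * h ^ 2 := by
  lift a to ℝ≥0 using ha
  lift h to ℝ≥0 using hh
  simp only [ENNReal.ofReal_coe_nnreal] at H
  exact_mod_cast H

theorem norm_sq_le_of_enorm {E : Type*} [SeminormedAddCommGroup E] {C : ℝ≥0} {a h : E}
    (H : ‖a‖ₑ ^ 2 ≤ C * ‖h‖ₑ ^ 2) : ‖a‖ ^ 2 ≤ C * ‖h‖ ^ 2 := by
  refine real_sq_le_of_enorm (norm_nonneg _) (norm_nonneg _) ?_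
  rwa [ofReal_norm, ofReal_norm]

theorem norm_le_of_enorm_sq {E : Type*} [SeminormedAddCommGroup E] {C : ℝ≥0} {z : ℂ} {h n k : E}
    (H : ‖z‖ₑ ^ 2 ≤ (‖n‖ₑ ^ 2 + ‖k‖ₑ ^ 2) * (2 * (C : ℝ≥0∞) ^ 2 * ‖h‖ₑ ^ 2)) :
    ‖z‖ ≤ 2 * C * ‖h‖ * (‖n‖ + ‖k‖) := by
  refine real_of_enorm_sq_le (norm_nonneg _) (norm_nonneg _) (norm_nonneg _) ?_
  rwa [ofReal_norm, ofReal_norm, ofReal_norm, ofReal_norm]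

theorem wave_fieldMomentum {j : Fin 3} (x : (fieldMomentum j).domain) (n : ℕ) :
    ∀ᵐ k, wave (fieldMomentum j x) n k = ((∑ i, k i j : ℝ) : ℂ) * wave x n k := wave_mulOp x n

theorem wave_freeOp (x : freeOp.domain) (n : ℕ) :
    ∀ᵐ k, wave (freeOp x) n k = (freeSymbol n k : ℂ) * wave x n k := wave_mulOp x n

theorem wave_sqrtField (x : sqrtField.domain) (n : ℕ) :
    ∀ᵐ k, wave (sqrtField x) n k = ((Real.sqrt (∑ i, ‖k i‖) : ℝ) : ℂ) * wave x n k :=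
  wave_mulOp x n

theorem inner_fieldMomentum_left {j : Fin 3} (x y : (fieldMomentum j).domain) :
    inner ℂ (fieldMomentum j x) (y : Fock) = inner ℂ (x : Fock) (fieldMomentum j y) :=
  inner_mulOp_left x y

theorem inner_sqrtField_left (x y : sqrtField.domain) :
    inner ℂ (sqrtField x) (y : Fock) = inner ℂ (x : Fock) (sqrtField y) := inner_mulOp_left x y

theorem en_sqrtField (w : Weight) (x : sqrtField.domain) :
    en w (wave (sqrtField x)) = en (fun n k => w n k * absSum n k) (wave x) := by
  refine (en_mulOp w x).trans ?_
  simp only [enorm_sqrtField]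

theorem mem_domain_fieldMomentum {ψ : Fock} {j : Fin 3}
    (h : en (fun _ k => ‖∑ i, k i j‖ₑ ^ 2) (wave ψ) < ⊤) : ψ ∈ (fieldMomentum j).domain :=
  mem_domain_mulOp (fun n => measurable_momentum n j) (fun n => momentum_perm n j) h

attribute [local irreducible] mulOp creation annihilation fieldMomentum freeOp sqrtField

theorem isBounded_nelsonForm (hf : ∀ j, IsFormFactor C (f j)) :
    (nelsonForm f).IsBounded (2 * C) where
  nonneg := by positivity
  A_le j x := by
    have h1 := enorm_annihilation_sq_le (hf j).meas ⟨x, formDom_le_annihilation f j x.2⟩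
    have h2 : ‖(nelsonForm f).A j x‖ ^ 2 ≤ C * ‖(nelsonForm f).H x‖ ^ 2 := by
      refine norm_sq_le_of_enorm ?_
      rw [enorm_H_sq]
      exact h1.trans (mul_le_mul_left (hf j).int_inv _)
    have : 0 ≤ (C : ℝ) * ‖(nelsonForm f).H x‖ ^ 2 := by positivity
    linarith
  B_le j x y := by
    refine norm_le_of_enorm_sq ?_
    rw [enorm_H_sq, enorm_H_sq]
    exact enorm_inner_pair_sq_le (hf j) y (formDom_le_pair f j x.2)

/-! ### The form of the Nelson operator -/

theorem mem_fieldMomentum_sq (j : Fin 3) (x : fdom) :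
    fieldMomentum j ⟨x, fdom_le_fieldMomentum j x.2⟩ ∈ (fieldMomentum j).domain := by
  refine mem_domain_fieldMomentum ?_
  rw [en_fieldMomentum]
  refine lt_of_le_of_lt (en_mono_weight _ fun n k => ?_) (mem_fdom.1 x.2)
  rw [pow_two (freeW n k)]
  exact mul_le_mul' (momentum_sq_le_freeW n k j) (momentum_sq_le_freeW n k j)

theorem fdom_le_sqrtField : fdom ≤ sqrtField.domain := fun ψ h =>
  mem_sqrtField (en_absSum_lt_top ⟨ψ, h⟩)

theorem mem_sqrtField_sq (x : fdom) :
    sqrtField ⟨x, fdom_le_sqrtField x.2⟩ ∈ sqrtField.domain := by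
  refine mem_sqrtField ?_
  rw [en_sqrtField]
  exact lt_of_le_of_lt (en_absSum_sq_le (x : Fock)) (mem_fdom.1 x.2)

theorem free_apply {E : Type*} [NormedAddCommGroup E] [InnerProductSpace ℂ E] (q : QForm E)
    (x y : q.V) : q.free x y = (∑ j, inner ℂ (q.P j x) (q.P j y)) + inner ℂ (q.H x) (q.H y) := by
  simp only [QForm.free, LinearMap.add_apply, LinearMap.sum_apply, sesq_apply]

theorem mixed_apply {E : Type*} [NormedAddCommGroup E] [InnerProductSpace ℂ E] {q : QForm E}
    (x y : q.V) : q.mixed x y = ∑ j, (inner ℂ (q.A j x) (q.P j y) + inner ℂ (q.P j x) (q.A j y)) := by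
  simp only [QForm.mixed, LinearMap.add_apply, LinearMap.sum_apply, sesq_apply]

theorem pair_apply {E : Type*} [NormedAddCommGroup E] [InnerProductSpace ℂ E] {q : QForm E}
    (x y : q.V) : q.pair x y = ∑ j, (inner ℂ (q.B j x) (y : E) + inner ℂ (x : E) (q.B j y)) := by
  simp only [QForm.pair, LinearMap.add_apply, LinearMap.sum_apply, sesq_apply]
  rfl

theorem number_apply {E : Type*} [NormedAddCommGroup E] [InnerProductSpace ℂ E] {q : QForm E}
    (x y : q.V) : q.number x y = ∑ j, inner ℂ (q.A j x) (q.A j y) := by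
  simp only [QForm.number, LinearMap.sum_apply, sesq_apply]

theorem sum_add_eq_inner {E : Type*} [NormedAddCommGroup E] [InnerProductSpace ℂ E]
    {z : E} {a : Fin 3 → E} {b χ : E} {c : Fin 3 → ℂ} {d : ℂ} (hz : z = ∑ j, a j + b)
    (h1 : ∀ j, inner ℂ (a j) χ = c j) (h2 : inner ℂ b χ = d) :
    (∑ j, c j) + d = inner ℂ z χ := by
  rw [hz, inner_add_left, sum_inner, h2]
  simp only [h1]

theorem sum_add_eq_inner_add {E : Type*} [NormedAddCommGroup E] [InnerProductSpace ℂ E]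
    {s p χ : E} {c d : Fin 3 → ℂ} (hs : inner ℂ s χ = ∑ j, c j) (hp : inner ℂ p χ = ∑ j, d j) :
    ∑ j, (d j + c j) = inner ℂ (s + p) χ := by
  rw [inner_add_left, hs, hp, Finset.sum_add_distrib, add_comm]

theorem sum_eq_inner {E : Type*} [NormedAddCommGroup E] [InnerProductSpace ℂ E]
    {s χ : E} {a : Fin 3 → E} {c : Fin 3 → ℂ} (hs : s = ∑ j, a j)
    (h1 : ∀ j, inner ℂ (a j) χ = c j) : ∑ j, c j = inner ℂ s χ := by
  rw [hs, sum_inner]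
  simp only [h1]

theorem inner_interaction_eq {E : Type*} [NormedAddCommGroup E] [InnerProductSpace ℂ E]
    (D s₁ s₂ s₃ s₄ s₅ χ : E) (e : ℝ) {a b c d : ℂ} (ha : a = inner ℂ D χ)
    (hb : b = inner ℂ (s₁ + s₂) χ) (hc : c = inner ℂ (s₃ + s₄) χ) (hd : d = inner ℂ s₅ χ) :
    a + ((2 * e : ℝ) : ℂ) * b + ((e ^ 2 : ℝ) : ℂ) * (c + 2 * d) =
      inner ℂ (D + (((2 * e : ℝ) : ℂ) • (s₁ + s₂) +
        ((e ^ 2 : ℝ) : ℂ) • (s₃ + s₄ + (2 : ℂ) • s₅))) χ := by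
  rw [ha, hb, hc, hd]
  simp only [inner_add_left, inner_smul_left, Complex.conj_ofReal, Complex.conj_ofNat]
  push_cast
  ring

theorem wave_sum_add {a : Fin 3 → Fock} {b : Fock} (n : ℕ) :
    ∀ᵐ k, wave (∑ j, a j + b) n k = wave (a 0) n k + wave (a 1) n k + wave (a 2) n k + wave b n k := by
  rw [Fin.sum_univ_three]
  filter_upwards [wave_add (a 0 + a 1 + a 2) b n, wave_add (a 0 + a 1) (a 2) n,
    wave_add (a 0) (a 1) n] with k h1 h2 h3
  rw [h1, h2, h3]

/-- `D_f = 𝒫² + H_f`. -/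
theorem freeOp_eq_sum (x : fdom) :
    freeOp x = (∑ j, fieldMomentum j ⟨_, mem_fieldMomentum_sq j x⟩) +
      sqrtField ⟨_, mem_sqrtField_sq x⟩ := by
  refine wave_ext fun n => ?_
  have hP : ∀ j, ∀ᵐ k, wave (fieldMomentum j ⟨_, mem_fieldMomentum_sq j x⟩) n k =
      (((∑ i, k i j) * ∑ i, k i j : ℝ) : ℂ) * wave x n k := fun j => by
    have h1 : ∀ᵐ k, wave (fieldMomentum j ⟨_, mem_fieldMomentum_sq j x⟩) n k =
      ((∑ i, k i j : ℝ) : ℂ) * wave (fieldMomentum j ⟨x, fdom_le_fieldMomentum j x.2⟩) n k :=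
      wave_fieldMomentum ⟨_, mem_fieldMomentum_sq j x⟩ n
    have h2 : ∀ᵐ k, wave (fieldMomentum j ⟨x, fdom_le_fieldMomentum j x.2⟩) n k =
      ((∑ i, k i j : ℝ) : ℂ) * wave x n k := wave_fieldMomentum ⟨x, fdom_le_fieldMomentum j x.2⟩ n
    filter_upwards [h1, h2] with k e1 e2
    rw [e1, e2, ← mul_assoc, ← Complex.ofReal_mul]
  have hH : ∀ᵐ k, wave (sqrtField ⟨_, mem_sqrtField_sq x⟩) n k =
      ((∑ i, ‖k i‖ : ℝ) : ℂ) * wave x n k := by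
    have h1 : ∀ᵐ k, wave (sqrtField ⟨_, mem_sqrtField_sq x⟩) n k =
      ((Real.sqrt (∑ i, ‖k i‖) : ℝ) : ℂ) * wave (sqrtField ⟨x, fdom_le_sqrtField x.2⟩) n k :=
      wave_sqrtField ⟨_, mem_sqrtField_sq x⟩ n
    have h2 : ∀ᵐ k, wave (sqrtField ⟨x, fdom_le_sqrtField x.2⟩) n k =
      ((Real.sqrt (∑ i, ‖k i‖) : ℝ) : ℂ) * wave x n k := wave_sqrtField ⟨x, fdom_le_sqrtField x.2⟩ n
    filter_upwards [h1, h2] with k e1 e2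
    rw [e1, e2, ← mul_assoc, ← Complex.ofReal_mul,
      Real.mul_self_sqrt (Finset.sum_nonneg fun i _ => norm_nonneg _)]
  have hD : ∀ᵐ k, wave (freeOp x) n k = (freeSymbol n k : ℂ) * wave x n k := wave_freeOp x n
  have hS := wave_sum_add (a := fun j => fieldMomentum j ⟨_, mem_fieldMomentum_sq j x⟩)
    (b := sqrtField ⟨_, mem_sqrtField_sq x⟩) n
  filter_upwards [hP 0, hP 1, hP 2, hH, hD, hS] with k e0 e1 e2 e3 e4 a1
  refine e4.trans (Eq.trans ?_ a1.symm)
  refine Eq.trans ?_ (congrArg₂ (· + ·) (congrArg₂ (· + ·) (congrArg₂ (· + ·) e0 e1) e2) e3).symm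
  rw [freeSymbol, EuclideanSpace.norm_sq_eq, Fin.sum_univ_three]
  simp only [← momentum_apply, Real.norm_eq_abs, sq_abs]
  push_cast
  ring

theorem free_eq_inner (hf : ∀ j, IsFormFactor C (f j)) (x : fdom) (χ : (nelsonForm f).V) :
    (nelsonForm f).free ⟨x, fdom_le_formDom hf x.2⟩ χ = inner ℂ (freeOp x) (χ : Fock) := by
  have h1 : ∀ j, inner ℂ (fieldMomentum j ⟨_, mem_fieldMomentum_sq j x⟩) (χ : Fock) =
      inner ℂ (fieldMomentum j ⟨x, fdom_le_fieldMomentum j x.2⟩)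
        (fieldMomentum j ⟨χ, formDom_le_fieldMomentum f j χ.2⟩) := fun j =>
    inner_fieldMomentum_left ⟨_, mem_fieldMomentum_sq j x⟩ ⟨χ, formDom_le_fieldMomentum f j χ.2⟩
  have h2 : inner ℂ (sqrtField ⟨_, mem_sqrtField_sq x⟩) (χ : Fock) =
      inner ℂ (sqrtField ⟨x, fdom_le_sqrtField x.2⟩)
        (sqrtField ⟨χ, formDom_le_sqrtField f χ.2⟩) :=
    inner_sqrtField_left ⟨_, mem_sqrtField_sq x⟩ ⟨χ, formDom_le_sqrtField f χ.2⟩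
  exact (free_apply _ _ _).trans (sum_add_eq_inner (freeOp_eq_sum x) h1 h2)

end

section

variable {C : ℝ≥0} {Λ : ℝ} (hf : ∀ j, IsFormFactor C (formFactor Λ j))
include hf

theorem inner_opPA_left (x : fdom) (χ : (nelsonForm (formFactor Λ)).V) :
    inner ℂ (resMap _ (fdom_le_opPA hf) x) (χ : Fock) =
      ∑ j, inner ℂ ((nelsonForm (formFactor Λ)).A j ⟨x, fdom_le_formDom hf x.2⟩)
        ((nelsonForm (formFactor Λ)).P j χ) := by
  have h1 : ∀ j, inner ℂ (resMap _ (fdom_le_fieldMomentum_annihilation (hf j) j) x) (χ : Fock) =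
      inner ℂ (annihilation (formFactor Λ j) ⟨x, fdom_le_annihilation (hf j) x.2⟩)
        (fieldMomentum j ⟨χ, formDom_le_fieldMomentum _ j χ.2⟩) := fun j =>
    inner_fieldMomentum_left ⟨_, (fdom_le_fieldMomentum_annihilation (hf j) j x.2).2⟩
      ⟨χ, formDom_le_fieldMomentum _ j χ.2⟩
  exact (sum_eq_inner (resMap_dot (fun j => fdom_le_fieldMomentum_annihilation (hf j) j) x)
    h1).symm

theorem inner_opAsP_left (x : fdom) (χ : (nelsonForm (formFactor Λ)).V) :
    inner ℂ (resMap _ (fdom_le_opAsP hf) x) (χ : Fock) =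
      ∑ j, inner ℂ ((nelsonForm (formFactor Λ)).P j ⟨x, fdom_le_formDom hf x.2⟩)
        ((nelsonForm (formFactor Λ)).A j χ) := by
  have h2 : ∀ j, inner ℂ (resMap _ (fdom_le_creation_fieldMomentum (hf j) j) x) (χ : Fock) =
      inner ℂ (fieldMomentum j ⟨x, fdom_le_fieldMomentum j x.2⟩)
        (annihilation (formFactor Λ j) ⟨χ, formDom_le_annihilation _ j χ.2⟩) := fun j =>
    inner_creation_left (hf j).meas (hf j).sq_lt_top
      ⟨_, (fdom_le_creation_fieldMomentum (hf j) j x.2).2⟩ ⟨χ, formDom_le_annihilation _ j χ.2⟩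
  exact (sum_eq_inner (resMap_dot (fun j => fdom_le_creation_fieldMomentum (hf j) j) x) h2).symm

theorem inner_opAsAs_left (x : fdom) (χ : (nelsonForm (formFactor Λ)).V) :
    inner ℂ (resMap _ (fdom_le_opAsAs hf) x) (χ : Fock) =
      ∑ j, inner ℂ (x : Fock) ((nelsonForm (formFactor Λ)).B j χ) := by
  have h2 : ∀ j, inner ℂ (resMap _ (fdom_le_creation_creation (hf j)) x) (χ : Fock) =
      inner ℂ (x : Fock) (opMul (annihilation (formFactor Λ j)) (annihilation (formFactor Λ j))
        ⟨χ, formDom_le_pair _ j χ.2⟩) := fun j =>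
    (inner_creation_left (hf j).meas (hf j).sq_lt_top
      ⟨_, (fdom_le_creation_creation (hf j) x.2).2⟩ ⟨χ, formDom_le_annihilation _ j χ.2⟩).trans
    (inner_creation_left (hf j).meas (hf j).sq_lt_top
      ⟨x, fdom_le_creation (hf j) x.2⟩ ⟨_, (formDom_le_pair _ j χ.2).2⟩)
  exact (sum_eq_inner (resMap_dot (fun j => fdom_le_creation_creation (hf j)) x) h2).symm

theorem inner_opAsA_left (x : fdom) (χ : (nelsonForm (formFactor Λ)).V) :
    inner ℂ (resMap _ (fdom_le_opAsA hf) x) (χ : Fock) =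
      ∑ j, inner ℂ ((nelsonForm (formFactor Λ)).A j ⟨x, fdom_le_formDom hf x.2⟩)
        ((nelsonForm (formFactor Λ)).A j χ) := by
  have h2 : ∀ j, inner ℂ (resMap _ (fdom_le_creation_annihilation (hf j)) x) (χ : Fock) =
      inner ℂ (annihilation (formFactor Λ j) ⟨x, fdom_le_annihilation (hf j) x.2⟩)
        (annihilation (formFactor Λ j) ⟨χ, formDom_le_annihilation _ j χ.2⟩) := fun j =>
    inner_creation_left (hf j).meas (hf j).sq_lt_top
      ⟨_, (fdom_le_creation_annihilation (hf j) x.2).2⟩ ⟨χ, formDom_le_annihilation _ j χ.2⟩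
  exact (sum_eq_inner (resMap_dot (fun j => fdom_le_creation_annihilation (hf j)) x) h2).symm

theorem inner_opAA_left (x : fdom) (χ : Fock) :
    inner ℂ (resMap _ (fdom_le_opAA hf) x) χ =
      ∑ j, inner ℂ ((nelsonForm (formFactor Λ)).B j ⟨x, fdom_le_formDom hf x.2⟩) χ :=
  (sum_eq_inner (resMap_dot (fun j => fdom_le_annihilation_annihilation (hf j)) x)
    fun _ => rfl).symm

theorem mixed_eq_inner (x : fdom) (χ : (nelsonForm (formFactor Λ)).V) :
    (nelsonForm (formFactor Λ)).mixed ⟨x, fdom_le_formDom hf x.2⟩ χ =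
      inner ℂ (resMap _ (fdom_le_opAsP hf) x + resMap _ (fdom_le_opPA hf) x) (χ : Fock) :=
  (mixed_apply _ _).trans (sum_add_eq_inner_add (inner_opAsP_left hf x χ)
    (inner_opPA_left hf x χ))

theorem pair_eq_inner (x : fdom) (χ : (nelsonForm (formFactor Λ)).V) :
    (nelsonForm (formFactor Λ)).pair ⟨x, fdom_le_formDom hf x.2⟩ χ =
      inner ℂ (resMap _ (fdom_le_opAsAs hf) x + resMap _ (fdom_le_opAA hf) x) (χ : Fock) :=
  (pair_apply _ _).trans (sum_add_eq_inner_add (inner_opAsAs_left hf x χ)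
    (inner_opAA_left hf x χ))

theorem number_eq_inner (x : fdom) (χ : (nelsonForm (formFactor Λ)).V) :
    (nelsonForm (formFactor Λ)).number ⟨x, fdom_le_formDom hf x.2⟩ χ =
      inner ℂ (resMap _ (fdom_le_opAsA hf) x) (χ : Fock) :=
  (number_apply _ _).trans (inner_opAsA_left hf x χ).symm

theorem form_eq_inner (e : ℝ) (x : fdom) (χ : (nelsonForm (formFactor Λ)).V) :
    (nelsonForm (formFactor Λ)).form e ⟨x, fdom_le_formDom hf x.2⟩ χ =
      inner ℂ (freeOp x + interaction hf e x) (χ : Fock) := by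
  exact (QForm.form_apply _ _ _ _).trans (inner_interaction_eq _ _ _ _ _ _ _ e
    (free_eq_inner hf x χ) (mixed_eq_inner hf x χ) (pair_eq_inner hf x χ) (number_eq_inner hf x χ))

end

/-! ### Self-adjointness -/

section

variable {C : ℝ≥0} {Λ : ℝ} (hf : ∀ j, IsFormFactor C (formFactor Λ j))
include hf

theorem form_eq_inner_nelsonT (e : ℝ) (x : (nelsonT Λ e).domain) (h : (x : Fock) ∈ fdom)
    (χ : (nelsonForm (formFactor Λ)).V) :
    (nelsonForm (formFactor Λ)).form e ⟨x, fdom_le_formDom hf h⟩ χ =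
      inner ℂ (nelsonT Λ e x) (χ : Fock) :=
  (form_eq_inner hf e ⟨x, h⟩ χ).trans
    (congrArg (fun z => inner ℂ z (χ : Fock)) (nelsonT_apply hf x h).symm)

theorem mem_fdom_of_mem_domain {e : ℝ} (x : (nelsonT Λ e).domain) : (x : Fock) ∈ fdom :=
  (domain_nelsonT hf e).le x.2

theorem inner_nelsonT_symm (e : ℝ) (x y : (nelsonT Λ e).domain) :
    inner ℂ (nelsonT Λ e x) (y : Fock) = inner ℂ (x : Fock) (nelsonT Λ e y) := by
  have hx := mem_fdom_of_mem_domain hf x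
  have hy := mem_fdom_of_mem_domain hf y
  have h1 := form_eq_inner_nelsonT hf e x hx ⟨y, fdom_le_formDom hf hy⟩
  have h2 := form_eq_inner_nelsonT hf e y hy ⟨x, fdom_le_formDom hf hx⟩
  have h3 := QForm.conj_form (nelsonForm (formFactor Λ)) e ⟨y, fdom_le_formDom hf hy⟩
    ⟨x, fdom_le_formDom hf hx⟩
  exact h1.symm.trans (h3.symm.trans ((congrArg (starRingEnd ℂ) h2).trans
    (inner_conj_symm (x : Fock) (nelsonT Λ e y))))

/-- `T_Λ` is self-adjoint on the domain of `D_f`, on which its natural domain coincides. -/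
theorem isSelfAdjoint_nelsonT {e : ℝ} (he : 12 * (|e| + e ^ 2) * (C + 1) < 1) :
    IsSelfAdjoint (nelsonT Λ e) := by
  have hdom := domain_nelsonT hf e
  obtain ⟨b, hb, hV⟩ := relBddBy_interaction hf e
  have h1 : ∀ l : ℝ, 0 < l → ∀ x : fdom,
      l * ‖(x : Fock)‖ ≤ ‖freeOp.toFun x + (l : ℂ) • (x : Fock)‖ := fun l hl x => by
    refine (abs_le_of_sq_le_sq' ?_ (norm_nonneg _)).2
    rw [mul_pow]
    exact le_trans (le_add_of_nonneg_left (sq_nonneg _)) (norm_freeOp_add_smul_sq hl x)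
  have h2 : ∀ l : ℝ, 0 < l → ∀ x : fdom,
      ‖freeOp.toFun x‖ ≤ ‖freeOp.toFun x + (l : ℂ) • (x : Fock)‖ := fun l hl x => by
    refine (abs_le_of_sq_le_sq' ?_ (norm_nonneg _)).2
    exact le_trans (le_add_of_nonneg_right (by positivity)) (norm_freeOp_add_smul_sq hl x)
  obtain ⟨l, hl⟩ := exists_surjective_add_of_relatively_bounded freeOp.toFun (interaction hf e)
    (fun l hl η => exists_freeOp_add_smul hl η) h1 h2 (by positivity) he hb hV
  refine isSelfAdjoint_of_symmetric_of_surjective ?_ (inner_nelsonT_symm hf e) l fun η => ?_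
  · rw [hdom]
    exact dense_fdom
  · obtain ⟨x, hx⟩ := hl η
    refine ⟨⟨x, hdom.ge x.2⟩, ?_⟩
    rw [nelsonT_apply hf ⟨x, hdom.ge x.2⟩ x.2]
    exact hx

end

/-! ### Inverting the free operator -/

/-- The weight `D_f⁻²`. -/
def resW : Weight := fun n k => (freeW n k ^ 2)⁻¹

/-- The weight `H_f⁻¹`. -/
def invSum : Weight := fun n k => (absSum n k)⁻¹

/-- The weight `H_f⁻²`. -/
def invSumSq : Weight := fun n k => (absSum n k ^ 2)⁻¹

theorem isBoseWeight_invSum : IsBoseWeight invSum where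
  meas n := (isBoseWeight_absSum.meas n).inv
  symm n σ k := by unfold invSum; rw [isBoseWeight_absSum.symm]

theorem isBoseWeight_invSumSq : IsBoseWeight invSumSq where
  meas n := ((isBoseWeight_absSum.meas n).pow_const 2).inv
  symm n σ k := by unfold invSumSq; rw [isBoseWeight_absSum.symm]

theorem measurable_resW (n : ℕ) : Measurable (resW n) :=
  ((isBoseWeight_freeW.meas n).pow_const 2).inv

theorem resW_le_invSumSq (n : ℕ) (k : Config n) : resW n k ≤ invSumSq n k :=
  ENNReal.inv_le_inv.2 (pow_le_pow_left' (absSum_le_freeW n k) 2)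

theorem one_add_mul_inv {q s : ℝ≥0∞} (hq : q ≠ 0) (hq' : q ≠ ⊤) :
    1 + s * q⁻¹ = (q + s) * q⁻¹ := by
  rw [add_mul, ENNReal.mul_inv_cancel hq hq']

theorem en_invSumSq_crW_le {f : R3 → ℂ} (hf : Measurable f) (ψ : Fock) :
    en invSumSq (crW f (wave ψ)) ≤ (∫⁻ q, ‖f q‖ₑ ^ 2 * ‖q‖ₑ⁻¹) * en invSum (wave ψ) := by
  rw [← en_rep, ← en_congr (crW_congr f (rep_ae ψ))]
  have h := en_crW_le_of_weight (N := 1) hf (isBose_rep ψ) isBoseWeight_invSumSq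
    (a := fun _ q => ‖q‖ₑ⁻¹) (b := fun _ => invSum) (fun _ => measurable_enorm.inv)
    (fun _ => isBoseWeight_invSum) (fun n q k hq => by
      have hq0 : ‖q‖ₑ ≠ 0 := by simpa using hq
      rw [one_add_mul_inv hq0 enorm_ne_top, Fin.sum_univ_one]
      unfold invSumSq invSum
      rw [absSum_cons]
      have h1 : ‖q‖ₑ + absSum n k ≠ 0 := by simp [hq]
      have h2 : ‖q‖ₑ + absSum n k ≠ ⊤ := by simp [(absSum_lt_top k).ne]
      calc ((‖q‖ₑ + absSum n k) ^ 2)⁻¹ * ((‖q‖ₑ + absSum n k) * ‖q‖ₑ⁻¹)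
          = ‖q‖ₑ⁻¹ * (‖q‖ₑ + absSum n k)⁻¹ *
            ((‖q‖ₑ + absSum n k) * (‖q‖ₑ + absSum n k)⁻¹) := by
            rw [ENNReal.inv_pow]; ring
        _ = ‖q‖ₑ⁻¹ * (‖q‖ₑ + absSum n k)⁻¹ := by rw [ENNReal.mul_inv_cancel h1 h2, mul_one]
        _ ≤ _ := by gcongr; exact le_add_self)
  simpa only [Fin.sum_univ_one] using h

theorem en_invSum_crW_le {f : R3 → ℂ} (hf : Measurable f) (ψ : Fock) :
    en invSum (crW f (wave ψ)) ≤ (∫⁻ q, ‖f q‖ₑ ^ 2 * ‖q‖ₑ⁻¹) * en one' (wave ψ) := by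
  rw [← en_rep, ← en_congr (crW_congr f (rep_ae ψ))]
  have h := en_crW_le_of_weight (N := 1) hf (isBose_rep ψ) isBoseWeight_invSum
    (a := fun _ q => ‖q‖ₑ⁻¹) (b := fun _ => one') (fun _ => measurable_enorm.inv)
    (fun _ => isBoseWeight_one) (fun n q k hq => by
      have hq0 : ‖q‖ₑ ≠ 0 := by simpa using hq
      rw [one_add_mul_inv hq0 enorm_ne_top, Fin.sum_univ_one]
      unfold invSum one'
      rw [absSum_cons]
      have h1 : ‖q‖ₑ + absSum n k ≠ 0 := by simp [hq]
      have h2 : ‖q‖ₑ + absSum n k ≠ ⊤ := by simp [(absSum_lt_top k).ne]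
      rw [← mul_assoc, ENNReal.inv_mul_cancel h1 h2, one_mul, mul_one])
  simpa only [Fin.sum_univ_one] using h

theorem enorm_inv_le' (x : ℝ) : ‖x⁻¹‖ₑ ≤ ‖x‖ₑ⁻¹ := by
  rcases eq_or_ne x 0 with rfl | h
  · simp
  · rw [enorm_inv h]

theorem enorm_freeSymbol_inv_sq_le (n : ℕ) (k : Config n) :
    ‖(freeSymbol n k)⁻¹‖ₑ ^ 2 ≤ resW n k := by
  unfold resW
  rw [← enorm_freeSymbol, ENNReal.inv_pow]
  exact pow_le_pow_left' (enorm_inv_le' _) 2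

theorem mem_freeInv {y : Fock} (h : en resW (wave y) < ⊤) : y ∈ freeInv.domain := by
  refine mem_domain_mulOp (fun n => (measurable_freeSymbol n).inv)
    (fun n σ k => congrArg (·⁻¹) (freeSymbol_perm n σ k)) ?_
  exact lt_of_le_of_lt (en_mono_weight _ enorm_freeSymbol_inv_sq_le) h

theorem wave_freeInv (y : freeInv.domain) (n : ℕ) :
    ∀ᵐ k, wave (freeInv y) n k = (((freeSymbol n k)⁻¹ : ℝ) : ℂ) * wave y n k := wave_mulOp y n

theorem en_freeInv_le (y : freeInv.domain) (m : Weight) :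
    en m (wave (freeInv y)) ≤ en (fun n k => m n k * resW n k) (wave y) := by
  refine (en_mulOp m y).trans_le (en_mono_weight _ fun n k => ?_)
  exact mul_le_mul_right (enorm_freeSymbol_inv_sq_le n k) _

theorem freeInv_mem_fdom (y : freeInv.domain) : freeInv y ∈ fdom := by
  rw [mem_fdom]
  refine lt_of_le_of_lt (en_freeInv_le y _) (lt_of_le_of_lt (en_mono_weight (m' := one') _
    fun n k => ?_) (en_wave_lt_top (y : Fock)))
  exact ENNReal.mul_inv_le_one _

theorem freeSymbol_pos {n : ℕ} (hn : n ≠ 0) {k : Config n} (hk : ∀ i, k i ≠ 0) :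
    0 < freeSymbol n k := by
  have : Nonempty (Fin n) := Fin.pos_iff_nonempty.1 (Nat.pos_of_ne_zero hn)
  have h : 0 < ∑ i, ‖k i‖ :=
    Finset.sum_pos (fun i _ => norm_pos_iff.2 (hk i)) Finset.univ_nonempty
  unfold freeSymbol
  positivity

theorem freeOp_freeInv (y : freeInv.domain) (h0 : ∀ᵐ k, wave y 0 k = 0) :
    freeOp ⟨freeInv y, freeInv_mem_fdom y⟩ = y := by
  refine wave_ext fun n => ?_
  have h1 : ∀ᵐ k, wave (freeOp ⟨freeInv y, freeInv_mem_fdom y⟩) n k =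
    (freeSymbol n k : ℂ) * wave (freeInv y) n k := wave_freeOp ⟨freeInv y, freeInv_mem_fdom y⟩ n
  rcases eq_or_ne n 0 with rfl | hn
  · filter_upwards [h1, wave_freeInv y 0, h0] with k e1 e2 e3
    rw [e1, e2, e3, mul_zero, mul_zero]
  · filter_upwards [h1, wave_freeInv y n, ae_forall_ne_zero n] with k e1 e2 e3
    rw [e1, e2, ← mul_assoc, ← Complex.ofReal_mul, mul_inv_cancel₀ (freeSymbol_pos hn e3).ne',
      Complex.ofReal_one, one_mul]

theorem enorm_add_three_sq_le (a b c : ℂ) :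
    ‖a + b + c‖ₑ ^ 2 ≤ 3 * (‖a‖ₑ ^ 2 + ‖b‖ₑ ^ 2 + ‖c‖ₑ ^ 2) := by
  have h : ‖a + b + c‖ ^ 2 ≤ 3 * (‖a‖ ^ 2 + ‖b‖ ^ 2 + ‖c‖ ^ 2) := by
    have h1 := norm_add₃_le (a := a) (b := b) (c := c)
    have h2 : ‖a + b + c‖ ^ 2 ≤ (‖a‖ + ‖b‖ + ‖c‖) ^ 2 := by gcongr
    nlinarith [sq_nonneg (‖a‖ - ‖b‖), sq_nonneg (‖b‖ - ‖c‖), sq_nonneg (‖a‖ - ‖c‖)]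
  simp only [← ofReal_norm, ← ENNReal.ofReal_pow (norm_nonneg _)]
  rw [← ENNReal.ofReal_add (by positivity) (by positivity),
    ← ENNReal.ofReal_add (by positivity) (by positivity),
    show (3 : ℝ≥0∞) = ENNReal.ofReal 3 by simp, ← ENNReal.ofReal_mul (by norm_num)]
  exact ENNReal.ofReal_le_ofReal h

theorem wave_sum_three (a : Fin 3 → Fock) (n : ℕ) :
    ∀ᵐ k, wave (∑ j, a j) n k = wave (a 0) n k + wave (a 1) n k + wave (a 2) n k := by
  rw [Fin.sum_univ_three]
  filter_upwards [wave_add (a 0 + a 1) (a 2) n, wave_add (a 0) (a 1) n] with k h2 h3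
  rw [h2, h3]

theorem en_sum_three_le {m : Weight} (hm : ∀ n, Measurable (m n)) (a : Fin 3 → Fock) {B : ℝ≥0∞}
    (h : ∀ j, en m (wave (a j)) ≤ B) : en m (wave (∑ j, a j)) ≤ 9 * B := by
  have h1 : en m (wave (∑ j, a j)) ≤
      3 * (en m (wave (a 0)) + en m (wave (a 1)) + en m (wave (a 2))) := by
    unfold en
    rw [← ENNReal.tsum_add, ← ENNReal.tsum_add, ← ENNReal.tsum_mul_left]
    refine ENNReal.tsum_le_tsum fun n => ?_
    have hmm : ∀ j, Measurable fun k => m n k * ‖wave (a j) n k‖ₑ ^ 2 := fun j =>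
      (hm n).mul ((measurable_wave (a j) n).enorm.pow_const 2)
    have h01 : Measurable fun k =>
        m n k * ‖wave (a 0) n k‖ₑ ^ 2 + m n k * ‖wave (a 1) n k‖ₑ ^ 2 := (hmm 0).add (hmm 1)
    have h012 : Measurable fun k => m n k * ‖wave (a 0) n k‖ₑ ^ 2 +
        m n k * ‖wave (a 1) n k‖ₑ ^ 2 + m n k * ‖wave (a 2) n k‖ₑ ^ 2 := h01.add (hmm 2)
    rw [← lintegral_add_left (hmm 0), ← lintegral_add_left h01, ← lintegral_const_mul _ h012]
    refine lintegral_mono_ae ?_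
    filter_upwards [wave_sum_three a n] with k hk
    rw [hk]
    refine (mul_le_mul_right (enorm_add_three_sq_le _ _ _) _).trans (le_of_eq ?_)
    ring
  calc _ ≤ 3 * (B + B + B) := h1.trans (by gcongr <;> exact h _)
    _ = 9 * B := by ring

/-! ### Sectors of the Fock space -/

/-- The `n`-boson sector. -/
def sector (n : ℕ) : Submodule ℂ Fock where
  carrier := {ψ | ∀ m, m ≠ n → ∀ᵐ k, wave ψ m k = 0}
  add_mem' := by
    intro a b ha hb m hm
    filter_upwards [ha m hm, hb m hm, wave_add a b m] with k h1 h2 h3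
    rw [h3, h1, h2, add_zero]
  zero_mem' := fun m _ => wave_zero m
  smul_mem' := by
    intro c a ha m hm
    filter_upwards [ha m hm, wave_smul c a m] with k h1 h3
    rw [h3, h1, mul_zero]

theorem creation_mem_sector {f : R3 → ℂ} {n : ℕ} (x : (creation f).domain)
    (hx : (x : Fock) ∈ sector n) : creation f x ∈ sector (n + 1) := by
  intro m hm
  cases m with
  | zero =>
    filter_upwards [wave_creation x 0] with k hk
    rw [hk, crW]
  | succ l =>
    have h : ∀ j : Fin (l + 1), ∀ᵐ k : Config (l + 1), wave (x : Fock) l (j.removeNth k) = 0 :=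
      fun j => (quasiMeasurePreserving_removeNth j).ae (hx l (by omega))
    filter_upwards [wave_creation x (l + 1), ae_all_iff.2 h] with k hk h2
    rw [hk, crW]
    simp only [h2, mul_zero, Finset.sum_const_zero]

theorem annihilation_mem_sector {f : R3 → ℂ} {n : ℕ} (x : (annihilation f).domain)
    (hx : (x : Fock) ∈ sector (n + 1)) : annihilation f x ∈ sector n := by
  intro m hm
  filter_upwards [wave_annihilation x m, ae_ae_cons (hx (m + 1) (by omega))] with k hk h2
  rw [hk, anW, integral_eq_zero_of_ae, mul_zero]
  filter_upwards [h2] with q hq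
  rw [hq, mul_zero]
  rfl

theorem annihilation_of_mem_sector_zero {f : R3 → ℂ} (x : (annihilation f).domain)
    (hx : (x : Fock) ∈ sector 0) : annihilation f x = 0 := by
  refine wave_ext fun m => ?_
  filter_upwards [wave_annihilation x m, ae_ae_cons (hx (m + 1) (by omega)), wave_zero m]
    with k hk h2 h3
  rw [hk, h3, anW, integral_eq_zero_of_ae, mul_zero]
  filter_upwards [h2] with q hq
  rw [hq, mul_zero]
  rfl

theorem mulOp_mem_sector {s : (n : ℕ) → Config n → ℝ} {n : ℕ} (x : (mulOp s).domain)
    (hx : (x : Fock) ∈ sector n) : mulOp s x ∈ sector n := by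
  intro m hm
  filter_upwards [wave_mulOp x m, hx m hm] with k hk h
  rw [hk, h, mul_zero]

theorem inner_eq_zero_of_sector {a b : Fock} {n m : ℕ} (hnm : n ≠ m) (ha : a ∈ sector n)
    (hb : b ∈ sector m) : inner ℂ a b = 0 := by
  have h := hasSum_inner_wave a b
  refine h.unique ?_
  refine (congrArg (fun F => HasSum F (0 : ℂ)) (funext fun l => ?_)).mp hasSum_zero
  symm
  refine integral_eq_zero_of_ae ?_
  rcases eq_or_ne l n with rfl | hl
  · filter_upwards [hb l hnm] with k hk
    rw [hk, mul_zero]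
    rfl
  · filter_upwards [ha l hl] with k hk
    rw [hk, map_zero, zero_mul]
    rfl

theorem wave_vacuum_zero : ∀ᵐ k, wave vacuum 0 k = 1 := by
  have h : ((vacuum 0 : symL2 0) : Lp ℂ 2 (volume : Measure (Config 0))) =
      (vacuumWave : Lp ℂ 2 (volume : Measure (Config 0))) := by
    rw [vacuum, lp.single_apply_self]
  unfold wave
  rw [h]
  filter_upwards [indicatorConstLp_coeFn (p := 2) (hs := MeasurableSet.univ)
    (hμs := volume_config_zero_ne_top) (c := (1 : ℂ))] with k hk
  exact hk.trans (by simp)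

theorem vacuum_mem_sector : vacuum ∈ sector 0 := by
  intro m hm
  have h : ((vacuum m : symL2 m) : Lp ℂ 2 (volume : Measure (Config m))) = 0 := by
    rw [vacuum, lp.single_apply_ne _ _ _ hm]
    rfl
  unfold wave
  rw [h]
  exact Lp.coeFn_zero _ _ _

theorem volume_config_zero : (volume : Measure (Config 0)) = Measure.dirac default := by
  rw [volume_pi, Measure.pi_of_empty]
  congr 1
  exact Subsingleton.elim _ _

/-- The vacuum spans the `0`-boson sector. -/
theorem exists_eq_smul_vacuum {a : Fock} (ha : a ∈ sector 0) : ∃ c : ℂ, a = c • vacuum := by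
  refine ⟨wave a 0 default, wave_ext fun m => ?_⟩
  rcases eq_or_ne m 0 with rfl | hm
  · filter_upwards [wave_smul (wave a 0 default) vacuum 0, wave_vacuum_zero] with k h1 h2
    rw [h1, h2, mul_one, Subsingleton.elim k default]
  · filter_upwards [wave_smul (wave a 0 default) vacuum m, ha m hm, vacuum_mem_sector m hm]
      with k h1 h2 h3
    rw [h1, h2, h3, mul_zero]

theorem en_vacuum (m : Weight) : en m (wave vacuum) = m 0 default := by
  unfold en
  rw [tsum_eq_single 0]
  · have h : ∀ᵐ k, m 0 k * ‖wave vacuum 0 k‖ₑ ^ 2 = m 0 default := by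
      filter_upwards [wave_vacuum_zero] with k hk
      rw [hk, enorm_one, one_pow, mul_one, Subsingleton.elim k default]
    rw [lintegral_congr_ae h, volume_config_zero]
    simp
  · intro l hl
    refine (lintegral_congr_ae ?_).trans lintegral_zero
    filter_upwards [vacuum_mem_sector l hl] with k hk
    simp [hk]

/-! ### Pointwise bounds on wave functions -/

theorem sq_add_three_le (a b c : ℝ≥0∞) : (a + b + c) ^ 2 ≤ 3 * (a ^ 2 + b ^ 2 + c ^ 2) := by
  rcases eq_or_ne a ⊤ with rfl | ha
  · simp
  rcases eq_or_ne b ⊤ with rfl | hb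
  · simp
  rcases eq_or_ne c ⊤ with rfl | hc
  · simp
  lift a to ℝ≥0 using ha
  lift b to ℝ≥0 using hb
  lift c to ℝ≥0 using hc
  norm_cast
  rw [← NNReal.coe_le_coe]
  push_cast
  nlinarith [sq_nonneg ((a : ℝ) - b), sq_nonneg ((b : ℝ) - c), sq_nonneg ((a : ℝ) - c)]

/-- The sum of the absolute values of the three form factors. -/
def radial (f : Fin 3 → R3 → ℂ) (q : R3) : ℝ≥0∞ := ∑ j, ‖f j q‖ₑ

/-- The product of `radial f` over all bosons. -/
def prodW (f : Fin 3 → R3 → ℂ) (n : ℕ) (k : Config n) : ℝ≥0∞ := ∏ i, radial f (k i)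

section

variable {f : Fin 3 → R3 → ℂ}

theorem measurable_radial (hf : ∀ j, Measurable (f j)) : Measurable (radial f) :=
  Finset.measurable_sum _ fun j _ => (hf j).enorm

theorem enorm_le_radial (j : Fin 3) (q : R3) : ‖f j q‖ₑ ≤ radial f q :=
  Finset.single_le_sum (f := fun j => ‖f j q‖ₑ) (fun _ _ => zero_le) (Finset.mem_univ j)

theorem lintegral_radial_sq_le (hf : ∀ j, Measurable (f j)) {t : R3 → ℝ≥0∞} (ht : Measurable t)
    {M : ℝ≥0∞} (h : ∀ j, ∫⁻ q, ‖f j q‖ₑ ^ 2 * t q ≤ M) : ∫⁻ q, radial f q ^ 2 * t q ≤ 9 * M := by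
  have hm : ∀ j, Measurable fun q => ‖f j q‖ₑ ^ 2 * t q := fun j =>
    ((hf j).enorm.pow_const 2).mul ht
  calc ∫⁻ q, radial f q ^ 2 * t q
      ≤ ∫⁻ q, 3 * ∑ j, ‖f j q‖ₑ ^ 2 * t q := by
        refine lintegral_mono fun q => ?_
        simp only [radial, Fin.sum_univ_three]
        refine (mul_le_mul_left (sq_add_three_le _ _ _) _).trans (le_of_eq ?_)
        ring
    _ = 3 * ∑ j, ∫⁻ q, ‖f j q‖ₑ ^ 2 * t q := by
        rw [lintegral_const_mul _ (Finset.measurable_sum _ fun j _ => hm j),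
          lintegral_finsetSum _ fun j _ => hm j]
    _ ≤ 3 * ∑ _j : Fin 3, M := by gcongr; exact h _
    _ = 9 * M := by rw [Fin.sum_univ_three]; ring

theorem prodW_succAbove (n : ℕ) (k : Config (n + 1)) (a : Fin (n + 1)) :
    prodW f (n + 1) k = radial f (k a) * prodW f n (a.removeNth k) := by
  unfold prodW
  rw [Fin.prod_univ_succAbove _ a]
  rfl

theorem prodW_cons (n : ℕ) (q : R3) (k : Config n) :
    prodW f (n + 1) (Fin.cons q k) = radial f q * prodW f n k := by
  simp [prodW, Fin.prod_univ_succ]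

theorem enorm_inv_sqrt_le (n : ℕ) : ‖(((Real.sqrt (n + 1) : ℝ) : ℂ))⁻¹‖ₑ ≤ 1 := by
  rw [← ofReal_norm, ENNReal.ofReal_le_one, norm_inv, Complex.norm_real, Real.norm_eq_abs,
    abs_of_nonneg (Real.sqrt_nonneg _)]
  refine inv_le_one_of_one_le₀ (Real.one_le_sqrt.2 ?_)
  linarith [Nat.cast_nonneg (α := ℝ) n]

theorem enorm_sqrt_le (n : ℕ) : ‖(((Real.sqrt (n + 1) : ℝ) : ℂ))‖ₑ ≤ (n : ℝ≥0∞) + 1 := by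
  rw [← ofReal_norm, Complex.norm_real, Real.norm_eq_abs, abs_of_nonneg (Real.sqrt_nonneg _)]
  have h : (n : ℝ≥0∞) + 1 = ENNReal.ofReal (n + 1) := by
    rw [ENNReal.ofReal_add (by positivity) zero_le_one]
    simp
  rw [h]
  refine ENNReal.ofReal_le_ofReal (Real.sqrt_le_iff.2 ⟨by positivity, ?_⟩)
  nlinarith [Nat.cast_nonneg (α := ℝ) n]

theorem enorm_crW_le {g : Wave} {n : ℕ} {B : ℝ≥0∞} {k : Config (n + 1)} (j : Fin 3)
    (h : ∀ a : Fin (n + 1), ‖g n (a.removeNth k)‖ₑ ≤ B * prodW f n (a.removeNth k)) :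
    ‖crW (f j) g (n + 1) k‖ₑ ≤
      ∑ a : Fin (n + 1), ‖f j (k a)‖ₑ * (B * prodW f n (a.removeNth k)) := by
  rw [crW, enorm_mul]
  refine (mul_le_mul' (enorm_inv_sqrt_le n) (enorm_sum_le _ _)).trans ?_
  rw [one_mul]
  refine Finset.sum_le_sum fun a _ => ?_
  rw [enorm_mul]
  exact mul_le_mul_right (h a) _

theorem ae_removeNth_le {g : Wave} {n : ℕ} {B : ℝ≥0∞}
    (h : ∀ᵐ k, ‖g n k‖ₑ ≤ B * prodW f n k) : ∀ᵐ k : Config (n + 1), ∀ a : Fin (n + 1),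
      ‖g n (a.removeNth k)‖ₑ ≤ B * prodW f n (a.removeNth k) :=
  ae_all_iff.2 fun a => (quasiMeasurePreserving_removeNth a).ae h

theorem enorm_wave_creation_le {n : ℕ} {B : ℝ≥0∞} (j : Fin 3) (x : (creation (f j)).domain)
    (h : ∀ᵐ k, ‖wave (x : Fock) n k‖ₑ ≤ B * prodW f n k) :
    ∀ᵐ k, ‖wave (creation (f j) x) (n + 1) k‖ₑ ≤ ((n + 1 : ℕ) : ℝ≥0∞) * B * prodW f (n + 1) k := by
  filter_upwards [wave_creation x (n + 1), ae_removeNth_le h] with k h1 h2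
  rw [h1]
  refine (enorm_crW_le j h2).trans ?_
  calc ∑ a : Fin (n + 1), ‖f j (k a)‖ₑ * (B * prodW f n (a.removeNth k))
      ≤ ∑ _a : Fin (n + 1), B * prodW f (n + 1) k := by
        refine Finset.sum_le_sum fun a _ => ?_
        rw [prodW_succAbove n k a, mul_left_comm]
        gcongr
        exact enorm_le_radial j _
    _ = _ := by
        rw [Finset.sum_const, Finset.card_univ, Fintype.card_fin, nsmul_eq_mul]
        ring

theorem enorm_wave_sum_creation_le {n : ℕ} {B : ℝ≥0∞} (x : ∀ j, (creation (f j)).domain)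
    (h : ∀ j, ∀ᵐ k, ‖wave (x j : Fock) n k‖ₑ ≤ B * prodW f n k) :
    ∀ᵐ k, ‖wave (∑ j, creation (f j) (x j)) (n + 1) k‖ₑ ≤
      ((n + 1 : ℕ) : ℝ≥0∞) * B * prodW f (n + 1) k := by
  have h1 := fun j => wave_creation (x j) (n + 1)
  filter_upwards [h1 0, h1 1, h1 2, wave_sum_three (fun j => creation (f j) (x j)) (n + 1),
    ae_removeNth_le (h 0), ae_removeNth_le (h 1), ae_removeNth_le (h 2)]
    with k a0 a1 a2 hs b0 b1 b2
  rw [hs, a0, a1, a2]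
  refine (enorm_add_le _ _).trans ((add_le_add (enorm_add_le _ _) le_rfl).trans ?_)
  refine (add_le_add (add_le_add (enorm_crW_le 0 b0) (enorm_crW_le 1 b1))
    (enorm_crW_le 2 b2)).trans (le_of_eq ?_)
  rw [← Finset.sum_add_distrib, ← Finset.sum_add_distrib]
  calc _ = ∑ _a : Fin (n + 1), B * prodW f (n + 1) k := by
        refine Finset.sum_congr rfl fun a _ => ?_
        rw [prodW_succAbove n k a, radial, Fin.sum_univ_three]
        ring
    _ = _ := by
        rw [Finset.sum_const, Finset.card_univ, Fintype.card_fin, nsmul_eq_mul]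
        ring

theorem enorm_wave_annihilation_le (hf : ∀ j, Measurable (f j)) {n : ℕ} {B M : ℝ≥0∞} (j : Fin 3)
    (x : (annihilation (f j)).domain) {t : R3 → ℝ≥0∞} (ht : Measurable t)
    (hM : ∫⁻ q, radial f q ^ 2 * t q ≤ M) {φ : Config n → ℝ≥0∞}
    (h : ∀ᵐ K : Config (n + 1), ‖wave (x : Fock) (n + 1) K‖ₑ ≤
      B * (radial f (K 0) * t (K 0)) * φ (Fin.tail K)) :
    ∀ᵐ k, ‖wave (annihilation (f j) x) n k‖ₑ ≤ ((n + 1 : ℕ) : ℝ≥0∞) * B * M * φ k := by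
  filter_upwards [wave_annihilation x n, ae_ae_cons h] with k h1 h2
  rw [h1, anW, enorm_mul]
  have h3 : ‖∫ q, (starRingEnd ℂ) (f j q) * wave (x : Fock) (n + 1) (Fin.cons q k)‖ₑ ≤
      B * φ k * M := by
    refine (enorm_integral_le_lintegral_enorm _).trans ?_
    calc ∫⁻ q, ‖(starRingEnd ℂ) (f j q) * wave (x : Fock) (n + 1) (Fin.cons q k)‖ₑ
        ≤ ∫⁻ q, (B * φ k) * (radial f q ^ 2 * t q) := by
          refine lintegral_mono_ae ?_
          filter_upwards [h2] with q hq
          rw [Fin.cons_zero, Fin.tail_cons] at hq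
          rw [enorm_mul, RCLike.enorm_conj]
          refine (mul_le_mul' (enorm_le_radial j q) hq).trans (le_of_eq ?_)
          ring
      _ = (B * φ k) * ∫⁻ q, radial f q ^ 2 * t q :=
          lintegral_const_mul _ (((measurable_radial hf).pow_const 2).mul ht)
      _ ≤ _ := by gcongr
  refine (mul_le_mul' (enorm_sqrt_le n) h3).trans (le_of_eq ?_)
  push_cast
  ring

theorem enorm_wave_freeInv_le {n : ℕ} {B : ℝ≥0∞} (y : freeInv.domain)
    (h : ∀ᵐ k, ‖wave (y : Fock) n k‖ₑ ≤ B * prodW f n k) :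
    ∀ᵐ k, ‖wave (freeInv y) n k‖ₑ ≤ B * prodW f n k * (freeW n k)⁻¹ := by
  filter_upwards [wave_freeInv y n, h] with k h1 h2
  rw [h1, enorm_mul, mul_comm]
  refine mul_le_mul' h2 ?_
  rw [← enorm_freeSymbol, ← ofReal_norm, Complex.norm_real, ofReal_norm]
  exact enorm_inv_le' _

theorem enorm_wave_fieldMomentum_le {n : ℕ} {B : ℝ≥0∞} {j : Fin 3} (x : (fieldMomentum j).domain)
    (h : ∀ᵐ k, ‖wave (x : Fock) n k‖ₑ ≤ B * prodW f n k * (freeW n k)⁻¹) :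
    ∀ᵐ k, ‖wave (fieldMomentum j x) n k‖ₑ ≤ B * prodW f n k := by
  filter_upwards [wave_fieldMomentum x n, h] with k h1 h2
  rw [h1, enorm_mul, ← ofReal_norm (((∑ i, k i j : ℝ) : ℂ)), Complex.norm_real, ofReal_norm]
  refine (mul_le_mul' ((momentum_le_absSum n k j).trans (absSum_le_freeW n k)) h2).trans ?_
  rw [mul_left_comm]
  refine (mul_le_mul_right (ENNReal.mul_inv_le_one _) _).trans ?_
  rw [mul_one]

theorem lintegral_config_one {F : R3 → ℝ≥0∞} (hF : Measurable F) :
    ∫⁻ k : Config 1, F (k 0) = ∫⁻ q, F q := by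
  have h := volume_preserving_funUnique (Fin 1) R3
  exact h.lintegral_comp hF

/-- One boson vectors bounded by the form factor have finite norm with respect to `H_f⁻¹`. -/
theorem en_invSum_le_of_sector (hf : ∀ j, Measurable (f j)) {M B : ℝ≥0∞}
    (hM : ∫⁻ q, radial f q ^ 2 * ‖q‖ₑ⁻¹ ≤ M) {ψ : Fock} (hψ : ψ ∈ sector 1)
    (h : ∀ᵐ k, ‖wave ψ 1 k‖ₑ ≤ B * prodW f 1 k) : en invSum (wave ψ) ≤ B ^ 2 * M := by
  have hmeas : Measurable fun q : R3 => radial f q ^ 2 * ‖q‖ₑ⁻¹ :=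
    ((measurable_radial hf).pow_const 2).mul measurable_enorm.inv
  unfold en
  rw [tsum_eq_single 1]
  · calc ∫⁻ k, invSum 1 k * ‖wave ψ 1 k‖ₑ ^ 2
        ≤ ∫⁻ k : Config 1, (fun q => B ^ 2 * (radial f q ^ 2 * ‖q‖ₑ⁻¹)) (k 0) := by
          refine lintegral_mono_ae ?_
          filter_upwards [h] with k hk
          refine (mul_le_mul_right (pow_le_pow_left' hk 2) _).trans (le_of_eq ?_)
          simp only [invSum, absSum, prodW, Fin.sum_univ_one, Fin.prod_univ_one]
          ring
      _ = ∫⁻ q, B ^ 2 * (radial f q ^ 2 * ‖q‖ₑ⁻¹) := lintegral_config_one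
          (hmeas.const_mul _)
      _ ≤ B ^ 2 * M := by
          rw [lintegral_const_mul _ hmeas]
          gcongr
  · intro m hm
    refine (lintegral_congr_ae ?_).trans lintegral_zero
    filter_upwards [hψ m hm] with k hk
    simp [hk]

end

/-! ### The vectors of second order perturbation theory -/

section

/-- The solution `D_f⁻¹ y` of `D_f x = y`. -/
def solve (y : Fock) (h : en resW (wave y) < ⊤) : fdom :=
  ⟨freeInv ⟨y, mem_freeInv h⟩, freeInv_mem_fdom _⟩

theorem freeOp_solve {y : Fock} (h : en resW (wave y) < ⊤) {n : ℕ} (hn : n ≠ 0)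
    (hy : y ∈ sector n) : freeOp (solve y h) = y :=
  freeOp_freeInv ⟨y, mem_freeInv h⟩ (hy 0 hn.symm)

theorem solve_mem_sector {y : Fock} (h : en resW (wave y) < ⊤) {n : ℕ} (hy : y ∈ sector n) :
    (solve y h : Fock) ∈ sector n := mulOp_mem_sector _ hy

theorem en_solve_le {y : Fock} (h : en resW (wave y) < ⊤) (m : Weight) :
    en m (wave (solve y h : Fock)) ≤ en (fun n k => m n k * resW n k) (wave y) :=
  en_freeInv_le ⟨y, mem_freeInv h⟩ m

theorem enorm_solve_sq_le {y : Fock} (h : en resW (wave y) < ⊤) :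
    ‖(solve y h : Fock)‖ₑ ^ 2 ≤ en resW (wave y) := by
  rw [enorm_sq_eq_en]
  refine (en_solve_le h one').trans (le_of_eq ?_)
  simp only [one', one_mul]

theorem enorm_wave_solve_le {f : Fin 3 → R3 → ℂ} {y : Fock} (h : en resW (wave y) < ⊤) {n : ℕ}
    {B : ℝ≥0∞} (hB : ∀ᵐ k, ‖wave y n k‖ₑ ≤ B * prodW f n k) :
    ∀ᵐ k, ‖wave (solve y h : Fock) n k‖ₑ ≤ B * prodW f n k * (freeW n k)⁻¹ :=
  enorm_wave_freeInv_le ⟨y, mem_freeInv h⟩ hB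

theorem vacuum_mem_fdom : vacuum ∈ fdom := by
  rw [mem_fdom, en_vacuum]
  simp [freeW]

/-- The vacuum as an element of the domain of `D_f`. -/
def vac : fdom := ⟨vacuum, vacuum_mem_fdom⟩

theorem vac_mem_sector : (vac : Fock) ∈ sector 0 := vacuum_mem_sector

theorem fieldMomentum_of_mem_sector_zero {j : Fin 3} (x : (fieldMomentum j).domain)
    (hx : (x : Fock) ∈ sector 0) : fieldMomentum j x = 0 := by
  refine wave_ext fun m => ?_
  rcases eq_or_ne m 0 with rfl | hm
  · filter_upwards [wave_fieldMomentum x 0, wave_zero 0] with k h1 h2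
    rw [h1, h2]
    simp
  · filter_upwards [wave_fieldMomentum x m, hx m hm, wave_zero m] with k h1 h2 h3
    rw [h1, h2, h3, mul_zero]

theorem sqrtField_of_mem_sector_zero (x : sqrtField.domain) (hx : (x : Fock) ∈ sector 0) :
    sqrtField x = 0 := by
  refine wave_ext fun m => ?_
  rcases eq_or_ne m 0 with rfl | hm
  · filter_upwards [wave_sqrtField x 0, wave_zero 0] with k h1 h2
    rw [h1, h2]
    simp
  · filter_upwards [wave_sqrtField x m, hx m hm, wave_zero m] with k h1 h2 h3
    rw [h1, h2, h3, mul_zero]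

theorem fieldMomentum_mem_sector {j : Fin 3} {n : ℕ} (x : (fieldMomentum j).domain)
    (hx : (x : Fock) ∈ sector n) : fieldMomentum j x ∈ sector n := mulOp_mem_sector x hx

theorem resW_mul_momentum_sq_le (n : ℕ) (k : Config n) (j : Fin 3) :
    resW n k * ‖∑ i, k i j‖ₑ ^ 2 ≤ invSum n k := by
  calc resW n k * ‖∑ i, k i j‖ₑ ^ 2 ≤ resW n k * freeW n k := by
        gcongr; exact momentum_sq_le_freeW n k j
    _ = (freeW n k)⁻¹ * ((freeW n k)⁻¹ * freeW n k) := by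
        rw [resW, ENNReal.inv_pow]; ring
    _ ≤ (freeW n k)⁻¹ * 1 := by gcongr; exact ENNReal.inv_mul_le_one _
    _ ≤ invSum n k := by
        rw [mul_one]
        exact ENNReal.inv_le_inv.2 (absSum_le_freeW n k)

theorem invSum_mul_momentum_sq_le (n : ℕ) (k : Config n) (j : Fin 3) :
    invSum n k * ‖∑ i, k i j‖ₑ ^ 2 ≤ absSum n k := by
  calc invSum n k * ‖∑ i, k i j‖ₑ ^ 2 ≤ (absSum n k)⁻¹ * absSum n k ^ 2 := by
        unfold invSum; gcongr; exact momentum_le_absSum n k j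
    _ = ((absSum n k)⁻¹ * absSum n k) * absSum n k := by ring
    _ ≤ 1 * absSum n k := by gcongr; exact ENNReal.inv_mul_le_one _
    _ = _ := one_mul _

theorem invSum_mul_momentum_sq_mul_resW_le (n : ℕ) (k : Config n) (j : Fin 3) :
    invSum n k * ‖∑ i, k i j‖ₑ ^ 2 * resW n k ≤ invSumSq n k := by
  calc invSum n k * ‖∑ i, k i j‖ₑ ^ 2 * resW n k
      = invSum n k * (resW n k * ‖∑ i, k i j‖ₑ ^ 2) := by ring
    _ ≤ invSum n k * invSum n k := by gcongr; exact resW_mul_momentum_sq_le n k j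
    _ = invSumSq n k := by rw [invSum, invSumSq, ENNReal.inv_pow, pow_two]

section

variable {C : ℝ≥0} {f : R3 → ℂ}

theorem en_invSumSq_creation_le (hf : IsFormFactor C f) (x : (creation f).domain) :
    en invSumSq (wave (creation f x)) ≤ C * en invSum (wave (x : Fock)) := by
  rw [en_congr (wave_creation x)]
  exact (en_invSumSq_crW_le hf.meas x).trans (mul_le_mul_left hf.int_inv _)

theorem en_invSum_creation_le (hf : IsFormFactor C f) (x : (creation f).domain) :
    en invSum (wave (creation f x)) ≤ C * en one' (wave (x : Fock)) := by
  rw [en_congr (wave_creation x)]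
  exact (en_invSum_crW_le hf.meas x).trans (mul_le_mul_left hf.int_inv _)

theorem en_resW_fieldMomentum_le (j : Fin 3) (x : (fieldMomentum j).domain) :
    en resW (wave (fieldMomentum j x)) ≤ en invSum (wave (x : Fock)) := by
  rw [en_fieldMomentum]
  exact en_mono_weight _ fun n k => resW_mul_momentum_sq_le n k j

theorem en_resW_fieldMomentum_lt_top (j : Fin 3) (x : (fieldMomentum j).domain) :
    en resW (wave (fieldMomentum j x)) < ⊤ := by
  rw [en_fieldMomentum]
  refine lt_of_le_of_lt (en_mono_weight (m' := one') _ fun n k => ?_) (en_wave_lt_top (x : Fock))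
  calc resW n k * ‖∑ i, k i j‖ₑ ^ 2 ≤ (freeW n k ^ 2)⁻¹ * freeW n k ^ 2 := by
        unfold resW
        gcongr
        exact (momentum_le_absSum n k j).trans (absSum_le_freeW n k)
    _ ≤ 1 := ENNReal.inv_mul_le_one _

theorem en_invSum_fieldMomentum_le (j : Fin 3) (x : (fieldMomentum j).domain) :
    en invSum (wave (fieldMomentum j x)) ≤ en absSum (wave (x : Fock)) := by
  rw [en_fieldMomentum]
  exact en_mono_weight _ fun n k => invSum_mul_momentum_sq_le n k j

theorem en_invSum_fieldMomentum_solve_le {y : Fock} (h : en resW (wave y) < ⊤) (j : Fin 3)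
    (hx : (solve y h : Fock) ∈ (fieldMomentum j).domain) :
    en invSum (wave (fieldMomentum j ⟨_, hx⟩)) ≤ en invSumSq (wave y) := by
  rw [en_fieldMomentum]
  exact (en_solve_le h _).trans
    (en_mono_weight _ fun n k => invSum_mul_momentum_sq_mul_resW_le n k j)

end

attribute [local irreducible] mulOp creation annihilation fieldMomentum freeOp sqrtField

section

variable {C : ℝ≥0} {Λ : ℝ} (hf : ∀ j, IsFormFactor C (formFactor Λ j))
include hf

theorem opAsAs_mem_sector {x : fdom} {n : ℕ} (hx : (x : Fock) ∈ sector n) :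
    resMap _ (fdom_le_opAsAs hf) x ∈ sector (n + 2) := by
  have e := resMap_dot (fun j => fdom_le_creation_creation (hf j)) x
  refine (congrArg (· ∈ sector (n + 2)) e).mpr (Submodule.sum_mem _ fun j _ => ?_)
  exact creation_mem_sector ⟨_, (fdom_le_creation_creation (hf j) x.2).2⟩
    (creation_mem_sector ⟨x, fdom_le_creation (hf j) x.2⟩ hx)

theorem opAsP_mem_sector {x : fdom} {n : ℕ} (hx : (x : Fock) ∈ sector n) :
    resMap _ (fdom_le_opAsP hf) x ∈ sector (n + 1) := by
  have e := resMap_dot (fun j => fdom_le_creation_fieldMomentum (hf j) j) x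
  refine (congrArg (· ∈ sector (n + 1)) e).mpr (Submodule.sum_mem _ fun j _ => ?_)
  exact creation_mem_sector ⟨_, (fdom_le_creation_fieldMomentum (hf j) j x.2).2⟩
    (fieldMomentum_mem_sector ⟨x, fdom_le_fieldMomentum j x.2⟩ hx)

theorem opPA_mem_sector {x : fdom} {n : ℕ} (hx : (x : Fock) ∈ sector (n + 1)) :
    resMap _ (fdom_le_opPA hf) x ∈ sector n := by
  have e := resMap_dot (fun j => fdom_le_fieldMomentum_annihilation (hf j) j) x
  refine (congrArg (· ∈ sector n) e).mpr (Submodule.sum_mem _ fun j _ => ?_)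
  exact fieldMomentum_mem_sector ⟨_, (fdom_le_fieldMomentum_annihilation (hf j) j x.2).2⟩
    (annihilation_mem_sector ⟨x, fdom_le_annihilation (hf j) x.2⟩ hx)

theorem opAsA_mem_sector {x : fdom} {n : ℕ} (hx : (x : Fock) ∈ sector (n + 1)) :
    resMap _ (fdom_le_opAsA hf) x ∈ sector (n + 1) := by
  have e := resMap_dot (fun j => fdom_le_creation_annihilation (hf j)) x
  refine (congrArg (· ∈ sector (n + 1)) e).mpr (Submodule.sum_mem _ fun j _ => ?_)
  exact creation_mem_sector ⟨_, (fdom_le_creation_annihilation (hf j) x.2).2⟩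
    (annihilation_mem_sector ⟨x, fdom_le_annihilation (hf j) x.2⟩ hx)

theorem en_opAsAs_le : en invSumSq (wave (resMap _ (fdom_le_opAsAs hf) vac)) ≤ 9 * (C * C) := by
  have e := resMap_dot (fun j => fdom_le_creation_creation (hf j)) vac
  refine (congrArg (fun z => en invSumSq (wave z)) e).trans_le
    (en_sum_three_le isBoseWeight_invSumSq.meas _ fun j => ?_)
  refine (en_invSumSq_creation_le (hf j)
    ⟨_, (fdom_le_creation_creation (hf j) vac.2).2⟩).trans (mul_le_mul_right ?_ _)
  refine (en_invSum_creation_le (hf j) ⟨vac, fdom_le_creation (hf j) vac.2⟩).trans (le_of_eq ?_)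
  exact (congrArg (fun z => (C : ℝ≥0∞) * z) (en_vacuum one')).trans (mul_one _)

theorem en_opAsP_lt_top (x : fdom) :
    en resW (wave (resMap _ (fdom_le_opAsP hf) x)) < ⊤ := by
  have e := resMap_dot (fun j => fdom_le_creation_fieldMomentum (hf j) j) x
  refine lt_of_le_of_lt ((en_mono_weight _ resW_le_invSumSq).trans
    ((congrArg (fun z => en invSumSq (wave z)) e).trans_le
    (en_sum_three_le isBoseWeight_invSumSq.meas (B := C * en absSum (wave (x : Fock))) _
      fun j => ?_))) ?_
  · refine (en_invSumSq_creation_le (hf j)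
      ⟨_, (fdom_le_creation_fieldMomentum (hf j) j x.2).2⟩).trans (mul_le_mul_right ?_ _)
    exact en_invSum_fieldMomentum_le j ⟨x, fdom_le_fieldMomentum j x.2⟩
  · exact ENNReal.mul_lt_top (by simp) (ENNReal.mul_lt_top (by simp) (en_absSum_lt_top x))

theorem en_opAsP_solve_le {y : Fock} (h : en resW (wave y) < ⊤) {B : ℝ≥0∞}
    (hB : en invSumSq (wave y) ≤ B) :
    en resW (wave (resMap _ (fdom_le_opAsP hf) (solve y h))) ≤ 9 * (C * B) := by
  have e := resMap_dot (fun j => fdom_le_creation_fieldMomentum (hf j) j) (solve y h)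
  refine (en_mono_weight _ resW_le_invSumSq).trans
    ((congrArg (fun z => en invSumSq (wave z)) e).trans_le
    (en_sum_three_le isBoseWeight_invSumSq.meas _ fun j => ?_))
  refine (en_invSumSq_creation_le (hf j)
    ⟨_, (fdom_le_creation_fieldMomentum (hf j) j (solve y h).2).2⟩).trans (mul_le_mul_right ?_ _)
  exact (en_invSum_fieldMomentum_solve_le h j (fdom_le_fieldMomentum j (solve y h).2)).trans hB

theorem en_opPA_lt_top (x : fdom) :
    en resW (wave (resMap _ (fdom_le_opPA hf) x)) < ⊤ := by
  have e := resMap_dot (fun j => fdom_le_fieldMomentum_annihilation (hf j) j) x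
  have h1 : ∀ j, en resW (wave (resMap _ (fdom_le_fieldMomentum_annihilation (hf j) j) x)) < ⊤ :=
    fun j => en_resW_fieldMomentum_lt_top j
      ⟨_, (fdom_le_fieldMomentum_annihilation (hf j) j x.2).2⟩
  refine lt_of_le_of_lt ((congrArg (fun z => en resW (wave z)) e).trans_le
    (en_sum_three_le measurable_resW _ (fun j => Finset.single_le_sum
      (f := fun j => en resW (wave (resMap _ (fdom_le_fieldMomentum_annihilation (hf j) j) x)))
      (fun _ _ => zero_le) (Finset.mem_univ j)))) ?_
  exact ENNReal.mul_lt_top (by simp) (ENNReal.sum_lt_top.2 fun j _ => h1 j)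

theorem en_opPA_le {x : fdom} {B : ℝ≥0∞}
    (h : ∀ j, en invSum (wave (annihilation (formFactor Λ j)
      ⟨x, fdom_le_annihilation (hf j) x.2⟩)) ≤ B) :
    en resW (wave (resMap _ (fdom_le_opPA hf) x)) ≤ 9 * B := by
  have e := resMap_dot (fun j => fdom_le_fieldMomentum_annihilation (hf j) j) x
  refine (congrArg (fun z => en resW (wave z)) e).trans_le
    (en_sum_three_le measurable_resW _ fun j => ?_)
  exact (en_resW_fieldMomentum_le j
    ⟨_, (fdom_le_fieldMomentum_annihilation (hf j) j x.2).2⟩).trans (h j)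

theorem en_opAsA_le {x : fdom} {B : ℝ≥0∞}
    (h : ∀ j, en invSum (wave (annihilation (formFactor Λ j)
      ⟨x, fdom_le_annihilation (hf j) x.2⟩)) ≤ B) :
    en resW (wave (resMap _ (fdom_le_opAsA hf) x)) ≤ 9 * (C * B) := by
  have e := resMap_dot (fun j => fdom_le_creation_annihilation (hf j)) x
  refine (en_mono_weight _ resW_le_invSumSq).trans
    ((congrArg (fun z => en invSumSq (wave z)) e).trans_le
    (en_sum_three_le isBoseWeight_invSumSq.meas _ fun j => ?_))
  exact (en_invSumSq_creation_le (hf j)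
    ⟨_, (fdom_le_creation_annihilation (hf j) x.2).2⟩).trans (mul_le_mul_right (h j) _)

end

end

/-! ### The trial vector -/

section

theorem rpow_half_mul_rpow_half_le (a b : ℝ≥0∞) :
    a ^ (1 / 2 : ℝ) * b ^ (1 / 2 : ℝ) ≤ a + b := by
  calc a ^ (1 / 2 : ℝ) * b ^ (1 / 2 : ℝ) ≤ (a + b) ^ (1 / 2 : ℝ) * (a + b) ^ (1 / 2 : ℝ) := by
        gcongr
        · exact le_self_add
        · exact le_add_self
    _ = a + b := rpow_half_mul_self _

theorem absSum_eq_add_tail (n : ℕ) (K : Config (n + 1)) :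
    absSum (n + 1) K = ‖K 0‖ₑ + absSum n (Fin.tail K) := by
  rw [← absSum_cons, Fin.cons_self_tail]

theorem prodW_eq_mul_tail (f : Fin 3 → R3 → ℂ) (n : ℕ) (K : Config (n + 1)) :
    prodW f (n + 1) K = radial f (K 0) * prodW f n (Fin.tail K) := by
  rw [← prodW_cons, Fin.cons_self_tail]

theorem inv_freeW_le_inv (n : ℕ) (K : Config (n + 1)) : (freeW (n + 1) K)⁻¹ ≤ ‖K 0‖ₑ⁻¹ := by
  refine ENNReal.inv_le_inv.2 (le_trans ?_ (absSum_le_freeW _ K))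
  rw [absSum_eq_add_tail]
  exact le_self_add

theorem inv_freeW_le_mul (n : ℕ) (K : Config (n + 1)) : (freeW (n + 1) K)⁻¹ ≤
    (‖K 0‖ₑ ^ (1 / 2 : ℝ))⁻¹ * (absSum n (Fin.tail K) ^ (1 / 2 : ℝ))⁻¹ := by
  have h1 : ‖K 0‖ₑ ^ (1 / 2 : ℝ) ≠ ⊤ := ENNReal.rpow_ne_top_of_nonneg (by norm_num) enorm_ne_top
  have h2 : absSum n (Fin.tail K) ^ (1 / 2 : ℝ) ≠ ⊤ :=
    ENNReal.rpow_ne_top_of_nonneg (by norm_num) (absSum_lt_top _).ne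
  rw [← ENNReal.mul_inv (Or.inr h2) (Or.inl h1)]
  refine ENNReal.inv_le_inv.2 (le_trans ?_ (absSum_le_freeW _ K))
  rw [absSum_eq_add_tail]
  exact rpow_half_mul_rpow_half_le _ _

theorem inv_absSum_rpow_le (n : ℕ) (K : Config (n + 1)) :
    (absSum (n + 1) K ^ (1 / 2 : ℝ))⁻¹ ≤ (‖K 0‖ₑ ^ (1 / 2 : ℝ))⁻¹ := by
  refine ENNReal.inv_le_inv.2 ?_
  rw [absSum_eq_add_tail]
  gcongr
  exact le_self_add

theorem norm_sq_le_of_enorm_sq_le {E : Type*} [SeminormedAddCommGroup E] {c : ℝ≥0} {a : E}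
    (H : ‖a‖ₑ ^ 2 ≤ c) : ‖a‖ ^ 2 ≤ c := by
  rw [← ofReal_norm, ← ENNReal.ofReal_pow (norm_nonneg _)] at H
  exact (ENNReal.ofReal_le_iff_le_toReal ENNReal.coe_ne_top).1 H

attribute [local irreducible] mulOp creation annihilation fieldMomentum freeOp sqrtField

section

variable {C : ℝ≥0} {Λ : ℝ} (hf : ∀ j, IsFormFactor C (formFactor Λ j))
include hf

theorem lintegral_radial_inv_le :
    ∫⁻ q, radial (formFactor Λ) q ^ 2 * ‖q‖ₑ⁻¹ ≤ 9 * (C : ℝ≥0∞) :=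
  lintegral_radial_sq_le (fun j => (hf j).meas) measurable_enorm.inv fun j => (hf j).int_inv

theorem lintegral_radial_inv_half_le :
    ∫⁻ q, radial (formFactor Λ) q ^ 2 * (‖q‖ₑ ^ (1 / 2 : ℝ))⁻¹ ≤ 9 * (C : ℝ≥0∞) :=
  lintegral_radial_sq_le (fun j => (hf j).meas) (measurable_enorm.pow_const _).inv
    fun j => (hf j).int_inv_half

theorem en_pairs_lt_top : en resW (wave (resMap _ (fdom_le_opAsAs hf) vac)) < ⊤ :=
  lt_of_le_of_lt ((en_mono_weight _ resW_le_invSumSq).trans (en_opAsAs_le hf))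
    (ENNReal.mul_lt_top (by simp) (by simp [ENNReal.mul_lt_top]))

/-- The vector `D_f⁻¹ A*A* Ω`. -/
def pairVec : fdom := solve (resMap _ (fdom_le_opAsAs hf) vac) (en_pairs_lt_top hf)

/-- The vector `D_f⁻¹ 𝒫A D_f⁻¹ A*A* Ω`. -/
def oneVec : fdom := solve (resMap _ (fdom_le_opPA hf) (pairVec hf)) (en_opPA_lt_top hf _)

/-- The vector `D_f⁻¹ A*𝒫 D_f⁻¹ A*A* Ω`. -/
def threeVec : fdom := solve (resMap _ (fdom_le_opAsP hf) (pairVec hf)) (en_opAsP_lt_top hf _)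

theorem pairVec_mem_sector : (pairVec hf : Fock) ∈ sector 2 :=
  solve_mem_sector _ (opAsAs_mem_sector hf vac_mem_sector)

theorem oneVec_mem_sector : (oneVec hf : Fock) ∈ sector 1 :=
  solve_mem_sector _ (opPA_mem_sector hf (pairVec_mem_sector hf))

theorem threeVec_mem_sector : (threeVec hf : Fock) ∈ sector 3 :=
  solve_mem_sector _ (opAsP_mem_sector hf (pairVec_mem_sector hf))

theorem freeOp_pairVec : freeOp (pairVec hf) = resMap _ (fdom_le_opAsAs hf) vac :=
  freeOp_solve _ two_ne_zero (opAsAs_mem_sector hf vac_mem_sector)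

theorem freeOp_oneVec : freeOp (oneVec hf) = resMap _ (fdom_le_opPA hf) (pairVec hf) :=
  freeOp_solve _ one_ne_zero (opPA_mem_sector hf (pairVec_mem_sector hf))

theorem freeOp_threeVec : freeOp (threeVec hf) = resMap _ (fdom_le_opAsP hf) (pairVec hf) :=
  freeOp_solve _ three_ne_zero (opAsP_mem_sector hf (pairVec_mem_sector hf))

theorem enorm_pairs_le : ∀ᵐ k, ‖wave (resMap _ (fdom_le_opAsAs hf) vac) 2 k‖ₑ ≤
    2 * prodW (formFactor Λ) 2 k := by
  have e := resMap_dot (fun j => fdom_le_creation_creation (hf j)) vac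
  have h0 : ∀ᵐ k, ‖wave (vac : Fock) 0 k‖ₑ ≤ 1 * prodW (formFactor Λ) 0 k := by
    filter_upwards [wave_vacuum_zero] with k hk
    rw [show wave (vac : Fock) 0 k = 1 from hk]
    simp [prodW]
  have h1 := fun j => enorm_wave_creation_le j ⟨vac, fdom_le_creation (hf j) vac.2⟩ h0
  have h2 := enorm_wave_sum_creation_le (fun j => ⟨_, (fdom_le_creation_creation (hf j) vac.2).2⟩)
    h1
  have e2 : ((1 + 1 : ℕ) : ℝ≥0∞) * (((0 + 1 : ℕ) : ℝ≥0∞) * 1) = 2 := by norm_num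
  simp only [zero_add, Nat.reduceAdd] at h2 e2
  rw [e2] at h2
  exact (congrArg (fun z => ∀ᵐ k, ‖wave z 2 k‖ₑ ≤ 2 * prodW (formFactor Λ) 2 k) e).mpr h2

theorem enorm_pairVec_le : ∀ᵐ k, ‖wave (pairVec hf : Fock) 2 k‖ₑ ≤
    2 * prodW (formFactor Λ) 2 k * (freeW 2 k)⁻¹ := enorm_wave_solve_le _ (enorm_pairs_le hf)

/-- The function `A D_f⁻¹ A*A* Ω` is bounded by the form factor. -/
theorem enorm_annihilation_pairVec_le (j : Fin 3) :
    ∀ᵐ k, ‖wave (annihilation (formFactor Λ j)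
      ⟨pairVec hf, fdom_le_annihilation (hf j) (pairVec hf).2⟩) 1 k‖ₑ ≤
      36 * C * prodW (formFactor Λ) 1 k := by
  have ht : Measurable fun q : R3 => ‖q‖ₑ⁻¹ := measurable_enorm.inv
  have h := enorm_wave_annihilation_le (fun j => (hf j).meas) (n := 1) (B := 2) j
    ⟨pairVec hf, fdom_le_annihilation (hf j) (pairVec hf).2⟩ ht
    (lintegral_radial_inv_le hf) (φ := prodW (formFactor Λ) 1) (by
      filter_upwards [enorm_pairVec_le hf] with K hK
      refine hK.trans ?_
      rw [prodW_eq_mul_tail]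
      refine (mul_le_mul_right (inv_freeW_le_inv 1 K) _).trans (le_of_eq ?_)
      ring)
  filter_upwards [h] with k hk
  refine hk.trans (le_of_eq ?_)
  push_cast
  ring

theorem en_annihilation_pairVec_le (j : Fin 3) :
    en invSum (wave (annihilation (formFactor Λ j)
      ⟨pairVec hf, fdom_le_annihilation (hf j) (pairVec hf).2⟩)) ≤
      (36 * C) ^ 2 * (9 * (C : ℝ≥0∞)) :=
  en_invSum_le_of_sector (fun j => (hf j).meas) (lintegral_radial_inv_le hf)
    (annihilation_mem_sector ⟨pairVec hf, fdom_le_annihilation (hf j) (pairVec hf).2⟩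
      (pairVec_mem_sector hf)) (enorm_annihilation_pairVec_le hf j)

theorem enorm_threeVec_le : ∀ᵐ k, ‖wave (threeVec hf : Fock) 3 k‖ₑ ≤
    6 * prodW (formFactor Λ) 3 k * (freeW 3 k)⁻¹ := by
  refine enorm_wave_solve_le _ ?_
  have e := resMap_dot (fun j => fdom_le_creation_fieldMomentum (hf j) j) (pairVec hf)
  have h1 := fun j => enorm_wave_fieldMomentum_le
    ⟨pairVec hf, fdom_le_fieldMomentum j (pairVec hf).2⟩ (enorm_pairVec_le hf)
  have h2 := enorm_wave_sum_creation_le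
    (fun j => ⟨_, (fdom_le_creation_fieldMomentum (hf j) j (pairVec hf).2).2⟩) h1
  have e2 : ((2 + 1 : ℕ) : ℝ≥0∞) * 2 = 6 := by norm_num
  rw [e2] at h2
  exact (congrArg (fun z => ∀ᵐ k, ‖wave z 3 k‖ₑ ≤ 6 * prodW (formFactor Λ) 3 k) e).mpr h2

/-- The function `A_j A_j D_f⁻¹ A*𝒫 D_f⁻¹ A*A* Ω` is bounded by the form factor. -/
theorem enorm_pair_threeVec_le (j : Fin 3) :
    ∀ᵐ k, ‖wave (annihilation (formFactor Λ j)
      ⟨_, (fdom_le_annihilation_annihilation (hf j) (threeVec hf).2).2⟩) 1 k‖ₑ ≤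
      2916 * C ^ 2 * prodW (formFactor Λ) 1 k := by
  have ht : Measurable fun q : R3 => (‖q‖ₑ ^ (1 / 2 : ℝ))⁻¹ := (measurable_enorm.pow_const _).inv
  have h := enorm_wave_annihilation_le (fun j => (hf j).meas) (n := 2) (B := 6) j
    ⟨threeVec hf, fdom_le_annihilation (hf j) (threeVec hf).2⟩ ht
    (lintegral_radial_inv_half_le hf)
    (φ := fun k => prodW (formFactor Λ) 2 k * (absSum 2 k ^ (1 / 2 : ℝ))⁻¹) (by
      filter_upwards [enorm_threeVec_le hf] with K hK
      refine hK.trans ?_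
      rw [prodW_eq_mul_tail]
      refine (mul_le_mul_right (inv_freeW_le_mul 2 K) _).trans (le_of_eq ?_)
      ring)
  have h' := enorm_wave_annihilation_le (fun j => (hf j).meas) (n := 1)
    (B := ((2 + 1 : ℕ) : ℝ≥0∞) * 6 * (9 * C)) j
    ⟨_, (fdom_le_annihilation_annihilation (hf j) (threeVec hf).2).2⟩ ht
    (lintegral_radial_inv_half_le hf) (φ := prodW (formFactor Λ) 1) (by
      filter_upwards [h] with K hK
      refine hK.trans ?_
      rw [prodW_eq_mul_tail]
      refine (mul_le_mul_right (mul_le_mul_right (inv_absSum_rpow_le 1 K) _) _).trans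
        (le_of_eq ?_)
      ring)
  filter_upwards [h'] with k hk
  refine hk.trans (le_of_eq ?_)
  push_cast
  ring

theorem enorm_pairVec_sq_le : ‖(pairVec hf : Fock)‖ₑ ^ 2 ≤ ((9 * (C * C) : ℝ≥0) : ℝ≥0∞) := by
  refine (enorm_solve_sq_le _).trans ((en_mono_weight _ resW_le_invSumSq).trans
    ((en_opAsAs_le hf).trans (le_of_eq ?_)))
  push_cast
  ring

theorem enorm_oneVec_sq_le :
    ‖(oneVec hf : Fock)‖ₑ ^ 2 ≤ ((9 * ((36 * C) ^ 2 * (9 * C)) : ℝ≥0) : ℝ≥0∞) := by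
  refine (enorm_solve_sq_le _).trans ((en_opPA_le hf (en_annihilation_pairVec_le hf)).trans
    (le_of_eq ?_))
  push_cast
  ring

theorem enorm_threeVec_sq_le :
    ‖(threeVec hf : Fock)‖ₑ ^ 2 ≤ ((9 * (C * (9 * (C * C))) : ℝ≥0) : ℝ≥0∞) := by
  refine (enorm_solve_sq_le _).trans ((en_opAsP_solve_le hf _ (en_opAsAs_le hf)).trans
    (le_of_eq ?_))
  push_cast
  ring

theorem enorm_inner_pair_threeVec_sq_le (j : Fin 3) (r : Fock) :
    ‖inner ℂ (annihilation (formFactor Λ j)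
      ⟨_, (fdom_le_annihilation_annihilation (hf j) (threeVec hf).2).2⟩) r‖ₑ ^ 2 ≤
      en absSum (wave r) * ((2916 * C ^ 2) ^ 2 * (9 * (C : ℝ≥0∞))) := by
  have hs : annihilation (formFactor Λ j)
      ⟨_, (fdom_le_annihilation_annihilation (hf j) (threeVec hf).2).2⟩ ∈ sector 1 :=
    annihilation_mem_sector ⟨_, (fdom_le_annihilation_annihilation (hf j) (threeVec hf).2).2⟩
      (annihilation_mem_sector ⟨threeVec hf, fdom_le_annihilation (hf j) (threeVec hf).2⟩
        (threeVec_mem_sector hf))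
  have h := en_invSum_le_of_sector (fun j => (hf j).meas) (lintegral_radial_inv_le hf) hs
    (enorm_pair_threeVec_le hf j)
  generalize annihilation (formFactor Λ j)
    ⟨_, (fdom_le_annihilation_annihilation (hf j) (threeVec hf).2).2⟩ = φ at hs h ⊢
  rw [← inner_conj_symm, RCLike.enorm_conj]
  refine (enorm_inner_sq_le r φ isBoseWeight_absSum.meas isBoseWeight_invSum.meas
    fun n => ?_).trans (mul_le_mul_right h _)
  rcases eq_or_ne n 1 with rfl | hn
  · filter_upwards [ae_forall_ne_zero 1] with k hk
    refine Or.inr (le_of_eq ?_)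
    rw [invSum, ENNReal.mul_inv_cancel _ (absSum_lt_top k).ne]
    simp [absSum, hk 0]
  · filter_upwards [hs n hn] with k hk
    exact Or.inl hk

end

end

/-! ### The trial vector in the form domain -/

section

attribute [local irreducible] mulOp creation annihilation fieldMomentum freeOp sqrtField

theorem norm_le_of_enorm_sq_le {E : Type*} [SeminormedAddCommGroup E] {c : ℝ≥0} {a : E} {K : ℝ}
    (hK : 0 ≤ K) (hc : (c : ℝ) ≤ K ^ 2) (H : ‖a‖ₑ ^ 2 ≤ c) : ‖a‖ ≤ K :=
  le_of_sq_le_sq ((norm_sq_le_of_enorm_sq_le H).trans hc) hK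

theorem norm_le_mul_of_enorm_sq_le {E F : Type*} [SeminormedAddCommGroup E]
    [SeminormedAddCommGroup F] {c : ℝ≥0} {a : E} {h : F} {K : ℝ}
    (hK : 0 ≤ K) (hc : (c : ℝ) ≤ K ^ 2) (H : ‖a‖ₑ ^ 2 ≤ ‖h‖ₑ ^ 2 * c) : ‖a‖ ≤ K * ‖h‖ := by
  rw [mul_comm, ← ofReal_norm, ← ofReal_norm] at H
  refine le_of_sq_le_sq ((real_sq_le_of_enorm (norm_nonneg a) (norm_nonneg h) H).trans ?_)
    (by positivity)
  rw [mul_pow]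
  gcongr

theorem norm_eq_one_of_enorm_sq {E : Type*} [SeminormedAddCommGroup E] {a : E}
    (h : ‖a‖ₑ ^ 2 = 1) : ‖a‖ = 1 := by
  rw [← ofReal_norm, ← ENNReal.ofReal_pow (norm_nonneg _), ENNReal.ofReal_eq_one] at h
  nlinarith [norm_nonneg a]

/-- Upper bound for the norms of the trial vectors. -/
def trialBound (C : ℝ) : ℝ := 10 ^ 4 * (1 + C) ^ 3

theorem le_sq_trialBound_half {C : ℝ} (hC : 0 ≤ C) {c : ℝ} {m : ℕ} (hm : m ≤ 6)
    (hc : c ≤ 25 * 10 ^ 6 * (1 + C) ^ m) : c ≤ (trialBound C / 2) ^ 2 := by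
  have h : (1 + C) ^ m ≤ (1 + C) ^ 6 := pow_le_pow_right₀ (by linarith) hm
  have : (trialBound C / 2) ^ 2 = 25 * 10 ^ 6 * (1 + C) ^ 6 := by unfold trialBound; ring
  rw [this]
  linarith

theorem trialBound_nonneg {C : ℝ} (hC : 0 ≤ C) : 0 ≤ trialBound C := by
  unfold trialBound
  positivity

theorem inner_eq_zero_of_sector_zero {φ r : Fock} (hφ : φ ∈ sector 0)
    (hr : inner ℂ vacuum r = 0) : inner ℂ φ r = 0 := by
  obtain ⟨c, rfl⟩ := exists_eq_smul_vacuum hφ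
  rw [inner_smul_left, hr, mul_zero]

theorem inner_add_left_eq {E : Type*} [NormedAddCommGroup E] [InnerProductSpace ℂ E] {a b c : E}
    {x y : ℂ} (h1 : inner ℂ a c = x) (h2 : inner ℂ b c = y) : inner ℂ (a + b) c = x + y := by
  rw [inner_add_left, h1, h2]

theorem inner_add_right_eq {E : Type*} [NormedAddCommGroup E] [InnerProductSpace ℂ E] {a b c : E}
    {x y : ℂ} (h1 : inner ℂ c a = x) (h2 : inner ℂ c b = y) : inner ℂ c (a + b) = x + y := by
  rw [inner_add_right, h1, h2]

section

variable {C : ℝ≥0} {Λ : ℝ} (hf : ∀ j, IsFormFactor C (formFactor Λ j))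
include hf

theorem norm_pairVec_le : ‖(pairVec hf : Fock)‖ ≤ trialBound C / 2 := by
  refine norm_le_of_enorm_sq_le (by have := trialBound_nonneg C.coe_nonneg; positivity) ?_
    (enorm_pairVec_sq_le hf)
  refine le_sq_trialBound_half C.coe_nonneg (m := 2) (by norm_num) ?_
  push_cast
  nlinarith [C.coe_nonneg, mul_nonneg C.coe_nonneg C.coe_nonneg]

theorem norm_oneVec_le : ‖(oneVec hf : Fock)‖ ≤ trialBound C / 2 := by
  refine norm_le_of_enorm_sq_le (by have := trialBound_nonneg C.coe_nonneg; positivity) ?_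
    (enorm_oneVec_sq_le hf)
  refine le_sq_trialBound_half C.coe_nonneg (m := 3) (by norm_num) ?_
  have h : (C : ℝ) ^ 3 ≤ (1 + C) ^ 3 := pow_le_pow_left₀ C.coe_nonneg (by linarith) 3
  have h' : 0 ≤ (1 + (C : ℝ)) ^ 3 := by positivity
  push_cast
  linarith

theorem norm_threeVec_le : ‖(threeVec hf : Fock)‖ ≤ trialBound C / 2 := by
  refine norm_le_of_enorm_sq_le (by have := trialBound_nonneg C.coe_nonneg; positivity) ?_
    (enorm_threeVec_sq_le hf)
  refine le_sq_trialBound_half C.coe_nonneg (m := 3) (by norm_num) ?_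
  have h : (C : ℝ) ^ 3 ≤ (1 + C) ^ 3 := pow_le_pow_left₀ C.coe_nonneg (by linarith) 3
  have h' : 0 ≤ (1 + (C : ℝ)) ^ 3 := by positivity
  push_cast
  linarith

/-- Elements of the domain of `D_f`, as elements of the form domain. -/
def toForm (x : fdom) : (nelsonForm (formFactor Λ)).V := ⟨x, fdom_le_formDom hf x.2⟩

theorem free_toForm (x : fdom) (χ : (nelsonForm (formFactor Λ)).V) :
    (nelsonForm (formFactor Λ)).free (toForm hf x) χ = inner ℂ (freeOp x) (χ : Fock) :=
  free_eq_inner hf x χ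

theorem mixed_toForm (x : fdom) (χ : (nelsonForm (formFactor Λ)).V) :
    (nelsonForm (formFactor Λ)).mixed (toForm hf x) χ =
      inner ℂ (resMap _ (fdom_le_opAsP hf) x + resMap _ (fdom_le_opPA hf) x) (χ : Fock) :=
  mixed_eq_inner hf x χ

theorem A_toForm_of_mem_sector {n : ℕ} {x : fdom} (hx : (x : Fock) ∈ sector (n + 1)) (j : Fin 3) :
    (nelsonForm (formFactor Λ)).A j (toForm hf x) ∈ sector n :=
  annihilation_mem_sector ⟨x, fdom_le_annihilation (hf j) x.2⟩ hx

theorem A_toForm_of_mem_sector_zero {x : fdom} (hx : (x : Fock) ∈ sector 0) (j : Fin 3) :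
    (nelsonForm (formFactor Λ)).A j (toForm hf x) = 0 :=
  annihilation_of_mem_sector_zero ⟨x, fdom_le_annihilation (hf j) x.2⟩ hx

theorem B_toForm_eq_zero {x : fdom} {j : Fin 3}
    (hx : (nelsonForm (formFactor Λ)).A j (toForm hf x) ∈ sector 0) :
    (nelsonForm (formFactor Λ)).B j (toForm hf x) = 0 :=
  annihilation_of_mem_sector_zero ⟨_, (fdom_le_annihilation_annihilation (hf j) x.2).2⟩ hx

theorem B_toForm_of_mem_sector {n : ℕ} {x : fdom} (hx : (x : Fock) ∈ sector (n + 2)) (j : Fin 3) :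
    (nelsonForm (formFactor Λ)).B j (toForm hf x) ∈ sector n :=
  annihilation_mem_sector ⟨_, (fdom_le_annihilation_annihilation (hf j) x.2).2⟩
    (A_toForm_of_mem_sector hf hx j)

theorem norm_inner_B_threeVec_le (j : Fin 3) (r : (nelsonForm (formFactor Λ)).V) :
    ‖inner ℂ ((nelsonForm (formFactor Λ)).B j (toForm hf (threeVec hf))) (r : Fock)‖ ≤
      trialBound C * ‖(nelsonForm (formFactor Λ)).H r‖ := by
  have h := enorm_inner_pair_threeVec_sq_le hf j r
  rw [← enorm_H_sq] at h
  have h' : ‖inner ℂ ((nelsonForm (formFactor Λ)).B j (toForm hf (threeVec hf))) (r : Fock)‖ₑ ^ 2 ≤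
      ‖(nelsonForm (formFactor Λ)).H r‖ₑ ^ 2 *
        (((2916 * C ^ 2) ^ 2 * (9 * C) : ℝ≥0) : ℝ≥0∞) := by
    refine h.trans (le_of_eq ?_)
    push_cast
    ring
  refine norm_le_mul_of_enorm_sq_le (trialBound_nonneg C.coe_nonneg) ?_ h'
  have h1 : (C : ℝ) ^ 5 ≤ (1 + C) ^ 5 := pow_le_pow_left₀ C.coe_nonneg (by linarith) 5
  have h2 : (1 + (C : ℝ)) ^ 5 ≤ (1 + C) ^ 6 :=
    pow_le_pow_right₀ (by linarith [C.coe_nonneg]) (by norm_num)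
  have h3 : 0 ≤ (C : ℝ) ^ 5 := by positivity
  have e : trialBound C ^ 2 = 10 ^ 8 * (1 + C) ^ 6 := by unfold trialBound; ring
  rw [e]
  push_cast
  linarith

theorem freeOp_one_add_three : freeOp (oneVec hf + threeVec hf) =
    resMap _ (fdom_le_opAsP hf) (pairVec hf) + resMap _ (fdom_le_opPA hf) (pairVec hf) :=
  (freeOp.map_add _ _).trans ((congrArg₂ (· + ·) (freeOp_oneVec hf) (freeOp_threeVec hf)).trans
    (add_comm _ _))

/-- The vectors of second order perturbation theory for the Nelson operator. -/
def trial : (nelsonForm (formFactor Λ)).Trial (trialBound C) where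
  Ω := toForm hf vac
  w := toForm hf (pairVec hf)
  v := toForm hf (oneVec hf + threeVec hf)
  norm_Ω := by
    have h : ‖vacuum‖ₑ ^ 2 = 1 := (enorm_sq_eq_en vacuum).trans (en_vacuum one')
    exact norm_eq_one_of_enorm_sq h
  P_Ω j := fieldMomentum_of_mem_sector_zero ⟨vac, fdom_le_fieldMomentum j vac.2⟩ vac_mem_sector
  A_Ω j := A_toForm_of_mem_sector_zero hf vac_mem_sector j
  B_Ω j := B_toForm_eq_zero hf ((congrArg (· ∈ sector 0)
    (A_toForm_of_mem_sector_zero hf vac_mem_sector j)).mpr (Submodule.zero_mem _))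
  H_Ω := sqrtField_of_mem_sector_zero ⟨vac, fdom_le_sqrtField vac.2⟩ vac_mem_sector
  free_w x := (free_toForm hf _ x).trans ((congrArg (fun z => inner ℂ z (x : Fock))
    (freeOp_pairVec hf)).trans (inner_opAsAs_left hf vac x))
  free_v x := (free_toForm hf _ x).trans ((congrArg (fun z => inner ℂ z (x : Fock))
    (freeOp_one_add_three hf)).trans (mixed_toForm hf (pairVec hf) x).symm)
  free_v_w := (free_toForm hf _ _).trans ((congrArg (fun z => inner ℂ z (pairVec hf : Fock))
    (freeOp_one_add_three hf)).trans ((inner_add_left_eq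
      (inner_eq_zero_of_sector (by norm_num) (opAsP_mem_sector hf (pairVec_mem_sector hf))
        (pairVec_mem_sector hf))
      (inner_eq_zero_of_sector (by norm_num) (opPA_mem_sector hf (pairVec_mem_sector hf))
        (pairVec_mem_sector hf))).trans (add_zero 0)))
  norm_w := (norm_pairVec_le hf).trans (half_le_self (trialBound_nonneg C.coe_nonneg))
  norm_v := (norm_add_le (oneVec hf : Fock) (threeVec hf : Fock)).trans
    ((add_le_add (norm_oneVec_le hf) (norm_threeVec_le hf)).trans (add_halves _).le)
  inner_Ω_w := inner_eq_zero_of_sector (by norm_num) vac_mem_sector (pairVec_mem_sector hf)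
  inner_Ω_v := (inner_add_right_eq
    (inner_eq_zero_of_sector (by norm_num) vac_mem_sector (oneVec_mem_sector hf))
    (inner_eq_zero_of_sector (by norm_num) vac_mem_sector (threeVec_mem_sector hf))).trans
      (add_zero 0)
  B_w j r hr := inner_eq_zero_of_sector_zero
    (B_toForm_of_mem_sector hf (pairVec_mem_sector hf) j) hr
  B_v j r := by
    have h1 : (nelsonForm (formFactor Λ)).B j (toForm hf (oneVec hf + threeVec hf)) =
        (nelsonForm (formFactor Λ)).B j (toForm hf (threeVec hf)) :=
      ((nelsonForm (formFactor Λ)).B j).map_add (toForm hf (oneVec hf))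
        (toForm hf (threeVec hf)) |>.trans ((congrArg₂ (· + ·) (B_toForm_eq_zero hf
          (A_toForm_of_mem_sector hf (oneVec_mem_sector hf) j)) rfl).trans (zero_add _))
    rw [h1]
    exact norm_inner_B_threeVec_le hf j r

end

end

/-! ### The coefficients of the expansion -/

section

/-- `x` is in the domain of `S`, and `S x = y`. -/
def HasValue {E : Type*} [AddCommGroup E] [Module ℂ E] (S : E →ₗ.[ℂ] E) (x y : E) : Prop :=
  ∃ h : x ∈ S.domain, S ⟨x, h⟩ = y

theorem HasValue.comp {E : Type*} [AddCommGroup E] [Module ℂ E] {S T : E →ₗ.[ℂ] E} {x y z : E}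
    (hS : HasValue S y z) (hT : HasValue T x y) : HasValue (opMul S T) x z := by
  obtain ⟨h, rfl⟩ := hT
  obtain ⟨h', rfl⟩ := hS
  exact ⟨⟨h, h'⟩, rfl⟩

theorem conj_sum_inner {E : Type*} [NormedAddCommGroup E] [InnerProductSpace ℂ E]
    (a b : Fin 3 → E) :
    (starRingEnd ℂ) (∑ j, inner ℂ (a j) (b j)) = ∑ j, inner ℂ (b j) (a j) := by
  rw [map_sum]
  exact Finset.sum_congr rfl fun j _ => inner_conj_symm _ _

theorem inner_eq_sum_of_left {E : Type*} [NormedAddCommGroup E] [InnerProductSpace ℂ E]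
    {x z : E} {b : Fin 3 → E} (h : inner ℂ z x = ∑ j, inner ℂ (b j) x) :
    inner ℂ x z = ∑ j, inner ℂ x (b j) := by
  rw [← inner_conj_symm, h, map_sum]
  exact Finset.sum_congr rfl fun j _ => inner_conj_symm _ _

theorem sum_inner_self_eq {E : Type*} [NormedAddCommGroup E] [InnerProductSpace ℂ E]
    (a : Fin 3 → E) : ∑ j, inner ℂ (a j) (a j) = ((∑ j, ‖a j‖ ^ 2 : ℝ) : ℂ) := by
  simp only [inner_self_eq_norm_sq_to_K]
  push_cast
  rfl

theorem QForm.kin_add {E : Type*} [NormedAddCommGroup E] [InnerProductSpace ℂ E] (q : QForm E)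
    {x y : q.V} (h : q.free x y = 0) : q.kin (x + y) = q.kin x + q.kin y := by
  have h' : q.free y x = 0 := by rw [← q.conj_free, h, map_zero]
  have e := q.free_self (x + y)
  rw [map_add, map_add, LinearMap.add_apply, LinearMap.add_apply, h, h', q.free_self,
    q.free_self] at e
  have e2 := congrArg Complex.re e
  simp only [add_zero, zero_add, Complex.add_re, Complex.ofReal_re] at e2
  exact e2.symm

attribute [local irreducible] mulOp creation annihilation fieldMomentum freeOp sqrtField

theorem hasValue_resMap {S : Fock →ₗ.[ℂ] Fock} (h : fdom ≤ S.domain) (x : fdom) :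
    HasValue S (x : Fock) (resMap S h x) := ⟨h x.2, rfl⟩

theorem hasValue_solve {y : Fock} (h : en resW (wave y) < ⊤) : HasValue freeInv y (solve y h) :=
  ⟨mem_freeInv h, rfl⟩

section

variable {C : ℝ≥0} {Λ : ℝ} (hf : ∀ j, IsFormFactor C (formFactor Λ j))
include hf

theorem inner_vacuum_opAA (z : fdom) : inner ℂ vacuum (resMap _ (fdom_le_opAA hf) z) =
    (nelsonForm (formFactor Λ)).free (toForm hf (pairVec hf)) (toForm hf z) :=
  (inner_eq_sum_of_left (inner_opAA_left hf z vacuum)).trans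
    ((trial hf).free_w (toForm hf z)).symm

theorem inner_vacuum_opAA_solve {y : Fock} (h : en resW (wave y) < ⊤) {n : ℕ} (hn : n ≠ 0)
    (hy : y ∈ sector n) : inner ℂ vacuum (resMap _ (fdom_le_opAA hf) (solve y h)) =
      (starRingEnd ℂ) (inner ℂ y (pairVec hf : Fock)) := by
  refine (inner_vacuum_opAA hf _).trans ?_
  rw [← QForm.conj_free]
  refine congrArg (starRingEnd ℂ) ((free_toForm hf _ _).trans ?_)
  exact congrArg (fun z => inner ℂ z (pairVec hf : Fock)) (freeOp_solve h hn hy)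

theorem inner_opPA_pairVec (x : fdom) :
    (starRingEnd ℂ) (inner ℂ (resMap _ (fdom_le_opPA hf) x) (pairVec hf : Fock)) =
      inner ℂ (resMap _ (fdom_le_opAsP hf) (pairVec hf)) (x : Fock) :=
  (congrArg (starRingEnd ℂ) (inner_opPA_left hf x (toForm hf (pairVec hf)))).trans
    ((conj_sum_inner _ _).trans (inner_opAsP_left hf (pairVec hf) (toForm hf x)).symm)

theorem inner_opAsP_pairVec (x : fdom) :
    (starRingEnd ℂ) (inner ℂ (resMap _ (fdom_le_opAsP hf) x) (pairVec hf : Fock)) =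
      inner ℂ (resMap _ (fdom_le_opPA hf) (pairVec hf)) (x : Fock) :=
  (congrArg (starRingEnd ℂ) (inner_opAsP_left hf x (toForm hf (pairVec hf)))).trans
    ((conj_sum_inner _ _).trans (inner_opPA_left hf (pairVec hf) (toForm hf x)).symm)

theorem kin_trial_v : (nelsonForm (formFactor Λ)).kin (trial hf).v =
    (nelsonForm (formFactor Λ)).kin (toForm hf (oneVec hf)) +
      (nelsonForm (formFactor Λ)).kin (toForm hf (threeVec hf)) := by
  refine QForm.kin_add _ (x := toForm hf (oneVec hf)) (y := toForm hf (threeVec hf)) ?_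
  refine (free_toForm hf _ _).trans ((congrArg (fun z => inner ℂ z (threeVec hf : Fock))
    (freeOp_oneVec hf)).trans ?_)
  exact inner_eq_zero_of_sector (by norm_num) (opPA_mem_sector hf (pairVec_mem_sector hf))
    (threeVec_mem_sector hf)

theorem hasValue_term4 : HasValue (term4 Λ) vacuum (resMap _ (fdom_le_opAA hf) (pairVec hf)) :=
  (hasValue_resMap _ _).comp ((hasValue_solve _).comp (hasValue_resMap (fdom_le_opAsAs hf) vac))

theorem hasValue_term6a : HasValue (term6a Λ) vacuum (resMap _ (fdom_le_opAA hf)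
    (solve (resMap _ (fdom_le_opPA hf) (threeVec hf)) (en_opPA_lt_top hf _))) :=
  (hasValue_resMap _ _).comp ((hasValue_solve _).comp ((hasValue_resMap _ _).comp
    ((hasValue_solve _).comp ((hasValue_resMap _ _).comp ((hasValue_solve _).comp
      (hasValue_resMap (fdom_le_opAsAs hf) vac))))))

theorem hasValue_term6b : HasValue (term6b Λ) vacuum (resMap _ (fdom_le_opAA hf)
    (solve (resMap _ (fdom_le_opAsP hf) (oneVec hf)) (en_opAsP_lt_top hf _))) :=
  (hasValue_resMap _ _).comp ((hasValue_solve _).comp ((hasValue_resMap _ _).comp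
    ((hasValue_solve _).comp ((hasValue_resMap _ _).comp ((hasValue_solve _).comp
      (hasValue_resMap (fdom_le_opAsAs hf) vac))))))

theorem en_opAsA_pairVec_lt_top : en resW (wave (resMap _ (fdom_le_opAsA hf) (pairVec hf))) < ⊤ :=
  lt_of_le_of_lt (en_opAsA_le hf (en_annihilation_pairVec_le hf)) (by
    refine ENNReal.mul_lt_top (by simp) (ENNReal.mul_lt_top (by simp) (ENNReal.mul_lt_top
      (ENNReal.pow_lt_top (ENNReal.mul_lt_top (by simp) (by simp)))
      (ENNReal.mul_lt_top (by simp) (by simp)))))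

theorem hasValue_term6c : HasValue (term6c Λ) vacuum (resMap _ (fdom_le_opAA hf)
    (solve (resMap _ (fdom_le_opAsA hf) (pairVec hf)) (en_opAsA_pairVec_lt_top hf))) :=
  (hasValue_resMap _ _).comp ((hasValue_solve _).comp ((hasValue_resMap _ _).comp
    ((hasValue_solve _).comp (hasValue_resMap (fdom_le_opAsAs hf) vac))))

theorem inner_term4 : inner ℂ vacuum (resMap _ (fdom_le_opAA hf) (pairVec hf)) =
    ((nelsonForm (formFactor Λ)).kin (trial hf).w : ℂ) :=
  (inner_vacuum_opAA hf _).trans (QForm.free_self _ _)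

theorem inner_term6a : inner ℂ vacuum (resMap _ (fdom_le_opAA hf)
    (solve (resMap _ (fdom_le_opPA hf) (threeVec hf)) (en_opPA_lt_top hf _))) =
    ((nelsonForm (formFactor Λ)).kin (toForm hf (threeVec hf)) : ℂ) := by
  refine (inner_vacuum_opAA_solve hf _ two_ne_zero
    (opPA_mem_sector hf (threeVec_mem_sector hf))).trans ((inner_opPA_pairVec hf _).trans ?_)
  refine Eq.trans ?_ (QForm.free_self _ (toForm hf (threeVec hf)))
  refine Eq.trans ?_ (free_toForm hf _ _).symm
  exact congrArg (fun z => inner ℂ z (threeVec hf : Fock)) (freeOp_threeVec hf).symm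

theorem inner_term6b : inner ℂ vacuum (resMap _ (fdom_le_opAA hf)
    (solve (resMap _ (fdom_le_opAsP hf) (oneVec hf)) (en_opAsP_lt_top hf _))) =
    ((nelsonForm (formFactor Λ)).kin (toForm hf (oneVec hf)) : ℂ) := by
  refine (inner_vacuum_opAA_solve hf _ two_ne_zero
    (opAsP_mem_sector hf (oneVec_mem_sector hf))).trans ((inner_opAsP_pairVec hf _).trans ?_)
  refine Eq.trans ?_ (QForm.free_self _ (toForm hf (oneVec hf)))
  refine Eq.trans ?_ (free_toForm hf _ _).symm
  exact congrArg (fun z => inner ℂ z (oneVec hf : Fock)) (freeOp_oneVec hf).symm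

theorem inner_term6c : inner ℂ vacuum (resMap _ (fdom_le_opAA hf)
    (solve (resMap _ (fdom_le_opAsA hf) (pairVec hf)) (en_opAsA_pairVec_lt_top hf))) =
    ((∑ j, ‖(nelsonForm (formFactor Λ)).A j (trial hf).w‖ ^ 2 : ℝ) : ℂ) := by
  refine (inner_vacuum_opAA_solve hf _ two_ne_zero
    (opAsA_mem_sector hf (pairVec_mem_sector hf))).trans ?_
  refine (congrArg (starRingEnd ℂ) (inner_opAsA_left hf (pairVec hf)
    (toForm hf (pairVec hf)))).trans ((conj_sum_inner _ _).trans ?_)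
  exact sum_inner_self_eq _

end

end

/-! ### Slicing off soft bosons -/

section

/-- The number of soft bosons, of energy less than `σ`, in a configuration. -/
def softCount (σ : ℝ≥0) (n : ℕ) (k : Config n) : ℕ := ∑ i, if ‖k i‖ < σ then 1 else 0

/-- The wave functions with exactly `j` soft bosons. -/
def HasSoft (σ : ℝ≥0) (j : ℕ) (g : Wave) : Prop := ∀ n k, softCount σ n k ≠ j → g n k = 0

/-- Functions that vanish at soft momenta. -/
def IsHard (σ : ℝ≥0) (f : R3 → ℂ) : Prop := ∀ q, ‖q‖ < σ → f q = 0

/-- The component of `g` with exactly `j` soft bosons. -/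
def softPart (σ : ℝ≥0) (j : ℕ) (g : Wave) : Wave :=
  fun n k => if softCount σ n k = j then g n k else 0

/-- The wave functions of the remaining bosons when one boson has momentum `q`, the value at `q`
of the vector valued function `q ↦ a(q) g`. -/
def slice (q : R3) (g : Wave) : Wave := fun n k =>
  ((Real.sqrt (n + 1) : ℝ) : ℂ) * g (n + 1) (Fin.cons q k)

variable {σ : ℝ≥0} {j : ℕ}

theorem softCount_cons (n : ℕ) (q : R3) (k : Config n) :
    softCount σ (n + 1) (Fin.cons q k) = (if ‖q‖ < σ then 1 else 0) + softCount σ n k := by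
  unfold softCount
  rw [Fin.sum_univ_succ]
  simp only [Fin.cons_zero, Fin.cons_succ]

theorem softCount_perm (n : ℕ) (τ : Equiv.Perm (Fin n)) (k : Config n) :
    softCount σ n (fun i => k (τ i)) = softCount σ n k :=
  Equiv.sum_comp τ fun i => if ‖k i‖ < σ then 1 else 0

theorem measurable_softCount (n : ℕ) : Measurable (softCount σ n) := by
  refine Finset.measurable_sum _ fun i _ => Measurable.ite ?_ measurable_const measurable_const
  exact measurableSet_lt (measurable_pi_apply i).norm measurable_const

theorem isBose_softPart {g : Wave} (hg : IsBose g) : IsBose (softPart σ j g) where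
  meas n := Measurable.ite (measurable_softCount n (measurableSet_singleton j)) (hg.meas n)
    measurable_const
  symm n τ k := by
    unfold softPart
    rw [softCount_perm, hg.symm]

theorem hasSoft_softPart (g : Wave) : HasSoft σ j (softPart σ j g) := fun _ _ h => if_neg h

theorem isBose_slice {g : Wave} (hg : IsBose g) (q : R3) : IsBose (slice q g) where
  meas n := ((hg.meas (n + 1)).comp (measurable_cons_right q)).const_mul _
  symm n τ k := by
    obtain ⟨τ', h⟩ := exists_perm_cons τ
    unfold slice
    rw [h q k, hg.symm]

theorem hasSoft_slice {g : Wave} (hg : HasSoft σ (j + 1) g) {q : R3} (hq : ‖q‖ < σ) :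
    HasSoft σ j (slice q g) := fun n k h => by
  unfold slice
  rw [hg, mul_zero]
  rw [softCount_cons, if_pos hq]
  omega

theorem anW_softPart {f : R3 → ℂ} (hf : IsHard σ f) (g : Wave) :
    anW f (softPart σ j g) = softPart σ j (anW f g) := by
  funext n k
  have h : ∀ q : R3, (starRingEnd ℂ) (f q) * softPart σ j g (n + 1) (Fin.cons q k) =
      if softCount σ n k = j then (starRingEnd ℂ) (f q) * g (n + 1) (Fin.cons q k) else 0 := by
    intro q
    by_cases hq : ‖q‖ < σ
    · simp [hf q hq]
    · simp only [softPart, softCount_cons, if_neg hq, zero_add]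
      split_ifs <;> simp
  unfold anW
  simp only [h]
  simp only [softPart]
  split_ifs <;> simp

theorem HasSoft.anW {f : R3 → ℂ} (hf : IsHard σ f) {g : Wave} (hg : HasSoft σ j g) :
    HasSoft σ j (anW f g) := by
  have h : softPart σ j g = g := by
    funext n k
    unfold softPart
    split_ifs with h
    · rfl
    · exact (hg n k h).symm
  rw [← h, anW_softPart hf]
  exact hasSoft_softPart _

theorem slice_anW {f : R3 → ℂ} {g : Wave} (hg : IsBose g) (q : R3) :
    slice q (anW f g) = anW f (slice q g) := by
  funext n k
  unfold slice anW
  have h : ∀ p : R3, (starRingEnd ℂ) (f p) * ((((Real.sqrt (((n + 1 : ℕ) : ℝ) + 1) : ℝ) : ℂ)) *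
      g (n + 1 + 1) (Fin.cons q (Fin.cons p k))) = ((Real.sqrt (((n + 1 : ℕ) : ℝ) + 1) : ℝ) : ℂ) *
      ((starRingEnd ℂ) (f p) * g (n + 1 + 1) (Fin.cons p (Fin.cons q k))) := fun p => by
    rw [hg.cons_swap q p k]
    ring
  simp only [h]
  rw [integral_const_mul]

theorem lintegral_en_slice_aux {w : Weight} (hw : IsBoseWeight w) {h : Wave} (hh : IsBose h)
    (n : ℕ) : Measurable fun p : R3 × Config n => w (n + 1) (Fin.cons p.1 p.2) *
      ‖slice p.1 h n p.2‖ₑ ^ 2 := by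
  refine ((hw.meas (n + 1)).comp (measurable_cons n)).mul (Measurable.pow_const ?_ 2)
  exact (((hh.meas (n + 1)).comp (measurable_cons n)).const_mul _).enorm

theorem measurable_en_slice {w : Weight} (hw : IsBoseWeight w) {h : Wave} (hh : IsBose h) :
    Measurable fun q => en (fun n k => w (n + 1) (Fin.cons q k)) (slice q h) :=
  Measurable.tsum fun n => (lintegral_en_slice_aux hw hh n).lintegral_prod_right'

/-- Summing over all choices of one of the `j + 1` soft bosons multiplies energies by `j + 1`. -/
theorem lintegral_en_slice {w : Weight} (hw : IsBoseWeight w) {h : Wave} (hh : IsBose h)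
    (hs : HasSoft σ (j + 1) h) :
    ∫⁻ q in {q : R3 | ‖q‖ < σ}, en (fun n k => w (n + 1) (Fin.cons q k)) (slice q h) =
      ((j : ℝ≥0∞) + 1) * en w h := by
  have hset : MeasurableSet {q : R3 | ‖q‖ < σ} := measurableSet_lt measurable_norm measurable_const
  have h0 : ∫⁻ k, w 0 k * ‖h 0 k‖ₑ ^ 2 = 0 := by
    refine (lintegral_congr fun k => ?_).trans lintegral_zero
    rw [hs 0 k (by simp [softCount])]
    simp
  have h1 : ∀ n, ∫⁻ q in {q : R3 | ‖q‖ < σ}, ∫⁻ k : Config n, w (n + 1) (Fin.cons q k) *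
      ‖slice q h n k‖ₑ ^ 2 = ((j : ℝ≥0∞) + 1) * ∫⁻ k, w (n + 1) k * ‖h (n + 1) k‖ₑ ^ 2 := by
    intro n
    have hwh : Measurable fun k : Config (n + 1) => w (n + 1) k * ‖h (n + 1) k‖ₑ ^ 2 :=
      (hw.meas _).mul (hh.measurable_sq _)
    have hi : Measurable fun q : R3 => if ‖q‖ < σ then (1 : ℝ≥0∞) else 0 :=
      Measurable.ite hset measurable_const measurable_const
    have e1 := lintegral_sum_symm hi hwh (fun τ k => by rw [hw.symm, hh.symm])
    have e2 : ∀ k : Config (n + 1), (∑ i, if ‖k i‖ < σ then (1 : ℝ≥0∞) else 0) *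
        (w (n + 1) k * ‖h (n + 1) k‖ₑ ^ 2) =
        ((j : ℝ≥0∞) + 1) * (w (n + 1) k * ‖h (n + 1) k‖ₑ ^ 2) := by
      intro k
      have e3 : (∑ i, if ‖k i‖ < σ then (1 : ℝ≥0∞) else 0) = (softCount σ (n + 1) k : ℝ≥0∞) := by
        simp [softCount]
      rw [e3]
      by_cases hk : softCount σ (n + 1) k = j + 1
      · rw [hk]
        push_cast
        rfl
      · rw [hs _ _ hk]
        simp
    simp only [e2] at e1
    rw [lintegral_const_mul _ hwh] at e1
    rw [e1, ← lintegral_indicator hset, ← lintegral_const_mul' _ _ (by simp)]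
    refine lintegral_congr fun q => ?_
    by_cases hq : ‖q‖ < σ
    · rw [Set.indicator_of_mem (show q ∈ {q : R3 | ‖q‖ < σ} from hq),
        ← lintegral_const_mul' _ _ (by simp)]
      refine lintegral_congr fun k => ?_
      rw [if_pos hq, slice, enorm_mul, mul_pow, enorm_sqrt_sq]
      ring
    · rw [Set.indicator_of_notMem (show q ∉ {q : R3 | ‖q‖ < σ} from hq)]
      simp [hq]
  unfold en
  rw [lintegral_tsum fun n =>
    (lintegral_en_slice_aux hw hh n).lintegral_prod_right'.aemeasurable]
  simp only [h1]
  rw [ENNReal.tsum_mul_left, tsum_eq_zero_add' (f := fun n => ∫⁻ k, w n k * ‖h n k‖ₑ ^ 2)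
    ENNReal.summable, h0, zero_add]

theorem en_eq_tsum_softPart (w : Weight) (hw : ∀ n, Measurable (w n)) {h : Wave} (hh : IsBose h) :
    en w h = ∑' j, en w (softPart σ j h) := by
  unfold en
  rw [ENNReal.tsum_comm]
  refine tsum_congr fun n => ?_
  have hm : ∀ j, AEMeasurable fun k => w n k * ‖softPart σ j h n k‖ₑ ^ 2 := fun j =>
    ((hw n).mul ((isBose_softPart (σ := σ) (j := j) hh).measurable_sq n)).aemeasurable
  rw [← lintegral_tsum hm]
  refine lintegral_congr fun k => ?_
  rw [tsum_eq_single (softCount σ n k)]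
  · simp [softPart]
  · intro i hi
    simp [softPart, hi.symm]

/-! ### The form inequality on wave functions -/

/-- The wave functions of `(𝒫_j + ξ_j) g + 2e A_j g`. -/
def momentumW (F : Fin 3 → R3 → ℂ) (e : ℝ) (ξ : R3) (i : Fin 3) (g : Wave) : Wave := fun n k =>
  ((∑ l, k l i + ξ i : ℝ) : ℂ) * g n k + ((2 * e : ℝ) : ℂ) * anW (F i) g n k

/-- The wave functions of `g + s A_j A_j g`. -/
def pairW (F : Fin 3 → R3 → ℂ) (s : ℂ) (i : Fin 3) (g : Wave) : Wave := fun n k =>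
  g n k + s * anW (F i) (anW (F i) g) n k

/-- The positive part of the form at total momentum `ξ`, after completing squares. The form is
bounded below by `-(a + |ξ|)` if this dominates the negative part; both are sums of energies in `[0,
∞]`, so no domains are involved. -/
def posForm (F : Fin 3 → R3 → ℂ) (e : ℝ) (a : ℝ≥0∞) (ξ : R3) (g : Wave) : ℝ≥0∞ :=
  (∑ i, en one' (momentumW F e ξ i g)) + en absSum g +
    ENNReal.ofReal (e ^ 2 / 2) * (∑ i, en one' (pairW F 1 i g)) + (a + ‖ξ‖ₑ) * en one' g

/-- The negative part of the form, after completing squares. -/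
def negForm (F : Fin 3 → R3 → ℂ) (e : ℝ) (g : Wave) : ℝ≥0∞ :=
  ENNReal.ofReal (2 * e ^ 2) * (∑ i, en one' (anW (F i) g)) +
    ENNReal.ofReal (e ^ 2 / 2) * (∑ i, en one' (pairW F (-1) i g))

section

variable {F : Fin 3 → R3 → ℂ} {e : ℝ} {a : ℝ≥0∞}

theorem isBose_momentumW (hF : ∀ i, Measurable (F i)) (ξ : R3) (i : Fin 3) {g : Wave}
    (hg : IsBose g) : IsBose (momentumW F e ξ i g) where
  meas n := ((Complex.measurable_ofReal.comp ((measurable_momentum n i).add_const _)).mul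
    (hg.meas n)).add (((isBose_anW (hF i) hg).meas n).const_mul _)
  symm n τ k := by
    unfold momentumW
    rw [hg.symm, (isBose_anW (hF i) hg).symm, momentum_perm n i τ k]

theorem isBose_pairW (hF : ∀ i, Measurable (F i)) (s : ℂ) (i : Fin 3) {g : Wave}
    (hg : IsBose g) : IsBose (pairW F s i g) where
  meas n := (hg.meas n).add (((isBose_anW (hF i) (isBose_anW (hF i) hg)).meas n).const_mul _)
  symm n τ k := by
    unfold pairW
    rw [hg.symm, (isBose_anW (hF i) (isBose_anW (hF i) hg)).symm]

theorem HasSoft.momentumW (hF : ∀ i, IsHard σ (F i)) (ξ : R3) (i : Fin 3) {g : Wave}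
    (hg : HasSoft σ j g) : HasSoft σ j (momentumW F e ξ i g) := fun n k h => by
  rw [Nelson.momentumW, hg n k h, hg.anW (hF i) n k h, mul_zero, mul_zero, add_zero]

theorem HasSoft.pairW (hF : ∀ i, IsHard σ (F i)) (s : ℂ) (i : Fin 3) {g : Wave}
    (hg : HasSoft σ j g) : HasSoft σ j (pairW F s i g) := fun n k h => by
  rw [Nelson.pairW, hg n k h, (hg.anW (hF i)).anW (hF i) n k h, mul_zero, add_zero]

theorem slice_momentumW (ξ q : R3) (i : Fin 3) {g : Wave} (hg : IsBose g) :
    slice q (momentumW F e ξ i g) = momentumW F e (ξ + q) i (slice q g) := by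
  funext n k
  have h := congrFun (congrFun (slice_anW (f := F i) hg q) n) k
  rw [momentumW, ← h]
  simp only [slice, momentumW, Fin.sum_univ_succ, Fin.cons_zero, Fin.cons_succ, PiLp.add_apply]
  push_cast
  ring

theorem slice_pairW (hF : ∀ i, Measurable (F i)) (s : ℂ) (q : R3) (i : Fin 3) {g : Wave}
    (hg : IsBose g) : slice q (pairW F s i g) = pairW F s i (slice q g) := by
  funext n k
  rw [pairW, ← slice_anW hg, ← slice_anW (isBose_anW (hF i) hg)]
  simp only [slice, pairW]
  ring

theorem softPart_momentumW (hF : ∀ i, IsHard σ (F i)) (ξ : R3) (i : Fin 3) (g : Wave) :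
    softPart σ j (momentumW F e ξ i g) = momentumW F e ξ i (softPart σ j g) := by
  funext n k
  rw [momentumW, anW_softPart (hF i)]
  simp only [softPart, momentumW]
  split_ifs <;> simp

theorem softPart_pairW (hF : ∀ i, IsHard σ (F i)) (s : ℂ) (i : Fin 3) (g : Wave) :
    softPart σ j (pairW F s i g) = pairW F s i (softPart σ j g) := by
  funext n k
  rw [pairW, anW_softPart (hF i), anW_softPart (hF i)]
  simp only [softPart, pairW]
  split_ifs <;> simp

theorem posForm_eq_tsum (hF : ∀ i, Measurable (F i)) (hh : ∀ i, IsHard σ (F i)) (ξ : R3)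
    {g : Wave} (hg : IsBose g) :
    posForm F e a ξ g = ∑' j, posForm F e a ξ (softPart σ j g) := by
  have h1 := fun i => en_eq_tsum_softPart (σ := σ) one' isBoseWeight_one.meas
    (isBose_momentumW (e := e) hF ξ i hg)
  have h2 := fun i => en_eq_tsum_softPart (σ := σ) one' isBoseWeight_one.meas
    (isBose_pairW hF 1 i hg)
  have h3 := en_eq_tsum_softPart (σ := σ) one' isBoseWeight_one.meas hg
  have h4 := en_eq_tsum_softPart (σ := σ) absSum isBoseWeight_absSum.meas hg
  simp only [softPart_momentumW hh] at h1
  simp only [softPart_pairW hh] at h2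
  simp only [posForm, h1, h2, h3, h4, Fin.sum_univ_three, ENNReal.tsum_add, ENNReal.tsum_mul_left]

theorem negForm_eq_tsum (hF : ∀ i, Measurable (F i)) (hh : ∀ i, IsHard σ (F i))
    {g : Wave} (hg : IsBose g) :
    negForm F e g = ∑' j, negForm F e (softPart σ j g) := by
  have h1 := fun i => en_eq_tsum_softPart (σ := σ) one' isBoseWeight_one.meas
    (isBose_anW (hF i) hg)
  have h2 := fun i => en_eq_tsum_softPart (σ := σ) one' isBoseWeight_one.meas
    (isBose_pairW hF (-1) i hg)
  simp only [← fun i j => anW_softPart (j := j) (hh i) g] at h1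
  simp only [softPart_pairW hh] at h2
  simp only [negForm, h1, h2, Fin.sum_univ_three, ENNReal.tsum_add, ENNReal.tsum_mul_left]

theorem lintegral_en_one_slice {h : Wave} (hh : IsBose h) (hs : HasSoft σ (j + 1) h) :
    ∫⁻ q in {q : R3 | ‖q‖ < σ}, en one' (slice q h) = ((j : ℝ≥0∞) + 1) * en one' h :=
  lintegral_en_slice isBoseWeight_one hh hs

theorem en_absSum_slice {g : Wave} (hg : IsBose g) (q : R3) :
    en (fun n k => absSum (n + 1) (Fin.cons q k)) (slice q g) =
      en absSum (slice q g) + ‖q‖ₑ * en one' (slice q g) := by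
  rw [← en_const_mul _ enorm_ne_top, ← en_add _ _ isBoseWeight_absSum.meas _ (isBose_slice hg q)]
  simp only [absSum_cons, one', mul_one, add_comm]

theorem measurable_en_one_slice {h : Wave} (hh : IsBose h) :
    Measurable fun q => en one' (slice q h) := measurable_en_slice isBoseWeight_one hh

theorem lintegral_posForm_slice_le (hF : ∀ i, Measurable (F i)) (hh : ∀ i, IsHard σ (F i))
    (ξ : R3) {g : Wave} (hg : IsBose g) (hs : HasSoft σ (j + 1) g) :
    ∫⁻ q in {q : R3 | ‖q‖ < σ}, posForm F e a (ξ + q) (slice q g) ≤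
      ((j : ℝ≥0∞) + 1) * posForm F e a ξ g := by
  have hD := fun i => isBose_momentumW (e := e) hF ξ i hg
  have hB := fun i => isBose_pairW hF 1 i hg
  have mD := fun i => measurable_en_one_slice (hD i)
  have mB := fun i => measurable_en_one_slice (hB i)
  have mS := measurable_en_slice isBoseWeight_absSum hg
  have mg := measurable_en_one_slice hg
  have iD := fun i => lintegral_en_one_slice (hD i) (hs.momentumW hh ξ i)
  have iB := fun i => lintegral_en_one_slice (hB i) (hs.pairW hh 1 i)
  have iS := lintegral_en_slice isBoseWeight_absSum hg hs
  have ig := lintegral_en_one_slice hg hs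
  calc ∫⁻ q in {q : R3 | ‖q‖ < σ}, posForm F e a (ξ + q) (slice q g)
      ≤ ∫⁻ q in {q : R3 | ‖q‖ < σ}, ((∑ i, en one' (slice q (momentumW F e ξ i g))) +
          en (fun n k => absSum (n + 1) (Fin.cons q k)) (slice q g) +
          ENNReal.ofReal (e ^ 2 / 2) * (∑ i, en one' (slice q (pairW F 1 i g))) +
          (a + ‖ξ‖ₑ) * en one' (slice q g)) := by
        refine lintegral_mono fun q => ?_
        simp only [slice_momentumW ξ q _ hg, slice_pairW hF 1 q _ hg, en_absSum_slice hg]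
        unfold posForm
        have h1 : a + ‖ξ + q‖ₑ ≤ (a + ‖ξ‖ₑ) + ‖q‖ₑ := by
          rw [add_assoc]
          gcongr
          exact enorm_add_le _ _
        refine (add_le_add le_rfl (mul_le_mul_left h1 _)).trans (le_of_eq ?_)
        ring
    _ = ((j : ℝ≥0∞) + 1) * posForm F e a ξ g := by
        have mD' : Measurable fun q => ∑ i, en one' (slice q (momentumW F e ξ i g)) :=
          Finset.measurable_sum _ fun i _ => mD i
        have mB' : Measurable fun q => ∑ i, en one' (slice q (pairW F 1 i g)) :=
          Finset.measurable_sum _ fun i _ => mB i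
        rw [lintegral_add_right _ (mg.const_mul _), lintegral_add_right _ (mB'.const_mul _),
          lintegral_add_right _ mS, lintegral_const_mul _ mg, lintegral_const_mul _ mB',
          lintegral_finsetSum _ fun i _ => mD i, lintegral_finsetSum _ fun i _ => mB i, iS, ig]
        simp only [iD, iB, ← Finset.mul_sum, posForm]
        ring

theorem le_lintegral_negForm_slice (hF : ∀ i, Measurable (F i)) (hh : ∀ i, IsHard σ (F i))
    {g : Wave} (hg : IsBose g) (hs : HasSoft σ (j + 1) g) :
    ((j : ℝ≥0∞) + 1) * negForm F e g =
      ∫⁻ q in {q : R3 | ‖q‖ < σ}, negForm F e (slice q g) := by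
  have hA := fun i => isBose_anW (hF i) hg
  have hB := fun i => isBose_pairW hF (-1) i hg
  have mA := fun i => measurable_en_one_slice (hA i)
  have mB := fun i => measurable_en_one_slice (hB i)
  have iA := fun i => lintegral_en_one_slice (hA i) (hs.anW (hh i))
  have iB := fun i => lintegral_en_one_slice (hB i) (hs.pairW hh (-1) i)
  have mA' : Measurable fun q => ∑ i, en one' (slice q (anW (F i) g)) :=
    Finset.measurable_sum _ fun i _ => mA i
  have mB' : Measurable fun q => ∑ i, en one' (slice q (pairW F (-1) i g)) :=
    Finset.measurable_sum _ fun i _ => mB i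
  unfold negForm
  simp only [← slice_anW hg, ← slice_pairW hF (-1) _ _ hg]
  rw [lintegral_add_right _ (mB'.const_mul _), lintegral_const_mul _ mA',
    lintegral_const_mul _ mB', lintegral_finsetSum _ fun i _ => mA i,
    lintegral_finsetSum _ fun i _ => mB i]
  simp only [iA, iB, ← Finset.mul_sum]
  ring

/-- If the form inequality holds, at all total momenta, for wave functions without soft bosons, and
soft bosons do not interact, then it holds for all wave functions. The components with different
numbers of soft bosons decouple, and slicing reduces their number one by one. -/
theorem negForm_le_posForm (hF : ∀ i, Measurable (F i)) (hh : ∀ i, IsHard σ (F i))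
    (h0 : ∀ (ξ : R3) (g : Wave), IsBose g → HasSoft σ 0 g → negForm F e g ≤ posForm F e a ξ g)
    (ξ : R3) {g : Wave} (hg : IsBose g) : negForm F e g ≤ posForm F e a ξ g := by
  have h : ∀ j, ∀ (ξ : R3) (g : Wave), IsBose g → HasSoft σ j g →
      negForm F e g ≤ posForm F e a ξ g := by
    intro j
    induction j with
    | zero => exact h0
    | succ j ih =>
      intro ξ g hg hs
      have h1 : ((j : ℝ≥0∞) + 1) * negForm F e g ≤ ((j : ℝ≥0∞) + 1) * posForm F e a ξ g := by
        rw [le_lintegral_negForm_slice hF hh hg hs]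
        refine le_trans (setLIntegral_mono' (measurableSet_lt measurable_norm measurable_const)
          fun q hq => ?_) (lintegral_posForm_slice_le hF hh ξ hg hs)
        -- the total momentum is shifted by `q`; the energy `|q|` pays for the shift
        exact ih (ξ + q) _ (isBose_slice hg q) (hasSoft_slice hs hq)
      exact (ENNReal.mul_le_mul_iff_right (by simp) (by simp)).1 h1
  rw [posForm_eq_tsum hF hh ξ hg, negForm_eq_tsum hF hh hg]
  exact ENNReal.tsum_le_tsum fun j => h j ξ _ (isBose_softPart hg) (hasSoft_softPart g)

end

end

/-! ### The form inequality and the Nelson form -/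

theorem ofReal_norm_sq {E : Type*} [SeminormedAddCommGroup E] (a : E) :
    ENNReal.ofReal (‖a‖ ^ 2) = ‖a‖ₑ ^ 2 := by
  rw [ENNReal.ofReal_pow (norm_nonneg _), ofReal_norm]

theorem sum_ofReal {a : Fin 3 → ℝ} (h : ∀ i, 0 ≤ a i) :
    ENNReal.ofReal (∑ i, a i) = ∑ i, ENNReal.ofReal (a i) :=
  ENNReal.ofReal_sum_of_nonneg fun i _ => h i

namespace QForm

variable {E : Type*} [NormedAddCommGroup E] [InnerProductSpace ℂ E] (q : QForm E)

/-- The positive part of the form, after completing squares. -/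
def posPart (e : ℝ) (x : q.V) : ℝ := (∑ j, ‖q.P j x + ((2 * e : ℝ) : ℂ) • q.A j x‖ ^ 2) +
  ‖q.H x‖ ^ 2 + e ^ 2 / 2 * ∑ j, ‖(x : E) + (1 : ℂ) • q.B j x‖ ^ 2

/-- The negative part of the form, after completing squares. -/
def negPart (e : ℝ) (x : q.V) : ℝ := 2 * e ^ 2 * (∑ j, ‖q.A j x‖ ^ 2) +
  e ^ 2 / 2 * ∑ j, ‖(x : E) + (-1 : ℂ) • q.B j x‖ ^ 2

theorem posPart_nonneg (e : ℝ) (x : q.V) : 0 ≤ q.posPart e x := by unfold posPart; positivity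

theorem re_form_eq_sub (e : ℝ) (x : q.V) :
    (q.form e x x).re = q.posPart e x - q.negPart e x := by
  have h1 : ∀ j, ‖q.P j x + ((2 * e : ℝ) : ℂ) • q.A j x‖ ^ 2 = ‖q.P j x‖ ^ 2 +
      4 * e * (inner ℂ (q.A j x) (q.P j x)).re + 4 * e ^ 2 * ‖q.A j x‖ ^ 2 := fun j => by
    have h := norm_add_sq (𝕜 := ℂ) (((2 * e : ℝ) : ℂ) • q.A j x) (q.P j x)
    rw [add_comm, h, inner_smul_left, norm_smul, Complex.conj_ofReal, Complex.norm_real, mul_pow,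
      Real.norm_eq_abs, sq_abs]
    have : RCLike.re (((2 * e : ℝ) : ℂ) * inner ℂ (q.A j x) (q.P j x)) =
        2 * e * (inner ℂ (q.A j x) (q.P j x)).re := Complex.re_ofReal_mul _ _
    rw [this]
    ring
  have h2 : ∀ j, ‖(x : E) + (1 : ℂ) • q.B j x‖ ^ 2 = ‖(x : E)‖ ^ 2 +
      2 * (inner ℂ (x : E) (q.B j x)).re + ‖q.B j x‖ ^ 2 := fun j => by
    rw [one_smul]
    exact norm_add_sq (𝕜 := ℂ) _ _
  have h3 : ∀ j, ‖(x : E) + (-1 : ℂ) • q.B j x‖ ^ 2 = ‖(x : E)‖ ^ 2 -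
      2 * (inner ℂ (x : E) (q.B j x)).re + ‖q.B j x‖ ^ 2 := fun j => by
    rw [neg_one_smul, ← sub_eq_add_neg]
    exact norm_sub_sq (𝕜 := ℂ) _ _
  rw [re_form_self, kin, posPart, negPart]
  simp only [h1, h2, h3, Fin.sum_univ_three]
  ring

theorem ofReal_negPart (e : ℝ) (x : q.V) : ENNReal.ofReal (q.negPart e x) =
    ENNReal.ofReal (2 * e ^ 2) * (∑ j, ‖q.A j x‖ₑ ^ 2) +
      ENNReal.ofReal (e ^ 2 / 2) * ∑ j, ‖(x : E) + (-1 : ℂ) • q.B j x‖ₑ ^ 2 := by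
  rw [negPart, ENNReal.ofReal_add (by positivity) (by positivity),
    ENNReal.ofReal_mul (p := 2 * e ^ 2) (by positivity),
    ENNReal.ofReal_mul (p := e ^ 2 / 2) (by positivity),
    sum_ofReal fun i => sq_nonneg _, sum_ofReal fun i => sq_nonneg _]
  simp only [ofReal_norm_sq]

theorem ofReal_posPart {b : ℝ} (hb : 0 ≤ b) (e : ℝ) (x : q.V) :
    ENNReal.ofReal (q.posPart e x + b * ‖(x : E)‖ ^ 2) =
    (∑ j, ‖q.P j x + ((2 * e : ℝ) : ℂ) • q.A j x‖ₑ ^ 2) + ‖q.H x‖ₑ ^ 2 +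
      ENNReal.ofReal (e ^ 2 / 2) * (∑ j, ‖(x : E) + (1 : ℂ) • q.B j x‖ₑ ^ 2) +
      ENNReal.ofReal b * ‖(x : E)‖ₑ ^ 2 := by
  rw [ENNReal.ofReal_add (q.posPart_nonneg e x) (by positivity), posPart,
    ENNReal.ofReal_add (by positivity) (by positivity),
    ENNReal.ofReal_add (by positivity) (by positivity),
    ENNReal.ofReal_mul (by positivity), ENNReal.ofReal_mul hb,
    sum_ofReal fun i => sq_nonneg _, sum_ofReal fun i => sq_nonneg _]
  simp only [ofReal_norm_sq]

theorem ofReal_negPart_le_iff {b : ℝ} (hb : 0 ≤ b) (e : ℝ) (x : q.V) :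
    ENNReal.ofReal (q.negPart e x) ≤ ENNReal.ofReal (q.posPart e x + b * ‖(x : E)‖ ^ 2) ↔
      -b * ‖(x : E)‖ ^ 2 ≤ (q.form e x x).re := by
  have h0 := q.posPart_nonneg e x
  rw [ENNReal.ofReal_le_ofReal_iff (by positivity), q.re_form_eq_sub]
  constructor <;> intro h' <;> linarith

end QForm

theorem wave_add_smul (ψ φ : Fock) (c : ℂ) (n : ℕ) :
    ∀ᵐ k, wave (ψ + c • φ) n k = wave ψ n k + c * wave φ n k := by
  filter_upwards [wave_add ψ (c • φ) n, wave_smul c φ n] with k h1 h2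
  rw [h1, h2]

section

variable {f : Fin 3 → R3 → ℂ} {e : ℝ}

theorem posForm_congr {g g' : Wave} (h : ∀ n, ∀ᵐ k, g n k = g' n k) (a : ℝ≥0∞) (ξ : R3) :
    posForm f e a ξ g = posForm f e a ξ g' := by
  have h1 : ∀ i, en one' (momentumW f e ξ i g) = en one' (momentumW f e ξ i g') := fun i =>
    en_congr fun n => by
      filter_upwards [h n, anW_congr (f i) h n] with k h1 h2
      rw [momentumW, momentumW, h1, h2]
  have h2 : ∀ i, en one' (pairW f 1 i g) = en one' (pairW f 1 i g') := fun i =>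
    en_congr fun n => by
      filter_upwards [h n, anW_congr (f i) (anW_congr (f i) h) n] with k h1 h2
      rw [pairW, pairW, h1, h2]
  simp only [posForm, h1, h2, en_congr h]

theorem negForm_congr {g g' : Wave} (h : ∀ n, ∀ᵐ k, g n k = g' n k) :
    negForm f e g = negForm f e g' := by
  have h1 : ∀ i, en one' (anW (f i) g) = en one' (anW (f i) g') := fun i =>
    en_congr (anW_congr (f i) h)
  have h2 : ∀ i, en one' (pairW f (-1) i g) = en one' (pairW f (-1) i g') := fun i =>
    en_congr fun n => by
      filter_upwards [h n, anW_congr (f i) (anW_congr (f i) h) n] with k h1 h2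
      rw [pairW, pairW, h1, h2]
  simp only [negForm, h1, h2]

attribute [local irreducible] mulOp creation annihilation fieldMomentum freeOp sqrtField

theorem wave_P (i : Fin 3) (x : (nelsonForm f).V) (n : ℕ) :
    ∀ᵐ k, wave ((nelsonForm f).P i x) n k = ((∑ l, k l i : ℝ) : ℂ) * wave x n k :=
  wave_fieldMomentum ⟨x, formDom_le_fieldMomentum f i x.2⟩ n

theorem wave_A (i : Fin 3) (x : (nelsonForm f).V) (n : ℕ) :
    ∀ᵐ k, wave ((nelsonForm f).A i x) n k = anW (f i) (wave x) n k :=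
  wave_annihilation ⟨x, formDom_le_annihilation f i x.2⟩ n

theorem wave_B (i : Fin 3) (x : (nelsonForm f).V) (n : ℕ) :
    ∀ᵐ k, wave ((nelsonForm f).B i x) n k = anW (f i) (anW (f i) (wave x)) n k :=
  wave_annihilation_annihilation (formDom_le_pair f i x.2) n

theorem enorm_A_sq (i : Fin 3) (x : (nelsonForm f).V) :
    ‖(nelsonForm f).A i x‖ₑ ^ 2 = en one' (anW (f i) (wave x)) := by
  rw [enorm_sq_eq_en]
  exact en_congr (wave_A i x)

theorem enorm_pairW_sq (i : Fin 3) (x : (nelsonForm f).V) (s : ℂ) :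
    ‖(x : Fock) + s • (nelsonForm f).B i x‖ₑ ^ 2 = en one' (pairW f s i (wave x)) := by
  rw [enorm_sq_eq_en]
  refine en_congr fun n => ?_
  filter_upwards [wave_add_smul (x : Fock) ((nelsonForm f).B i x) s n, wave_B i x n] with k h1 h2
  rw [h1, h2, pairW]

theorem enorm_momentumW_sq (i : Fin 3) (x : (nelsonForm f).V) (ξ : R3) :
    ‖((nelsonForm f).shift ξ).P i x + ((2 * e : ℝ) : ℂ) • (nelsonForm f).A i x‖ₑ ^ 2 =
      en one' (momentumW f e ξ i (wave x)) := by
  have h : ((nelsonForm f).shift ξ).P i x =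
    (nelsonForm f).P i x + ((ξ i : ℝ) : ℂ) • (x : Fock) := rfl
  rw [h, enorm_sq_eq_en]
  refine en_congr fun n => ?_
  filter_upwards [wave_add_smul ((nelsonForm f).P i x + ((ξ i : ℝ) : ℂ) • (x : Fock))
    ((nelsonForm f).A i x) ((2 * e : ℝ) : ℂ) n, wave_add_smul ((nelsonForm f).P i x) (x : Fock)
    ((ξ i : ℝ) : ℂ) n, wave_A i x n, wave_P i x n] with k h1 h2 h3 h4
  rw [h1, h2, h3, h4, momentumW]
  push_cast
  ring

theorem negForm_wave (x : (nelsonForm f).V) (ξ : R3) : negForm f e (wave x) =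
    ENNReal.ofReal (((nelsonForm f).shift ξ).negPart e x) :=
  (congrArg₂ (fun s t => ENNReal.ofReal (2 * e ^ 2) * s + ENNReal.ofReal (e ^ 2 / 2) * t)
    (Finset.sum_congr rfl fun i _ => (enorm_A_sq i x).symm)
    (Finset.sum_congr rfl fun i _ => (enorm_pairW_sq i x (-1)).symm)).trans
    (QForm.ofReal_negPart ((nelsonForm f).shift ξ) e x).symm

theorem posForm_wave {a : ℝ} (ha : 0 ≤ a) (x : (nelsonForm f).V) (ξ : R3) :
    posForm f e (ENNReal.ofReal a) ξ (wave x) =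
    ENNReal.ofReal (((nelsonForm f).shift ξ).posPart e x + (a + ‖ξ‖) * ‖(x : Fock)‖ ^ 2) := by
  have h := QForm.ofReal_posPart ((nelsonForm f).shift ξ) (add_nonneg ha (norm_nonneg ξ)) e x
  refine Eq.trans ?_ h.symm
  have e1 : ∀ i, en one' (momentumW f e ξ i (wave x)) = ‖((nelsonForm f).shift ξ).P i x +
    ((2 * e : ℝ) : ℂ) • ((nelsonForm f).shift ξ).A i x‖ₑ ^ 2 :=
    fun i => (enorm_momentumW_sq i x ξ).symm
  have e2 : ∀ i, en one' (pairW f 1 i (wave x)) =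
    ‖(x : Fock) + (1 : ℂ) • ((nelsonForm f).shift ξ).B i x‖ₑ ^ 2 :=
    fun i => (enorm_pairW_sq i x 1).symm
  have e3 : en absSum (wave x) = ‖((nelsonForm f).shift ξ).H x‖ₑ ^ 2 := (enorm_H_sq x).symm
  have e4 : ENNReal.ofReal a + ‖ξ‖ₑ = ENNReal.ofReal (a + ‖ξ‖) := by
    rw [ENNReal.ofReal_add ha (norm_nonneg ξ), ofReal_norm]
  have e5 : en one' (wave x) = ‖(x : Fock)‖ₑ ^ 2 := (enorm_sq_eq_en (x : Fock)).symm
  unfold posForm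
  simp only [e1, e2, e3, e4, e5]

/-- The form inequality on wave functions expresses a lower bound of the form. -/
theorem negForm_le_posForm_iff {a : ℝ} (ha : 0 ≤ a) (x : (nelsonForm f).V) (ξ : R3) :
    negForm f e (wave x) ≤ posForm f e (ENNReal.ofReal a) ξ (wave x) ↔
      -(a + ‖ξ‖) * ‖(x : Fock)‖ ^ 2 ≤ (((nelsonForm f).shift ξ).form e x x).re :=
  (iff_of_eq (congrArg₂ (· ≤ ·) (negForm_wave x ξ) (posForm_wave ha x ξ))).trans
    (QForm.ofReal_negPart_le_iff ((nelsonForm f).shift ξ) (add_nonneg ha (norm_nonneg ξ)) e x)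

end

section

variable {C : ℝ≥0} {f : Fin 3 → R3 → ℂ} {e : ℝ}

attribute [local irreducible] mulOp creation annihilation fieldMomentum freeOp sqrtField

/-- Wave functions with finite form belong to the form domain. The squares control `𝒫 + 2eA` and
`1 + A·A`, and `A` is controlled by `H_f`. -/
theorem ofWave_mem_formDom (hf : ∀ j, IsFormFactor C (f j)) {g : Wave} (hg : IsBose g)
    (h : en one' g < ⊤) (h1 : en absSum g < ⊤) (ξ : R3)
    (h2 : ∀ i, en one' (momentumW f e ξ i g) < ⊤) (h3 : ∀ i, en one' (pairW f 1 i g) < ⊤) :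
    ofWave g hg h ∈ formDom f := by
  set ψ := ofWave g hg h
  have hw := wave_ofWave hg h
  have hS : en absSum (wave ψ) < ⊤ := by
    rw [en_congr hw]
    exact h1
  have hA : ∀ i, ψ ∈ (annihilation (f i)).domain := fun i => mem_annihilation_of_formFactor (hf i) hS
  have wA : ∀ i n, ∀ᵐ k, wave (annihilation (f i) ⟨ψ, hA i⟩) n k = anW (f i) g n k := fun i n => by
    filter_upwards [wave_annihilation ⟨ψ, hA i⟩ n, anW_congr (f i) hw n] with k e1 e2
    rw [e1, e2]
  refine mem_formDom.2 ⟨⟨fun i => ?_, fun i => mem_opMul (hA i) ?_⟩, mem_sqrtField hS⟩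
  · have hm := isBose_momentumW (e := e) (fun i => (hf i).meas) ξ i hg
    set η := ofWave _ hm (h2 i)
    refine mem_domain_fieldMomentum ?_
    set φ := (η + (-((ξ i : ℝ) : ℂ)) • ψ) + (-((2 * e : ℝ) : ℂ)) • annihilation (f i) ⟨ψ, hA i⟩
    refine lt_of_le_of_lt (le_of_eq ?_) (en_wave_lt_top φ)
    have : ∀ n, ∀ᵐ k : Config n, wave φ n k = ((∑ l, k l i : ℝ) : ℂ) * wave ψ n k := fun n => by
      filter_upwards [wave_add_smul (η + (-((ξ i : ℝ) : ℂ)) • ψ) (annihilation (f i) ⟨ψ, hA i⟩)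
        (-((2 * e : ℝ) : ℂ)) n, wave_add_smul η ψ (-((ξ i : ℝ) : ℂ)) n, wA i n,
        wave_ofWave hm (h2 i) n, hw n] with k e1 e2 e3 e4 e5
      rw [e1, e2, e3, e4, e5, momentumW]
      push_cast
      ring
    rw [en_congr this]
    unfold en one'
    simp only [one_mul, enorm_ofReal_mul_sq]
  · have hm := isBose_pairW (fun i => (hf i).meas) 1 i hg
    set η := ofWave _ hm (h3 i)
    refine mem_domain_annihilation (hf i).meas (hf i).sq_lt_top ?_
    refine lt_of_le_of_lt (le_of_eq (en_congr fun n => ?_)) (en_wave_lt_top (η + (-1 : ℂ) • ψ))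
    filter_upwards [wave_add_smul η ψ (-1) n, wave_ofWave hm (h3 i) n, hw n,
      anW_congr (f i) (wA i) n] with k e1 e2 e3 e4
    rw [e4, e1, e2, e3, pairW]
    ring

/-- It suffices to prove the form inequality on the form domain: outside, the right-hand side is
infinite. This needs `l > 0` and `e ≠ 0`, so that all terms have positive coefficients. -/
theorem negForm_le_posForm_of_form (hf : ∀ j, IsFormFactor C (f j)) (he : e ≠ 0) {l : ℝ}
    (hl : 0 < l) (ξ : R3) {g : Wave} (hg : IsBose g)
    (h : ∀ x : (nelsonForm f).V, (∀ n, ∀ᵐ k, wave x n k = g n k) →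
      -(l + ‖ξ‖) * ‖(x : Fock)‖ ^ 2 ≤ (((nelsonForm f).shift ξ).form e x x).re) :
    negForm f e g ≤ posForm f e (ENNReal.ofReal l) ξ g := by
  rcases eq_or_ne (posForm f e (ENNReal.ofReal l) ξ g) ⊤ with htop | htop
  · rw [htop]
    exact le_top
  have hl' : ENNReal.ofReal l ≠ 0 := by simpa using hl
  have he' : ENNReal.ofReal (e ^ 2 / 2) ≠ 0 := by
    have : 0 < e ^ 2 / 2 := by positivity
    simpa using this
  unfold posForm at htop
  simp only [ENNReal.add_ne_top] at htop
  obtain ⟨⟨⟨h1, h2⟩, h3⟩, h4⟩ := htop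
  have h1' : ∀ i, en one' (momentumW f e ξ i g) < ⊤ := fun i =>
    (ENNReal.sum_ne_top.1 h1 i (Finset.mem_univ i)).lt_top
  have h3' : ∀ i, en one' (pairW f 1 i g) < ⊤ := fun i => by
    have : ∑ i, en one' (pairW f 1 i g) ≠ ⊤ := fun hc => h3 (by rw [hc, ENNReal.mul_top he'])
    exact (ENNReal.sum_ne_top.1 this i (Finset.mem_univ i)).lt_top
  have h4' : en one' g < ⊤ := by
    refine lt_top_iff_ne_top.2 fun hc => h4 ?_
    rw [hc, ENNReal.mul_top]
    simp [hl]
  have hw := wave_ofWave hg h4'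
  have hx := (negForm_le_posForm_iff (e := e) hl.le
    ⟨_, ofWave_mem_formDom hf hg h4' h2.lt_top ξ h1' h3'⟩ ξ).2 (h _ hw)
  rwa [negForm_congr hw, posForm_congr hw] at hx

end

/-! ### The energy of hard bosons -/

/-- The restriction of `f` to momenta with `|q| ≥ σ`. -/
def hardPart (σ : ℝ≥0) (f : R3 → ℂ) (q : R3) : ℂ := if ‖q‖ < σ then 0 else f q

section

variable {σ C : ℝ≥0}

theorem isHard_hardPart (f : R3 → ℂ) : IsHard σ (hardPart σ f) := fun _ h => if_pos h

theorem enorm_hardPart_le (f : R3 → ℂ) (q : R3) : ‖hardPart σ f q‖ₑ ≤ ‖f q‖ₑ := by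
  unfold hardPart
  split_ifs <;> simp

theorem measurable_hardPart {f : R3 → ℂ} (hf : Measurable f) : Measurable (hardPart σ f) :=
  Measurable.ite (measurableSet_lt measurable_norm measurable_const) measurable_const hf

theorem IsFormFactor.hardPart {f : R3 → ℂ} (hf : IsFormFactor C f) (σ : ℝ≥0) :
    IsFormFactor C (hardPart σ f) := by
  have h : ∀ (μ : Measure R3) (w : R3 → ℝ≥0∞),
      ∫⁻ q, ‖Nelson.hardPart σ f q‖ₑ ^ 2 * w q ∂μ ≤ ∫⁻ q, ‖f q‖ₑ ^ 2 * w q ∂μ :=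
    fun μ w => lintegral_mono fun q =>
      mul_le_mul_left (pow_le_pow_left' (enorm_hardPart_le f q) 2) _
  exact {
    meas := measurable_hardPart hf.meas
    real := fun q => by
      unfold Nelson.hardPart
      split_ifs
      · exact map_zero _
      · exact hf.real q
    int_inv := (h _ _).trans hf.int_inv
    int_inv_half := (h _ _).trans hf.int_inv_half
    int_soft := fun τ => (h _ _).trans (hf.int_soft τ)
    sq_lt_top := lt_of_le_of_lt (lintegral_mono fun q =>
      pow_le_pow_left' (enorm_hardPart_le f q) 2) hf.sq_lt_top
    sq_mul_lt_top := lt_of_le_of_lt (h _ _) hf.sq_mul_lt_top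
    sq_mul_sq_lt_top := lt_of_le_of_lt (h _ _) hf.sq_mul_sq_lt_top
    integrable := hf.integrable.mono (measurable_hardPart hf.meas).aestronglyMeasurable
      (Filter.Eventually.of_forall fun q => enorm_le_iff_norm_le.1 (enorm_hardPart_le f q)) }

theorem anW_hardPart (f : R3 → ℂ) {g : Wave} (hg : HasSoft σ 0 g) :
    anW (hardPart σ f) g = anW f g := by
  funext n k
  unfold anW
  congr 1
  refine integral_congr_ae (Filter.Eventually.of_forall fun q => ?_)
  simp only [hardPart]
  split_ifs with hq
  · rw [hg _ _ (by rw [softCount_cons, if_pos hq]; omega), mul_zero, mul_zero]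
  · rfl

theorem posForm_hardPart (f : Fin 3 → R3 → ℂ) (e : ℝ) (a : ℝ≥0∞) (ξ : R3) {g : Wave}
    (hg : HasSoft σ 0 g) :
    posForm (fun j => hardPart σ (f j)) e a ξ g = posForm f e a ξ g := by
  have h1 := fun i => anW_hardPart (f i) hg
  have h2 := fun i => anW_hardPart (f i) (hg.anW (isHard_hardPart (f i)))
  simp only [h1] at h2
  have h3 : ∀ i, momentumW (fun j => hardPart σ (f j)) e ξ i g = momentumW f e ξ i g := fun i => by
    funext n k
    simp only [momentumW, h1]
  have h4 : ∀ i, pairW (fun j => hardPart σ (f j)) 1 i g = pairW f 1 i g := fun i => by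
    funext n k
    simp only [pairW, h1, h2]
  simp only [posForm, h3, h4]

theorem negForm_hardPart (f : Fin 3 → R3 → ℂ) (e : ℝ) {g : Wave} (hg : HasSoft σ 0 g) :
    negForm (fun j => hardPart σ (f j)) e g = negForm f e g := by
  have h1 := fun i => anW_hardPart (f i) hg
  have h2 := fun i => anW_hardPart (f i) (hg.anW (isHard_hardPart (f i)))
  simp only [h1] at h2
  have h4 : ∀ i, pairW (fun j => hardPart σ (f j)) (-1) i g = pairW f (-1) i g := fun i => by
    funext n k
    simp only [pairW, h1, h2]
  simp only [negForm, h1, h4]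

theorem wave_zero_of_inner_vacuum {r : Fock} (h : inner ℂ vacuum r = 0) :
    ∀ᵐ k, wave r 0 k = 0 := by
  have h1 := hasSum_inner_wave vacuum r
  have h2 : ∀ n, n ≠ 0 → ∫ k, (starRingEnd ℂ) (wave vacuum n k) * wave r n k = 0 := fun n hn => by
    refine integral_eq_zero_of_ae ?_
    filter_upwards [vacuum_mem_sector n hn] with k hk
    rw [hk, map_zero, zero_mul]
    rfl
  have h3 := h1.unique (hasSum_single 0 h2)
  have h4 : ∫ k, (starRingEnd ℂ) (wave vacuum 0 k) * wave r 0 k = ∫ k, wave r 0 k :=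
    integral_congr_ae (by
      filter_upwards [wave_vacuum_zero] with k hk
      rw [hk, map_one, one_mul])
  rw [h, h4, volume_config_zero, integral_dirac] at h3
  refine Filter.Eventually.of_forall fun k => ?_
  rw [Subsingleton.elim k default, ← h3]

theorem coe_le_absSum {n : ℕ} (hn : n ≠ 0) {k : Config n} (h : softCount σ n k = 0) :
    (σ : ℝ≥0∞) ≤ absSum n k := by
  obtain ⟨m, rfl⟩ := Nat.exists_eq_succ_of_ne_zero hn
  have h1 : ¬ ‖k 0‖ < σ := fun hk => by
    have := Finset.sum_eq_zero_iff.1 h 0 (Finset.mem_univ _)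
    rw [if_pos hk] at this
    exact one_ne_zero this
  refine le_trans ?_ (Finset.single_le_sum (f := fun i => ‖k i‖ₑ) (fun i _ => zero_le)
    (Finset.mem_univ 0))
  rw [← ofReal_norm, ← ENNReal.ofReal_coe_nnreal]
  exact ENNReal.ofReal_le_ofReal (not_lt.1 h1)

/-- A vector orthogonal to the vacuum has energy `σ`, up to its part with soft bosons. -/
theorem coe_mul_enorm_sq_le {r y : Fock} (h0 : ∀ᵐ k, wave r 0 k = 0)
    (h : ∀ n, n ≠ 0 → ∀ᵐ k, softCount σ n k ≠ 0 → ‖wave r n k‖ₑ = ‖wave y n k‖ₑ) :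
    σ * ‖r‖ₑ ^ 2 ≤ en absSum (wave r) + σ * ‖y‖ₑ ^ 2 := by
  rw [enorm_sq_eq_en, enorm_sq_eq_en, ← en_const_mul _ ENNReal.coe_ne_top,
    ← en_const_mul _ ENNReal.coe_ne_top]
  unfold en
  rw [← ENNReal.tsum_add]
  refine ENNReal.tsum_le_tsum fun n => ?_
  have hm : Measurable fun k => absSum n k * ‖wave r n k‖ₑ ^ 2 :=
    (isBoseWeight_absSum.meas n).mul ((measurable_wave r n).enorm.pow_const 2)
  rw [← lintegral_add_left hm]
  refine lintegral_mono_ae ?_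
  simp only [one', mul_one]
  rcases eq_or_ne n 0 with rfl | hn
  · filter_upwards [h0] with k hk
    simp [hk]
  · filter_upwards [h n hn] with k hk
    by_cases hs : softCount σ n k = 0
    · exact le_add_right (mul_le_mul_left (coe_le_absSum hn hs) _)
    · rw [hk hs]
      exact le_add_left le_rfl

theorem real_gap_of_enorm {E : Type*} [NormedAddCommGroup E] {r h y : E}
    (H : (σ : ℝ≥0∞) * ‖r‖ₑ ^ 2 ≤ ‖h‖ₑ ^ 2 + σ * ‖y‖ₑ ^ 2) :
    (σ : ℝ) * ‖r‖ ^ 2 ≤ ‖h‖ ^ 2 + σ * ‖y‖ ^ 2 := by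
  rw [← ofReal_norm_sq, ← ofReal_norm_sq, ← ofReal_norm_sq, ← ENNReal.ofReal_coe_nnreal,
    ← ENNReal.ofReal_mul (by positivity), ← ENNReal.ofReal_mul (by positivity),
    ← ENNReal.ofReal_add (by positivity) (by positivity)] at H
  exact (ENNReal.ofReal_le_ofReal_iff (by positivity)).1 H

theorem inner_sub_smul_add {E : Type*} [NormedAddCommGroup E] [InnerProductSpace ℂ E]
    {Ω x u : E} {α : ℂ} (hΩ : ‖Ω‖ = 1) (hu : inner ℂ Ω u = 0) (hα : inner ℂ Ω x = α) :
    inner ℂ Ω (x - α • (Ω + u)) = 0 := by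
  rw [inner_sub_right, inner_smul_right, inner_add_right, hu, hα, inner_self_eq_norm_sq_to_K, hΩ]
  simp

theorem wave_sub_smul_add (x Ω u : Fock) (α : ℂ) (n : ℕ) :
    ∀ᵐ k, wave (x - α • (Ω + u)) n k = wave x n k - α * (wave Ω n k + wave u n k) := by
  filter_upwards [wave_sub x (α • (Ω + u)) n, wave_smul α (Ω + u) n, wave_add Ω u n]
    with k h1 h2 h3
  rw [h1, h2, h3]

theorem mul_le_add_mul_of_le {s t a b c : ℝ} (hs : 0 ≤ s) (hst : s ≤ t) (hb : 0 ≤ b)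
    (h : t * a ≤ b + t * c) : s * a ≤ b + s * c := by
  rcases le_total a c with hac | hac
  · nlinarith
  · nlinarith [mul_nonneg (sub_nonneg.2 hst) (sub_nonneg.2 hac)]

/-- The gap above the vacuum for vectors `x` without soft bosons. The soft bosons in the remainder
are those of `α • u`. -/
theorem gap_of_hard {s : ℝ} (hs0 : 0 ≤ s) (hs : s ≤ σ) {x u h : Fock} {α : ℂ}
    (hu : inner ℂ vacuum u = 0) (hα : inner ℂ vacuum x = α) (hΩ : ‖vacuum‖ = 1)
    (hx : ∀ n, ∀ᵐ k, softCount σ n k ≠ 0 → wave x n k = 0)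
    (hh : ‖h‖ₑ ^ 2 = en absSum (wave (x - α • (vacuum + u)))) :
    s * ‖x - α • (vacuum + u)‖ ^ 2 ≤ ‖h‖ ^ 2 + s * (‖α‖ ^ 2 * ‖u‖ ^ 2) := by
  rw [← mul_pow, ← norm_smul]
  refine mul_le_add_mul_of_le hs0 hs (sq_nonneg _) (real_gap_of_enorm (hh ▸ coe_mul_enorm_sq_le
    (wave_zero_of_inner_vacuum (inner_sub_smul_add hΩ hu hα)) fun n hn => ?_))
  filter_upwards [hx n, wave_sub_smul_add x vacuum u α n, vacuum_mem_sector n hn, wave_smul α u n]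
    with k h1 h2 h3 h4 hs
  rw [h2, h3, h4, h1 hs, zero_add, zero_sub, enorm_neg]

section

variable {Λ e : ℝ} (hf : ∀ j, IsFormFactor C (formFactor Λ j))
include hf

attribute [local irreducible] mulOp creation annihilation fieldMomentum freeOp sqrtField

/-- The constant in the bounds at form factors of size `C`. -/
def formBound (C : ℝ) : ℝ := 18 * (1 + 2 * C) ^ 2 + |trialBound C|

theorem trial_isBdd : (trial hf).IsBdd (2 * C) (formBound C) :=
  (isBounded_nelsonForm hf).trial_isBdd (trial hf)

/-- The lower bound without soft bosons at total momentum `ξ`; such vectors have a gap `σ`. -/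
theorem lower_hard (he : |e| ≤ 1) (he' : 120 * (2 * C) * e ^ 2 ≤ 1)
    (he'' : 300 * formBound C ^ 2 * e ^ 2 ≤ 1) (hσ : 288 * (2 * C) ^ 2 * e ^ 4 ≤ (σ : ℝ))
    (x : (nelsonForm (formFactor Λ)).V)
    (hx : ∀ n, ∀ᵐ k, softCount σ n k ≠ 0 → wave x n k = 0) (ξ : R3) :
    -((-(trial hf).series e + 20132 * formBound C ^ 6 * |e| ^ 7) + ‖ξ‖) * ‖(x : Fock)‖ ^ 2 ≤
      (((nelsonForm (formFactor Λ)).shift ξ).form e x x).re := by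
  have hq := isBounded_nelsonForm hf
  have hT := trial_isBdd hf
  have hs := hq.series_nonpos (T := trial hf) he'
  refine hq.lower_shift (l := ‖ξ‖) hT.one_le hT.C_le hT.sqrt_C he he'' ?_
    (fun j => abs_coord_le ξ j) x ?_
  · have := hT.one_le
    have : 0 ≤ 20132 * formBound C ^ 6 * |e| ^ 7 := by positivity
    linarith
  · exact hq.lower_of_gap hT he he' x (inner ℂ vacuum (x : Fock)) rfl
      (gap_of_hard (by positivity) hσ ((trial hf).inner_Ω_u e) rfl (trial hf).norm_Ω hx
        (enorm_H_sq (x - inner ℂ vacuum (x : Fock) • ((trial hf).Ω + (trial hf).u e))))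

end

end

/-! ### Decoupling of the soft bosons -/

namespace QForm

variable {E : Type*} [NormedAddCommGroup E] [InnerProductSpace ℂ E] (q : QForm E)

/-- The restriction of a form to a subspace. -/
def restrict {W : Submodule ℂ E} (h : W ≤ q.V) : QForm E where
  V := W
  P j := q.P j ∘ₗ Submodule.inclusion h
  A j := q.A j ∘ₗ Submodule.inclusion h
  B j := q.B j ∘ₗ Submodule.inclusion h
  H := q.H ∘ₗ Submodule.inclusion h

theorem IsBounded.restrict {q : QForm E} {C : ℝ} (hq : q.IsBounded C) {W : Submodule ℂ E}
    (h : W ≤ q.V) : (q.restrict h).IsBounded C :=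
  ⟨hq.nonneg, fun j x => hq.A_le j (Submodule.inclusion h x),
    fun j x y => hq.B_le j (Submodule.inclusion h x) (Submodule.inclusion h y)⟩

theorem re_form_restrict {W : Submodule ℂ E} (h : W ≤ q.V) (e : ℝ) (x : W) :
    ((q.restrict h).form e x x).re =
      (q.form e (Submodule.inclusion h x) (Submodule.inclusion h x)).re :=
  (re_form_self (q := q.restrict h) e x).trans
    (re_form_self (q := q) e (Submodule.inclusion h x)).symm

theorem re_form_shift_zero {ξ : Fin 3 → ℝ} (hξ : ∀ j, ξ j = 0) (e : ℝ) (x : q.V) :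
    ((q.shift ξ).form e x x).re = (q.form e x x).re := by
  have h : q.shift ξ = q := by
    unfold shift
    simp only [hξ, Complex.ofReal_zero, zero_smul, add_zero]
  have h' : ∀ q' : QForm E, q' = q → ∀ y : q'.V, (y : E) = x →
      (q'.form e y y).re = (q.form e x x).re := by
    rintro _ rfl y hy
    rw [Subtype.ext hy]
  exact h' _ h x rfl

end QForm

/-- The restriction of `f` to momenta with `|q| < σ`. -/
def softFun (σ : ℝ≥0) (f : R3 → ℂ) (q : R3) : ℂ := if ‖q‖ < σ then f q else 0

section

variable {σ C : ℝ≥0} {f : R3 → ℂ}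

theorem softFun_add_hardPart (q : R3) : softFun σ f q + hardPart σ f q = f q := by
  unfold softFun hardPart
  split_ifs <;> simp

theorem measurable_softFun (hf : Measurable f) : Measurable (softFun σ f) :=
  Measurable.ite (measurableSet_lt measurable_norm measurable_const) hf measurable_const

theorem enorm_softFun_le (q : R3) : ‖softFun σ f q‖ₑ ≤ ‖f q‖ₑ := by
  unfold softFun
  split_ifs <;> simp

theorem lintegral_softFun (w : R3 → ℝ≥0∞) : ∫⁻ q, ‖softFun σ f q‖ₑ ^ 2 * w q =
    ∫⁻ q in {q : R3 | ‖q‖ < σ}, ‖f q‖ₑ ^ 2 * w q := by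
  rw [← lintegral_indicator (measurableSet_lt measurable_norm measurable_const)]
  refine lintegral_congr fun q => ?_
  by_cases hq : ‖q‖ < σ <;> simp [softFun, hq]

theorem lintegral_softFun_inv_le (hf : IsFormFactor C f) :
    ∫⁻ q, ‖softFun σ f q‖ₑ ^ 2 * ‖q‖ₑ⁻¹ ≤ C * σ := by
  rw [lintegral_softFun]
  exact hf.int_soft σ

theorem lintegral_softFun_inv_half_le (hf : IsFormFactor C f) (δ : ℝ≥0) :
    ∫⁻ q, ‖softFun (δ ^ 2) f q‖ₑ ^ 2 * (‖q‖ₑ ^ (1 / 2 : ℝ))⁻¹ ≤ C * δ ^ 2 * δ := by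
  have h : ∀ᵐ q : R3, ‖softFun (δ ^ 2) f q‖ₑ ^ 2 * (‖q‖ₑ ^ (1 / 2 : ℝ))⁻¹ ≤
      ‖softFun (δ ^ 2) f q‖ₑ ^ 2 * ‖q‖ₑ⁻¹ * δ := by
    filter_upwards [ae_enorm_ne_zero] with q hq0
    by_cases hq : ‖q‖ < (δ ^ 2 : ℝ≥0)
    · rw [mul_assoc]
      refine mul_le_mul_right ?_ _
      have h1 : ‖q‖ₑ ^ (1 / 2 : ℝ) ≤ δ := by
        have h2 : ‖q‖ₑ ≤ (δ : ℝ≥0∞) ^ 2 := by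
          rw [← ofReal_norm, ← ENNReal.coe_pow, ← ENNReal.ofReal_coe_nnreal]
          exact ENNReal.ofReal_le_ofReal hq.le
        calc ‖q‖ₑ ^ (1 / 2 : ℝ) ≤ ((δ : ℝ≥0∞) ^ 2) ^ (1 / 2 : ℝ) := by gcongr
          _ = δ := by
            rw [← ENNReal.rpow_natCast, ← ENNReal.rpow_mul]
            norm_num
      have h3 : ‖q‖ₑ ^ (1 / 2 : ℝ) ≠ 0 := by simp [hq0, ENNReal.rpow_eq_zero_iff]
      have h4 : ‖q‖ₑ ^ (1 / 2 : ℝ) ≠ ⊤ := (lt_of_le_of_lt h1 ENNReal.coe_lt_top).ne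
      calc (‖q‖ₑ ^ (1 / 2 : ℝ))⁻¹
          = (‖q‖ₑ ^ (1 / 2 : ℝ) * ‖q‖ₑ ^ (1 / 2 : ℝ))⁻¹ * ‖q‖ₑ ^ (1 / 2 : ℝ) := by
            rw [ENNReal.mul_inv (Or.inl h3) (Or.inl h4), mul_assoc, ENNReal.inv_mul_cancel h3 h4,
              mul_one]
        _ ≤ ‖q‖ₑ⁻¹ * δ := by
            rw [rpow_half_mul_self]
            gcongr
    · rw [softFun, if_neg hq]
      simp
  refine (lintegral_mono_ae h).trans ?_
  rw [lintegral_mul_const' _ _ ENNReal.coe_ne_top]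
  gcongr
  refine (lintegral_softFun_inv_le hf).trans_eq ?_
  push_cast
  rfl

theorem sq_softFun_lt_top (hf : IsFormFactor C f) : ∫⁻ q, ‖softFun σ f q‖ₑ ^ 2 < ⊤ :=
  lt_of_le_of_lt (lintegral_mono fun q => pow_le_pow_left' (enorm_softFun_le q) 2) hf.sq_lt_top

theorem anW_eq_soft_add_hard (hf : IsFormFactor C f) (ψ : Fock) (n : ℕ) :
    ∀ᵐ k, anW f (wave ψ) n k =
      anW (softFun σ f) (wave ψ) n k + anW (hardPart σ f) (wave ψ) n k := by
  filter_upwards [integrable_conj_mul_cons (measurable_softFun hf.meas)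
    (sq_softFun_lt_top hf) ψ n, integrable_conj_mul_cons (hf.hardPart σ).meas
    (hf.hardPart σ).sq_lt_top ψ n] with k h1 h2
  unfold anW
  rw [← mul_add, ← integral_add h1 h2]
  congr 1
  refine integral_congr_ae (Filter.Eventually.of_forall fun q => ?_)
  simp only
  rw [← add_mul, ← map_add, softFun_add_hardPart]

theorem anW_sub_hard (hf : IsFormFactor C f) (φ φ' : Fock) (n : ℕ) :
    ∀ᵐ k, anW f (wave φ) n k - anW (hardPart σ f) (wave φ') n k =
      anW (softFun σ f) (wave φ) n k + anW (hardPart σ f) (wave (φ - φ')) n k := by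
  have hF := hf.hardPart σ
  have h := annihilationWave_add (hardPart σ f) φ' (integrable_conj_mul_cons hF.meas hF.sq_lt_top φ')
    (φ - φ') (integrable_conj_mul_cons hF.meas hF.sq_lt_top _) n
  rw [add_sub_cancel] at h
  filter_upwards [h, anW_eq_soft_add_hard (σ := σ) hf φ n] with k h1 h2
  rw [annihilationWave_eq, annihilationWave_eq, annihilationWave_eq] at h1
  rw [h2, h1]
  ring

attribute [local irreducible] mulOp creation annihilation fieldMomentum freeOp sqrtField

theorem wave_annihilation_sub (hf : IsFormFactor C f) {ψ : Fock} (h : ψ ∈ (annihilation f).domain)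
    (h' : ψ ∈ (annihilation (hardPart σ f)).domain) (n : ℕ) :
    ∀ᵐ k, wave (annihilation f ⟨ψ, h⟩ - annihilation (hardPart σ f) ⟨ψ, h'⟩) n k =
      anW (softFun σ f) (wave ψ) n k := by
  filter_upwards [wave_sub (annihilation f ⟨ψ, h⟩) (annihilation (hardPart σ f) ⟨ψ, h'⟩) n,
    wave_annihilation ⟨ψ, h⟩ n, wave_annihilation ⟨ψ, h'⟩ n,
    anW_eq_soft_add_hard (σ := σ) hf ψ n] with k h1 h2 h3 h4
  rw [h1, h2, h3, h4, add_sub_cancel_right]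

theorem enorm_annihilation_sub_sq_le (hf : IsFormFactor C f) {ψ : Fock}
    (h : ψ ∈ (annihilation f).domain) (h' : ψ ∈ (annihilation (hardPart σ f)).domain) :
    ‖annihilation f ⟨ψ, h⟩ - annihilation (hardPart σ f) ⟨ψ, h'⟩‖ₑ ^ 2 ≤
      C * σ * en absSum (wave ψ) := by
  rw [enorm_sq_eq_en, en_congr (wave_annihilation_sub hf h h')]
  have h1 := en_anW_wave_le (measurable_softFun (σ := σ) hf.meas) ψ (m := one') (m' := one')
    isBoseWeight_one fun n q k => le_rfl
  simp only [one', one_mul] at h1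
  exact h1.trans (mul_le_mul_left (lintegral_softFun_inv_le hf) _)

theorem en_inv_wave_add_le (w : Weight) {φ : Fock} {g g' : Wave} {B : ℝ≥0∞}
    (hw : ∀ n, Measurable (w n)) (hg : IsBose g)
    (h : ∀ n, ∀ᵐ k, wave φ n k = g n k + g' n k) (h1 : en w g ≤ B) (h2 : en w g' ≤ B) :
    en w (wave φ) ≤ 4 * B := by
  have h3 : en w (wave φ) ≤ 2 * en w g + 2 * en w g' := by
    unfold en
    rw [← ENNReal.tsum_mul_left, ← ENNReal.tsum_mul_left, ← ENNReal.tsum_add]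
    refine ENNReal.tsum_le_tsum fun n => ?_
    have hm : Measurable fun k => w n k * ‖g n k‖ₑ ^ 2 := (hw n).mul (hg.measurable_sq n)
    rw [← mul_add, ← lintegral_add_left hm, ← lintegral_const_mul' _ _ (by simp)]
    refine lintegral_mono_ae ?_
    filter_upwards [h n] with k hk
    rw [hk, ← mul_add, mul_left_comm]
    refine mul_le_mul_right ?_ _
    rw [← ofReal_norm_sq, ← ofReal_norm_sq, ← ofReal_norm_sq, ← ENNReal.ofReal_add (by positivity)
      (by positivity), ← ENNReal.ofReal_ofNat 2, ← ENNReal.ofReal_mul (by norm_num)]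
    refine ENNReal.ofReal_le_ofReal ?_
    have h5 := norm_add_le (g n k) (g' n k)
    have h6 := norm_nonneg (g n k + g' n k)
    nlinarith [sq_nonneg (‖g n k‖ - ‖g' n k‖)]
  refine h3.trans ?_
  calc 2 * en w g + 2 * en w g' ≤ 2 * B + 2 * B := by gcongr
    _ = 4 * B := by ring

/-- Removing the interaction with soft bosons changes `A_j A_j` by a small amount. In the
difference, one of the two form factors is soft, which gives the factor `δ²`. -/
theorem enorm_inner_pair_sub_sq_le (hf : IsFormFactor C f) {δ : ℝ≥0} (hδ : δ ≠ 0) (y : Fock)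
    {ψ : Fock} (h : ψ ∈ (opMul (annihilation f) (annihilation f)).domain)
    (h' : ψ ∈ (opMul (annihilation (hardPart (δ ^ 2) f)) (annihilation (hardPart (δ ^ 2) f))).domain) :
    ‖inner ℂ y (opMul (annihilation f) (annihilation f) ⟨ψ, h⟩ -
      opMul (annihilation (hardPart (δ ^ 2) f)) (annihilation (hardPart (δ ^ 2) f)) ⟨ψ, h'⟩)‖ₑ ^ 2 ≤
      (δ * ‖y‖ₑ ^ 2 + en absSum (wave y)) * (8 * ((C : ℝ≥0∞) ^ 2 * δ ^ 2) * en absSum (wave ψ)) := by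
  have hδ0 : (δ : ℝ≥0∞) ≠ 0 := by simpa using hδ
  have e0 : en (fun n k => δ + absSum n k) (wave y) = δ * ‖y‖ₑ ^ 2 + en absSum (wave y) := by
    rw [enorm_sq_eq_en, ← en_rep, ← en_rep, ← en_rep, ← en_const_mul _ ENNReal.coe_ne_top]
    refine Eq.trans ?_ (en_add (fun n k => δ * one' n k) absSum (fun n => measurable_const) _
      (isBose_rep y))
    simp only [one', mul_one]
  have hm : ∀ n, Measurable fun k : Config n => δ + absSum n k := fun n =>
    (isBoseWeight_absSum.meas n).const_add _
  rw [← e0]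
  set S := softFun (δ ^ 2) f with hS
  set F := hardPart (δ ^ 2) f with hF'
  have hF : IsFormFactor C F := hf.hardPart _
  have hSm : Measurable S := measurable_softFun hf.meas
  have s1 : ∫⁻ q, ‖S q‖ₑ ^ 2 * ‖q‖ₑ⁻¹ ≤ C * δ ^ 2 :=
    (lintegral_softFun_inv_le hf).trans_eq (by push_cast; rfl)
  have s2 : ∫⁻ q, ‖S q‖ₑ ^ 2 * (‖q‖ₑ ^ (1 / 2 : ℝ))⁻¹ ≤ C * δ ^ 2 * δ :=
    lintegral_softFun_inv_half_le hf δ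
  refine (enorm_inner_sq_le _ _ (m' := fun n k => (δ + absSum n k)⁻¹) hm (fun n => (hm n).inv)
    (fun n => Filter.Eventually.of_forall fun k => Or.inr (le_of_eq ?_))).trans
    (mul_le_mul_right ?_ _)
  · exact (ENNReal.mul_inv_cancel (by simp [hδ]) (by simp [(absSum_lt_top k).ne])).symm
  · have b1 : en (fun n k => (δ + absSum n k)⁻¹) (anW S (anW f (rep ψ))) ≤
        2 * ((C : ℝ≥0∞) ^ 2 * δ ^ 2) * en absSum (rep ψ) := by
      refine en_anW_anW_le hSm hf.meas (isBose_rep _) hδ0 ENNReal.coe_ne_top ?_ ?_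
      · refine (mul_le_mul' s1 hf.int_inv).trans_eq (by ring)
      · refine (mul_le_mul' s2 hf.int_inv_half).trans_eq (by ring)
    have b2 : en (fun n k => (δ + absSum n k)⁻¹) (anW F (anW S (rep ψ))) ≤
        2 * ((C : ℝ≥0∞) ^ 2 * δ ^ 2) * en absSum (rep ψ) := by
      refine en_anW_anW_le hF.meas hSm (isBose_rep _) hδ0 ENNReal.coe_ne_top ?_ ?_
      · refine (mul_le_mul' hF.int_inv s1).trans_eq (by ring)
      · refine (mul_le_mul' hF.int_inv_half s2).trans_eq (by ring)
    refine (en_inv_wave_add_le _ (fun n => (hm n).inv)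
      (isBose_anW hSm (isBose_anW hf.meas (isBose_rep ψ))) (fun n => ?_) b1 b2).trans_eq ?_
    · have w1 : ∀ᵐ k, wave (opMul (annihilation f) (annihilation f) ⟨ψ, h⟩) n k =
        anW f (wave (annihilation f ⟨ψ, h.1⟩)) n k :=
        wave_annihilation ⟨annihilation f ⟨ψ, h.1⟩, h.2⟩ n
      have w2 : ∀ᵐ k, wave (opMul (annihilation F) (annihilation F) ⟨ψ, h'⟩) n k =
        anW F (wave (annihilation F ⟨ψ, h'.1⟩)) n k :=
        wave_annihilation ⟨annihilation F ⟨ψ, h'.1⟩, h'.2⟩ n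
      have w3 : ∀ m, ∀ᵐ k, wave (annihilation f ⟨ψ, h.1⟩ - annihilation F ⟨ψ, h'.1⟩) m k =
          anW S (rep ψ) m k := fun m => by
        filter_upwards [wave_annihilation_sub hf h.1 h'.1 m, anW_congr S (rep_ae ψ) m] with k e1 e2
        rw [e1, e2]
      have w4 : ∀ m, ∀ᵐ k, wave (annihilation f ⟨ψ, h.1⟩) m k = anW f (rep ψ) m k := fun m => by
        filter_upwards [wave_annihilation ⟨ψ, h.1⟩ m, anW_congr f (rep_ae ψ) m] with k e1 e2
        rw [e1, e2]
      filter_upwards [wave_sub (opMul (annihilation f) (annihilation f) ⟨ψ, h⟩)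
        (opMul (annihilation F) (annihilation F) ⟨ψ, h'⟩) n, w1, w2,
        anW_sub_hard (σ := δ ^ 2) hf (annihilation f ⟨ψ, h.1⟩) (annihilation F ⟨ψ, h'.1⟩) n,
        anW_congr F w3 n, anW_congr S w4 n] with k e1 e2 e3 e4 e5 e6
      rw [e1, e2, e3, e4, e5, e6]
    · rw [en_rep]
      ring

end

section

variable {C : ℝ≥0} {Λ e : ℝ} (hf : ∀ j, IsFormFactor C (formFactor Λ j))
include hf

attribute [local irreducible] mulOp creation annihilation fieldMomentum freeOp sqrtField

/-- The lower bound for the form without interaction with soft bosons. The form inequality is proved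
with a margin `ε`, which makes it a statement about the form domain. -/
theorem lower_hardPart {σ : ℝ≥0} (he0 : e ≠ 0) (he : |e| ≤ 1) (he' : 120 * (2 * C) * e ^ 2 ≤ 1)
    (he'' : 300 * formBound C ^ 2 * e ^ 2 ≤ 1) (hσ : 288 * (2 * C) ^ 2 * e ^ 4 ≤ (σ : ℝ))
    (x : (nelsonForm fun j => hardPart σ (formFactor Λ j)).V) :
    -(-(trial hf).series e + 20132 * formBound C ^ 6 * |e| ^ 7) * ‖(x : Fock)‖ ^ 2 ≤
      ((nelsonForm fun j => hardPart σ (formFactor Λ j)).form e x x).re := by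
  set l := -(trial hf).series e + 20132 * formBound C ^ 6 * |e| ^ 7 with hl
  have hl0 : 0 ≤ l := by
    have h1 := (trial_isBdd hf).one_le
    have h2 := (isBounded_nelsonForm hf).series_nonpos (T := trial hf) he'
    have h3 : 0 ≤ 20132 * formBound C ^ 6 * |e| ^ 7 := by positivity
    linarith
  have h : ∀ ε : ℝ, 0 < ε → -(l + ε + ‖(0 : R3)‖) * ‖(x : Fock)‖ ^ 2 ≤
      (((nelsonForm fun j => hardPart σ (formFactor Λ j)).shift (0 : R3)).form e x x).re := by
    intro ε hε
    refine (negForm_le_posForm_iff (by linarith) x 0).1 ?_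
    rw [← negForm_congr (rep_ae (x : Fock)), ← posForm_congr (rep_ae (x : Fock))]
    refine negForm_le_posForm (fun j => ((hf j).hardPart σ).meas) (fun j => isHard_hardPart _)
      (fun ξ g hg hs => ?_) 0 (isBose_rep _)
    rw [negForm_hardPart _ _ hs, posForm_hardPart _ _ _ _ hs]
    refine negForm_le_posForm_of_form hf he0 (by linarith) ξ hg fun y hy => ?_
    have h1 := lower_hard hf he he' he'' hσ y (fun n => by
      filter_upwards [hy n] with k hk hs'
      rw [hk, hs n k hs']) ξ
    refine le_trans ?_ h1
    have := sq_nonneg ‖(y : Fock)‖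
    rw [← hl]
    nlinarith
  have h' : ∀ ε : ℝ, 0 < ε → -(l + ε + ‖(0 : R3)‖) * ‖(x : Fock)‖ ^ 2 ≤
      ((nelsonForm fun j => hardPart σ (formFactor Λ j)).form e x x).re := fun ε hε =>
    (h ε hε).trans_eq (QForm.re_form_shift_zero _ (fun j => rfl) e x)
  generalize ((nelsonForm fun j => hardPart σ (formFactor Λ j)).form e x x).re = r at h'
  simp only [norm_zero, add_zero] at h'
  refine le_of_forall_pos_le_add fun ε hε => ?_
  have h2 := h' (ε / (‖(x : Fock)‖ ^ 2 + 1)) (by positivity)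
  have h3 : ε / (‖(x : Fock)‖ ^ 2 + 1) * ‖(x : Fock)‖ ^ 2 ≤ ε := by
    rw [div_mul_eq_mul_div, div_le_iff₀ (by positivity)]
    nlinarith
  linarith

end

/-! ### The lower bound on the form -/

namespace QForm

variable {E : Type*} [NormedAddCommGroup E] [InnerProductSpace ℂ E]

theorem re_form_replaceA_restrict {q q' : QForm E} {W : Submodule ℂ E} (h : W ≤ q.V)
    (h' : W ≤ q'.V) (hP : ∀ j (x : W), q.P j (Submodule.inclusion h x) =
      q'.P j (Submodule.inclusion h' x))
    (hH : ∀ x : W, q.H (Submodule.inclusion h x) = q'.H (Submodule.inclusion h' x))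
    (e : ℝ) (x : W) :
    (((q.restrict h).replaceA (q'.restrict h').A (q'.restrict h').B).form e x x).re =
      (q'.form e (Submodule.inclusion h' x) (Submodule.inclusion h' x)).re := by
  have h1 : (((q.restrict h).replaceA (q'.restrict h').A (q'.restrict h').B).form e x x).re =
      ((∑ j, ‖q.P j (Submodule.inclusion h x)‖ ^ 2) + ‖q.H (Submodule.inclusion h x)‖ ^ 2) +
      4 * e * (∑ j, (inner ℂ (q'.A j (Submodule.inclusion h' x))
        (q.P j (Submodule.inclusion h x))).re) +
      e ^ 2 * (2 * (∑ j, (inner ℂ (x : E) (q'.B j (Submodule.inclusion h' x))).re) +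
        2 * ∑ j, ‖q'.A j (Submodule.inclusion h' x)‖ ^ 2) :=
    re_form_self (q := (q.restrict h).replaceA (q'.restrict h').A (q'.restrict h').B) e x
  rw [h1]
  simp only [hP, hH]
  exact (re_form_self (q := q') e (Submodule.inclusion h' x)).symm

theorem IsBounded.lower_of_restrict {q q' : QForm E} {C : ℝ} (hq : q.IsBounded C) {M e ε : ℝ}
    (hM : 1 ≤ M) (hCM : C ≤ M) (hsM : Real.sqrt C ≤ M) (he : |e| ≤ 1) (he' : 120 * C * e ^ 2 ≤ 1)
    (hε : 0 ≤ ε) {W : Submodule ℂ E} (h : W ≤ q.V)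
    (h' : W ≤ q'.V) (hP : ∀ j (x : W), q.P j (Submodule.inclusion h x) =
      q'.P j (Submodule.inclusion h' x))
    (hH : ∀ x : W, q.H (Submodule.inclusion h x) = q'.H (Submodule.inclusion h' x)) (x : W)
    (hA : ∀ j, ‖q.A j (Submodule.inclusion h x) - q'.A j (Submodule.inclusion h' x)‖ ≤
      M * e ^ 2 * ‖q.H (Submodule.inclusion h x)‖)
    (hB : ∀ j, ‖inner ℂ (x : E) (q.B j (Submodule.inclusion h x) -
      q'.B j (Submodule.inclusion h' x))‖ ≤ M * e ^ 2 * ‖q.H (Submodule.inclusion h x)‖ *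
        (M * |e| * ‖(x : E)‖ + ‖q.H (Submodule.inclusion h x)‖))
    (hx : -ε * ‖(x : E)‖ ^ 2 ≤
      (q'.form e (Submodule.inclusion h' x) (Submodule.inclusion h' x)).re) :
    -(ε + 3000 * M ^ 4 * |e| ^ 7) * ‖(x : E)‖ ^ 2 ≤
      (q.form e (Submodule.inclusion h x) (Submodule.inclusion h x)).re :=
  ((hq.restrict h).lower_replace hM hCM hsM he he' hε (A := (q'.restrict h').A)
    (B := (q'.restrict h').B) x hA hB
    (hx.trans_eq (re_form_replaceA_restrict h h' hP hH e x).symm)).trans_eq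
    (re_form_restrict q h e x)

end QForm

theorem norm_le_mul_sq_mul {E : Type*} [SeminormedAddCommGroup E] {a h : E} {D : ℝ≥0} {M e : ℝ}
    (hM : 0 ≤ M) (hD : (D : ℝ) ≤ M ^ 2 * e ^ 4) (H : ‖a‖ₑ ^ 2 ≤ D * ‖h‖ₑ ^ 2) :
    ‖a‖ ≤ M * e ^ 2 * ‖h‖ := by
  refine le_of_sq_le_sq ((norm_sq_le_of_enorm H).trans ?_) (by positivity)
  calc (D : ℝ) * ‖h‖ ^ 2 ≤ M ^ 2 * e ^ 4 * ‖h‖ ^ 2 := by gcongr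
    _ = _ := by ring

theorem norm_le_mul_sq_mul_add {E : Type*} [SeminormedAddCommGroup E] {z : ℂ} {y h : E}
    {δ D : ℝ≥0} {M e : ℝ} (hM : 0 ≤ M) (hδ : (δ : ℝ) ≤ M ^ 2 * e ^ 2)
    (hD : (D : ℝ) ≤ M ^ 2 * e ^ 4)
    (H : ‖z‖ₑ ^ 2 ≤ (δ * ‖y‖ₑ ^ 2 + ‖h‖ₑ ^ 2) * (D * ‖h‖ₑ ^ 2)) :
    ‖z‖ ≤ M * e ^ 2 * ‖h‖ * (M * |e| * ‖y‖ + ‖h‖) := by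
  have H1 : ‖z‖₊ ^ 2 ≤ (δ * ‖y‖₊ ^ 2 + ‖h‖₊ ^ 2) * (D * ‖h‖₊ ^ 2) := by
    simp only [enorm_eq_nnnorm] at H
    exact_mod_cast H
  have H2 : ‖z‖ ^ 2 ≤ (δ * ‖y‖ ^ 2 + ‖h‖ ^ 2) * (D * ‖h‖ ^ 2) := by exact_mod_cast H1
  refine le_of_sq_le_sq (H2.trans ?_) (by positivity)
  calc (δ * ‖y‖ ^ 2 + ‖h‖ ^ 2) * (D * ‖h‖ ^ 2)
      ≤ (M ^ 2 * e ^ 2 * ‖y‖ ^ 2 + ‖h‖ ^ 2) * (M ^ 2 * e ^ 4 * ‖h‖ ^ 2) := by gcongr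
    _ = (M * e ^ 2 * ‖h‖) ^ 2 * ((M * |e| * ‖y‖) ^ 2 + ‖h‖ ^ 2) := by
        rw [mul_pow, mul_pow, mul_pow, mul_pow, sq_abs]
        ring
    _ ≤ (M * e ^ 2 * ‖h‖) ^ 2 * (M * |e| * ‖y‖ + ‖h‖) ^ 2 := by
        gcongr
        have : 0 ≤ M * |e| * ‖y‖ * ‖h‖ := by positivity
        nlinarith
    _ = _ := by ring

theorem pow_le_sq_formBound (C : ℝ≥0) : 10 ^ 8 * (1 + (C : ℝ)) ^ 6 ≤ formBound C ^ 2 := by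
  have h1 := trialBound_nonneg C.coe_nonneg
  have h2 : trialBound C ≤ formBound C := by
    unfold formBound
    rw [abs_of_nonneg h1]
    have : 0 ≤ 18 * (1 + 2 * (C : ℝ)) ^ 2 := by positivity
    linarith
  calc 10 ^ 8 * (1 + (C : ℝ)) ^ 6 = trialBound C ^ 2 := by unfold trialBound; ring
    _ ≤ _ := by gcongr

theorem mul_pow_le_sq_formBound (C : ℝ≥0) {m : ℕ} (hm : m ≤ 6) :
    12800 * (C : ℝ) ^ m ≤ formBound C ^ 2 := by
  refine le_trans ?_ (pow_le_sq_formBound C)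
  have h1 : (C : ℝ) ^ m ≤ (1 + C) ^ m := pow_le_pow_left₀ C.coe_nonneg (by linarith) m
  have h2 : (1 + (C : ℝ)) ^ m ≤ (1 + C) ^ 6 :=
    pow_le_pow_right₀ (by linarith [C.coe_nonneg]) hm
  have h3 : 0 ≤ (1 + (C : ℝ)) ^ 6 := by positivity
  linarith

section

variable {C : ℝ≥0} {e : ℝ}

attribute [local irreducible] mulOp creation annihilation fieldMomentum freeOp sqrtField

/-- The energy below which bosons are decoupled, of order `e⁴`, is the square of this. The number
`40` makes `(40 C e²)² ≥ 288 (2C)² e⁴`, the gap that is needed. -/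
def softScale (C : ℝ≥0) (e : ℝ) : ℝ≥0 := 40 * C * ‖e‖₊ ^ 2

theorem coe_softScale : (softScale C e : ℝ) = 40 * C * e ^ 2 := by
  unfold softScale
  push_cast
  rw [Real.norm_eq_abs, sq_abs]

theorem softScale_ne_zero (hC : C ≠ 0) (he : e ≠ 0) : softScale C e ≠ 0 := by
  have : ‖e‖₊ ≠ 0 := by simpa using he
  unfold softScale
  positivity

theorem le_sq_softScale : 288 * (2 * C) ^ 2 * e ^ 4 ≤ ((softScale C e ^ 2 : ℝ≥0) : ℝ) := by
  push_cast
  rw [coe_softScale]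
  have : 0 ≤ (C : ℝ) ^ 2 * e ^ 4 := by positivity
  nlinarith

theorem formBound_nonneg (C : ℝ≥0) : 0 ≤ formBound C := by unfold formBound; positivity

theorem P_congr {f f' : Fin 3 → R3 → ℂ} (j : Fin 3) (x : (nelsonForm f).V)
    (x' : (nelsonForm f').V) (hx : (x : Fock) = x') :
    (nelsonForm f).P j x = (nelsonForm f').P j x' := by
  obtain ⟨x, h⟩ := x
  obtain ⟨x', h'⟩ := x'
  obtain rfl : x = x' := hx
  exact (restrictTo_apply _ (formDom_le_fieldMomentum f j) ⟨x, h⟩).trans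
    (restrictTo_apply _ (formDom_le_fieldMomentum f' j) ⟨x, h'⟩).symm

theorem H_congr {f f' : Fin 3 → R3 → ℂ} (x : (nelsonForm f).V)
    (x' : (nelsonForm f').V) (hx : (x : Fock) = x') :
    (nelsonForm f).H x = (nelsonForm f').H x' := by
  obtain ⟨x, h⟩ := x
  obtain ⟨x', h'⟩ := x'
  obtain rfl : x = x' := hx
  exact (restrictTo_apply _ (formDom_le_sqrtField f) ⟨x, h⟩).trans
    (restrictTo_apply _ (formDom_le_sqrtField f') ⟨x, h'⟩).symm

section

variable {f : Fin 3 → R3 → ℂ} (hf : ∀ j, IsFormFactor C (f j))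
include hf

theorem norm_A_sub_le (j : Fin 3) (x : (nelsonForm f).V)
    (x' : (nelsonForm fun j => hardPart (softScale C e ^ 2) (f j)).V) (hx : (x : Fock) = x') :
    ‖(nelsonForm f).A j x - (nelsonForm fun j => hardPart (softScale C e ^ 2) (f j)).A j x'‖ ≤
      formBound C * e ^ 2 * ‖(nelsonForm f).H x‖ := by
  obtain ⟨x, h⟩ := x
  obtain ⟨x', h'⟩ := x'
  obtain rfl : x = x' := hx
  have h1 := enorm_annihilation_sub_sq_le (hf j) (formDom_le_annihilation _ j h)
    (formDom_le_annihilation _ j h')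
  refine norm_le_mul_sq_mul (D := C * softScale C e ^ 2) (formBound_nonneg C) ?_ (h1.trans_eq ?_)
  · push_cast
    rw [coe_softScale]
    have h2 := mul_pow_le_sq_formBound C (m := 3) (by norm_num)
    have h3 : 0 ≤ e ^ 4 := by positivity
    have h4 : 0 ≤ (C : ℝ) ^ 3 := by positivity
    nlinarith
  · rw [ENNReal.coe_mul]
    exact congrArg (_ * ·) (enorm_H_sq ⟨x, h⟩).symm

theorem norm_inner_B_sub_le (hδ : softScale C e ≠ 0) (j : Fin 3) (y : Fock) (x : (nelsonForm f).V)
    (x' : (nelsonForm fun j => hardPart (softScale C e ^ 2) (f j)).V) (hx : (x : Fock) = x')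
    (hy : y = x) :
    ‖inner ℂ y ((nelsonForm f).B j x -
      (nelsonForm fun j => hardPart (softScale C e ^ 2) (f j)).B j x')‖ ≤
      formBound C * e ^ 2 * ‖(nelsonForm f).H x‖ *
        (formBound C * |e| * ‖y‖ + ‖(nelsonForm f).H x‖) := by
  subst hy
  obtain ⟨x, h⟩ := x
  obtain ⟨x', h'⟩ := x'
  obtain rfl : x = x' := hx
  have h1 := enorm_inner_pair_sub_sq_le (hf j) hδ x (formDom_le_pair _ j h) (formDom_le_pair _ j h')
  refine norm_le_mul_sq_mul_add (δ := softScale C e) (D := 8 * (C ^ 2 * softScale C e ^ 2))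
    (formBound_nonneg C) ?_ ?_ (h1.trans_eq ?_)
  · rw [coe_softScale]
    have h2 := mul_pow_le_sq_formBound C (m := 1) (by norm_num)
    have h3 := C.coe_nonneg
    have h4 := sq_nonneg e
    rw [pow_one] at h2
    nlinarith
  · push_cast
    rw [coe_softScale]
    have h2 := mul_pow_le_sq_formBound C (m := 4) (by norm_num)
    have h3 : 0 ≤ e ^ 4 := by positivity
    nlinarith
  · have h5 : en absSum (wave x) = ‖(nelsonForm f).H ⟨x, h⟩‖ₑ ^ 2 := (enorm_H_sq ⟨x, h⟩).symm
    rw [h5]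
    push_cast
    rfl

/-- Restoring the interaction with soft bosons costs `O(e⁷)`. The bounds are needed only on a common
subspace `W` of the two form domains. -/
theorem lower_of_hardPart {M ε : ℝ} (hM : M = formBound C) (h1M : 1 ≤ M) (hCM : 2 * C ≤ M)
    (hsM : Real.sqrt (2 * C) ≤ M) (he : |e| ≤ 1) (he' : 120 * (2 * C) * e ^ 2 ≤ 1) (hε : 0 ≤ ε)
    (hδ : softScale C e ≠ 0) {W : Submodule ℂ Fock} (hW : W ≤ (nelsonForm f).V)
    (hW' : W ≤ (nelsonForm fun j => hardPart (softScale C e ^ 2) (f j)).V) (x : W)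
    (hx : -ε * ‖(x : Fock)‖ ^ 2 ≤ ((nelsonForm fun j => hardPart (softScale C e ^ 2) (f j)).form e
      (Submodule.inclusion hW' x) (Submodule.inclusion hW' x)).re) :
    -(ε + 3000 * M ^ 4 * |e| ^ 7) * ‖(x : Fock)‖ ^ 2 ≤
      ((nelsonForm f).form e (Submodule.inclusion hW x) (Submodule.inclusion hW x)).re := by
  -- The two form domains are not unfolded: comparing them would compare the form factors.
  have hi : ∀ x : W, ((Submodule.inclusion hW x : (nelsonForm f).V) : Fock) =
      (Submodule.inclusion hW' x :
        (nelsonForm fun j => hardPart (softScale C e ^ 2) (f j)).V) := fun x =>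
    (Submodule.coe_inclusion hW x).trans (Submodule.coe_inclusion hW' x).symm
  refine (isBounded_nelsonForm hf).lower_of_restrict h1M hCM hsM he he' hε hW hW'
    (fun j x => P_congr j _ _ (hi x)) (fun x => H_congr _ _ (hi x)) x (fun j => ?_) (fun j => ?_) hx
  · rw [hM]
    exact norm_A_sub_le hf j _ _ (hi x)
  · rw [hM]
    exact norm_inner_B_sub_le hf hδ j _ _ _ (hi x) (Submodule.coe_inclusion hW x).symm

end

section

variable {Λ : ℝ} (hf : ∀ j, IsFormFactor C (formFactor Λ j))
include hf

/-- The lower bound for the Nelson form. -/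
theorem lower_bound (hC : C ≠ 0) (he0 : e ≠ 0) (he : |e| ≤ 1) (he' : 120 * (2 * C) * e ^ 2 ≤ 1)
    (he'' : 300 * formBound C ^ 2 * e ^ 2 ≤ 1) (x : fdom) :
    -(-(trial hf).series e + 20132 * formBound C ^ 6 * |e| ^ 7 +
      3000 * formBound C ^ 4 * |e| ^ 7) * ‖(x : Fock)‖ ^ 2 ≤
      ((nelsonForm (formFactor Λ)).form e (Submodule.inclusion (fdom_le_formDom hf) x)
        (Submodule.inclusion (fdom_le_formDom hf) x)).re := by
  have hT := trial_isBdd hf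
  have h0 : 0 ≤ -(trial hf).series e + 20132 * formBound C ^ 6 * |e| ^ 7 := by
    have h2 := (isBounded_nelsonForm hf).series_nonpos (T := trial hf) he'
    have h3 : 0 ≤ 20132 * formBound C ^ 6 * |e| ^ 7 := by
      have := formBound_nonneg C
      positivity
    linarith
  have hF : ∀ j, IsFormFactor C (hardPart (softScale C e ^ 2) (formFactor Λ j)) :=
    fun j => (hf j).hardPart _
  exact lower_of_hardPart hf rfl hT.one_le hT.C_le hT.sqrt_C he he' h0
    (softScale_ne_zero hC he0) (fdom_le_formDom hf) (fdom_le_formDom hF) x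
    (lower_hardPart hf he0 he he' he'' le_sq_softScale
      (Submodule.inclusion (fdom_le_formDom hF) x))

end

end

/-! ### Bounds on the form factor -/

theorem formFactor_of_le {Λ : ℝ} {q : R3} (j : Fin 3) (h : Λ ≤ ‖q‖) : formFactor Λ j q = 0 := by
  simp [formFactor, not_lt.2 h]

theorem formFactor_zero (Λ : ℝ) (j : Fin 3) : formFactor Λ j 0 = 0 := by simp [formFactor]

theorem measurable_formFactor (Λ : ℝ) (j : Fin 3) : Measurable (formFactor Λ j) := by
  have h : MeasurableSet {q : R3 | ‖q‖ < Λ} := measurableSet_lt measurable_norm measurable_const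
  have h1 : Measurable fun q : R3 => if ‖q‖ < Λ then (2 * Real.pi) ^ (-(3 / 2) : ℝ) else 0 :=
    Measurable.ite h measurable_const measurable_const
  refine Complex.measurable_ofReal.comp ((h1.mul ?_).mul ?_) <;> fun_prop

theorem norm_formFactor_sq_le (Λ : ℝ) (j : Fin 3) (q : R3) :
    ‖formFactor Λ j q‖ ^ 2 ≤ ‖q‖⁻¹ * ((1 + ‖q‖) ^ 2)⁻¹ := by
  rcases eq_or_ne q 0 with rfl | hq
  · simp [formFactor_zero]
  have hq' : 0 < ‖q‖ := norm_pos_iff.2 hq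
  have h1 : (if ‖q‖ < Λ then (2 * Real.pi) ^ (-(3 / 2) : ℝ) else 0) ^ 2 ≤ (1 : ℝ) := by
    split_ifs
    · refine pow_le_one₀ (by positivity) (Real.rpow_le_one_of_one_le_of_nonpos ?_ (by norm_num))
      linarith [Real.pi_gt_three]
    · norm_num
  have h2 : (1 / Real.sqrt (2 * ‖q‖)) ^ 2 ≤ ‖q‖⁻¹ := by
    rw [div_pow, one_pow, Real.sq_sqrt (by positivity), one_div]
    exact inv_anti₀ hq' (by linarith)
  have h3 : (q j / (‖q‖ + ‖q‖ ^ 2)) ^ 2 ≤ ((1 + ‖q‖) ^ 2)⁻¹ := by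
    have h4 : q j ^ 2 ≤ ‖q‖ ^ 2 := sq_le_sq.2 (by simpa using abs_coord_le q j)
    rw [div_pow, show ‖q‖ + ‖q‖ ^ 2 = ‖q‖ * (1 + ‖q‖) by ring, mul_pow, div_le_iff₀ (by positivity),
      mul_comm (‖q‖ ^ 2), inv_mul_cancel_left₀ (by positivity)]
    exact h4
  rw [formFactor, Complex.norm_real, Real.norm_eq_abs, sq_abs, mul_pow, mul_pow]
  calc _ ≤ 1 * ‖q‖⁻¹ * ((1 + ‖q‖) ^ 2)⁻¹ := by gcongr
    _ = _ := by rw [one_mul]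

/-- A radial majorant of `|φ|² / |k|` and of `|φ|² / |k|^{1/2}`. -/
def majorant (y : ℝ) : ℝ := (y ^ 2)⁻¹ * (1 + y) ^ (-(3 / 2) : ℝ)

theorem integrable_majorant : Integrable fun q : R3 => majorant ‖q‖ := by
  rw [integrable_fun_norm_addHaar (volume : Measure R3) (f := majorant), finrank_euclideanSpace_fin]
  have h := integrableOn_add_rpow_Ioi_of_lt (a := -(3 / 2)) (c := 0) (m := 1) (by norm_num)
    (by norm_num)
  refine h.congr_fun (fun y hy => ?_) measurableSet_Ioi
  have hy' : (0 : ℝ) < y := hy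
  simp only [majorant, smul_eq_mul, Nat.add_one_sub_one]
  rw [mul_inv_cancel_left₀ (by positivity), add_comm]

theorem inv_le_majorant {y w : ℝ} (hy : 0 < y) (hw : w ≤ 1 + y) :
    y⁻¹ * ((1 + y) ^ 2)⁻¹ * (y⁻¹ * Real.sqrt w) ≤ majorant y := by
  have h0 : (0 : ℝ) < 1 + y := by linarith
  have h1 : (1 + y) ^ (-(3 / 2) : ℝ) = ((1 + y) ^ 2)⁻¹ * Real.sqrt (1 + y) := by
    rw [Real.sqrt_eq_rpow, ← Real.rpow_natCast, ← Real.rpow_neg h0.le, ← Real.rpow_add h0]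
    norm_num
  rw [majorant, h1]
  calc y⁻¹ * ((1 + y) ^ 2)⁻¹ * (y⁻¹ * Real.sqrt w)
      ≤ y⁻¹ * ((1 + y) ^ 2)⁻¹ * (y⁻¹ * Real.sqrt (1 + y)) := by gcongr
    _ = _ := by
      rw [pow_two y, mul_inv]
      ring

theorem lintegral_majorant_lt_top : ∫⁻ q : R3, ENNReal.ofReal (majorant ‖q‖) < ⊤ :=
  integrable_majorant.lintegral_lt_top

theorem enorm_inv_eq {q : R3} (hq : q ≠ 0) : ‖q‖ₑ⁻¹ = ENNReal.ofReal ‖q‖⁻¹ := by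
  rw [ENNReal.ofReal_inv_of_pos (norm_pos_iff.2 hq), ofReal_norm]

theorem enorm_rpow_half_inv_eq {q : R3} (hq : q ≠ 0) :
    (‖q‖ₑ ^ (1 / 2 : ℝ))⁻¹ = ENNReal.ofReal (‖q‖⁻¹ * Real.sqrt ‖q‖) := by
  have h := norm_pos_iff.2 hq
  have h1 : ‖q‖⁻¹ * Real.sqrt ‖q‖ = (Real.sqrt ‖q‖)⁻¹ := by
    have h2 := Real.mul_self_sqrt h.le
    have h3 := Real.sqrt_pos.2 h
    field_simp
    nlinarith
  rw [h1, ENNReal.ofReal_inv_of_pos (Real.sqrt_pos.2 h), Real.sqrt_eq_rpow,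
    ← ENNReal.ofReal_rpow_of_pos h, ofReal_norm]

theorem lintegral_formFactor_inv_le (Λ : ℝ) (j : Fin 3) :
    ∫⁻ q, ‖formFactor Λ j q‖ₑ ^ 2 * ‖q‖ₑ⁻¹ ≤ ∫⁻ q : R3, ENNReal.ofReal (majorant ‖q‖) := by
  refine lintegral_mono_ae ?_
  filter_upwards [ae_ne_zero_R3] with q hq
  have h := norm_pos_iff.2 hq
  rw [enorm_inv_eq hq, ← ofReal_norm_sq, ← ENNReal.ofReal_mul (sq_nonneg _)]
  refine ENNReal.ofReal_le_ofReal ?_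
  have h1 := inv_le_majorant (w := 1) h (by linarith)
  rw [Real.sqrt_one, mul_one] at h1
  exact (mul_le_mul_of_nonneg_right (norm_formFactor_sq_le Λ j q) (by positivity)).trans h1

theorem lintegral_formFactor_inv_half_le (Λ : ℝ) (j : Fin 3) :
    ∫⁻ q, ‖formFactor Λ j q‖ₑ ^ 2 * (‖q‖ₑ ^ (1 / 2 : ℝ))⁻¹ ≤
      ∫⁻ q : R3, ENNReal.ofReal (majorant ‖q‖) := by
  refine lintegral_mono_ae ?_
  filter_upwards [ae_ne_zero_R3] with q hq
  have h := norm_pos_iff.2 hq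
  rw [enorm_rpow_half_inv_eq hq, ← ofReal_norm_sq, ← ENNReal.ofReal_mul (sq_nonneg _)]
  refine ENNReal.ofReal_le_ofReal ?_
  exact (mul_le_mul_of_nonneg_right (norm_formFactor_sq_le Λ j q) (by positivity)).trans
    (inv_le_majorant h (by linarith))

theorem lintegral_formFactor_soft_le (Λ : ℝ) (j : Fin 3) (σ : ℝ≥0) :
    ∫⁻ q in {q : R3 | ‖q‖ < σ}, ‖formFactor Λ j q‖ₑ ^ 2 * ‖q‖ₑ⁻¹ ≤
      ENNReal.ofReal (3 * volume.real (Metric.ball (0 : R3) 1)) * σ := by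
  set g : ℝ → ℝ := (Set.Iio (σ : ℝ)).indicator fun y => (y ^ 2)⁻¹ with hg
  have hg0 : ∀ y, 0 ≤ g y := Set.indicator_nonneg fun y _ => by positivity
  have hgi : ∀ y ∈ Set.Ioi (0 : ℝ), y ^ 2 • g y = (Set.Iio (σ : ℝ)).indicator (fun _ => (1 : ℝ)) y :=
    fun y hy => by
      have hy' : (0 : ℝ) < y := hy
      by_cases h : y < σ
      · simp [hg, h, hy'.ne']
      · simp [hg, h]
  have h1 : Integrable fun q : R3 => g ‖q‖ := by
    rw [integrable_fun_norm_addHaar (volume : Measure R3) (f := g), finrank_euclideanSpace_fin,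
      integrableOn_congr_fun hgi measurableSet_Ioi, IntegrableOn,
      integrable_indicator_iff measurableSet_Iio, IntegrableOn, Measure.restrict_restrict
      measurableSet_Iio, Set.Iio_inter_Ioi]
    exact integrableOn_const (by simp)
  have h2 : ∫ q : R3, g ‖q‖ = 3 * volume.real (Metric.ball (0 : R3) 1) * σ := by
    rw [integral_fun_norm_addHaar (volume : Measure R3) g, finrank_euclideanSpace_fin,
      setIntegral_congr_fun measurableSet_Ioi hgi, setIntegral_indicator measurableSet_Iio,
      Set.Ioi_inter_Iio, setIntegral_const]
    simp [mul_assoc]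
  have h3 : ∫⁻ q : R3, ENNReal.ofReal (g ‖q‖) =
      ENNReal.ofReal (3 * volume.real (Metric.ball (0 : R3) 1)) * σ := by
    rw [← ofReal_integral_eq_lintegral_ofReal h1 (Filter.Eventually.of_forall fun q => hg0 _), h2,
      ENNReal.ofReal_mul (by positivity), ENNReal.ofReal_coe_nnreal]
  rw [← h3, ← lintegral_indicator (measurableSet_lt measurable_norm measurable_const)]
  refine lintegral_mono_ae ?_
  filter_upwards [ae_ne_zero_R3] with q hq
  by_cases h : ‖q‖ < σ
  · rw [Set.indicator_of_mem (show q ∈ {q : R3 | ‖q‖ < σ} from h), enorm_inv_eq hq,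
      ← ofReal_norm_sq, ← ENNReal.ofReal_mul (sq_nonneg _)]
    refine ENNReal.ofReal_le_ofReal ?_
    have hq' := norm_pos_iff.2 hq
    simp only [hg, Set.indicator_of_mem (show ‖q‖ ∈ Set.Iio (σ : ℝ) from h)]
    refine (mul_le_mul_of_nonneg_right (norm_formFactor_sq_le Λ j q) (by positivity)).trans ?_
    have h4 : ((1 + ‖q‖) ^ 2)⁻¹ ≤ 1 := inv_le_one_of_one_le₀ (one_le_pow₀ (by linarith))
    calc ‖q‖⁻¹ * ((1 + ‖q‖) ^ 2)⁻¹ * ‖q‖⁻¹ ≤ ‖q‖⁻¹ * 1 * ‖q‖⁻¹ := by gcongr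
      _ = (‖q‖ ^ 2)⁻¹ := by rw [mul_one, pow_two, mul_inv]
  · rw [Set.indicator_of_notMem (show q ∉ {q : R3 | ‖q‖ < σ} from h)]
    exact zero_le

/-- Because of the cutoff, all moments of `|φ|²` are finite. -/
theorem lintegral_formFactor_mul_pow_lt_top (Λ : ℝ) (j : Fin 3) (m : ℕ) :
    ∫⁻ q, ‖formFactor Λ j q‖ₑ ^ 2 * ‖q‖ₑ ^ m < ⊤ := by
  have h : ∀ᵐ q : R3, ‖formFactor Λ j q‖ₑ ^ 2 * ‖q‖ₑ ^ m ≤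
      ENNReal.ofReal Λ ^ (m + 1) * (‖formFactor Λ j q‖ₑ ^ 2 * ‖q‖ₑ⁻¹) := by
    filter_upwards [ae_enorm_ne_zero] with q hq
    rcases le_or_gt Λ ‖q‖ with hΛ | hΛ
    · simp [formFactor_of_le j hΛ]
    · have h1 : ‖q‖ₑ ≤ ENNReal.ofReal Λ := by
        rw [← ofReal_norm]
        exact ENNReal.ofReal_le_ofReal hΛ.le
      calc ‖formFactor Λ j q‖ₑ ^ 2 * ‖q‖ₑ ^ m
          = ‖q‖ₑ ^ (m + 1) * (‖formFactor Λ j q‖ₑ ^ 2 * ‖q‖ₑ⁻¹) := by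
            rw [← one_mul (_ * _), ← ENNReal.mul_inv_cancel hq enorm_ne_top]
            ring
        _ ≤ _ := by gcongr
  refine lt_of_le_of_lt (lintegral_mono_ae h) ?_
  rw [lintegral_const_mul' _ _ (by simp)]
  exact ENNReal.mul_lt_top (by simp)
    (lt_of_le_of_lt (lintegral_formFactor_inv_le Λ j) lintegral_majorant_lt_top)

theorem integrable_formFactor (Λ : ℝ) (j : Fin 3) : Integrable (formFactor Λ j) := by
  refine ⟨(measurable_formFactor Λ j).aestronglyMeasurable, ?_⟩
  have h : ∀ q : R3, ‖formFactor Λ j q‖ₑ ≤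
      ‖formFactor Λ j q‖ₑ ^ 2 * ‖q‖ₑ ^ 0 + (Metric.ball (0 : R3) Λ).indicator 1 q := fun q => by
    rcases le_or_gt Λ ‖q‖ with hΛ | hΛ
    · simp [formFactor_of_le j hΛ]
    · rw [Set.indicator_of_mem (by simpa using hΛ), pow_zero, mul_one]
      rcases le_total ‖formFactor Λ j q‖ₑ 1 with h1 | h1
      · exact le_add_left h1
      · exact le_add_right (le_self_pow₀ h1 two_ne_zero)
  refine lt_of_le_of_lt (lintegral_mono h) ?_
  rw [lintegral_add_right _ (measurable_one.indicator Metric.isOpen_ball.measurableSet),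
    lintegral_indicator_one Metric.isOpen_ball.measurableSet]
  exact ENNReal.add_lt_top.2 ⟨lintegral_formFactor_mul_pow_lt_top Λ j 0, measure_ball_lt_top⟩

/-- The bounds on the form factor that hold uniformly in the cutoff. -/
theorem exists_isFormFactor :
    ∃ C : ℝ≥0, C ≠ 0 ∧ ∀ (Λ : ℝ) (j : Fin 3), IsFormFactor C (formFactor Λ j) := by
  set I := ∫⁻ q : R3, ENNReal.ofReal (majorant ‖q‖)
  set S := Real.toNNReal (3 * volume.real (Metric.ball (0 : R3) 1))
  have hI : (I.toNNReal : ℝ≥0∞) = I := ENNReal.coe_toNNReal lintegral_majorant_lt_top.ne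
  have h1 : I ≤ ((1 + I.toNNReal + S : ℝ≥0) : ℝ≥0∞) := by
    rw [← hI]
    exact_mod_cast le_add_right le_add_self
  refine ⟨1 + I.toNNReal + S, by positivity, fun Λ j => ?_⟩
  exact {
    meas := measurable_formFactor Λ j
    real := fun q => Complex.conj_ofReal _
    int_inv := (lintegral_formFactor_inv_le Λ j).trans h1
    int_inv_half := (lintegral_formFactor_inv_half_le Λ j).trans h1
    int_soft := fun σ => (lintegral_formFactor_soft_le Λ j σ).trans (mul_le_mul_left
      (ENNReal.coe_le_coe.2 le_add_self) _)
    sq_lt_top := by simpa using lintegral_formFactor_mul_pow_lt_top Λ j 0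
    sq_mul_lt_top := by simpa using lintegral_formFactor_mul_pow_lt_top Λ j 1
    sq_mul_sq_lt_top := lintegral_formFactor_mul_pow_lt_top Λ j 2
    integrable := integrable_formFactor Λ j }

/-! ### The self-energy -/

/-- The infimum of the form of a semibounded operator on unit vectors. -/
theorem exists_inf_form {E : Type*} [NormedAddCommGroup E] [InnerProductSpace ℂ E]
    {T : E →ₗ.[ℂ] E} {L : ℝ} (hL : ∀ x : T.domain, L * ‖(x : E)‖ ^ 2 ≤ (inner ℂ (x : E) (T x)).re)
    {x₀ : T.domain} (h0 : (x₀ : E) ≠ 0) :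
    ∃ c : ℝ, L ≤ c ∧ (∀ x : T.domain, c * ‖(x : E)‖ ^ 2 ≤ (inner ℂ (x : E) (T x)).re) ∧
      ∀ δ > 0, ∃ x : T.domain, (inner ℂ (x : E) (T x)).re < (c + δ) * ‖(x : E)‖ ^ 2 := by
  set S : Set ℝ := {r | ∃ x : T.domain, (x : E) ≠ 0 ∧ (inner ℂ (x : E) (T x)).re / ‖(x : E)‖ ^ 2 = r}
    with hS
  have hpos : ∀ x : T.domain, (x : E) ≠ 0 → 0 < ‖(x : E)‖ ^ 2 := fun x hx =>
    pow_pos (norm_pos_iff.2 hx) 2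
  have hlow : ∀ r ∈ S, L ≤ r := by
    rintro _ ⟨x, hx, rfl⟩
    exact (le_div_iff₀ (hpos x hx)).2 (hL x)
  have hne : S.Nonempty := ⟨_, x₀, h0, rfl⟩
  refine ⟨sInf S, le_csInf hne hlow, fun x => ?_, fun δ hδ => ?_⟩
  · by_cases hx : (x : E) = 0
    · simp [hx]
    · exact (le_div_iff₀ (hpos x hx)).1 (csInf_le ⟨L, hlow⟩ ⟨x, hx, rfl⟩)
  · obtain ⟨_, ⟨x, hx, rfl⟩, h⟩ := exists_lt_of_csInf_lt hne (lt_add_of_pos_right _ hδ)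
    exact ⟨x, (div_lt_iff₀ (hpos x hx)).1 h⟩

theorem norm_sub_eq_of_eq {z₄ z₆ z₆' z₆'' : ℂ} {w v₁ v₃ s e t : ℝ} (h₄ : z₄ = w) (h₆ : z₆ = v₃)
    (h₆' : z₆' = v₁) (h₆'' : z₆'' = s) (ht : t = -e ^ 4 * w - 4 * e ^ 6 * (v₁ + v₃) + 2 * e ^ 6 * s)
    (c : ℝ) : ‖(c : ℂ) - (-(e : ℂ) ^ 4 * z₄ - 4 * (e : ℂ) ^ 6 * z₆ - 4 * (e : ℂ) ^ 6 * z₆' +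
      2 * (e : ℂ) ^ 6 * z₆'')‖ = |c - t| := by
  rw [← Real.norm_eq_abs, ← Complex.norm_real, h₄, h₆, h₆', h₆'', ht]
  congr 1
  push_cast
  ring

theorem re_inner_eq_of_eq {E : Type*} [NormedAddCommGroup E] [InnerProductSpace ℂ E] {a b : E}
    {z : ℂ} (h : z = inner ℂ b a) : (inner ℂ a b).re = z.re := by
  rw [h, ← inner_conj_symm, Complex.conj_re]

theorem QForm.Trial.series_eq {E : Type*} [NormedAddCommGroup E] [InnerProductSpace ℂ E]
    {q : QForm E} {K : ℝ} (T : q.Trial K) (e : ℝ) {v₁ v₃ : ℝ} (h : q.kin T.v = v₁ + v₃) :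
    T.series e = -e ^ 4 * q.kin T.w - 4 * e ^ 6 * (v₁ + v₃) +
      2 * e ^ 6 * ∑ j, ‖q.A j T.w‖ ^ 2 := by
  rw [← h]
  rfl

/-- A lower bound on the energy `c`, together with the variational principle for `Ω + u`, pins `c`
to the perturbation series. -/
theorem QForm.IsBounded.abs_sub_series_le {E : Type*} [NormedAddCommGroup E]
    [InnerProductSpace ℂ E] {q : QForm E} {C K : ℝ} (hq : q.IsBounded C) {T : q.Trial K}
    {M e c L : ℝ} (hT : T.IsBdd C M) (he : |e| ≤ 1) (hL : 0 ≤ L)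
    (hlow : T.series e - L * |e| ^ 7 ≤ c)
    (hup : c * ‖(T.Ω + T.u e : E)‖ ^ 2 ≤ (q.form e (T.Ω + T.u e) (T.Ω + T.u e)).re) :
    |c - T.series e| ≤ (L + (132 * M ^ 4 + 9 * M ^ 2 * (5 * M ^ 2 + L))) * |e| ^ 7 := by
  have hs := hq.neg_series_le hT he
  have h7 : |e| ^ 7 ≤ e ^ 4 := by
    have h8 : |e| ^ 4 = e ^ 4 := by rw [pow_abs, abs_of_nonneg (by positivity)]
    rw [← h8]
    exact pow_le_pow_of_le_one (abs_nonneg e) he (by norm_num)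
  have h2 : -c ≤ (5 * M ^ 2 + L) * e ^ 4 := by
    have := mul_le_mul_of_nonneg_left h7 hL
    linarith
  have h3 := hq.upper hT he (by positivity) h2 hup
  have h4 : 0 ≤ L * |e| ^ 7 := by positivity
  have h5 : 0 ≤ (132 * M ^ 4 + 9 * M ^ 2 * (5 * M ^ 2 + L)) * |e| ^ 7 := by positivity
  rw [add_mul, abs_le]
  constructor <;> linarith

theorem HasValue.exists_inner {T : Fock →ₗ.[ℂ] Fock} {x y z : Fock} {r : ℂ} (h : HasValue T x y)
    (hr : inner ℂ z y = r) : ∃ h : x ∈ T.domain, inner ℂ z (T ⟨x, h⟩) = r :=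
  h.imp fun _ h => (congrArg (inner ℂ z) h).trans hr

/-- The coupling constants for which all the estimates hold. -/
theorem small_coupling (C : ℝ≥0) : 0 < 1 / (300 * formBound C ^ 2) ∧
    ∀ e : ℝ, |e| ≤ 1 / (300 * formBound C ^ 2) → 12 * (|e| + e ^ 2) * (C + 1) < 1 ∧ |e| ≤ 1 ∧
      120 * (2 * C) * e ^ 2 ≤ 1 ∧ 300 * formBound C ^ 2 * e ^ 2 ≤ 1 := by
  have hC0 := C.coe_nonneg
  set M := formBound C with hM
  have hM0 : 12800 ≤ M ^ 2 := by simpa using mul_pow_le_sq_formBound C (m := 0) (by norm_num)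
  have hM1 : 12800 * (C : ℝ) ≤ M ^ 2 := by
    simpa using mul_pow_le_sq_formBound C (m := 1) (by norm_num)
  refine ⟨by positivity, fun e he => ?_⟩
  have he0 : |e| * (300 * M ^ 2) ≤ 1 := (le_div_iff₀ (by positivity)).1 he
  have ha := abs_nonneg e
  have he1 : |e| ≤ 1 := by nlinarith
  have he2 : e ^ 2 ≤ |e| := by
    rw [← sq_abs]
    nlinarith
  have h1 : (|e| + e ^ 2) * ((C : ℝ) + 1) ≤ 2 * |e| * (C + 1) := by gcongr; linarith
  refine ⟨by nlinarith, he1, ?_, ?_⟩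
  · nlinarith [mul_le_mul_of_nonneg_left he2 hC0]
  · nlinarith [mul_le_mul_of_nonneg_left he2 (sq_nonneg M)]

section

variable {C : ℝ≥0} {Λ e : ℝ} (hf : ∀ j, IsFormFactor C (formFactor Λ j))
include hf

attribute [local irreducible] mulOp creation annihilation fieldMomentum freeOp sqrtField

theorem re_inner_nelsonT (x : (nelsonT Λ e).domain) (h : (x : Fock) ∈ fdom) :
    (inner ℂ (x : Fock) (nelsonT Λ e x)).re = ((nelsonForm (formFactor Λ)).form e
      (Submodule.inclusion (fdom_le_formDom hf) ⟨x, h⟩)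
      (Submodule.inclusion (fdom_le_formDom hf) ⟨x, h⟩)).re :=
  re_inner_eq_of_eq (form_eq_inner_nelsonT hf e x h ⟨x, fdom_le_formDom hf h⟩)

/-- The trial vector `Ω + u`, in the domain of `T_Λ`. -/
def trialVec (e : ℝ) : fdom := vac + (((-e ^ 2 : ℝ) : ℂ) • pairVec hf +
  ((2 * e ^ 3 : ℝ) : ℂ) • (oneVec hf + threeVec hf))

theorem inclusion_trialVec (e : ℝ) : Submodule.inclusion (fdom_le_formDom hf) (trialVec hf e) =
    (trial hf).Ω + (trial hf).u e := rfl

theorem trialVec_ne_zero (e : ℝ) : (trialVec hf e : Fock) ≠ 0 := fun h => by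
  have h1 : inner ℂ ((trial hf).Ω : Fock) ((trial hf).Ω + (trial hf).u e : Fock) = 0 :=
    (congrArg (inner ℂ ((trial hf).Ω : Fock)) h).trans (inner_zero_right _)
  rw [inner_add_right, (trial hf).inner_Ω_u, inner_self_eq_norm_sq_to_K, (trial hf).norm_Ω] at h1
  simp at h1

/-- The constant in the lower bound on the energy. -/
def lowerConst (C : ℝ) : ℝ := 20132 * formBound C ^ 6 + 3000 * formBound C ^ 4

theorem form_lower_bound (hC : C ≠ 0) (he : |e| ≤ 1) (he' : 120 * (2 * C) * e ^ 2 ≤ 1)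
    (he'' : 300 * formBound C ^ 2 * e ^ 2 ≤ 1) (x : fdom) :
    ((trial hf).series e - lowerConst C * |e| ^ 7) * ‖(x : Fock)‖ ^ 2 ≤
      ((nelsonForm (formFactor Λ)).form e (Submodule.inclusion (fdom_le_formDom hf) x)
        (Submodule.inclusion (fdom_le_formDom hf) x)).re := by
  rcases eq_or_ne e 0 with rfl | he0
  · have h := QForm.re_form_self (q := nelsonForm (formFactor Λ)) 0
      (Submodule.inclusion (fdom_le_formDom hf) x)
    rw [h]
    have h2 := (nelsonForm (formFactor Λ)).kin_nonneg (Submodule.inclusion (fdom_le_formDom hf) x)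
    simpa [QForm.Trial.series] using h2
  · refine le_of_eq_of_le ?_ (lower_bound hf hC he0 he he' he'' x)
    unfold lowerConst
    ring

/-- A lower bound of the form of `T_Λ` applies to the trial vector. -/
theorem form_trial_ge {c : ℝ} (hc : ∀ x : (nelsonT Λ e).domain,
    c * ‖(x : Fock)‖ ^ 2 ≤ (inner ℂ (x : Fock) (nelsonT Λ e x)).re) :
    c * ‖((trial hf).Ω + (trial hf).u e : Fock)‖ ^ 2 ≤ ((nelsonForm (formFactor Λ)).form e
      ((trial hf).Ω + (trial hf).u e) ((trial hf).Ω + (trial hf).u e)).re :=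
  (hc ⟨trialVec hf e, (domain_nelsonT hf e).ge (trialVec hf e).2⟩).trans_eq
    ((re_inner_nelsonT hf ⟨trialVec hf e, (domain_nelsonT hf e).ge (trialVec hf e).2⟩
      (trialVec hf e).2).trans (congrArg (fun y => ((nelsonForm (formFactor Λ)).form e y y).re)
        (inclusion_trialVec hf e)))

/-- The infimum of the quadratic form of `T_Λ`. -/
theorem exists_inf_form_nelsonT (hC : C ≠ 0) (he : |e| ≤ 1) (he' : 120 * (2 * C) * e ^ 2 ≤ 1)
    (he'' : 300 * formBound C ^ 2 * e ^ 2 ≤ 1) :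
    ∃ c : ℝ, (trial hf).series e - lowerConst C * |e| ^ 7 ≤ c ∧
      (∀ x : (nelsonT Λ e).domain,
        c * ‖(x : Fock)‖ ^ 2 ≤ (inner ℂ (x : Fock) (nelsonT Λ e x)).re) ∧
      ∀ δ > 0, ∃ x : (nelsonT Λ e).domain,
        (inner ℂ (x : Fock) (nelsonT Λ e x)).re < (c + δ) * ‖(x : Fock)‖ ^ 2 :=
  exists_inf_form (fun x => (form_lower_bound hf hC he he' he''
      ⟨x, mem_fdom_of_mem_domain hf x⟩).trans_eq
        (re_inner_nelsonT hf x (mem_fdom_of_mem_domain hf x)).symm)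
    (x₀ := ⟨trialVec hf e, (domain_nelsonT hf e).ge (trialVec hf e).2⟩) (trialVec_ne_zero hf e)

/-- The energy agrees with the perturbation series up to an error of order `e⁷`. -/
theorem exists_energy (hC : C ≠ 0) (he : |e| ≤ 1) (he' : 120 * (2 * C) * e ^ 2 ≤ 1)
    (he'' : 300 * formBound C ^ 2 * e ^ 2 ≤ 1) (hT : IsSelfAdjoint (nelsonT Λ e)) :
    ∃ c : ℝ, IsGLB {x : ℝ | ¬ HasResolvent (nelsonT Λ e) (x : ℂ)} c ∧
      |c - (trial hf).series e| ≤ (lowerConst C + (132 * formBound C ^ 4 + 9 * formBound C ^ 2 *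
        (5 * formBound C ^ 2 + lowerConst C))) * |e| ^ 7 :=
  have hM := formBound_nonneg C
  have hK : 0 ≤ lowerConst C := by unfold lowerConst; positivity
  (exists_inf_form_nelsonT hf hC he he' he'').imp fun _ h =>
    ⟨isGLB_spectrum_of_isGLB_form hT h.2.1 h.2.2,
      (isBounded_nelsonForm hf).abs_sub_series_le (trial_isBdd hf) he hK h.1
        (form_trial_ge hf h.2.1)⟩

/-- The perturbation series in terms of vacuum expectation values. -/
theorem vacuum_expectations : ∃ (h4 : vacuum ∈ (term4 Λ).domain)
    (h6a : vacuum ∈ (term6a Λ).domain) (h6b : vacuum ∈ (term6b Λ).domain)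
    (h6c : vacuum ∈ (term6c Λ).domain), ∀ c : ℝ,
    ‖(c : ℂ) - (-(e : ℂ) ^ 4 * inner ℂ vacuum (term4 Λ ⟨vacuum, h4⟩)
      - 4 * (e : ℂ) ^ 6 * inner ℂ vacuum (term6a Λ ⟨vacuum, h6a⟩)
      - 4 * (e : ℂ) ^ 6 * inner ℂ vacuum (term6b Λ ⟨vacuum, h6b⟩)
      + 2 * (e : ℂ) ^ 6 * inner ℂ vacuum (term6c Λ ⟨vacuum, h6c⟩))‖ =
      |c - (trial hf).series e| :=
  ((hasValue_term4 hf).exists_inner (inner_term4 hf)).imp fun _ i4 =>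
  ((hasValue_term6a hf).exists_inner (inner_term6a hf)).imp fun _ i6a =>
  ((hasValue_term6b hf).exists_inner (inner_term6b hf)).imp fun _ i6b =>
  ((hasValue_term6c hf).exists_inner (inner_term6c hf)).imp fun _ i6c =>
  norm_sub_eq_of_eq i4 i6a i6b i6c ((trial hf).series_eq e (kin_trial_v hf))

/-- The expansion of the self-energy, with explicit constants. -/
theorem selfEnergy_expansion (hC : C ≠ 0) (he : |e| ≤ 1) (he' : 120 * (2 * C) * e ^ 2 ≤ 1)
    (he'' : 300 * formBound C ^ 2 * e ^ 2 ≤ 1) (hT : IsSelfAdjoint (nelsonT Λ e)) :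
    IsGLB {x : ℝ | (x : ℂ) ∈ spec (nelsonT Λ e)} (selfEnergy Λ e) ∧
      ∃ (h4 : vacuum ∈ (term4 Λ).domain) (h6a : vacuum ∈ (term6a Λ).domain)
        (h6b : vacuum ∈ (term6b Λ).domain) (h6c : vacuum ∈ (term6c Λ).domain),
        ‖(selfEnergy Λ e : ℂ) - (-(e : ℂ) ^ 4 * inner ℂ vacuum (term4 Λ ⟨vacuum, h4⟩)
          - 4 * (e : ℂ) ^ 6 * inner ℂ vacuum (term6a Λ ⟨vacuum, h6a⟩)
          - 4 * (e : ℂ) ^ 6 * inner ℂ vacuum (term6b Λ ⟨vacuum, h6b⟩)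
          + 2 * (e : ℂ) ^ 6 * inner ℂ vacuum (term6c Λ ⟨vacuum, h6c⟩))‖ ≤
        (lowerConst C + (132 * formBound C ^ 4 + 9 * formBound C ^ 2 *
          (5 * formBound C ^ 2 + lowerConst C))) * |e| ^ 7 :=
  (exists_energy hf hC he he' he'' hT).elim fun c h =>
    have hE : selfEnergy Λ e = c := h.1.csInf_eq h.1.nonempty
    ⟨hE ▸ h.1, (vacuum_expectations hf).imp fun _ h' => h'.imp fun _ h' => h'.imp fun _ h' =>
      h'.imp fun _ h' => (h' _).trans_le (hE ▸ h.2)⟩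

end

end Nelson

end

theorem theorem2p1 :
    ∃ e₀ : ℝ, 0 < e₀ ∧ ∃ C : ℝ, ∀ Λ : ℝ, 0 < Λ → ∀ e : ℝ, |e| ≤ e₀ →
      IsSelfAdjoint (Nelson.nelsonT Λ e) ∧
      IsGLB {x : ℝ | (x : ℂ) ∈ Nelson.spec (Nelson.nelsonT Λ e)} (Nelson.selfEnergy Λ e) ∧
      ∃ (h4 : Nelson.vacuum ∈ (Nelson.term4 Λ).domain)
        (h6a : Nelson.vacuum ∈ (Nelson.term6a Λ).domain)
        (h6b : Nelson.vacuum ∈ (Nelson.term6b Λ).domain)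
        (h6c : Nelson.vacuum ∈ (Nelson.term6c Λ).domain),
        ‖(Nelson.selfEnergy Λ e : ℂ) -
          (-(e : ℂ) ^ 4 * inner ℂ Nelson.vacuum (Nelson.term4 Λ ⟨Nelson.vacuum, h4⟩)
            - 4 * (e : ℂ) ^ 6 * inner ℂ Nelson.vacuum (Nelson.term6a Λ ⟨Nelson.vacuum, h6a⟩)
            - 4 * (e : ℂ) ^ 6 * inner ℂ Nelson.vacuum (Nelson.term6b Λ ⟨Nelson.vacuum, h6b⟩)
            + 2 * (e : ℂ) ^ 6 * inner ℂ Nelson.vacuum (Nelson.term6c Λ ⟨Nelson.vacuum, h6c⟩))‖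
        ≤ C * |e| ^ 7 :=
  Nelson.exists_isFormFactor.elim fun C h => ⟨_, (Nelson.small_coupling C).1, _, fun Λ _ e he =>
    have he' := (Nelson.small_coupling C).2 e he
    have hT := Nelson.isSelfAdjoint_nelsonT (h.2 Λ) he'.1
    ⟨hT, Nelson.selfEnergy_expansion (h.2 Λ) h.1 he'.2.1 he'.2.2.1 he'.2.2.2 hT⟩⟩
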